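/- Let $k$ be a field of characteristic zero. **Rings and modules.** Let $W=k\langle z,\frac{d}{dz}\rangle$ be the Weyl algebra, regarded as the ring of differential operators on $\mathbb A^1$. The Fourier transform $\mathfrak F$ is the functor from left $W$-modules to left $W$-modules which keeps the underlying vector space and lets $W$ act through the automorphism $z\mapsto-\frac{d}{dz}$, $\frac{d}{dz}\mapsto z$. For a closed point $x\in\mathbb A^1$ with residue field $k_x$, let $A_x\simeq k_x[[t]]$ be the completed local ring and $K_x=k_x((t))$ its fraction field; let $K_\infty=k((\zeta))$ with $\zeta=1/z$. For $R=A_x,K_x,K_\infty$ let $D_R$ be the ring of differential operators over $R$, and for $K=K_x,K_\infty$ let $\mathrm{Hol}(D_K)$ be the category of left $D_K$-modules of finite dimension over $K$. For $M\in\mathrm{Hol}(D_{K_x})$ put $\jmath^\circ_!M=\mathbb D(\jmath^\circ_*(M^\vee))$, where $M^\vee=\mathrm{Hom}_{K_x}(M,K_x)$ with the dual derivation, $\jmath^\circ_*$ is restriction of scalars from $D_{K_x}$ to $D_{A_x}$, and $\mathbb D(N)=\mathrm{Ext}^1_{D_{A_x}}(N,D_{A_x})$, made into a left module by the anti-involution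 $\partial^*=-\partial$. Let $j_{x*}$ (resp. $\jmath^\circ_{\infty*}$) be restriction of scalars from $D_{A_x}$ (resp. $D_{K_\infty}$) to $W$. **Topology.** For a module $M$ over $D_{A}$, $A=A_x$ or $A=k[[\zeta]]$, with uniformizer $\pi$ of $A$, a $k$-subspace $U\subset M$ is open if for every finitely generated $A$-submodule $N\subset M$ there is $n$ with $\pi^nN\subset U$; these subspaces form a base of neighbourhoods of $0$. A $D_{K_\infty}$-module is given the topology of the underlying $D_{k[[\zeta]]}$-module. Thus $j_{x*}\jmath^\circ_!M$ and $\jmath^\circ_{\infty*}M$, as well as their Fourier transforms, carry natural topologies. **Slopes and types.** The slopes of $M$ are the slopes of its irreducible components. Let $\mathrm{Hol}(D_{K_\infty})^{>1}$ be the full subcategory of the modules in $\mathrm{Hol}(D_{K_\infty})$ all of whose slopes are $>1$. For $\beta\in\bar k$ let $\ell_\beta$ be $\bar k((\zeta))$ with $\partial_\zeta=\frac{d}{d\zeta}+\frac{\beta}{\zeta^2}$. For a closed point $x\in\mathbb A^1$ let $\mathrm{Hol}(D_{K_\infty})^{\le1,(x)}$ be the full subcategory of those $M\in\mathrm{Hol}(D_{K_\infty})$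 whose base change to $\bar k((\zeta))$ is a direct sum, over the geometric points $\beta\in\bar k$ of $x$, of modules $\ell_\beta\otimes N_\beta$, where $N_\beta$ is holonomic with all slopes $<1$. Let $-x$ be the image of $x$ under $z\mapsto-z$. **Theorem.** 1. For every closed point $x\in\mathbb A^1$ there are an equivalence $$\mathfrak F(x,\infty):\mathrm{Hol}(D_{K_x})\to\mathrm{Hol}(D_{K_\infty})^{\le1,(-x)}$$ and an isomorphism of $W$-modules, functorial in $M$ and a homeomorphism for every $M$, $$\mathfrak F(j_{x*}\jmath^\circ_!M)\simeq\jmath^\circ_{\infty*}(\mathfrak F(x,\infty)M).$$ 2. For every closed point $x\in\mathbb A^1$ there are an equivalence $$\mathfrak F(\infty,x):\mathrm{Hol}(D_{K_\infty})^{\le1,(x)}\to\mathrm{Hol}(D_{K_x})$$ and an isomorphism of $W$-modules, functorial in $M$ and a homeomorphism for every $M$, $$\mathfrak F(\jmath^\circ_{\infty*}M)\simeq j_{x*}\jmath^\circ_!(\mathfrak F(\infty,x)M).$$ 3. There are an equivalence $$\mathfrak F(\infty,\infty):\mathrm{Hol}(D_{K_\infty})^{>1}\to\mathrm{Hol}(D_{K_\infty})^{>1}$$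 and an isomorphism of $W$-modules, functorial in $M$ and a homeomorphism for every $M$, $$\mathfrak F(\jmath^\circ_{\infty*}M)\simeq\jmath^\circ_{\infty*}(\mathfrak F(\infty,\infty)M).$$ In each case these properties determine the local transform up to natural isomorphism: if $G$ is a functor between the same categories with a functorial isomorphism of the same kind, consisting of homeomorphisms, then there is exactly one isomorphism of functors from the local transform to $G$ which is compatible with the two functorial isomorphisms. -/

import Mathlib

open CategoryTheory

universe u v

noncomputable section

namespace LocalFourier

/-! ### Rings of differential operators -/

section DiffOp

/-- A derivation of a commutative ring `R`: an additive map satisfying the Leibniz rule. -/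
structure Der (R : Type u) [CommRing R] extends R →+ R where
  leibniz' : ∀ r s : R, toFun (r * s) = r * toFun s + s * toFun r

instance (R : Type u) [CommRing R] : CoeFun (Der R) (fun _ => R → R) :=
  ⟨fun d => d.toAddMonoidHom⟩

theorem Der.leibniz {R : Type u} [CommRing R] (d : Der R) (r s : R) :
    d (r * s) = r * d s + s * d r := d.leibniz' r s

variable {R : Type u} [CommRing R] (d : Der R)

/-- Defining relations of the ring `R⟨∂⟩` with `∂ r = r ∂ + d r`;
`some r` stands for the function `r` and `none` stands for `∂`. -/
inductive DiffOp.Rel : FreeAlgebra ℤ (Option R) → FreeAlgebra ℤ (Option R) → Prop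
  | one : DiffOp.Rel (FreeAlgebra.ι ℤ (some 1)) 1
  | add (r s : R) : DiffOp.Rel (FreeAlgebra.ι ℤ (some (r + s)))
      (FreeAlgebra.ι ℤ (some r) + FreeAlgebra.ι ℤ (some s))
  | mul (r s : R) : DiffOp.Rel (FreeAlgebra.ι ℤ (some (r * s)))
      (FreeAlgebra.ι ℤ (some r) * FreeAlgebra.ι ℤ (some s))
  | leibniz (r : R) : DiffOp.Rel (FreeAlgebra.ι ℤ none * FreeAlgebra.ι ℤ (some r))
      (FreeAlgebra.ι ℤ (some r) * FreeAlgebra.ι ℤ none + FreeAlgebra.ι ℤ (some (d r)))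

/-- The ring of differential operators `R⟨∂⟩`, where `∂ r = r ∂ + d r`. -/
def DiffOp : Type u := RingQuot (DiffOp.Rel d)

instance : Ring (DiffOp d) := inferInstanceAs (Ring (RingQuot (DiffOp.Rel d)))

/-- The canonical map from words in functions and `∂` to differential operators. -/
def DiffOp.mk : FreeAlgebra ℤ (Option R) →+* DiffOp d := RingQuot.mkRingHom (DiffOp.Rel d)

/-- The operator `∂`. -/
def DiffOp.del : DiffOp d := DiffOp.mk d (FreeAlgebra.ι ℤ none)

/-- Functions as differential operators. -/
def DiffOp.of : R →+* DiffOp d where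
  toFun r := DiffOp.mk d (FreeAlgebra.ι ℤ (some r))
  map_one' := (RingQuot.mkRingHom_rel (DiffOp.Rel.one (d := d))).trans (map_one _)
  map_mul' r s := (RingQuot.mkRingHom_rel (DiffOp.Rel.mul (d := d) r s)).trans (map_mul _ _ _)
  map_add' r s := (RingQuot.mkRingHom_rel (DiffOp.Rel.add (d := d) r s)).trans (map_add _ _ _)
  map_zero' := by
    have h := (RingQuot.mkRingHom_rel (DiffOp.Rel.add (d := d) 0 0)).trans (map_add _ _ _)
    rw [add_zero] at h
    exact left_eq_add.mp h

theorem DiffOp.del_mul_of (r : R) :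
    DiffOp.del d * DiffOp.of d r = DiffOp.of d r * DiffOp.del d + DiffOp.of d (d r) := by
  have h := RingQuot.mkRingHom_rel (DiffOp.Rel.leibniz (d := d) r)
  rw [map_mul, map_add, map_mul] at h
  exact h

/-- The universal property of `R⟨∂⟩`. -/
def DiffOp.lift {B : Type v} [Ring B] (f : R →+* B) (D : B)
    (h : ∀ r, D * f r = f r * D + f (d r)) : DiffOp d →+* B :=
  RingQuot.lift ⟨((FreeAlgebra.lift ℤ fun o : Option R => o.elim D f :
      FreeAlgebra ℤ (Option R) →ₐ[ℤ] B) : FreeAlgebra ℤ (Option R) →+* B), by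
    intro x y hxy
    induction hxy with
    | one => simp
    | add r s => simp
    | mul r s => simp
    | leibniz r => simpa using h r⟩

@[simp]
theorem DiffOp.lift_of {B : Type v} [Ring B] (f : R →+* B) (D : B)
    (h : ∀ r, D * f r = f r * D + f (d r)) (r : R) :
    DiffOp.lift d f D h (DiffOp.of d r) = f r :=
  (RingQuot.lift_mkRingHom_apply _ _ _).trans (by simp)

@[simp]
theorem DiffOp.lift_del {B : Type v} [Ring B] (f : R →+* B) (D : B)
    (h : ∀ r, D * f r = f r * D + f (d r)) :
    DiffOp.lift d f D h (DiffOp.del d) = D :=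
  (RingQuot.lift_mkRingHom_apply _ _ _).trans (by simp)

/-- The ring homomorphism `R⟨∂⟩ → S⟨∂⟩` which is `φ` on functions and maps `∂` to `s ∂`. -/
def DiffOp.map {S : Type v} [CommRing S] (e : Der S) (φ : R →+* S) (s : S)
    (h : ∀ r, s * e (φ r) = φ (d r)) : DiffOp d →+* DiffOp e :=
  DiffOp.lift d ((DiffOp.of e).comp φ) (DiffOp.of e s * DiffOp.del e) fun r => by
    rw [RingHom.comp_apply, mul_assoc, DiffOp.del_mul_of, mul_add, ← mul_assoc, ← mul_assoc,
      ← map_mul, ← map_mul, ← map_mul, h, mul_comm s, RingHom.comp_apply]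

/-- The automorphism `∂ ↦ ∂ + f` of `R⟨∂⟩`. Restriction of scalars along it turns `N` into the
tensor product over `R` of `N` and of the rank one module `R` with derivation `d + f`. -/
def DiffOp.twist (f : R) : DiffOp d →+* DiffOp d :=
  DiffOp.lift d (DiffOp.of d) (DiffOp.del d + DiffOp.of d f) fun r => by
    rw [add_mul, mul_add, DiffOp.del_mul_of, ← map_mul, ← map_mul, mul_comm f r]
    abel

/-- The anti-involution `P ↦ P*` with `r* = r` and `∂* = -∂`, which exchanges left and right
modules. -/
def DiffOp.adjoint : DiffOp d →+* (DiffOp d)ᵐᵒᵖ :=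
  DiffOp.lift d
    { toFun := fun r => MulOpposite.op (DiffOp.of d r)
      map_one' := by simp
      map_mul' := fun r s => by rw [← MulOpposite.op_mul, ← map_mul, mul_comm]
      map_zero' := by simp
      map_add' := by simp }
    (MulOpposite.op (-DiffOp.del d)) fun r => by
      apply MulOpposite.unop_injective
      simp [DiffOp.del_mul_of]

/-- The `R`-module underlying an `R⟨∂⟩`-module. -/
abbrev under (M : ModuleCat.{u} (DiffOp d)) : ModuleCat.{u} R :=
  (ModuleCat.restrictScalars (DiffOp.of d)).obj M

/-- The derivation `∂ : M → M` of an `R⟨∂⟩`-module. -/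
def nabla (M : ModuleCat.{u} (DiffOp d)) : under d M →+ under d M where
  toFun m := (DiffOp.del d • (show M from m) : M)
  map_zero' := smul_zero (A := M) _
  map_add' m n := smul_add (A := M) _ m n

theorem nabla_smul (M : ModuleCat.{u} (DiffOp d)) (r : R) (m : under d M) :
    nabla d M (r • m) = r • nabla d M m + d r • m := by
  change (DiffOp.del d • DiffOp.of d r • (show M from m) : M) =
    DiffOp.of d r • DiffOp.del d • (show M from m) + DiffOp.of d (d r) • (show M from m)
  rw [← mul_smul, DiffOp.del_mul_of, add_smul, mul_smul]

/-- An `R`-module with a derivation is an `R⟨∂⟩`-module. -/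
abbrev moduleOfDerivation (M : Type v) [AddCommGroup M] [Module R M]
    (D : AddMonoid.End M)
    (h : ∀ (r : R) (m : M), D (r • m) = r • D m + d r • m) : Module (DiffOp d) M :=
  Module.compHom M (DiffOp.lift d (Module.toAddMonoidEnd R M) D
    fun r => by ext m; exact h r m)

/-- An `R⟨∂⟩`-module is holonomic if it is finitely generated over `R`.
(This is only used when `R` is a field.) -/
def holonomic : ObjectProperty (ModuleCat.{u} (DiffOp d)) := fun M => Module.Finite R (under d M)

/-! ### Duality -/

/-- The linear dual `Hom_R(M, R)`. -/
abbrev LinDual (M : ModuleCat.{u} (DiffOp d)) : Type u := under d M →ₗ[R] R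

/-- The dual derivation `φ ↦ d ∘ φ - φ ∘ ∂`. -/
def LinDual.nabla (M : ModuleCat.{u} (DiffOp d)) : AddMonoid.End (LinDual d M) where
  toFun φ :=
    { toFun := fun m => d (φ m) - φ (LocalFourier.nabla d M m)
      map_add' := fun m n => by simp only [map_add]; abel
      map_smul' := fun r m => by
        simp only [map_smul, nabla_smul, map_add, smul_eq_mul, Der.leibniz,
          RingHom.id_apply]
        ring }
  map_zero' := by
    apply LinearMap.ext; intro m
    change d 0 - 0 = 0
    simp
  map_add' φ ψ := by
    apply LinearMap.ext; intro m
    change d (φ m + ψ m) - (_ + _) = (d _ - _) + (d _ - _)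
    rw [map_add]
    abel

instance (M : ModuleCat.{u} (DiffOp d)) : Module (DiffOp d) (LinDual d M) :=
  moduleOfDerivation d (LinDual d M) (LinDual.nabla d M) fun r φ => by
    apply LinearMap.ext; intro m
    change d (r * φ m) - r * φ (nabla d M m) =
      r * (d (φ m) - φ (nabla d M m)) + d r * φ m
    rw [Der.leibniz]
    ring

theorem LinDual.of_smul (M : ModuleCat.{u} (DiffOp d)) (r : R) (φ : LinDual d M) :
    DiffOp.of d r • φ = r • φ := by
  change (DiffOp.lift d _ _ _ (DiffOp.of d r) : AddMonoid.End (LinDual d M)) φ = _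
  rw [DiffOp.lift_of]
  rfl

theorem LinDual.del_smul (M : ModuleCat.{u} (DiffOp d)) (φ : LinDual d M) :
    DiffOp.del d • φ = LinDual.nabla d M φ := by
  change (DiffOp.lift d _ _ _ (DiffOp.del d) : AddMonoid.End (LinDual d M)) φ = _
  rw [DiffOp.lift_del]

/-- A map of `R⟨∂⟩`-modules is determined by commuting with functions and with `∂`. -/
theorem DiffOp.smul_induction {M N : Type*} [AddCommGroup M] [AddCommGroup N]
    [Module (DiffOp d) M] [Module (DiffOp d) N] (f : M →+ N)
    (h₁ : ∀ (r : R) (m : M), f (DiffOp.of d r • m) = DiffOp.of d r • f m)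
    (h₂ : ∀ m : M, f (DiffOp.del d • m) = DiffOp.del d • f m) (P : DiffOp d) (m : M) :
    f (P • m) = P • f m := by
  obtain ⟨Q, rfl⟩ := RingQuot.mkRingHom_surjective (DiffOp.Rel d) P
  change f (DiffOp.mk d Q • m) = DiffOp.mk d Q • f m
  induction Q using FreeAlgebra.induction generalizing m with
  | grade0 n => rw [eq_intCast, map_intCast, Int.cast_smul_eq_zsmul, Int.cast_smul_eq_zsmul, map_zsmul]
  | grade1 o =>
    cases o with
    | none => exact h₂ m
    | some r => exact h₁ r m
  | mul P Q hP hQ => rw [map_mul, mul_smul, mul_smul, hP, hQ]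
  | add P Q hP hQ => rw [map_add, add_smul, add_smul, map_add, hP, hQ]

/-- The duality functor `M ↦ M^∨ = Hom_R(M, R)` for `R⟨∂⟩`-modules. -/
def linDual : (ModuleCat.{u} (DiffOp d))ᵒᵖ ⥤ ModuleCat.{u} (DiffOp d) where
  obj M := ModuleCat.of (DiffOp d) (LinDual d M.unop)
  map {M N} f := ModuleCat.ofHom
    { toFun := fun φ : LinDual d M.unop =>
        φ.comp ((ModuleCat.restrictScalars (DiffOp.of d)).map f.unop).hom
      map_add' := fun _ _ => rfl
      map_smul' := DiffOp.smul_induction d (AddMonoidHom.mk' (fun φ : LinDual d M.unop =>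
          (φ.comp ((ModuleCat.restrictScalars (DiffOp.of d)).map f.unop).hom : LinDual d N.unop))
          fun _ _ => rfl)
        (fun r φ => by rw [LinDual.of_smul, LinDual.of_smul]; rfl)
        (fun φ => by
          rw [LinDual.del_smul, LinDual.del_smul]
          apply LinearMap.ext; intro m
          change d (φ _) - φ (DiffOp.del d • f.unop.hom m) =
            d (φ _) - φ (f.unop.hom (DiffOp.del d • m))
          exact congrArg (fun t => d _ - φ t) (f.unop.hom.map_smul (DiffOp.del d) m).symm) }
  map_id _ := rfl
  map_comp _ _ := rfl

/-- Right multiplication by `P` on the left module `R⟨∂⟩`. -/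
def rightMul (P : DiffOp d) :
    ModuleCat.of (DiffOp d) (DiffOp d) ⟶ ModuleCat.of (DiffOp d) (DiffOp d) :=
  ModuleCat.ofHom (LinearMap.toSpanSingleton (DiffOp d) (DiffOp d) P)

/-- `Ext¹(N, R⟨∂⟩)` in the category of left `R⟨∂⟩`-modules. -/
abbrev VerdierDual (N : ModuleCat.{u} (DiffOp d)) : Type u :=
  Abelian.Ext.{u} N (ModuleCat.of (DiffOp d) (DiffOp d)) 1

/-- The right action of `R⟨∂⟩` on `Ext¹(N, R⟨∂⟩)`, turned into a left action by means of the
anti-involution `P ↦ P*`. -/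
instance (N : ModuleCat.{u} (DiffOp d)) : Module (DiffOp d) (VerdierDual d N) where
  smul P e := Abelian.Ext.comp e
    (Abelian.Ext.mk₀ (rightMul d (DiffOp.adjoint d P).unop)) (add_zero 1)
  one_smul e := by
    have h : rightMul d (DiffOp.adjoint d 1).unop = 𝟙 _ := by
      ext; simp [rightMul]
    change Abelian.Ext.comp e (Abelian.Ext.mk₀ _) _ = e
    rw [h, Abelian.Ext.comp_mk₀_id]
  mul_smul P Q e := by
    have h : rightMul d (DiffOp.adjoint d (P * Q)).unop =
        rightMul d (DiffOp.adjoint d Q).unop ≫ rightMul d (DiffOp.adjoint d P).unop := by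
      ext; simp [rightMul]
    change Abelian.Ext.comp e (Abelian.Ext.mk₀ _) _ =
      Abelian.Ext.comp (Abelian.Ext.comp e (Abelian.Ext.mk₀ _) _) (Abelian.Ext.mk₀ _) _
    rw [h, ← Abelian.Ext.mk₀_comp_mk₀, Abelian.Ext.comp_assoc_of_third_deg_zero]
  smul_zero P := by
    change Abelian.Ext.comp 0 (Abelian.Ext.mk₀ _) _ = 0
    rw [Abelian.Ext.zero_comp]
  smul_add P e f := Abelian.Ext.add_comp _ _ _ _
  add_smul P Q e := by
    have h : rightMul d (DiffOp.adjoint d (P + Q)).unop =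
        rightMul d (DiffOp.adjoint d P).unop + rightMul d (DiffOp.adjoint d Q).unop := by
      ext; simp [rightMul]
    change Abelian.Ext.comp e (Abelian.Ext.mk₀ _) _ =
      Abelian.Ext.comp e (Abelian.Ext.mk₀ _) _ + Abelian.Ext.comp e (Abelian.Ext.mk₀ _) _
    rw [h, Abelian.Ext.mk₀_add, Abelian.Ext.comp_add]
  zero_smul e := by
    have h : rightMul d (DiffOp.adjoint d 0).unop = 0 := by
      ext; simp [rightMul]
    change Abelian.Ext.comp e (Abelian.Ext.mk₀ _) _ = 0
    rw [h, Abelian.Ext.mk₀_zero, Abelian.Ext.comp_zero]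

/-- Verdier duality `N ↦ Ext¹(N, R⟨∂⟩)` (for one-dimensional `R`), as a functor to left
`R⟨∂⟩`-modules. -/
def verdierDual : (ModuleCat.{u} (DiffOp d))ᵒᵖ ⥤ ModuleCat.{u} (DiffOp d) where
  obj N := ModuleCat.of (DiffOp d) (VerdierDual d N.unop)
  map {M N} f := ModuleCat.ofHom
    { toFun := fun e : VerdierDual d M.unop =>
        (Abelian.Ext.comp (Abelian.Ext.mk₀ f.unop) e (zero_add 1) : VerdierDual d N.unop)
      map_add' := fun _ _ => Abelian.Ext.comp_add _ _ _ _
      map_smul' := fun P e => (Abelian.Ext.comp_assoc_of_third_deg_zero _ _ _ _).symm }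
  map_id M := by
    ext e
    exact Abelian.Ext.mk₀_id_comp _
  map_comp f g := by
    ext e
    exact (Abelian.Ext.mk₀_comp_mk₀_assoc _ _ _).symm

/-! ### Base change -/

section BaseChange

variable {S : Type u} [CommRing S] [Algebra R S] (e : Der S)
  (he : ∀ r, e (algebraMap R S r) = algebraMap R S (d r))

open scoped TensorProduct

/-- The derivation `s ⊗ m ↦ e s ⊗ m + s ⊗ ∂ m` of `S ⊗_R M`. -/
def baseChangeNabla (M : ModuleCat.{u} (DiffOp d)) : AddMonoid.End (S ⊗[R] under d M) :=
  TensorProduct.liftAddHom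
    (AddMonoidHom.mk' (fun s => AddMonoidHom.mk'
      (fun m => e s ⊗ₜ[R] m + s ⊗ₜ[R] nabla d M m)
      (fun m n => by simp only [map_add, TensorProduct.tmul_add]; abel))
      (fun s t => by
        ext m
        simp only [AddMonoidHom.mk'_apply, AddMonoidHom.add_apply, map_add,
          TensorProduct.add_tmul]
        abel))
    (fun r s m => by
      simp only [AddMonoidHom.mk'_apply]
      rw [nabla_smul, Algebra.smul_def, Der.leibniz, he, TensorProduct.add_tmul,
        TensorProduct.tmul_add, mul_comm s, ← Algebra.smul_def, ← Algebra.smul_def,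
        ← Algebra.smul_def, TensorProduct.smul_tmul, TensorProduct.smul_tmul,
        TensorProduct.smul_tmul]
      abel)

/-- The base change `S ⊗_R M` of an `R⟨∂⟩`-module along a homomorphism `R → S` which is compatible
with the derivations. -/
def baseChange (M : ModuleCat.{u} (DiffOp d)) : ModuleCat.{u} (DiffOp e) :=
  letI : Module (DiffOp e) (S ⊗[R] under d M) :=
    moduleOfDerivation e (S ⊗[R] under d M) (baseChangeNabla d e he M) fun s x => by
      induction x with
      | zero => simp
      | add x y hx hy =>
        rw [smul_add, map_add, hx, hy, map_add, smul_add, smul_add]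
        abel
      | tmul t m =>
        change e (s * t) ⊗ₜ[R] m + (s * t) ⊗ₜ[R] nabla d M m =
          s • (e t ⊗ₜ[R] m + t ⊗ₜ[R] nabla d M m) + (e s * t) ⊗ₜ[R] m
        rw [Der.leibniz, smul_add, TensorProduct.smul_tmul', TensorProduct.smul_tmul',
          TensorProduct.add_tmul, smul_eq_mul, smul_eq_mul, mul_comm (e s)]
        abel
  ModuleCat.of (DiffOp e) (S ⊗[R] under d M)

end BaseChange

end DiffOp

/-! ### The rings of the affine line, of the formal disk and of the punctured formal disk -/

section Rings

open scoped LaurentSeries PowerSeries Polynomial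

variable (κ : Type u) [CommRing κ]

/-- The derivation `d/dt` of `κ[t]`. -/
def polyD : Der κ[X] where
  toAddMonoidHom := (Polynomial.derivative (R := κ)).toAddMonoidHom
  leibniz' p q := by
    change Polynomial.derivative (p * q) = p * Polynomial.derivative q + q * Polynomial.derivative p
    rw [Polynomial.derivative_mul]
    ring

/-- The derivation `d/dt` of `κ⟦t⟧`. -/
def powerD : Der κ⟦X⟧ where
  toAddMonoidHom := (PowerSeries.derivative (R := κ)).toLinearMap.toAddMonoidHom
  leibniz' := (PowerSeries.derivative (R := κ)).leibniz

theorem laurent_derivative_coeff (f : κ⸨X⸩) (n : ℤ) :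
    (LaurentSeries.derivative κ f).coeff n = ((n + 1 : ℤ) : κ) * f.coeff (n + 1) := by
  rw [LaurentSeries.derivative_apply, LaurentSeries.hasseDeriv_coeff]
  simp

theorem laurent_derivative_ofPowerSeries (f : κ⟦X⟧) :
    LaurentSeries.derivative κ (HahnSeries.ofPowerSeries ℤ κ f) =
      HahnSeries.ofPowerSeries ℤ κ (PowerSeries.derivative κ f) := by
  ext n
  rw [laurent_derivative_coeff, PowerSeries.coeff_coe, PowerSeries.coeff_coe]
  rcases lt_trichotomy n (-1) with h | rfl | h
  · rw [if_pos (by lia), if_pos (by lia), mul_zero]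
  · simp
  · rw [if_neg (by lia), if_neg (by lia), PowerSeries.coeff_derivative]
    obtain ⟨m, rfl⟩ := Int.eq_ofNat_of_zero_le (show 0 ≤ n by lia)
    have h1 : ((m : ℤ) + 1).natAbs = m + 1 := by lia
    rw [h1, Int.natAbs_natCast]
    push_cast
    ring

theorem laurent_euler_coeff (f : κ⸨X⸩) (n : ℤ) :
    (HahnSeries.single 1 1 * LaurentSeries.derivative κ f).coeff n = (n : κ) * f.coeff n := by
  rw [HahnSeries.coeff_single_mul, laurent_derivative_coeff, one_mul, sub_add_cancel]

theorem laurent_euler_support (f : κ⸨X⸩) :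
    (HahnSeries.single 1 1 * LaurentSeries.derivative κ f).support ⊆ f.support := fun n hn hf => by
  rw [HahnSeries.mem_support, laurent_euler_coeff, hf, mul_zero] at hn
  exact hn rfl

theorem laurent_derivative_mul (f g : κ⸨X⸩) :
    LaurentSeries.derivative κ (f * g) =
      f * LaurentSeries.derivative κ g + g * LaurentSeries.derivative κ f := by
  have key : (HahnSeries.single 1 1 : κ⸨X⸩) * LaurentSeries.derivative κ (f * g) =
      f * (HahnSeries.single 1 1 * LaurentSeries.derivative κ g) +
        (HahnSeries.single 1 1 * LaurentSeries.derivative κ f) * g := by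
    ext n
    rw [HahnSeries.coeff_add, laurent_euler_coeff,
      HahnSeries.coeff_mul_right' g.isPWO_support (laurent_euler_support κ g),
      HahnSeries.coeff_mul_left' f.isPWO_support (laurent_euler_support κ f),
      HahnSeries.coeff_mul, Finset.mul_sum, ← Finset.sum_add_distrib]
    refine Finset.sum_congr rfl fun ij hij => ?_
    rw [Finset.mem_antidiagonal] at hij
    rw [laurent_euler_coeff, laurent_euler_coeff, ← hij.2.2]
    push_cast
    ring
  have h1 : (HahnSeries.single (-1) 1 : κ⸨X⸩) * HahnSeries.single 1 1 = 1 := by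
    rw [HahnSeries.single_mul_single]
    simp
  have h2 := congrArg (fun x => (HahnSeries.single (-1) 1 : κ⸨X⸩) * x) key
  calc LaurentSeries.derivative κ (f * g)
      = (HahnSeries.single (-1) 1 * HahnSeries.single 1 1) *
          LaurentSeries.derivative κ (f * g) := by rw [h1, one_mul]
    _ = (HahnSeries.single (-1) 1 * HahnSeries.single 1 1) *
          (f * LaurentSeries.derivative κ g + g * LaurentSeries.derivative κ f) := by
        rw [mul_assoc]
        refine h2.trans ?_
        ring
    _ = _ := by rw [h1, one_mul]

/-- The derivation `d/dt` of `κ((t))`. -/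
def laurentD : Der κ⸨X⸩ where
  toAddMonoidHom := (LaurentSeries.derivative κ).toAddMonoidHom
  leibniz' := laurent_derivative_mul κ

theorem laurentD_C (c : κ) : laurentD κ (HahnSeries.C c) = 0 := by
  change LaurentSeries.derivative κ _ = 0
  rw [LaurentSeries.derivative_apply, HahnSeries.C_apply, LaurentSeries.hasseDeriv_single]
  simp

theorem laurentD_inv : laurentD κ (HahnSeries.single (-1) 1) = -HahnSeries.single (-2) 1 := by
  change LaurentSeries.derivative κ _ = _
  rw [LaurentSeries.derivative_apply, LaurentSeries.hasseDeriv_single]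
  simp

/-- The chain rule. -/
theorem Der.map_eval₂ {κ : Type v} [CommRing κ] {S : Type u} [CommRing S] (e : Der S)
    (f : κ →+* S) (x : S) (h : ∀ c, e (f c) = 0) (p : κ[X]) :
    e (Polynomial.eval₂RingHom f x p) =
      Polynomial.eval₂RingHom f x (Polynomial.derivative p) * e x := by
  induction p using Polynomial.induction_on with
  | C a => simp [h]
  | add p q hp hq => simp only [map_add, add_mul, hp, hq]
  | monomial n a ih =>
    have h1 : Polynomial.C a * Polynomial.X ^ (n + 1) =
        (Polynomial.C a * Polynomial.X ^ n) * Polynomial.X := by ring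
    rw [h1]
    generalize Polynomial.C a * Polynomial.X ^ n = q at ih
    rw [map_mul, Der.leibniz, ih, Polynomial.derivative_mul, Polynomial.derivative_X, mul_one,
      map_add, map_mul]
    simp only [Polynomial.coe_eval₂RingHom, Polynomial.eval₂_X]
    ring

/-- The Weyl algebra `κ⟨z, d/dz⟩`. -/
abbrev Weyl : Type u := DiffOp (polyD κ)

/-- `D_A` for `A = κ⟦t⟧`. -/
abbrev DiskOp : Type u := DiffOp (powerD κ)

/-- `D_K` for `K = κ((t))`. -/
abbrev PuncturedOp : Type u := DiffOp (laurentD κ)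

/-- The inclusion of `D_A` into `D_K`. -/
def diskToPunctured : DiskOp κ →+* PuncturedOp κ :=
  DiffOp.map (powerD κ) (laurentD κ) (HahnSeries.ofPowerSeries ℤ κ) 1 fun f =>
    (one_mul _).trans (laurent_derivative_ofPowerSeries κ f)

/-- The extension functor `jo_*`. -/
def lowerStar : ModuleCat.{u} (PuncturedOp κ) ⥤ ModuleCat.{u} (DiskOp κ) :=
  ModuleCat.restrictScalars (diskToPunctured κ)

/-- The extension functor `jo_! = D ∘ jo_* ∘ D`. -/
def lowerShriek : ModuleCat.{u} (PuncturedOp κ) ⥤ ModuleCat.{u} (DiskOp κ) :=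
  (linDual (laurentD κ)).rightOp ⋙ (lowerStar κ).op ⋙ verdierDual (powerD κ)

/-- The Fourier automorphism of the Weyl algebra: `z ↦ -d/dz`, `d/dz ↦ z`. -/
def fourierHom : Weyl κ →+* Weyl κ :=
  DiffOp.lift (polyD κ)
    (Polynomial.eval₂RingHom' ((DiffOp.of (polyD κ)).comp Polynomial.C) (-DiffOp.del (polyD κ))
      fun c => by
        have h : polyD κ (Polynomial.C c) = 0 := Polynomial.derivative_C
        have h' := DiffOp.del_mul_of (polyD κ) (Polynomial.C c)
        rw [h, map_zero, add_zero] at h'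
        exact (Commute.neg_right h'.symm :))
    (DiffOp.of (polyD κ) Polynomial.X) fun p => by
      have hX : polyD κ Polynomial.X = 1 := Polynomial.derivative_X
      have hc := DiffOp.del_mul_of (polyD κ) Polynomial.X
      rw [hX, map_one] at hc
      change _ = _ + Polynomial.eval₂RingHom' _ _ _ (Polynomial.derivative p)
      induction p using Polynomial.induction_on with
      | C a =>
        simp only [Polynomial.eval₂RingHom'_apply, Polynomial.eval₂_C, Polynomial.derivative_C,
          Polynomial.eval₂_zero, add_zero, RingHom.comp_apply]
        rw [← map_mul, ← map_mul, mul_comm]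
      | add p q hp hq =>
        simp only [map_add, mul_add, add_mul, hp, hq]
        abel
      | monomial n a ih =>
        have h1 : Polynomial.C a * Polynomial.X ^ (n + 1) =
            (Polynomial.C a * Polynomial.X ^ n) * Polynomial.X := by ring
        rw [h1]
        generalize Polynomial.C a * Polynomial.X ^ n = q at ih
        rw [map_mul, ← mul_assoc, ih, Polynomial.derivative_mul, Polynomial.derivative_X,
          mul_one, map_add, map_mul]
        simp only [Polynomial.eval₂RingHom'_apply, Polynomial.eval₂_X, add_mul, mul_neg,
          neg_mul, mul_assoc, hc, mul_add, mul_one]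
        abel

/-- The Fourier transform of modules over the Weyl algebra: the same space, on which the Weyl
algebra acts through the Fourier automorphism. -/
def fourier : ModuleCat.{u} (Weyl κ) ⥤ ModuleCat.{u} (Weyl κ) :=
  ModuleCat.restrictScalars (fourierHom κ)

/-- The homomorphism from the Weyl algebra to `D_K`, `K = κ((ζ))`, which describes the punctured
formal neighbourhood of infinity: `z ↦ ζ⁻¹`, `d/dz ↦ -ζ² d/dζ`. -/
def weylToInfinity : Weyl κ →+* PuncturedOp κ :=
  DiffOp.map (polyD κ) (laurentD κ)
    (Polynomial.eval₂RingHom (HahnSeries.C : κ →+* κ⸨X⸩) (HahnSeries.single (-1) 1))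
    (-HahnSeries.single 2 1) fun p => by
      rw [Der.map_eval₂ _ _ _ (laurentD_C κ), laurentD_inv, mul_comm, mul_assoc,
        neg_mul_neg, HahnSeries.single_mul_single]
      norm_num
      rfl

/-- For `a : κ`, where `κ` is an algebra over `k`, the homomorphism from the Weyl algebra over `k`
to `D_A`, `A = κ⟦t⟧`, given by `z ↦ a + t`, `d/dz ↦ d/dt`. -/
def weylToDisk (k : Type u) [CommRing k] [Algebra k κ] (a : κ) : Weyl k →+* DiskOp κ :=
  DiffOp.map (polyD k) (powerD κ)
    (Polynomial.eval₂RingHom ((PowerSeries.C : κ →+* κ⟦X⟧).comp (algebraMap k κ))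
      (PowerSeries.C a + PowerSeries.X))
    1 fun p => by
      have hX : powerD κ (PowerSeries.C a + PowerSeries.X) = 1 := by
        change PowerSeries.derivative κ _ = 1
        simp
      rw [Der.map_eval₂ _ _ _ (fun c => PowerSeries.derivative_C), hX, mul_one, one_mul]
      rfl

/-! ### Topologies -/

/-- A `k`-subspace `U` of a `D_A`-module `M`, where `A = κ⟦t⟧`, is open for the `t`-adic topology if
for every finitely generated `A`-submodule `N` of `M` it contains `tⁿ N` for some `n`. -/
def IsAdicOpen (k : Type u) [CommRing k] [Algebra k κ] (M : ModuleCat.{u} (DiskOp κ))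
    (U : Submodule k ((ModuleCat.restrictScalars
      ((DiffOp.of (powerD κ)).comp (algebraMap k κ⟦X⟧))).obj M)) : Prop :=
  ∀ N : Submodule κ⟦X⟧ (under (powerD κ) M), N.FG →
    ∃ n : ℕ, ∀ m ∈ N, ((PowerSeries.X ^ n : κ⟦X⟧) • m : under (powerD κ) M) ∈ U

/-- The `t`-adic topology on a `D_A`-module: the open subspaces form a base of neighbourhoods
of zero. -/
abbrev adicTopology (k : Type u) [CommRing k] [Algebra k κ] (M : ModuleCat.{u} (DiskOp κ)) :
    TopologicalSpace M where
  IsOpen S := ∀ s ∈ S, ∃ U, IsAdicOpen κ k M U ∧ ∀ w ∈ U, s + (show M from w) ∈ S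
  isOpen_univ _ _ := ⟨⊤, fun _ _ => ⟨0, fun _ _ => trivial⟩, fun _ _ => trivial⟩
  isOpen_inter S T hS hT s hs := by
    obtain ⟨U, hU, hUS⟩ := hS s hs.1
    obtain ⟨V, hV, hVT⟩ := hT s hs.2
    refine ⟨U ⊓ V, fun N hN => ?_, fun w hw => ⟨hUS w hw.1, hVT w hw.2⟩⟩
    obtain ⟨a, ha⟩ := hU N hN
    obtain ⟨b, hb⟩ := hV N hN
    refine ⟨a + b, fun m hm => ⟨?_, ?_⟩⟩
    · rw [pow_add, mul_smul]
      exact ha _ (N.smul_mem _ hm)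
    · rw [add_comm, pow_add, mul_smul]
      exact hb _ (N.smul_mem _ hm)
  isOpen_sUnion 𝒮 h s := by
    rintro ⟨T, hT, hs⟩
    obtain ⟨U, hU, hUT⟩ := h T hT s hs
    exact ⟨U, hU, fun w hw => ⟨T, hT, hUT w hw⟩⟩

/-! ### Slopes -/

/-- The operator `t d/dt` in `D_K`. -/
def eulerOp : PuncturedOp κ :=
  DiffOp.of (laurentD κ) (HahnSeries.single 1 1) * DiffOp.del (laurentD κ)

/-- `s` is the slope of the irreducible `D_K`-module `Q`. Here `q` is a nonzero (hence cyclic)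
vector, `q, δq, …, δⁿ⁻¹q` with `δ = t d/dt` is a basis of `Q` over `K`, and
`δⁿq = c₀ q + c₁ δq + ⋯ + cₙ₋₁ δⁿ⁻¹q`. The slope is the slope of the Newton polygon of this
equation, that is the maximum of `0` and of the numbers `-ord(cᵢ) / (n - i)`. (If `cᵢ = 0` the
convention `ord 0 = 0` makes the index `i` contribute `0`.) -/
def HasSlope (Q : Type u) [AddCommGroup Q] [Module (PuncturedOp κ) Q] (s : ℚ) : Prop :=
  letI : Module κ⸨X⸩ Q := Module.compHom Q (DiffOp.of (laurentD κ))
  ∃ (n : ℕ) (q : Q) (c : Fin n → κ⸨X⸩), q ≠ 0 ∧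
    LinearIndependent κ⸨X⸩ (fun i : Fin n => eulerOp κ ^ (i : ℕ) • q) ∧
    eulerOp κ ^ n • q = ∑ i : Fin n, c i • (eulerOp κ ^ (i : ℕ) • q) ∧
    IsGreatest (insert 0 (Set.range fun i : Fin n =>
      -((c i).order : ℚ) / ((n : ℚ) - ((i : ℕ) : ℚ)))) s

/-- `s` is a slope of `M`: it is the slope of one of the irreducible subquotients of `M`. -/
def IsSlope (M : ModuleCat.{u} (PuncturedOp κ)) (s : ℚ) : Prop :=
  ∃ N₁ N₂ : Submodule (PuncturedOp κ) M, N₁ ≤ N₂ ∧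
    IsSimpleModule (PuncturedOp κ) (N₂ ⧸ N₁.submoduleOf N₂) ∧
    HasSlope κ (N₂ ⧸ N₁.submoduleOf N₂) s

/-- The holonomic `D_K`-modules `Hol(D_K)`. -/
abbrev Hol : ObjectProperty (ModuleCat.{u} (PuncturedOp κ)) := holonomic (laurentD κ)

/-- The holonomic `D_K`-modules all of whose slopes are less than one. -/
def HolSlopeLT : ObjectProperty (ModuleCat.{u} (PuncturedOp κ)) :=
  fun M => Hol κ M ∧ ∀ s, IsSlope κ M s → s < 1

/-- The holonomic `D_K`-modules all of whose slopes are greater than one. -/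
def HolSlopeGT : ObjectProperty (ModuleCat.{u} (PuncturedOp κ)) :=
  fun M => Hol κ M ∧ ∀ s, IsSlope κ M s → 1 < s

/-- The modules isomorphic to `ℓ_β ⊗ N`, where the slopes of the holonomic module `N` are less than
one and `ℓ_β` is `K` with the derivation `d/dζ + β ζ⁻²`. -/
def HolTypeGeom (β : κ) : ObjectProperty (ModuleCat.{u} (PuncturedOp κ)) := fun M =>
  ∃ N : ModuleCat.{u} (PuncturedOp κ), HolSlopeLT κ N ∧
    Nonempty (M ≅ (ModuleCat.restrictScalars
      (DiffOp.twist (laurentD κ) (HahnSeries.single (-2) β))).obj N)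

/-! ### Extension of constants -/

variable {κ} in
/-- The homomorphism `κ((t)) → κ'((t))` induced by `φ : κ → κ'`. -/
def laurentMap {κ' : Type v} [CommRing κ'] (φ : κ →+* κ') : κ⸨X⸩ →+* κ'⸨X⸩ where
  toFun f := HahnSeries.map f φ
  map_one' := by
    ext n
    simp only [HahnSeries.map_coeff, HahnSeries.coeff_one]
    split_ifs <;> simp
  map_mul' f g := HahnSeries.map_mul (φ : κ →ₙ+* κ')
  map_zero' := by
    ext n
    simp
  map_add' f g := by
    ext n
    simp

theorem laurentD_map {κ : Type u} {κ' : Type v} [CommRing κ] [CommRing κ'] (φ : κ →+* κ')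
    (f : κ⸨X⸩) : laurentD κ' (laurentMap φ f) = laurentMap φ (laurentD κ f) := by
  ext n
  change (LaurentSeries.derivative κ' _).coeff n = φ ((LaurentSeries.derivative κ f).coeff n)
  rw [laurent_derivative_coeff, laurent_derivative_coeff, map_mul, map_intCast]
  rfl

end Rings


/-! ### The affine line -/

section AffineLine

open scoped LaurentSeries PowerSeries Polynomial

variable (k : Type u) [Field k]

/-- Base change from `k((ζ))` to `k̄((ζ))`, where `k̄` is the algebraic closure of `k`. -/
def toUnr (M : ModuleCat.{u} (PuncturedOp k)) :
    ModuleCat.{u} (PuncturedOp (AlgebraicClosure k)) :=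
  letI : Algebra k⸨X⸩ (AlgebraicClosure k)⸨X⸩ :=
    (laurentMap (algebraMap k (AlgebraicClosure k))).toAlgebra
  baseChange (laurentD k) (laurentD (AlgebraicClosure k)) (laurentD_map _) M

/-- The closed points of the affine line over `k`. -/
abbrev ClosedPt : Type u := MaximalSpectrum k[X]

variable {k}

/-- The residue field of a closed point. -/
abbrev ClosedPt.residue (x : ClosedPt k) : Type u := k[X] ⧸ x.asIdeal

/-- The coordinate of the closed point `x`, as an element of its residue field. -/
def ClosedPt.coord (x : ClosedPt k) : x.residue := Ideal.Quotient.mk x.asIdeal Polynomial.X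

/-- The geometric points corresponding to a closed point. -/
def ClosedPt.geom (x : ClosedPt k) : Set (AlgebraicClosure k) :=
  {β | ∀ p ∈ x.asIdeal, Polynomial.aeval β p = 0}

/-- The closed point `-x`. -/
def ClosedPt.neg (x : ClosedPt k) : ClosedPt k where
  asIdeal := x.asIdeal.comap (Polynomial.aeval (-Polynomial.X : k[X]))
  isMaximal := by
    have := x.isMaximal
    refine Ideal.comap_isMaximal_of_surjective _ fun p => ⟨p.comp (-Polynomial.X), ?_⟩
    rw [Polynomial.aeval_def, Polynomial.algebraMap_eq, ← Polynomial.comp, Polynomial.comp_assoc]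
    simp

/-- The full subcategory `Hol(D_{K_∞})^{≤1,(x)}`: the holonomic modules `M` such that `M ⊗ k̄` is a
direct sum over the geometric points `β` of `x` of modules of the form `ℓ_β ⊗ N` where the slopes of
`N` are less than one. -/
def HolType (x : ClosedPt k) : ObjectProperty (ModuleCat.{u} (PuncturedOp k)) := fun M =>
  Hol k M ∧ ∃ N : x.geom → Submodule (PuncturedOp (AlgebraicClosure k)) (toUnr k M),
    iSupIndep N ∧ ⨆ β, N β = ⊤ ∧
      ∀ β : x.geom, HolTypeGeom (AlgebraicClosure k) β (ModuleCat.of _ (N β))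

/-- The restriction of differential operators from the affine line to the formal neighbourhood of
the closed point `x`. The completed local ring at `x` is `κ⟦t⟧`, where `κ` is the residue field and
`t = z - a` with `a ∈ κ` the coordinate of `x`; so `z ↦ a + t` and `d/dz ↦ d/dt`. -/
def ClosedPt.restrict (x : ClosedPt k) : Weyl k →+* DiskOp x.residue :=
  weylToDisk x.residue k x.coord

/-- The functor `j_{x*} jo_!` from `Hol(D_{K_x})` to modules over the Weyl algebra. -/
def extendFinite (x : ClosedPt k) : (Hol x.residue).FullSubcategory ⥤ ModuleCat.{u} (Weyl k) :=
  (Hol x.residue).ι ⋙ lowerShriek x.residue ⋙ ModuleCat.restrictScalars x.restrict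

/-- The functor `jo_{∞*}` to modules over the Weyl algebra, on a full subcategory of the category
of `D_{K_∞}`-modules. -/
def extendInfinite (P : ObjectProperty (ModuleCat.{u} (PuncturedOp k))) :
    P.FullSubcategory ⥤ ModuleCat.{u} (Weyl k) :=
  P.ι ⋙ ModuleCat.restrictScalars (weylToInfinity k)

/-- The natural topology on `j_{x*} jo_! M` (and on its Fourier transform, which is the same
space). -/
abbrev topFinite (x : ClosedPt k) (M : (Hol x.residue).FullSubcategory) :
    TopologicalSpace ((lowerShriek x.residue).obj M.obj) :=
  adicTopology x.residue k ((lowerShriek x.residue).obj M.obj)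

/-- The natural topology on `jo_{∞*} M` (and on its Fourier transform, which is the same space). -/
abbrev topInfinite {P : ObjectProperty (ModuleCat.{u} (PuncturedOp k))}
    (M : P.FullSubcategory) : TopologicalSpace M.obj :=
  adicTopology k k ((lowerStar k).obj M.obj)

/-- A functorial isomorphism `S ≅ T` all of whose components are homeomorphisms for given
topologies on the modules `S M` and `T M`. -/
def IsBicontinuous {C : Type*} [Category* C] {S T : C ⥤ ModuleCat.{u} (Weyl k)}
    (tS : ∀ M, TopologicalSpace (S.obj M)) (tT : ∀ M, TopologicalSpace (T.obj M))
    (θ : S ≅ T) : Prop :=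
  ∀ M, @IsHomeomorph _ _ (tS M) (tT M) (θ.hom.app M).hom

end AffineLine

end LocalFourier

end

/-!
The theorem rests on a reduction of equivalences of categories to statements about single objects.
Continuous Weyl-linear maps between modules `j_{x*} jo_! M`, or between modules `jo_{∞*} M`, come
from unique maps of `D_K`-modules, because polynomials in `z` are dense in the completed local ring
at `x`, and polynomials in `z` and `1/z` in `k((1/z))` (`contFF_lowerShriek`,
`contFF_extendInfinite`). Once every topological Weyl module on one side is
the Fourier transform of one on the other side, and conversely, there is an equivalence inducing
these correspondences, and it is unique up to unique isomorphism (`ContFF.exists_equivalence`).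

It remains to recognize the transformed modules. Let `X = 1/z`. The Fourier transform of a module at
infinity has `z` acting as `X² d/dX` and `d/dz` acting as `X⁻¹`, so the question is when these two
operators, with their roles exchanged, again define a differential module.

* Infinity to infinity. All slopes are greater than one if and only if `X² d/dX` is expanding, that
  is, bijective with a topologically nilpotent inverse (`forall_one_lt_slope_iff`). Then series in
  the inverse act, and `X² d/dX` may serve as the new `X⁻¹` (`IsExpanding.exists_module`). The old
  `X⁻¹` is expanding too, so the new slopes are greater than one
  (`exists_transform_infinity_infinity`).

* A finite point to infinity. The module `M` has a cyclic vector whose equation, after a shift by a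
  power of `X`, is nonresonant: its indicial polynomial has no root in `ℕ`. Nonresonant operators
  present `jo_* M`, and their adjoints present `jo_! M`. Hence `d/dX` is bijective on `jo_! M`, and
  its inverse is topologically nilpotent, so `d/dX` may serve, up to sign, as `X⁻¹` at infinity
  (`exists_transform_finite_infinity`). There `X² d/dX` acts, up to sign, as a function whose
  value at the point is its coordinate; decomposing over the algebraic closure gives modules on
  which `X² d/dX - β` is topologically nilpotent, which means slopes less than one after a twist
  (`forall_slope_lt_one_iff`, `exists_transform_finite_infinity_holType`).

* Infinity to a finite point. A module of type `x` has a stable lattice on which `p(X² d/dX)` is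
  topologically nilpotent, where `p` is a generator of the ideal of `x`
  (`exists_lattice_of_holType`). By Hensel's lemma `X² d/dX` is congruent to a root of `p` commuting
  with `X⁻¹` (`TopNilpotent.exists_root`), which makes the module a vector space over the residue
  field (`exists_module_over_residue`). After subtracting this root, power series in `X² d/dX` act.
  The image of a lattice under `X d/dX` is open (`exists_isLattice_euler_surjective`), whence the
  topology given by these power series is the original one. With `X⁻¹` as derivation the result is
  of the form `jo_! M`, as the modules `jo_! M` are those with a lattice and a bijective derivation
  (`exists_lowerShriek_of_nilpotent`, `exists_lowerShriek_equiv`).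

Slopes are tied to stable lattices by Newton polygons: with `δ = X d/dX`, the minimal equation of
`q` has slope at most one if and only if the `Xⁱ δⁱ q` generate a lattice stable under `X² d/dX`
(`SlopeAt.isBounded`, `SlopeAt.of_isBounded`).
-/

noncomputable section

set_option linter.unusedSectionVars false

namespace LocalFourier

open scoped PowerSeries LaurentSeries Polynomial Pointwise
open PowerSeries (X C trunc constantCoeff X_dvd_iff)
open Polynomial (aeval aeval_X aeval_C eval_X eval_C eval₂_add)
open Polynomial renaming X → PX, C → PC
open HahnSeries (single ofPowerSeries ofPowerSeries_X ofPowerSeries_C single_mul_single)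
open Submodule (span subset_span mem_sup mem_sup_left mem_sup_right mem_map_of_mem span_le fg_span
  smul_mem)
open Submodule renaming mem_span_range_iff_exists_fun → mem_span_range,
  mem_smul_pointwise_iff_exists → mem_smul_iff, fg_iff_exists_fin_generating_family → fg_iff_fin
open Submodule.Quotient (mk_eq_zero)
open Module.End (mul_apply)
open Set (range)
open LinearMap (ker mem_ker)
open Finset (smul_sum sum_congr sum_sub_distrib sum_smul single_le_sum sum_eq_zero mem_univ)
open ModuleCat (restrictScalars)
open Function (iterate_succ_apply)
open Function renaming iterate_succ_apply' → iter_succ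
open DiffOp (of del adjoint twist lift_of lift_del smul_induction del_mul_of)

set_option hygiene false in
/-- Power series over the field `K` of the context. -/
scoped notation "O" => PowerSeries K

set_option hygiene false in
/-- The uniformizer of `O`. -/
scoped notation "ϖ" => (X : PowerSeries K)

set_option hygiene false in
/-- Laurent series over `K`. -/
scoped notation "Kx" => LaurentSeries K

set_option hygiene false in
/-- The derivation of `O`. -/
scoped notation "dO" => powerD K

set_option hygiene false in
/-- The derivation of `Kx`. -/
scoped notation "dK" => laurentD K

set_option hygiene false in
/-- The differential operators over `O`. -/
scoped notation "DO" => DiskOp K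

set_option hygiene false in
/-- The differential operators over `Kx`. -/
scoped notation "DK" => PuncturedOp K

/-! ### Equivalences detected by continuous maps -/

section Reconstruction

variable {k : Type u} [Field k] {C D : Type*} [Category* C] [Category* D]

/-- The functor `S` to topological modules over the Weyl algebra is fully faithful: the maps `S f`
are the continuous Weyl-linear maps, and `f` can be recovered from `S f`. -/
structure ContFF (S : C ⥤ ModuleCat.{u} (Weyl k)) (tS : ∀ c, TopologicalSpace (S.obj c)) :
    Prop where
  faithful : S.Faithful
  cont : ∀ {c c' : C} (f : c ⟶ c'), @Continuous _ _ (tS c) (tS c') (S.map f).hom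
  full : ∀ {c c' : C} (g : S.obj c ⟶ S.obj c'), @Continuous _ _ (tS c) (tS c') g.hom →
    ∃ f : c ⟶ c', S.map f = g

variable {S : C ⥤ ModuleCat.{u} (Weyl k)} {tS : ∀ c, TopologicalSpace (S.obj c)}
  {T : D ⥤ ModuleCat.{u} (Weyl k)} {tT : ∀ d, TopologicalSpace (T.obj d)}

/-- A bicontinuous isomorphism between values of `T` is the image of an isomorphism. -/
theorem ContFF.exists_iso (hT : ContFF T tT) {d d' : D} (e : T.obj d ≅ T.obj d')
    (he : @Continuous _ _ (tT d) (tT d') e.hom.hom)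
    (he' : @Continuous _ _ (tT d') (tT d) e.inv.hom) : ∃ i : d ≅ d', T.mapIso i = e := by
  have := hT.faithful
  obtain ⟨f, hf⟩ := hT.full e.hom he
  obtain ⟨g, hg⟩ := hT.full e.inv he'
  exact ⟨⟨f, g, T.map_injective (by simp [hf, hg]), T.map_injective (by simp [hf, hg])⟩,
    by ext1; exact hf⟩

theorem continuous_inv_of_isHomeomorph {X Y : ModuleCat.{u} (Weyl k)} (tX : TopologicalSpace X)
    (tY : TopologicalSpace Y) (e : X ≅ Y) (h : IsHomeomorph e.hom.hom) :
    Continuous e.inv.hom := by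
  have h1 : (e.inv.hom : Y → X) = (h.homeomorph _).symm := by
    funext y
    apply (h.homeomorph _).injective
    rw [Homeomorph.apply_symm_apply]
    exact congrArg (fun f => f.hom y) e.inv_hom_id
  rw [h1]
  exact (h.homeomorph _).symm.continuous

/-- If the continuous maps between the objects `S c` and between the objects `T d` come from the
source categories, then a correspondence between the topological modules `S c` and `T d` is induced
by an equivalence, which is unique up to unique isomorphism. -/
theorem ContFF.exists_equivalence (hS : ContFF S tS) (hT : ContFF T tT)
    (h₁ : ∀ c, ∃ d, ∃ e : S.obj c ≅ T.obj d, @IsHomeomorph _ _ (tS c) (tT d) e.hom.hom)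
    (h₂ : ∀ d, ∃ c, ∃ e : S.obj c ≅ T.obj d, @IsHomeomorph _ _ (tS c) (tT d) e.hom.hom) :
    ∃ (F : C ≌ D) (θ : S ≅ F.functor ⋙ T), IsBicontinuous tS (fun c => tT (F.functor.obj c)) θ ∧
      ∀ (G : C ⥤ D) (η : S ≅ G ⋙ T), IsBicontinuous tS (fun c => tT (G.obj c)) η →
        ∃! α : F.functor ≅ G, θ ≪≫ Functor.isoWhiskerRight α T = η := by
  have := hS.faithful
  have := hT.faithful
  choose obj e he using h₁
  have hinv : ∀ c, @Continuous _ _ (tT (obj c)) (tS c) (e c).inv.hom := fun c =>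
    continuous_inv_of_isHomeomorph (tS c) (tT (obj c)) (e c) (he c)
  have hmap : ∀ (c c' : C) (f : c ⟶ c'), ∃ g : obj c ⟶ obj c',
      T.map g = (e c).inv ≫ S.map f ≫ (e c').hom := fun c c' f => by
    refine hT.full _ ?_
    let := tS c
    let := tS c'
    let := tT (obj c)
    let := tT (obj c')
    exact (he c').continuous.comp ((hS.cont f).comp (hinv c))
  choose map hmap using hmap
  let F : C ⥤ D :=
    { obj := obj
      map := fun {c c'} f => map c c' f
      map_id := fun c => T.map_injective (by rw [hmap]; simp)
      map_comp := fun f g => T.map_injective (by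
        rw [hmap, T.map_comp, hmap, hmap]
        simp) }
  let θ : S ≅ F ⋙ T := NatIso.ofComponents e fun {c c'} f => by
    change S.map f ≫ (e c').hom = (e c).hom ≫ T.map (map _ _ f)
    rw [hmap]
    simp
  have hFf : F.Faithful := ⟨fun {c c'} f g hfg => S.map_injective (by
    have h1 : T.map (map _ _ f) = T.map (map _ _ g) := congrArg T.map hfg
    rw [hmap, hmap] at h1
    simpa using h1)⟩
  have hFF : F.Full := ⟨fun {c c'} g => by
    obtain ⟨f, hf⟩ := hS.full ((e c).hom ≫ T.map g ≫ (e c').inv) (by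
      let := tS c
      let := tS c'
      let := tT (obj c)
      let := tT (obj c')
      exact (hinv c').comp ((hT.cont g).comp (he c).continuous))
    refine ⟨f, T.map_injective ?_⟩
    change T.map (map _ _ f) = T.map g
    rw [hmap, hf]
    simp⟩
  have hFE : F.EssSurj := ⟨fun d => by
    obtain ⟨c, i, hi⟩ := h₂ d
    obtain ⟨j, -⟩ := hT.exists_iso (d := obj c) (d' := d) ((e c).symm ≪≫ i) (by
      let := tS c
      let := tT d
      let := tT (obj c)
      exact hi.continuous.comp (hinv c)) (by
      let := tS c
      let := tT d
      let := tT (obj c)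
      exact (he c).continuous.comp (continuous_inv_of_isHomeomorph _ _ i hi))
    exact ⟨c, ⟨j⟩⟩⟩
  have hFeq : F.IsEquivalence := { faithful := hFf, full := hFF, essSurj := hFE }
  refine ⟨F.asEquivalence, θ, fun c => he c, fun G η hη => ?_⟩
  have hα : ∀ c, ∃ i : obj c ≅ G.obj c, T.mapIso i = (e c).symm ≪≫ η.app c := fun c => by
    let := tS c
    let := tT (obj c)
    let : TopologicalSpace ((G ⋙ T).obj c) := tT (G.obj c)
    exact hT.exists_iso _ ((hη c).continuous.comp (hinv c))
      ((he c).continuous.comp (continuous_inv_of_isHomeomorph _ _ (η.app c) (hη c)))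
  choose i hi using hα
  have hi' : ∀ c, T.map (i c).hom = (e c).inv ≫ η.hom.app c := fun c =>
    congrArg Iso.hom (hi c)
  refine ⟨NatIso.ofComponents i fun {c c'} f => T.map_injective ?_, ?_, fun β hβ => ?_⟩
  · change T.map (map _ _ f ≫ (i c').hom) = T.map ((i c).hom ≫ G.map f)
    rw [T.map_comp, T.map_comp, hmap, hi', hi']
    have := η.hom.naturality f
    simp only [Functor.comp_map] at this
    simp [this]
  · ext1
    ext1
    funext c
    change (e c).hom ≫ T.map (i c).hom = η.hom.app c
    rw [hi']
    simp
  · ext1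
    ext1
    funext c
    apply T.map_injective
    change T.map (β.hom.app c) = T.map (i c).hom
    have h1 : (e c).hom ≫ T.map (β.hom.app c) = η.hom.app c :=
      congrArg (fun t : S ≅ G ⋙ T => t.hom.app c) hβ
    rw [hi', ← h1, Iso.inv_hom_id_assoc]
    rfl

end Reconstruction

/-! ### Finitely generated modules over a ring of formal power series -/

section PowerSeriesModules

variable {K : Type u} [Field K] {V : Type v} [AddCommGroup V] [Module O V]

variable {L : Submodule O V} {v : V}

theorem mem_pow_smul {n : ℕ} :
    v ∈ ϖ ^ n • L ↔ ∃ w ∈ L, ϖ ^ n • w = v :=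
  mem_smul_iff _ _ _

theorem pow_smul_le (n : ℕ) (L : Submodule O V) : ϖ ^ n • L ≤ L := by
  intro v hv
  obtain ⟨w, hw, rfl⟩ := mem_pow_smul.1 hv
  exact L.smul_mem _ hw

theorem pow_smul_anti {m n : ℕ} (h : m ≤ n) (L : Submodule O V) :
    ϖ ^ n • L ≤ ϖ ^ m • L := by
  intro v hv
  obtain ⟨w, hw, rfl⟩ := mem_pow_smul.1 hv
  obtain ⟨r, rfl⟩ := Nat.exists_eq_add_of_le h
  rw [pow_add, mul_smul]
  exact mem_pow_smul.2 ⟨_, L.smul_mem _ hw, rfl⟩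

theorem pow_smul_mono (n : ℕ) {L M : Submodule O V} (h : L ≤ M) :
    ϖ ^ n • L ≤ ϖ ^ n • M := by
  intro v hv
  obtain ⟨w, hw, rfl⟩ := mem_pow_smul.1 hv
  exact mem_pow_smul.2 ⟨w, h hw, rfl⟩

theorem pow_smul_mem_add {n m : ℕ} (h : v ∈ ϖ ^ n • L) :
    ϖ ^ m • v ∈ ϖ ^ (m + n) • L := by
  obtain ⟨w, hw, rfl⟩ := mem_pow_smul.1 h
  exact mem_pow_smul.2 ⟨w, hw, by rw [pow_add, mul_smul]⟩

/-- Sums `∑ Xⁱ aᵢ` of power series. -/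
theorem exists_powerSeries_sum (a : ℕ → O) : ∃ s : O, ∀ n,
    (ϖ ^ n) ∣ s - ∑ i ∈ Finset.range n, X ^ i * a i := by
  refine ⟨PowerSeries.mk fun m => PowerSeries.coeff m
    (∑ i ∈ Finset.range (m + 1), X ^ i * a i), fun n => ?_⟩
  rw [PowerSeries.X_pow_dvd_iff]
  intro m hm
  rw [map_sub, PowerSeries.coeff_mk, sub_eq_zero, map_sum, map_sum]
  refine Finset.sum_subset (Finset.range_mono hm) fun i _ hi => ?_
  rw [PowerSeries.coeff_X_pow_mul', if_neg]
  simpa using hi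

/-- A finitely generated module over `O` is complete. -/
theorem exists_limit (hL : L.FG) (w : ℕ → V) (hw : ∀ n, w n ∈ L) :
    ∃ s ∈ L, ∀ n, s - ∑ i ∈ Finset.range n, ϖ ^ i • w i ∈ ϖ ^ n • L := by
  obtain ⟨r, b, rfl⟩ := fg_iff_fin.1 hL
  have h1 : ∀ n, ∃ c : Fin r → O, ∑ j, c j • b j = w n := fun n =>
    (mem_span_range _).1 (hw n)
  choose c hc using h1
  choose s hs using fun j => exists_powerSeries_sum fun n => c n j
  refine ⟨∑ j, s j • b j, sum_mem fun j _ => smul_mem _ _ (subset_span ⟨j, rfl⟩), fun n => ?_⟩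
  choose q hq using fun j => hs j n
  refine mem_pow_smul.2 ⟨∑ j, q j • b j, sum_mem fun j _ => smul_mem _ _ (subset_span ⟨j, rfl⟩), ?_⟩
  simp_rw [← hc, smul_sum]
  rw [Finset.sum_comm, ← sum_sub_distrib]
  refine sum_congr rfl fun j _ => ?_
  rw [← mul_smul, ← hq, sub_smul, sum_smul]
  simp_rw [mul_smul]

/-- A limit of a Cauchy sequence in a finitely generated module over `O`. -/
theorem exists_limit_of_cauchy (hL : L.FG) (y : ℕ → V) (hy : ∀ n, y (n + 1) - y n ∈ ϖ ^ n • L) :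
    ∃ s, ∀ n, s - y n ∈ ϖ ^ n • L := by
  choose w hw hw' using fun n => mem_pow_smul.1 (hy n)
  obtain ⟨s, -, hs⟩ := exists_limit hL w hw
  refine ⟨s + y 0, fun n => ?_⟩
  have h1 := hs n
  simp_rw [hw', Finset.sum_range_sub] at h1
  convert h1 using 1
  abel

/-- A finitely generated module over `O` is separated. -/
theorem eq_zero_of_forall_mem_pow (hL : L.FG) (h : ∀ n, v ∈ ϖ ^ n • L) : v = 0 := by
  have hfin : Module.Finite O L := Module.Finite.iff_fg.2 hL
  have hv : v ∈ L := pow_smul_le 0 L (h 0)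
  have h1 : (⟨v, hv⟩ : L) ∈ (⨅ i : ℕ, Ideal.span {ϖ} ^ i • ⊤ : Submodule O L) := by
    rw [Submodule.mem_iInf]
    intro n
    obtain ⟨w, hw, hwv⟩ := mem_pow_smul.1 (h n)
    have h2 : (⟨v, hv⟩ : L) = ϖ ^ n • ⟨w, hw⟩ := Subtype.ext hwv.symm
    rw [h2]
    exact Submodule.smul_mem_smul (Ideal.pow_mem_pow (Ideal.mem_span_singleton_self _) n) trivial
  rw [Ideal.iInf_pow_smul_eq_bot_of_isLocalRing] at h1
  · exact congrArg Subtype.val ((Submodule.mem_bot _).1 h1)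
  · rw [Ne, Ideal.eq_top_iff_one, Ideal.mem_span_singleton]
    exact fun h => PowerSeries.X_prime.not_isUnit (isUnit_of_dvd_one h)

/-- Submodules of finitely generated modules over `O` are closed. -/
theorem mem_of_forall_mem_sup {L E : Submodule O V} (hL : L.FG)
    (h : ∀ n, ∃ c ∈ E, v - c ∈ ϖ ^ n • L) : v ∈ E := by
  rw [← mk_eq_zero E]
  refine eq_zero_of_forall_mem_pow (L := L.map E.mkQ) (hL.map _) fun n => ?_
  obtain ⟨c, hc, hvc⟩ := h n
  obtain ⟨w, hw, hwv⟩ := mem_pow_smul.1 hvc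
  refine mem_pow_smul.2 ⟨E.mkQ w, ⟨w, hw, rfl⟩, ?_⟩
  rw [← map_smul, hwv]
  change Submodule.Quotient.mk (v - c) = _
  rw [Submodule.Quotient.mk_sub, (mk_eq_zero E).2 hc, sub_zero]

theorem FG.of_le {L M : Submodule O V} (hL : L.FG) (h : M ≤ L) : M.FG := by
  have hfin : Module.Finite O L := Module.Finite.iff_fg.2 hL
  have h1 := (IsNoetherian.noetherian (M.submoduleOf L) : (M.submoduleOf L).FG).map L.subtype
  rwa [Submodule.submoduleOf, Submodule.map_comap_subtype, inf_eq_right.2 h] at h1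

theorem eq_bot_of_le_smul (hL : L.FG) (h : L ≤ ϖ • L) : L = ⊥ := by
  have h1 : ∀ n, L ≤ ϖ ^ n • L := by
    intro n
    induction n with
    | zero => simp
    | succ n ih =>
      intro v hv
      obtain ⟨w, hw, rfl⟩ := mem_pow_smul.1 (ih hv)
      have := h hw
      rw [← pow_one ϖ] at this
      exact pow_smul_mem_add this
  rw [eq_bot_iff]
  exact fun v hv => eq_zero_of_forall_mem_pow hL fun n => h1 n hv

/-- The quotient `L / Xⁿ L` is finite over the field of constants. -/
theorem exists_finite_mod_pow (hL : L.FG) (m : ℕ) :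
    ∃ (r : ℕ) (b : Fin r → V), (∀ i, b i ∈ L) ∧ ∀ v ∈ L, ∃ c : Fin r → K,
      v - ∑ i, (C (c i) : O) • b i ∈ ϖ ^ m • L := by
  obtain ⟨r, b, rfl⟩ := fg_iff_fin.1 hL
  have hb : ∀ j, b j ∈ span O (range b) := fun j => subset_span ⟨j, rfl⟩
  let e := finProdFinEquiv (m := r) (n := m)
  refine ⟨r * m, fun i => (X ^ ((e.symm i).2 : ℕ) : O) • b (e.symm i).1,
    fun i => smul_mem _ _ (hb _), fun v hv => ?_⟩
  obtain ⟨f, rfl⟩ := (mem_span_range _).1 hv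
  refine ⟨fun i => PowerSeries.coeff ((e.symm i).2 : ℕ) (f (e.symm i).1), ?_⟩
  rw [e.symm.sum_comp fun x : Fin r × Fin m =>
    (C (PowerSeries.coeff (x.2 : ℕ) (f x.1)) : O) •
      (X ^ (x.2 : ℕ) : O) • b x.1, Fintype.sum_prod_type, ← sum_sub_distrib]
  refine sum_mem fun j _ => ?_
  have h1 : (ϖ ^ m) ∣ f j - ∑ i : Fin m, C (PowerSeries.coeff (i : ℕ) (f j)) * X ^ (i : ℕ) := by
    rw [PowerSeries.X_pow_dvd_iff]
    intro n hn
    rw [map_sub, map_sum, sub_eq_zero, Finset.sum_eq_single ⟨n, hn⟩]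
    · simp [PowerSeries.coeff_C_mul]
    · intro i _ hi
      rw [PowerSeries.coeff_C_mul, PowerSeries.coeff_X_pow, if_neg, mul_zero]
      exact fun h => hi (Fin.ext h.symm)
    · simp
  obtain ⟨q, hq⟩ := h1
  refine mem_pow_smul.2 ⟨q • b j, smul_mem _ _ (hb j), ?_⟩
  rw [← mul_smul, ← hq, sub_smul, sum_smul]
  simp_rw [mul_smul]

/-- Modulo `Xᵐ`, where `L` is finite-dimensional over `K`, a decreasing sequence of submodules is
stationary. -/
theorem eventually_sup_eq (hL : L.FG) (E : ℕ → Submodule O V)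
    (hE : Antitone E) (hCL : ∀ n, E n ≤ L) (m : ℕ) : ∃ N, ∀ n, N ≤ n → E N ≤ E n ⊔ ϖ ^ m • L := by
  obtain ⟨r, b, hb, hbL⟩ := exists_finite_mod_pow hL m
  let : Module K V := Module.compHom V (C : K →+* O)
  let F : ℕ → Submodule K (Fin r → K) := fun n =>
    { carrier := {c | ∑ i, (C (c i) : O) • b i ∈ E n ⊔ ϖ ^ m • L}
      add_mem' := fun {x y} hx hy => by
        simp only [Set.mem_ofPred_eq, Pi.add_apply, map_add, add_smul, Finset.sum_add_distrib]
        exact add_mem hx hy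
      zero_mem' := by simp
      smul_mem' := fun c x hx => by
        simp only [Set.mem_ofPred_eq, Pi.smul_apply, smul_eq_mul, map_mul, mul_smul, ← smul_sum]
        exact smul_mem _ _ hx }
  have hF : Antitone F := fun i j hij c hc => sup_le_sup_right (hE hij) _ hc
  obtain ⟨N, hN⟩ := IsArtinian.monotone_stabilizes (R := K) (M := Fin r → K)
    ⟨fun n => OrderDual.toDual (F n), fun i j hij => hF hij⟩
  refine ⟨N, fun n hn v hv => ?_⟩
  obtain ⟨c, hc⟩ := hbL v (hCL N hv)
  have h1 : c ∈ F N := by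
    change ∑ i, (C (c i) : O) • b i ∈ E N ⊔ ϖ ^ m • L
    have := sub_mem (mem_sup_left (T := ϖ ^ m • L) hv) (mem_sup_right (S := E N) hc)
    rwa [sub_sub_cancel] at this
  rw [show F N = F n from hN n hn] at h1
  have := add_mem (mem_sup_right (S := E n) hc)
    (show ∑ i, (C (c i) : O) • b i ∈ E n ⊔ ϖ ^ m • L from h1)
  rwa [sub_add_cancel] at this

/-- Finitely generated modules over `O` are linearly compact: a decreasing sequence of cosets of
submodules has a common point. -/
theorem exists_mem_cosets (hL : L.FG) (E : ℕ → Submodule O V)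
    (hE : Antitone E) (hCL : ∀ n, E n ≤ L) (c : ℕ → V)
    (hc : ∀ n, c (n + 1) - c n ∈ E n) : ∃ x, ∀ n, x - c n ∈ E n := by
  have hcc : ∀ m n, m ≤ n → c n - c m ∈ E m := by
    intro m n hmn
    induction n, hmn using Nat.le_induction with
    | base => simp
    | succ n hmn ih =>
      rw [← sub_add_sub_cancel (c (n + 1)) (c n) (c m)]
      exact add_mem (hE hmn (hc n)) ih
  choose N hN using eventually_sup_eq hL E hE hCL
  let M : ℕ → ℕ := fun m => (∑ i ∈ Finset.range (m + 1), N i) + m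
  have hM : Monotone M := fun i j hij => add_le_add
    (Finset.sum_le_sum_of_subset (Finset.range_mono (by lia))) hij
  have hNM : ∀ m, N m ≤ M m := fun m =>
    (single_le_sum (f := N) (fun _ _ => Nat.zero_le _)
      (Finset.self_mem_range_succ m)).trans (Nat.le_add_right _ _)
  have hstep : ∀ m y, y - c (M m) ∈ E (M m) → ∃ y', y' - c (M (m + 1)) ∈ E (M (m + 1)) ∧
      y' - y ∈ ϖ ^ m • L := by
    intro m y hy
    have h1 : c (M (m + 1)) - y ∈ E (M m) := by
      rw [← sub_sub_sub_cancel_right _ _ (c (M m))]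
      exact sub_mem (hcc _ _ (hM (Nat.le_succ m))) hy
    obtain ⟨z, hz, w, hw, hzw⟩ := mem_sup.1
      (hN m (M (m + 1)) ((hNM m).trans (hM (Nat.le_succ m))) (hE (hNM m) h1))
    refine ⟨c (M (m + 1)) - z, by simpa using hz, ?_⟩
    have : c (M (m + 1)) - z - y = w := by
      rw [sub_right_comm, ← hzw, add_sub_cancel_left]
    rwa [this]
  choose! nx hnx1 hnx2 using hstep
  let y : ℕ → V := fun m => Nat.rec (c (M 0)) (fun m z => nx m z) m
  have hy : ∀ m, y m - c (M m) ∈ E (M m) := by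
    intro m
    induction m with
    | zero => simp [y]
    | succ m ih => exact hnx1 m _ ih
  obtain ⟨x, hx⟩ := exists_limit_of_cauchy hL y fun m => hnx2 m _ (hy m)
  refine ⟨x, fun n => mem_of_forall_mem_sup hL fun m => ?_⟩
  refine ⟨y (m + n) - c n, ?_, ?_⟩
  · rw [← sub_add_sub_cancel _ (c (M (m + n)))]
    have hle : n ≤ M (m + n) := le_trans (Nat.le_add_left n m) (Nat.le_add_left _ _)
    exact add_mem (hE hle (hy _)) (hcc _ _ hle)
  · rw [sub_sub_sub_cancel_right]
    exact pow_smul_anti (Nat.le_add_right m n) L (hx _)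

/-- Chevalley's theorem: a decreasing sequence of submodules with zero intersection tends to
zero. -/
theorem exists_le_pow_smul (hL : L.FG) (E : ℕ → Submodule O V)
    (hE : Antitone E) (hCL : ∀ n, E n ≤ L) (h0 : ∀ v, (∀ n, v ∈ E n) → v = 0) (m : ℕ) :
    ∃ n, E n ≤ ϖ ^ m • L := by
  obtain ⟨N, hN⟩ := eventually_sup_eq hL E hE hCL m
  refine ⟨N, fun e he => ?_⟩
  have h1 : ∀ n, ∃ c ∈ E (N + n), c - e ∈ ϖ ^ m • L := fun n => by
    obtain ⟨z, hz, w, hw, hzw⟩ := mem_sup.1 (hN (N + n) (Nat.le_add_right _ _) he)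
    exact ⟨z, hz, by rw [← hzw, sub_add_cancel_left]; exact neg_mem hw⟩
  choose c hc hce using h1
  have hle := pow_smul_le m L
  obtain ⟨x, hx⟩ := exists_mem_cosets hL (fun n => E (N + n) ⊓ ϖ ^ m • L)
    (fun i j hij => inf_le_inf_right _ (hE (by lia)))
    (fun n => inf_le_left.trans (hCL _)) c fun n => by
      refine ⟨sub_mem (hE (by lia) (hc _)) (hc n), ?_⟩
      rw [← sub_sub_sub_cancel_right _ _ e]
      exact sub_mem (hce _) (hce _)
  have hx0 : x = 0 := h0 x fun n => hE (Nat.le_add_left n N) (by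
    have := add_mem (hx n).1 (hc n)
    rwa [sub_add_cancel] at this)
  have h2 := sub_mem (neg_mem (hx 0).2) (hce 0)
  rw [hx0] at h2
  simpa using h2

/-- Successive approximation: if `T` is continuous and `T` maps `Xᵐ M` onto `Xᵐ L` modulo
`Xᵐ⁺¹ L` for every `m`, then `T` maps `M` onto `L`. -/
theorem le_image_of_approx {L M M' : Submodule O V} (hL : L.FG) (hM : M.FG) (hM' : M'.FG)
    (T : V →+ V)
    (hT : ∀ m, ∀ v ∈ ϖ ^ (m + 1) • M, T v ∈ ϖ ^ m • M')
    (h : ∀ m, ∀ v ∈ ϖ ^ m • L, ∃ w ∈ ϖ ^ m • M, v - T w ∈ ϖ ^ (m + 1) • L) :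
    ∀ v ∈ L, ∃ w ∈ M, T w = v := by
  intro v hv
  choose! f hf hfT using h
  let r : ℕ → V := fun n => Nat.rec v (fun m z => z - T (f m z)) n
  have hr : ∀ n, r n ∈ ϖ ^ n • L := by
    intro n
    induction n with
    | zero => simpa [r] using hv
    | succ n ih => exact hfT n _ ih
  choose w hw hwf using fun n => mem_pow_smul.1 (hf n _ (hr n))
  obtain ⟨s, hs, hsum⟩ := exists_limit hM w hw
  refine ⟨s, hs, ?_⟩
  have hrs : ∀ n, r n = v - T (∑ i ∈ Finset.range n, ϖ ^ i • w i) := by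
    intro n
    induction n with
    | zero => simp [r]
    | succ n ih =>
      rw [Finset.sum_range_succ, map_add, ← sub_sub, ← ih, hwf]
  rw [← sub_eq_zero, ← neg_eq_zero, neg_sub]
  refine eq_zero_of_forall_mem_pow (L := L ⊔ M') (hL.sup hM') fun n => ?_
  have h1 : v - T s = r (n + 1) - T (s - ∑ i ∈ Finset.range (n + 1), ϖ ^ i • w i) := by
    rw [hrs (n + 1), map_sub]
    abel
  rw [h1]
  exact sub_mem (pow_smul_mono n le_sup_left (pow_smul_anti (Nat.le_succ n) L (hr (n + 1))))
    (pow_smul_mono n le_sup_right (hT n _ (hsum (n + 1))))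

end PowerSeriesModules

/-! ### Filtrations generated by a differential operator -/

section Filtration

variable {R : Type u} [CommRing R] {V : Type v} [AddCommGroup V] [Module R V]

/-- `T` is a derivation of the `R`-module `V` over the derivation `d` of `R`. -/
def IsDerivation (d : Der R) (T : V →+ V) : Prop := ∀ (f : R) (v : V), T (f • v) = f • T v + d f • v

variable {d : Der R} {T : V →+ V}

variable {L : Submodule R V} {v : V}

/-- The submodule `L + T L`. -/
def stepUp (hT : IsDerivation d T) (L : Submodule R V) : Submodule R V where
  carrier := {v | ∃ a ∈ L, ∃ b ∈ L, v = a + T b}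
  add_mem' := by
    rintro _ _ ⟨a, ha, b, hb, rfl⟩ ⟨a', ha', b', hb', rfl⟩
    exact ⟨a + a', add_mem ha ha', b + b', add_mem hb hb', by rw [map_add]; abel⟩
  zero_mem' := ⟨0, L.zero_mem, 0, L.zero_mem, by simp⟩
  smul_mem' := by
    rintro f _ ⟨a, ha, b, hb, rfl⟩
    refine ⟨f • a - d f • b, sub_mem (L.smul_mem _ ha) (L.smul_mem _ hb), f • b,
      L.smul_mem _ hb, ?_⟩
    rw [hT, smul_add]
    abel

theorem mem_stepUp {hT : IsDerivation d T} :
    v ∈ stepUp hT L ↔ ∃ a ∈ L, ∃ b ∈ L, v = a + T b := Iff.rfl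

theorem le_stepUp (hT : IsDerivation d T) (L : Submodule R V) : L ≤ stepUp hT L :=
  fun v hv => ⟨v, hv, 0, L.zero_mem, by simp⟩

theorem map_mem_stepUp (hT : IsDerivation d T) (hv : v ∈ L) :
    T v ∈ stepUp hT L := ⟨0, L.zero_mem, v, hv, by simp⟩

theorem stepUp_le {hT : IsDerivation d T} {L M : Submodule R V} (h : L ≤ M)
    (h' : ∀ v ∈ L, T v ∈ M) : stepUp hT L ≤ M := by
  rintro _ ⟨a, ha, b, hb, rfl⟩
  exact add_mem (h ha) (h' b hb)

theorem stepUp_fg (hT : IsDerivation d T) (hL : L.FG) : (stepUp hT L).FG := by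
  obtain ⟨r, b, rfl⟩ := fg_iff_fin.1 hL
  have h1 : stepUp hT (span R (range b)) =
      span R (range b) ⊔ span R (range fun i => T (b i)) := by
    apply le_antisymm
    · refine stepUp_le le_sup_left fun v hv => ?_
      obtain ⟨f, rfl⟩ := (mem_span_range _).1 hv
      rw [map_sum]
      refine sum_mem fun i _ => ?_
      rw [hT]
      exact add_mem (mem_sup_right (smul_mem _ _
        (subset_span ⟨i, rfl⟩))) (mem_sup_left (smul_mem _ _
        (subset_span ⟨i, rfl⟩)))
    · refine sup_le (le_stepUp _ _) (span_le.2 ?_)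
      rintro _ ⟨i, rfl⟩
      exact map_mem_stepUp hT (subset_span ⟨i, rfl⟩)
  rw [h1]
  exact hL.sup (fg_span (Set.finite_range _))

/-- The filtration `L + T L + ⋯ + Tʲ L`. -/
def filt (hT : IsDerivation d T) (L : Submodule R V) (j : ℕ) : Submodule R V := (stepUp hT)^[j] L

theorem filt_succ (hT : IsDerivation d T) (L : Submodule R V) (j : ℕ) :
    filt hT L (j + 1) = stepUp hT (filt hT L j) := iter_succ _ _ _

theorem filt_mono (hT : IsDerivation d T) (L : Submodule R V) : Monotone (filt hT L) :=
  monotone_nat_of_le_succ fun j => by rw [filt_succ]; exact le_stepUp _ _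

theorem filt_fg (hT : IsDerivation d T) (hL : L.FG) (j : ℕ) : (filt hT L j).FG := by
  induction j with
  | zero => exact hL
  | succ j ih => rw [filt_succ]; exact stepUp_fg hT ih

theorem map_mem_filt (hT : IsDerivation d T) {j : ℕ}
    (hv : v ∈ filt hT L j) : T v ∈ filt hT L (j + 1) := by
  rw [filt_succ]; exact map_mem_stepUp hT hv

theorem iterate_mem_filt (hT : IsDerivation d T) (hv : v ∈ L) (j : ℕ) : T^[j] v ∈ filt hT L j := by
  induction j with
  | zero => exact hv
  | succ j ih => rw [iter_succ]; exact map_mem_filt hT ih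

theorem exists_mem_filt_succ (hT : IsDerivation d T) (j : ℕ) :
    ∀ v ∈ filt hT L (j + 1), ∃ u ∈ L, v - T^[j + 1] u ∈ filt hT L j := by
  induction j with
  | zero =>
    rintro _ ⟨a, ha, b, hb, rfl⟩
    exact ⟨b, hb, by simpa [filt] using ha⟩
  | succ j ih =>
    intro v hv
    rw [filt_succ] at hv
    obtain ⟨a, ha, b, hb, rfl⟩ := hv
    obtain ⟨u, hu, hbu⟩ := ih b hb
    refine ⟨u, hu, ?_⟩
    rw [iter_succ, add_sub_assoc, ← map_sub]
    exact add_mem ha (map_mem_filt hT hbu)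

theorem iterate_smul_sub_mem (hT : IsDerivation d T) {u : V} (hu : u ∈ L)
    (f : R) (j : ℕ) : T^[j + 1] (f • u) - f • T^[j + 1] u ∈ filt hT L j := by
  induction j with
  | zero =>
    simp only [zero_add, Function.iterate_one]
    rw [hT, add_sub_cancel_left]
    exact L.smul_mem _ hu
  | succ j ih =>
    have h1 : T^[j + 1 + 1] (f • u) - f • T^[j + 1 + 1] u =
        T (T^[j + 1] (f • u) - f • T^[j + 1] u) + d f • T^[j + 1] u := by
      rw [iter_succ _ (j + 1), iter_succ _ (j + 1), map_sub, hT]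
      abel
    rw [h1]
    exact add_mem (map_mem_filt hT ih) (smul_mem _ _ (iterate_mem_filt hT hu _))

/-- On the union of the filtration, `T` is eventually strictly compatible with the filtration: the
surjections `gr_j → gr_{j+1}` induced by `T` are linear, so they are bijective for large `j`. -/
theorem exists_filt_strict [IsNoetherianRing R] (hT : IsDerivation d T)
    (hL : L.FG) : ∃ j₀, ∀ j, j₀ ≤ j → ∀ v i, v ∈ filt hT L i → T v ∈ filt hT L (j + 1) →
      v ∈ filt hT L j := by
  let A : ℕ → Submodule R L := fun j =>
    { carrier := {u | T^[j + 1] (u : V) ∈ filt hT L j}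
      add_mem' := fun {x y} hx hy => by
        change T^[j + 1] ((x : V) + y) ∈ filt hT L j
        rw [iterate_map_add]
        exact add_mem hx hy
      zero_mem' := by
        change T^[j + 1] (0 : V) ∈ filt hT L j
        rw [iterate_map_zero]
        exact zero_mem _
      smul_mem' := fun f x hx => by
        have h1 := add_mem (iterate_smul_sub_mem hT x.2 f j) (smul_mem _ f hx)
        rwa [sub_add_cancel] at h1 }
  have hA : Monotone A := monotone_nat_of_le_succ fun j u hu => by
    change T^[j + 1 + 1] (u : V) ∈ filt hT L (j + 1)
    rw [iter_succ]
    exact map_mem_filt hT hu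
  have hfin : Module.Finite R L := Module.Finite.iff_fg.2 hL
  obtain ⟨j₀, hj₀⟩ := monotone_stabilizes_iff_noetherian.2
    (inferInstanceAs (IsNoetherian R L)) ⟨A, hA⟩
  refine ⟨j₀, fun j hj v i hv hTv => ?_⟩
  rcases le_total i j with hij | hij
  · exact filt_mono hT L hij hv
  induction i, hij using Nat.le_induction with
  | base => exact hv
  | succ i hij ih =>
    apply ih
    obtain ⟨u, hu, hvu⟩ := exists_mem_filt_succ hT i v hv
    have h1 : (⟨u, hu⟩ : L) ∈ A (i + 1) := by
      change T^[i + 1 + 1] u ∈ filt hT L (i + 1)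
      rw [iter_succ, show T (T^[i + 1] u) = T v - T (v - T^[i + 1] u) by
        rw [map_sub]; abel]
      exact sub_mem (filt_mono hT L (by lia) hTv) (map_mem_filt hT hvu)
    have h2 : A (i + 1) = A i := (hj₀ (i + 1) (by lia)).symm.trans (hj₀ i (by lia))
    rw [h2] at h1
    have h3 := add_mem hvu h1
    rwa [sub_add_cancel] at h3

end Filtration

section Contraction

variable {K : Type u} [Field K] {V : Type v} [AddCommGroup V] [Module O V]
  {d : Der O} {T : V →+ V}

/-- If `V` is the union of the filtration generated by a finitely generated module `L` and has no
nonzero finitely generated `T`-stable submodule, then `T` is expanding: for a suitable step `M` of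
the filtration, `T⁻¹ M ⊆ M` and the sets `T⁻ⁿ M` tend to zero. -/
theorem exists_expanding (hT : IsDerivation d T) {L : Submodule O V} (hL : L.FG)
    (hV : ∀ v, ∃ j, v ∈ filt hT L j)
    (h0 : ∀ C : Submodule O V, C.FG → (∀ v ∈ C, T v ∈ C) → C = ⊥) :
    ∃ j₀, ∀ j, j₀ ≤ j → (∀ v, T v ∈ filt hT L j → v ∈ filt hT L j) ∧
      (∀ m, ∃ n, ∀ v, T^[n] v ∈ filt hT L j → v ∈ ϖ ^ m • filt hT L j) ∧
      ∀ v, ∃ n, ∀ w, T^[n] w = v → w ∈ filt hT L j := by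
  obtain ⟨j₀, hj₀⟩ := exists_filt_strict hT hL
  refine ⟨j₀, fun j hj => ?_⟩
  have h1 : ∀ v, T v ∈ filt hT L j → v ∈ filt hT L j := fun v hv => by
    obtain ⟨i, hi⟩ := hV v
    exact hj₀ j hj v i hi (filt_mono hT L (Nat.le_succ j) hv)
  have h1' : ∀ n v, T^[n] v ∈ filt hT L j → ∀ i ≤ n, T^[i] v ∈ filt hT L j := by
    intro n v hv i hi
    obtain ⟨r, rfl⟩ := Nat.exists_eq_add_of_le hi
    clear hi
    induction r with
    | zero => exact hv
    | succ r ih => exact ih (h1 _ (by rwa [← iter_succ T]))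
  refine ⟨h1, fun m => ?_, fun v => ?_⟩
  · have hsm : ∀ (n : ℕ) (f : O) (v : V), (∀ i ≤ n, T^[i] v ∈ filt hT L j) →
        ∀ i ≤ n, T^[i] (f • v) ∈ filt hT L j := by
      intro n
      induction n with
      | zero =>
        intro f v hv i hi
        obtain rfl : i = 0 := by lia
        exact smul_mem _ _ (hv 0 le_rfl)
      | succ n ih =>
        intro f v hv i hi
        cases i with
        | zero => exact smul_mem _ _ (hv 0 (Nat.zero_le _))
        | succ i =>
          rw [iterate_succ_apply, hT, iterate_map_add]
          refine add_mem (ih f (T v) (fun l hl => ?_) i (by lia))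
            (ih _ v (fun l hl => hv l (by lia)) i (by lia))
          rw [← iterate_succ_apply]
          exact hv _ (by lia)
    let C : ℕ → Submodule O V := fun n =>
      { carrier := {v | ∀ i ≤ n, T^[i] v ∈ filt hT L j}
        add_mem' := fun hx hy i hi => by
          rw [iterate_map_add]
          exact add_mem (hx i hi) (hy i hi)
        zero_mem' := fun i _ => by
          rw [iterate_map_zero]
          exact zero_mem _
        smul_mem' := fun f v hv => hsm n f v hv }
    have hC : Antitone C := fun a b hab v hv i hi => hv i (hi.trans hab)
    have hCL : ∀ n, C n ≤ filt hT L j := fun n v hv => hv 0 (Nat.zero_le _)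
    have hbot : (⨅ n, C n) = ⊥ := by
      refine h0 _ (FG.of_le (filt_fg hT hL j) ((iInf_le _ 0).trans (hCL 0))) fun v hv => ?_
      rw [Submodule.mem_iInf] at hv ⊢
      intro n i hi
      rw [← iterate_succ_apply]
      exact hv (n + 1) (i + 1) (by lia)
    obtain ⟨n, hn⟩ := exists_le_pow_smul (filt_fg hT hL j) C hC hCL (fun v hv => by
      rw [← Submodule.mem_bot O, ← hbot, Submodule.mem_iInf]
      exact hv) m
    exact ⟨n, fun v hv => hn fun i hi => h1' n v hv i hi⟩
  · obtain ⟨i, hi⟩ := hV v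
    have key : ∀ n w, T^[n] w ∈ filt hT L (j + n) → w ∈ filt hT L j := by
      intro n
      induction n with
      | zero => exact fun w hw => hw
      | succ n ih =>
        intro w hw
        apply ih
        rw [iter_succ] at hw
        obtain ⟨l, hl⟩ := hV (T^[n] w)
        exact hj₀ (j + n) (by lia) _ l hl hw
    exact ⟨i, fun w hw => key i w (hw ▸ filt_mono hT L (Nat.le_add_left i j) hi)⟩

end Contraction

/-! ### Power series in a topologically nilpotent operator -/

/-- The derivation `r d`. -/
def mulDer {R : Type u} [CommRing R] (r : R) (d : Der R) : Der R where
  toAddMonoidHom := (AddMonoidHom.mulLeft r).comp d.toAddMonoidHom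
  leibniz' s t := by
    change r * d (s * t) = s * (r * d t) + t * (r * d s)
    rw [d.leibniz]
    ring

theorem mulDer_apply {R : Type u} [CommRing R] (r : R) (d : Der R) (s : R) :
    mulDer r d s = r * d s := rfl

section Action

variable {K : Type u} [Field K] {V : Type v} [AddCommGroup V] [Module K V]

theorem aeval_apply_mem {S : Submodule K V} {T : Module.End K V} (hS : ∀ v ∈ S, T v ∈ S) (p : K[X])
    {v : V} (hv : v ∈ S) : aeval T p v ∈ S := by
  induction p using Polynomial.induction_on generalizing v with
  | C a =>
    rw [aeval_C, Module.algebraMap_end_apply]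
    exact smul_mem _ _ hv
  | add p q hp hq =>
    rw [map_add, LinearMap.add_apply]
    exact add_mem (hp hv) (hq hv)
  | monomial i a ih =>
    rw [pow_succ, ← mul_assoc, map_mul, aeval_X, mul_apply]
    exact ih (hS v hv)

/-- `V` is separated and complete for the filtration `F`, and the operator `T` preserves `F` and is
topologically nilpotent. -/
structure TopNilpotent (F : ℕ → Submodule K V) (T : Module.End K V) : Prop where
  anti : Antitone F
  sep : ∀ v, (∀ n, v ∈ F n) → v = 0
  compl : ∀ w : ℕ → V, (∀ n, w (n + 1) - w n ∈ F n) → ∃ s, ∀ n, s - w n ∈ F n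
  stab : ∀ n, ∀ v ∈ F n, T v ∈ F n
  nilp : ∀ v m, ∃ N, (T ^ N) v ∈ F m

namespace TopNilpotent

variable {F : ℕ → Submodule K V} {T : Module.End K V} (h : TopNilpotent F T)

include h in
theorem aeval_mem (p : K[X]) {n : ℕ} {v : V} (hv : v ∈ F n) : aeval T p v ∈ F n :=
  aeval_apply_mem (h.stab n) p hv

include h in
theorem aeval_mem_of_dvd {p : K[X]} {N n : ℕ} {v : V} (hp : PX ^ N ∣ p)
    (hv : (T ^ N) v ∈ F n) : aeval T p v ∈ F n := by
  obtain ⟨q, rfl⟩ := hp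
  rw [mul_comm, map_mul, map_pow, aeval_X, mul_apply]
  exact h.aeval_mem q hv

include h in
theorem pow_mem {N N' n : ℕ} (hN : N ≤ N') {v : V} (hv : (T ^ N) v ∈ F n) : (T ^ N') v ∈ F n := by
  have := h.aeval_mem_of_dvd (pow_dvd_pow PX hN) hv
  rwa [map_pow, aeval_X] at this

theorem X_pow_dvd_trunc_sub {N N' : ℕ} (hN : N ≤ N') (f : O) :
    (PX ^ N : K[X]) ∣ trunc N' f - trunc N f := by
  rw [Polynomial.X_pow_dvd_iff]
  intro d hd
  rw [Polynomial.coeff_sub, PowerSeries.coeff_trunc, PowerSeries.coeff_trunc, if_pos hd,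
    if_pos (hd.trans_le hN), sub_self]

include h in
theorem trunc_sub_mem {N N' n : ℕ} {v : V} (hN : (T ^ N) v ∈ F n) (hN' : (T ^ N') v ∈ F n)
    (f : O) : aeval T (trunc N' f) v -
      aeval T (trunc N f) v ∈ F n := by
  rcases le_total N N' with hle | hle
  · rw [← LinearMap.sub_apply, ← map_sub]
    exact h.aeval_mem_of_dvd (X_pow_dvd_trunc_sub hle f) hN
  · rw [← neg_mem_iff, neg_sub, ← LinearMap.sub_apply, ← map_sub]
    exact h.aeval_mem_of_dvd (X_pow_dvd_trunc_sub hle f) hN'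

include h in
theorem exists_sum (f : O) (v : V) : ∃ w, ∀ m N, (T ^ N) v ∈ F m →
    w - aeval T (trunc N f) v ∈ F m := by
  choose N hN using h.nilp v
  obtain ⟨w, hw⟩ := h.compl (fun m => aeval T (trunc (N m) f) v) fun n =>
    h.trunc_sub_mem (hN n) (h.anti (Nat.le_succ n) (hN (n + 1))) f
  refine ⟨w, fun m n hn => ?_⟩
  rw [← sub_add_sub_cancel w]
  exact add_mem (hw m) (h.trunc_sub_mem hn (hN m) f)

/-- The sum `∑ fᵢ Tⁱ v`. -/
def sum (f : O) (v : V) : V := (h.exists_sum f v).choose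

theorem sum_sub_mem (f : O) {v : V} {m N : ℕ} (hv : (T ^ N) v ∈ F m) :
    h.sum f v - aeval T (trunc N f) v ∈ F m :=
  (h.exists_sum f v).choose_spec m N hv

theorem sum_mem (f : O) {v : V} {m : ℕ} (hv : v ∈ F m) : h.sum f v ∈ F m := by
  have := h.sum_sub_mem f (v := v) (m := m) (N := 0) (by simpa using hv)
  simpa using this

theorem sum_eq {f : O} {v w : V} (hw : ∀ m, ∃ N₀, ∀ N, N₀ ≤ N →
    w - aeval T (trunc N f) v ∈ F m) : h.sum f v = w := by
  rw [← sub_eq_zero]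
  refine h.sep _ fun m => ?_
  obtain ⟨N, hN⟩ := hw m
  obtain ⟨N', hN'⟩ := h.nilp v m
  rw [← sub_sub_sub_cancel_right _ _ (aeval T (trunc (max N N') f) v)]
  exact sub_mem (h.sum_sub_mem f (h.pow_mem (le_max_right _ _) hN')) (hN _ (le_max_left _ _))

include h in
theorem eventually_pow_mem (v : V) (m : ℕ) : ∃ N₀, ∀ N, N₀ ≤ N → (T ^ N) v ∈ F m := by
  obtain ⟨N, hN⟩ := h.nilp v m
  exact ⟨N, fun N' hle => h.pow_mem hle hN⟩

/-- The action of power series by `X ↦ T`. -/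
def act : O →+* Module.End K V where
  toFun f :=
    { toFun := h.sum f
      map_add' := fun v w => h.sum_eq fun m => by
        obtain ⟨N, hN⟩ := h.eventually_pow_mem v m
        obtain ⟨N', hN'⟩ := h.eventually_pow_mem w m
        refine ⟨max N N', fun n hn => ?_⟩
        rw [map_add, add_sub_add_comm]
        exact add_mem (h.sum_sub_mem f (hN n (by lia))) (h.sum_sub_mem f (hN' n (by lia)))
      map_smul' := fun c v => h.sum_eq fun m => by
        obtain ⟨N, hN⟩ := h.eventually_pow_mem v m
        refine ⟨N, fun n hn => ?_⟩
        rw [map_smul, RingHom.id_apply, ← smul_sub]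
        exact smul_mem _ _ (h.sum_sub_mem f (hN n hn)) }
  map_one' := by
    ext v
    exact h.sum_eq fun m => ⟨1, fun n hn => by
      obtain ⟨r, rfl⟩ := Nat.exists_eq_add_of_le' hn
      rw [PowerSeries.trunc_one]
      simp⟩
  map_zero' := by
    ext v
    exact h.sum_eq fun m => ⟨0, fun n hn => by simp⟩
  map_add' f g := by
    ext v
    refine h.sum_eq fun m => ?_
    obtain ⟨N, hN⟩ := h.eventually_pow_mem v m
    refine ⟨N, fun n hn => ?_⟩
    change h.sum f v + h.sum g v - _ ∈ _
    rw [map_add, map_add, LinearMap.add_apply, add_sub_add_comm]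
    exact add_mem (h.sum_sub_mem f (hN n hn)) (h.sum_sub_mem g (hN n hn))
  map_mul' f g := by
    ext v
    refine h.sum_eq fun m => ?_
    obtain ⟨N, hN⟩ := h.eventually_pow_mem v m
    obtain ⟨N', hN'⟩ := h.eventually_pow_mem (h.sum g v) m
    refine ⟨max N N', fun n hn => ?_⟩
    change h.sum f (h.sum g v) - _ ∈ _
    have h1 := h.sum_sub_mem f (hN' n (by lia))
    have h2 := h.aeval_mem (trunc n f) (h.sum_sub_mem g (hN n (by lia)))
    have h3 : (PX ^ n : K[X]) ∣ trunc n f * trunc n g -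
        trunc n (f * g) := by
      rw [Polynomial.X_pow_dvd_iff]
      intro d hd
      rw [Polynomial.coeff_sub, PowerSeries.coeff_trunc, if_pos hd, sub_eq_zero,
        ← Polynomial.coeff_coe, Polynomial.coe_mul, ← PowerSeries.coeff_mul_eq_coeff_trunc_mul_trunc
          f g hd]
    have h4 := h.aeval_mem_of_dvd h3 (hN n (by lia))
    rw [map_sub, ← mul_apply, ← map_mul] at h2
    rw [map_sub, LinearMap.sub_apply] at h4
    have h5 := add_mem (add_mem h1 h2) h4
    convert h5 using 1
    abel

theorem act_apply (f : O) (v : V) : h.act f v = h.sum f v := rfl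

theorem act_X : h.act X = T := by
  ext v
  refine h.sum_eq fun m => ⟨2, fun n hn => ?_⟩
  obtain ⟨r, rfl⟩ := Nat.exists_eq_add_of_le' hn
  rw [PowerSeries.trunc_X]
  simp

theorem act_C (c : K) (v : V) : h.act (C c) v = c • v := by
  refine h.sum_eq fun m => ⟨1, fun n hn => ?_⟩
  obtain ⟨r, rfl⟩ := Nat.exists_eq_add_of_le' hn
  rw [PowerSeries.trunc_C]
  simp

theorem aeval_derivation {D : Module.End K V} {q : K[X]}
    (hD : ∀ v, D (T v) = T (D v) + aeval T q v) (p : K[X]) (v : V) :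
    D (aeval T p v) = aeval T p (D v) +
      aeval T (q * Polynomial.derivative p) v := by
  induction p using Polynomial.induction_on generalizing v with
  | C a => simp
  | add p r hp hr =>
    simp only [map_add, LinearMap.add_apply, hp, hr, mul_add]
    abel
  | monomial i a ih =>
    rw [pow_succ, ← mul_assoc]
    generalize PC a * PX ^ i = r at ih
    rw [map_mul, aeval_X, mul_apply, ih, hD, map_add,
      Polynomial.derivative_mul, Polynomial.derivative_X, mul_one, mul_add, map_add,
      ← mul_assoc, map_mul _ _ PX, aeval_X, mul_apply,
      LinearMap.add_apply, mul_apply, mul_comm q r,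
      show aeval T (r * q) v = aeval T r (aeval T q v) by
        rw [map_mul, mul_apply]]
    abel

/-- A continuous operator `D` with `D T = T D + q(T)` acts on power series in `T` by the derivation
`q(T) d/dT`. -/
theorem act_derivation {D : Module.End K V} {q : K[X]} (hD : ∀ v, D (T v) = T (D v) + aeval T q v)
    (hc : ∀ m, ∃ m', ∀ v ∈ F m', D v ∈ F m) (f : O) (v : V) :
    D (h.act f v) = h.act f (D v) + h.act (mulDer (q : O) dO f) v := by
  have hq : ∀ w, h.act (q : O) w = aeval T q w := fun w => by
    refine h.sum_eq fun m => ⟨q.natDegree + 1, fun n hn => ?_⟩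
    rw [PowerSeries.trunc_coe_eq_self hn, sub_self]
    exact zero_mem _
  rw [mulDer_apply, map_mul, mul_apply, ← sub_eq_zero]
  refine h.sep _ fun m => ?_
  obtain ⟨m', hm'⟩ := hc m
  obtain ⟨N₁, h₁⟩ := h.eventually_pow_mem v m'
  obtain ⟨N₂, h₂⟩ := h.eventually_pow_mem (D v) m
  obtain ⟨N₃, h₃⟩ := h.eventually_pow_mem v m
  let n := N₁ + N₂ + N₃
  have e₁ := hm' _ (h.sum_sub_mem f (h₁ (n + 1) (by lia)))
  have e₂ := h.sum_sub_mem f (h₂ (n + 1) (by lia))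
  have e₃ := h.aeval_mem q (h.sum_sub_mem (dO f) (h₃ n (by lia)))
  rw [map_sub, aeval_derivation hD] at e₁
  have h5 : Polynomial.derivative (trunc (n + 1) f) =
      trunc n (dO f) := (PowerSeries.trunc_derivative f n).symm
  rw [h5, map_mul, mul_apply] at e₁
  rw [map_sub] at e₃
  have e := sub_mem (sub_mem e₁ e₂) e₃
  rw [hq, act_apply, act_apply, act_apply]
  convert e using 1
  abel

end TopNilpotent

/-! ### Laurent series in a bicontinuous operator -/

/-- If `X` acts invertibly, an action of power series extends to Laurent series. -/
theorem exists_laurent_extension {B : Type v} [Ring B] (φ : O →+* B)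
    (hX : IsUnit (φ X)) : ∃ ψ : Kx →+* B, ∀ f, ψ (ofPowerSeries ℤ K f) = φ f := by
  obtain ⟨s, hs⟩ := hX
  let E : Set B := range φ ∪ {((s⁻¹ : Bˣ) : B)}
  have hcomm : ∀ a ∈ E, ∀ b ∈ E, a * b = b * a := by
    have h1 : ∀ f, φ f * ((s⁻¹ : Bˣ) : B) = ((s⁻¹ : Bˣ) : B) * φ f := fun f => by
      have : Commute (s : B) (φ f) := by
        rw [hs]
        exact (Commute.all _ _).map φ
      exact (this.units_inv_left.eq).symm
    rintro _ (⟨f, rfl⟩ | rfl) _ (⟨g, rfl⟩ | rfl)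
    · exact (Commute.all _ _).map φ
    · exact h1 f
    · exact (h1 g).symm
    · rfl
  have hc := Subring.isMulCommutative_closure hcomm
  let : CommRing (Subring.closure E) :=
    { (Subring.closure E).toRing with mul_comm := hc.is_comm.comm }
  let φ' : O →+* Subring.closure E := φ.codRestrict _ fun f =>
    Subring.subset_closure (Or.inl ⟨f, rfl⟩)
  have hu : ∀ y : Submonoid.powers ϖ, IsUnit (φ' y) := by
    rintro ⟨_, n, rfl⟩
    rw [map_pow]
    refine IsUnit.pow n (IsUnit.of_mul_eq_one ⟨_, Subring.subset_closure (Or.inr rfl)⟩ ?_)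
    apply Subtype.ext
    change φ X * ((s⁻¹ : Bˣ) : B) = 1
    rw [← hs, Units.mul_inv]
  let ψ : Kx →+* Subring.closure E := IsLocalization.lift (S := Kx) (P := Subring.closure E) hu
  refine ⟨(Subring.closure E).subtype.comp ψ, fun f => ?_⟩
  have h2 : ψ (algebraMap O Kx f) = φ' f := IsLocalization.lift_eq (S := Kx) hu f
  rw [LaurentSeries.coe_algebraMap] at h2
  rw [RingHom.comp_apply, h2]
  rfl

theorem exists_pow_mul_eq_ofPowerSeries (f : Kx) : ∃ (n : ℕ) (g : O),
    (single 1 1 : Kx) ^ n * f = ofPowerSeries ℤ K g := by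
  obtain ⟨⟨g, ⟨_, n, rfl⟩⟩, h⟩ := IsLocalization.surj (Submonoid.powers ϖ) f
  refine ⟨n, g, ?_⟩
  rw [LaurentSeries.coe_algebraMap] at h
  rw [← h, mul_comm]
  simp

end Action

/-! ### Lattices in vector spaces over a field of Laurent series -/

section Lattices

variable {K : Type u} [Field K]

theorem exists_primitive_factor {ι : Type*} (r : ℕ) (g : ι → O)
    (hg : ∃ i, PowerSeries.coeff r (g i) ≠ 0) : ∃ (m : ℕ) (h : ι → O),
      (∀ i, g i = X ^ m * h i) ∧ ∃ i, constantCoeff (h i) ≠ 0 := by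
  induction r generalizing g with
  | zero => exact ⟨0, g, by simp, by simpa using hg⟩
  | succ r ih =>
    by_cases h0 : ∃ i, constantCoeff (g i) ≠ 0
    · exact ⟨0, g, by simp, h0⟩
    push Not at h0
    choose h hh using fun i => X_dvd_iff.2 (h0 i)
    obtain ⟨i, hi⟩ := hg
    obtain ⟨m, h', hm, hh'⟩ := ih h ⟨i, by
      rwa [hh i, PowerSeries.coeff_succ_X_mul] at hi⟩
    exact ⟨m + 1, h', fun i => by rw [hh, hm, pow_succ', mul_assoc], hh'⟩

theorem exists_common_denominator {ι : Type*} [Finite ι] (f : ι → Kx) :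
    ∃ (n : ℕ) (g : ι → O), ∀ i, (single 1 1 : Kx) ^ n * f i = ofPowerSeries ℤ K (g i) := by
  have := Fintype.ofFinite ι
  choose n g hg using fun i => exists_pow_mul_eq_ofPowerSeries (f i)
  refine ⟨∑ i, n i, fun i => X ^ (∑ j, n j - n i) * g i, fun i => ?_⟩
  rw [map_mul, ← hg, map_pow, ofPowerSeries_X, ← mul_assoc, ← pow_add,
    Nat.sub_add_cancel (single_le_sum (fun _ _ => Nat.zero_le _) (mem_univ i))]

theorem single_one_ne_zero : (single 1 1 : Kx) ≠ 0 := HahnSeries.single_ne_zero one_ne_zero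

/-- A nonzero vector of Laurent series is proportional to a primitive vector of power series. -/
theorem exists_primitive {ι : Type*} [Finite ι] (f : ι → Kx) (hf : ∃ i, f i ≠ 0) :
    ∃ (a : Kx) (g : ι → O), a ≠ 0 ∧ (∀ i, a * f i = ofPowerSeries ℤ K (g i)) ∧
      ∃ i, constantCoeff (g i) ≠ 0 := by
  obtain ⟨n, g, hg⟩ := exists_common_denominator f
  obtain ⟨i, hi⟩ := hf
  have h1 : g i ≠ 0 := fun h => by
    have h2 := hg i
    rw [h, map_zero] at h2
    exact (mul_ne_zero (pow_ne_zero n single_one_ne_zero) hi) h2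
  obtain ⟨r, hr⟩ := PowerSeries.exists_coeff_ne_zero_iff_ne_zero.2 h1
  obtain ⟨m, h, hm, hh⟩ := exists_primitive_factor r g ⟨i, hr⟩
  refine ⟨((single 1 1 : Kx) ^ m)⁻¹ * (single 1 1 : Kx) ^ n, h,
    mul_ne_zero (inv_ne_zero (pow_ne_zero m single_one_ne_zero))
      (pow_ne_zero n single_one_ne_zero), fun i => ?_, hh⟩
  rw [mul_assoc, hg, hm, map_mul, map_pow, ofPowerSeries_X,
    inv_mul_cancel_left₀ (pow_ne_zero m single_one_ne_zero)]

/-- A finitely generated `O`-submodule `L` of `V` which generates `V` up to `X`-torsion. -/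
structure IsLattice {V : Type v} [AddCommGroup V] [Module O V] (L : Submodule O V) : Prop where
  fg : L.FG
  full : ∀ v, ∃ n, ϖ ^ n • v ∈ L

section General

variable {V : Type v} [AddCommGroup V] [Module O V] {L : Submodule O V}

theorem IsLattice.exists_pow_smul_le (hL : IsLattice L) {N : Submodule O V} (hN : N.FG) :
    ∃ n, ∀ v ∈ N, ϖ ^ n • v ∈ L := by
  obtain ⟨r, b, rfl⟩ := fg_iff_fin.1 hN
  choose n hn using fun i => hL.full (b i)
  refine ⟨∑ i, n i, fun v hv => ?_⟩
  obtain ⟨f, rfl⟩ := (mem_span_range _).1 hv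
  rw [smul_sum]
  refine sum_mem fun i _ => ?_
  rw [smul_comm, ← Nat.sub_add_cancel
    (single_le_sum (f := n) (fun _ _ => Nat.zero_le _) (mem_univ i)), pow_add,
    mul_smul]
  exact L.smul_mem _ (L.smul_mem _ (hn i))

theorem IsLattice.of_le (hL : IsLattice L) {N : Submodule O V} (hN : N.FG) (h : L ≤ N) :
    IsLattice N := ⟨hN, fun v => (hL.full v).imp fun _ hn => h hn⟩

theorem le_of_le_sup_smul {N : Submodule O V} (hL : L.FG)
    (h : ∀ v ∈ L, ∃ c ∈ N, v - c ∈ ϖ • L) : L ≤ N := by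
  have h1 : ∀ n, ∀ v ∈ L, ∃ c ∈ N, v - c ∈ ϖ ^ n • L := by
    intro n
    induction n with
    | zero => exact fun v hv => ⟨0, N.zero_mem, by simpa using hv⟩
    | succ n ih =>
      intro v hv
      obtain ⟨c, hc, hvc⟩ := ih v hv
      obtain ⟨w, hw, hwv⟩ := mem_pow_smul.1 hvc
      obtain ⟨c', hc', hwc⟩ := h w hw
      refine ⟨c + ϖ ^ n • c', add_mem hc (N.smul_mem _ hc'), ?_⟩
      rw [← sub_sub, ← hwv, ← smul_sub]
      rw [← pow_one ϖ] at hwc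
      exact pow_smul_mem_add hwc
  exact fun v hv => mem_of_forall_mem_sup hL fun n => h1 n v hv

end General

variable {V : Type v} [AddCommGroup V] [Module Kx V] [Module O V] [IsScalarTower O Kx V]

theorem ofPowerSeries_smul (f : O) (v : V) : (ofPowerSeries ℤ K f : Kx) • v = f • v := by
  rw [← LaurentSeries.coe_algebraMap, algebraMap_smul]

theorem X_smul (v : V) : ϖ • v = (single 1 1 : Kx) • v := by
  rw [← ofPowerSeries_smul, ofPowerSeries_X]

theorem X_pow_smul (n : ℕ) (v : V) : ϖ ^ n • v = ((single 1 1 : Kx) ^ n) • v := by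
  rw [← ofPowerSeries_smul, map_pow, ofPowerSeries_X]

theorem X_pow_smul_injective (n : ℕ) : Function.Injective fun v : V => ϖ ^ n • v := fun v w h => by
  simp only [X_pow_smul] at h
  exact smul_right_injective V (pow_ne_zero n single_one_ne_zero) h

variable (K V) in
theorem exists_isLattice [Module.Finite Kx V] : ∃ L : Submodule O V, IsLattice L := by
  obtain ⟨r, b, hb⟩ := Module.Finite.exists_fin (R := Kx) (M := V)
  refine ⟨span O (range b), fg_span (Set.finite_range b), fun v => ?_⟩
  have hv : v ∈ span Kx (range b) := hb ▸ Submodule.mem_top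
  obtain ⟨f, rfl⟩ := (mem_span_range _).1 hv
  obtain ⟨n, g, hg⟩ := exists_common_denominator f
  refine ⟨n, ?_⟩
  rw [X_pow_smul, smul_sum]
  refine sum_mem fun i _ => ?_
  rw [← mul_smul, hg, ofPowerSeries_smul]
  exact smul_mem _ _ (subset_span ⟨i, rfl⟩)

theorem IsLattice.finite {L : Submodule O V} (hL : IsLattice L) : Module.Finite Kx V := by
  obtain ⟨r, b, rfl⟩ := fg_iff_fin.1 hL.fg
  refine ⟨fg_iff_fin.2 ⟨r, b, eq_top_iff.2 fun v _ => ?_⟩⟩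
  obtain ⟨n, hn⟩ := hL.full v
  obtain ⟨f, hf⟩ := (mem_span_range _).1 hn
  have h1 : ϖ ^ n • v ∈ span Kx (range b) := by
    rw [← hf]
    refine sum_mem fun i _ => ?_
    rw [← ofPowerSeries_smul]
    exact smul_mem _ _ (subset_span ⟨i, rfl⟩)
  rw [X_pow_smul] at h1
  exact (Submodule.smul_mem_iff _ (pow_ne_zero n single_one_ne_zero)).1 h1

end Lattices

/-! ### Newton slopes and lattices -/

section Slopes

variable {K : Type u} [Field K]

variable (K) in
/-- The derivation `X d/dX` of `K((X))`. -/
def eulerD : Der Kx := mulDer (single 1 1) dK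

set_option hygiene false in
/-- Derivations over the Euler derivation of the Laurent series. -/
scoped notation "IsEuler" => IsDerivation (eulerD K)

variable (K) in
/-- The derivation `X² d/dX` of `O`. -/
def irregD : Der O := mulDer (X ^ 2) dO

variable {V : Type v} [AddCommGroup V] [Module Kx V] [Module O V] [IsScalarTower O Kx V]

variable (K) in
/-- The operator `X δ`. -/
def irregOp (δ : V →+ V) : V →+ V := (DistribSMul.toAddMonoidHom V ϖ).comp δ

theorem irregOp_apply (δ : V →+ V) (v : V) : irregOp K δ v = ϖ • δ v := rfl

variable {δ : V →+ V}

theorem eulerD_ofPowerSeries (f : O) : eulerD K (ofPowerSeries ℤ K f) =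
      ofPowerSeries ℤ K (X * dO f) := by
  rw [eulerD, mulDer_apply, map_mul, ofPowerSeries_X]
  exact congrArg _ (laurent_derivative_ofPowerSeries K f)

theorem derivation_smul (hδ : IsEuler δ) (f : O) (v : V) :
    δ (f • v) = f • δ v + (X * dO f) • v := by
  rw [← ofPowerSeries_smul, hδ, eulerD_ofPowerSeries, ofPowerSeries_smul, ofPowerSeries_smul]

theorem isDerivation_irregOp (hδ : IsEuler δ) :
    IsDerivation (irregD K) (irregOp K δ) := fun f v => by
  rw [irregOp_apply, derivation_smul hδ, smul_add, smul_comm, ← mul_smul X, ← mul_assoc, ← pow_two]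
  rfl

theorem powerD_X_pow (n : ℕ) : X * dO (X ^ n) = (n : O) * X ^ n := by
  change X * PowerSeries.derivative K (X ^ n) = _
  rw [Derivation.leibniz_pow, PowerSeries.derivative_X]
  cases n with
  | zero => simp
  | succ n =>
    rw [Nat.add_sub_cancel, smul_eq_mul, nsmul_eq_mul, mul_one, pow_succ]
    ring

theorem derivation_X_pow_smul (hδ : IsEuler δ) (n : ℕ) (v : V) : δ (ϖ ^ n • v) =
      ϖ ^ n • (δ v + (n : O) • v) := by
  rw [derivation_smul hδ, powerD_X_pow, smul_add, ← mul_smul, mul_comm]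

theorem irregOp_X_pow_smul (hδ : IsEuler δ) (n : ℕ) (v : V) : irregOp K δ (ϖ ^ n • v) =
      ϖ ^ n • (irregOp K δ v + ϖ • (n : O) • v) := by
  rw [irregOp_apply, derivation_X_pow_smul hδ, smul_comm, smul_add, irregOp_apply]

/-- `T`-stable submodules are preserved by multiplication by powers of `X`. -/
theorem irregOp_mem_pow_smul (hδ : IsEuler δ) {L : Submodule O V}
    (hL : ∀ v ∈ L, irregOp K δ v ∈ L) (n : ℕ) :
    ∀ v ∈ ϖ ^ n • L, irregOp K δ v ∈ ϖ ^ n • L := by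
  intro v hv
  obtain ⟨w, hw, rfl⟩ := mem_pow_smul.1 hv
  rw [irregOp_X_pow_smul hδ]
  exact mem_pow_smul.2 ⟨_, add_mem (hL w hw) (L.smul_mem _ (L.smul_mem _ hw)), rfl⟩

variable (K) in
/-- The vectors `Xⁱ δⁱ q`. -/
def eulerVec (δ : V →+ V) (q : V) (i : ℕ) : V := ϖ ^ i • δ^[i] q

theorem irregOp_eulerVec (hδ : IsEuler δ) (q : V) (i : ℕ) :
    irregOp K δ (eulerVec K δ q i) = eulerVec K δ q (i + 1) + ϖ • (i : O) • eulerVec K δ q i := by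
  simp only [eulerVec]
  rw [irregOp_X_pow_smul hδ, smul_add, irregOp_apply, ← mul_smul, ← pow_succ, ← iter_succ δ]
  congr 1
  rw [smul_comm _ ϖ, smul_comm _ (i : O)]

variable (K) in
/-- `q` lies in a finitely generated module which is stable under the operator `T`. -/
def IsBounded (T : V →+ V) (q : V) : Prop := ∃ L : Submodule O V, L.FG ∧ (∀ v ∈ L, T v ∈ L) ∧ q ∈ L

variable (K) in
/-- `q` lies in a finitely generated module which is stable under the operator `T`, and on which
`T` is topologically nilpotent. -/
def IsContracted (T : V →+ V) (q : V) : Prop :=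
  ∃ L : Submodule O V, L.FG ∧ (∀ v ∈ L, T v ∈ L) ∧ q ∈ L ∧ ∃ m, ∀ v ∈ L, T^[m] v ∈ ϖ • L

variable (K) in
/-- The maximum of the Newton slopes of the equation satisfied by the cyclic vector `q` is `s`. -/
def SlopeAt (δ : V →+ V) (q : V) (s : ℚ) : Prop := ∃ (n : ℕ) (c : Fin n → Kx), q ≠ 0 ∧
    LinearIndependent Kx (fun i : Fin n => δ^[i] q) ∧
    δ^[n] q = ∑ i : Fin n, c i • δ^[i] q ∧
    IsGreatest (insert 0 (range fun i : Fin n =>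
      -((c i).order : ℚ) / ((n : ℚ) - ((i : ℕ) : ℚ)))) s

/-- Multiplying the coefficient of index `i` of an equation of degree `n` by `Xⁿ⁻ⁱ` transforms the
slope condition into integrality. -/
theorem order_slope_le_iff {n : ℕ} (i : Fin n) (c : Kx) (hc : c ≠ 0) (a : Kx)
    (ha : (single 1 1 : Kx) ^ (n - (i : ℕ)) * c = a) :
    (-(c.order : ℚ) / ((n : ℚ) - ((i : ℕ) : ℚ)) ≤ 1 ↔ 0 ≤ a.order) ∧
    (-(c.order : ℚ) / ((n : ℚ) - ((i : ℕ) : ℚ)) < 1 ↔ 0 < a.order) := by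
  have h1 : a.order = ((n : ℤ) - (i : ℕ)) + c.order := by
    rw [← ha, HahnSeries.order_mul (pow_ne_zero _ single_one_ne_zero) hc, HahnSeries.order_pow,
      HahnSeries.order_single one_ne_zero, nsmul_eq_mul, mul_one, Nat.cast_sub i.2.le]
  have h2 : (0 : ℚ) < (n : ℚ) - ((i : ℕ) : ℚ) := sub_pos.2 (Nat.cast_lt.2 i.2)
  have h3 : ((a.order : ℤ) : ℚ) = ((n : ℚ) - ((i : ℕ) : ℚ)) + c.order := by
    rw [h1]
    push_cast
    rfl
  constructor
  · rw [div_le_one h2, ← Int.cast_nonneg_iff (R := ℚ), h3]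
    constructor <;> intro h <;> linarith
  · rw [div_lt_one h2, ← Int.cast_pos (R := ℚ), h3]
    constructor <;> intro h <;> linarith

theorem exists_ofPowerSeries_of_order {a : Kx} (ha : a ≠ 0) (h : 0 ≤ a.order) :
    ∃ g : O, a = ofPowerSeries ℤ K g ∧ (constantCoeff g = 0 ↔ 0 < a.order) := by
  refine ⟨X ^ a.order.toNat * a.powerSeriesPart, ?_, ?_⟩
  · rw [map_mul, map_pow, ofPowerSeries_X, HahnSeries.single_pow, one_pow,
      nsmul_eq_mul, mul_one, Int.toNat_of_nonneg h, LaurentSeries.single_order_mul_powerSeriesPart]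
  · rw [map_mul, map_pow, PowerSeries.constantCoeff_X, mul_eq_zero]
    have h1 : constantCoeff a.powerSeriesPart ≠ 0 := by
      rw [← PowerSeries.coeff_zero_eq_constantCoeff_apply, LaurentSeries.powerSeriesPart_coeff]
      simpa using ha
    rw [or_iff_left h1]
    constructor
    · intro h2
      by_contra h3
      rw [show a.order.toNat = 0 by lia, pow_zero] at h2
      exact one_ne_zero h2
    · intro h2
      exact zero_pow (by lia)

theorem order_ofPowerSeries (g : O) :
    0 ≤ (ofPowerSeries ℤ K g : Kx).order ∧ (constantCoeff g = 0 → ofPowerSeries ℤ K g ≠ 0 →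
      0 < (ofPowerSeries ℤ K g : Kx).order) := by
  by_cases h0 : (ofPowerSeries ℤ K g : Kx) = 0
  · rw [h0]
    simp
  have h1 : 0 ≤ (ofPowerSeries ℤ K g : Kx).order := by
    by_contra h2
    have h3 := HahnSeries.coeff_order_eq_zero.not.2 h0
    rw [PowerSeries.coeff_coe, if_pos (not_le.1 h2)] at h3
    exact h3 rfl
  refine ⟨h1, fun h2 _ => lt_of_le_of_ne h1 fun h3 => ?_⟩
  have h4 := HahnSeries.coeff_order_eq_zero.not.2 h0
  rw [← h3, PowerSeries.coeff_coe] at h4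
  simp [h2] at h4

end Slopes

/-! ### Lattices stable under an irregular operator -/

section StableLattices

variable {K : Type u} [Field K] {V : Type v} [AddCommGroup V]

theorem span_stable {R : Type u} [CommRing R] [Module R V] {d : Der R} {T : V →+ V}
    (hT : IsDerivation d T) {E : Submodule R V} {ι : Type*} (b : ι → V) (hb : ∀ i, b i ∈ E)
    (h : ∀ i, T (b i) ∈ E) : ∀ v ∈ span R (range b), T v ∈ E := by
  have h1 : span R (range b) ≤ E := span_le.2 (by rintro _ ⟨i, rfl⟩; exact hb i)
  intro v hv
  induction hv using Submodule.span_induction with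
  | mem x hx =>
    obtain ⟨i, rfl⟩ := hx
    exact h i
  | zero => rw [map_zero]; exact zero_mem _
  | add x y _ _ hx hy => rw [map_add]; exact add_mem hx hy
  | smul f x hx hfx =>
    rw [hT]
    exact add_mem (E.smul_mem _ hfx) (E.smul_mem _ (h1 hx))

variable [Module Kx V] [Module O V] [IsScalarTower O Kx V] {δ : V →+ V}

variable {L : Submodule O V} {v q : V} {n : ℕ} {s : ℚ}

local notation "τ" => irregOp K δ

theorem irregOp_mem_X_smul (hδ : IsEuler δ) (hL : ∀ v ∈ L, τ v ∈ L) : ∀ v ∈ ϖ • L, τ v ∈ ϖ • L := by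
  have := irregOp_mem_pow_smul hδ hL 1
  rwa [pow_one] at this

theorem X_smul_mem (hv : v ∈ L) (f : O) : (X * f : O) • v ∈ ϖ • L :=
  (mem_smul_iff _ _ _).2 ⟨_, L.smul_mem f hv, (mul_smul _ _ _).symm⟩

theorem X_smul_mem' (hv : v ∈ L) : ϖ • v ∈ ϖ • L := by
  have := X_smul_mem hv (1 : O)
  rwa [mul_one] at this

theorem iterate_mem {T : V →+ V} (hL : ∀ v ∈ L, T v ∈ L) (n : ℕ) : ∀ v ∈ L, T^[n] v ∈ L := by
  intro v hv
  induction n with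
  | zero => exact hv
  | succ n ih => rw [iter_succ]; exact hL _ ih

/-- Modulo `X`, a derivation `T` over `X² d/dX` is linear. -/
theorem irregOp_iterate_smul_sub_mem (hδ : IsEuler δ)
    (hL : ∀ v ∈ L, τ v ∈ L) (f : O) (n : ℕ) (hv : v ∈ L) :
    τ^[n] (f • v) - f • τ^[n] v ∈ ϖ • L := by
  induction n with
  | zero => simp
  | succ n ih =>
    have h1 : τ^[n + 1] (f • v) - f • τ^[n + 1] v = τ (τ^[n] (f • v) - f • τ^[n] v) +
          irregD K f • τ^[n] v := by
      rw [iter_succ, iter_succ, map_sub, isDerivation_irregOp hδ f]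
      abel
    rw [h1]
    refine add_mem (irregOp_mem_X_smul hδ hL _ ih) ?_
    rw [irregD, mulDer_apply, pow_two, mul_assoc]
    exact X_smul_mem (iterate_mem hL n v hv) _

theorem iterate_mem_X_smul_of_span (hδ : IsEuler δ)
    (hL : ∀ v ∈ L, τ v ∈ L) {ι : Type*} (b : ι → V) (n : ℕ)
    (hb : ∀ i, b i ∈ L)
    (h : ∀ i, τ^[n] (b i) ∈ ϖ • L) :
    ∀ v ∈ span O (range b), τ^[n] v ∈ ϖ • L := by
  have h1 : span O (range b) ≤ L := span_le.2 (by rintro _ ⟨i, rfl⟩; exact hb i)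
  intro v hv
  induction hv using Submodule.span_induction with
  | mem x hx =>
    obtain ⟨i, rfl⟩ := hx
    exact h i
  | zero => rw [iterate_map_zero]; exact zero_mem _
  | add x y _ _ hx hy => rw [iterate_map_add]; exact add_mem hx hy
  | smul f x hx hfx =>
    have := add_mem (irregOp_iterate_smul_sub_mem hδ hL f n (h1 hx)) (smul_mem _ f hfx)
    rwa [sub_add_cancel] at this

theorem eulerVec_succ (hδ : IsEuler δ) (q : V) (i : ℕ) :
    eulerVec K δ q (i + 1) = τ (eulerVec K δ q i) - ϖ • (i : O) • eulerVec K δ q i := by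
  rw [irregOp_eulerVec hδ, add_sub_cancel_right]

theorem eulerVec_mem (hδ : IsEuler δ) (hL : ∀ v ∈ L, τ v ∈ L) (hq : q ∈ L) (i : ℕ) :
    eulerVec K δ q i ∈ L := by
  induction i with
  | zero => simpa [eulerVec] using hq
  | succ i ih =>
    rw [eulerVec_succ hδ]
    exact sub_mem (hL _ ih) (L.smul_mem _ (L.smul_mem _ ih))

theorem eulerVec_relation {c : Fin n → Kx} (h : δ^[n] q = ∑ i : Fin n, c i • δ^[i] q) :
    eulerVec K δ q n = ∑ i : Fin n,
      ((single 1 1 : Kx) ^ (n - (i : ℕ)) * c i) • eulerVec K δ q i := by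
  simp only [eulerVec, h, smul_sum]
  refine sum_congr rfl fun i _ => ?_
  rw [X_pow_smul, X_pow_smul, ← mul_smul, ← mul_smul]
  congr 1
  rw [mul_right_comm, ← pow_add, Nat.sub_add_cancel i.2.le]

theorem linearIndependent_eulerVec (h : LinearIndependent Kx (fun i : Fin n => δ^[i] q)) :
    LinearIndependent Kx (fun i : Fin n => eulerVec K δ q i) := by
  have := h.units_smul fun i : Fin n =>
    Units.mk0 ((single 1 1 : Kx) ^ (i : ℕ)) (pow_ne_zero _ single_one_ne_zero)
  convert this using 2 with i
  exact X_pow_smul _ _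

theorem iterate_sub_eulerVec_mem (hδ : IsEuler δ) (hL : ∀ v ∈ L, τ v ∈ L) (hq : q ∈ L)
    (j i : ℕ) : τ^[j] (eulerVec K δ q i) - eulerVec K δ q (i + j) ∈ ϖ • L := by
  induction j with
  | zero => simp
  | succ j ih =>
    rw [iter_succ, ← add_assoc, eulerVec_succ hδ, sub_sub_eq_add_sub, add_sub_right_comm, ← map_sub]
    exact add_mem (irregOp_mem_X_smul hδ hL _ ih)
      (X_smul_mem' (L.smul_mem _ (eulerVec_mem hδ hL hq _)))

/-- If the vectors `Xⁱ δⁱ q` satisfy an integral monic equation, they generate a stable lattice. -/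
theorem isBounded_of_integral (hδ : IsEuler δ) (hn : 0 < n) (g : Fin n → O)
    (hg : eulerVec K δ q n = ∑ i : Fin n, g i • eulerVec K δ q i) :
    IsBounded K τ q ∧ ((∀ i, constantCoeff (g i) = 0) → IsContracted K τ q) := by
  let E : Submodule O V := span O (range fun i : Fin n => eulerVec K δ q i)
  have hE : ∀ i, i ≤ n → eulerVec K δ q i ∈ E := by
    intro i hi
    rcases hi.lt_or_eq with hi | rfl
    · exact subset_span ⟨⟨i, hi⟩, rfl⟩
    · rw [hg]
      exact sum_mem fun j _ => E.smul_mem _ (subset_span ⟨j, rfl⟩)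
  have hfg : E.FG := fg_span (Set.finite_range _)
  have hst : ∀ v ∈ E, τ v ∈ E :=
    span_stable (isDerivation_irregOp hδ) _ (fun i => hE i i.2.le) fun i => by
      rw [irregOp_eulerVec hδ]
      exact add_mem (hE _ i.2) (E.smul_mem _ (E.smul_mem _ (hE _ i.2.le)))
  have hq : q ∈ E := by simpa [eulerVec] using hE 0 (Nat.zero_le _)
  refine ⟨⟨E, hfg, hst, hq⟩, fun h0 => ⟨E, hfg, hst, hq, n, ?_⟩⟩
  have hall : ∀ i, eulerVec K δ q i ∈ E := eulerVec_mem hδ hst hq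
  have hlarge : ∀ j, eulerVec K δ q (n + j) ∈ ϖ • E := by
    intro j
    induction j with
    | zero =>
      rw [add_zero, hg]
      refine sum_mem fun i _ => ?_
      obtain ⟨f, hf⟩ := X_dvd_iff.2 (h0 i)
      rw [hf]
      exact X_smul_mem (hall _) f
    | succ j ih =>
      rw [← add_assoc, eulerVec_succ hδ]
      exact sub_mem (irregOp_mem_X_smul hδ hst _ ih) (X_smul_mem' (E.smul_mem _ (hall _)))
  refine iterate_mem_X_smul_of_span hδ hst _ n (fun i => hall i) fun i => ?_
  have := add_mem (iterate_sub_eulerVec_mem hδ hst hq n i) (hlarge i)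
  rwa [add_comm n, sub_add_cancel] at this

theorem irregD_C (c : K) : irregD K (C c) = 0 := by
  rw [irregD, mulDer_apply]
  change _ * PowerSeries.derivative K _ = 0
  rw [PowerSeries.derivative_C, mul_zero]

/-- If the cyclic vector `q` lies in a `T`-stable lattice, its equation in terms of the vectors
`Xⁱ δⁱ q` is integral: modulo `X`, the lattice `M` generated by the `Tⁱ q` is a cyclic
`K[T]`-module, so it is generated by the first of these vectors. If `T` is nilpotent modulo `X`, the
annihilator of `q` modulo `X` is generated by a power of `T`. -/
theorem integral_of_isBounded (hδ : IsEuler δ) (hn : 0 < n)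
    (hli : LinearIndependent Kx (fun i : Fin n => δ^[i] q)) {a : Fin n → Kx}
    (ha : eulerVec K δ q n = ∑ i : Fin n, a i • eulerVec K δ q i)
    (hL : L.FG) (hst : ∀ v ∈ L, τ v ∈ L) (hq : q ∈ L) :
    ∃ g : Fin n → O, (∀ i, a i = ofPowerSeries ℤ K (g i)) ∧
      ((∃ m, ∀ v ∈ L, τ^[m] v ∈ ϖ • L) → ∀ i, constantCoeff (g i) = 0) := by
  have hT := isDerivation_irregOp hδ
  let : Module K V := Module.compHom V (C : K →+* O)
  have : IsScalarTower K O V := .of_algebraMap_smul fun _ _ => rfl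
  let e : ℕ → V := eulerVec K δ q
  obtain ⟨T, hTi⟩ : ∃ T : Module.End K V, ∀ i v, (T ^ i) v = τ^[i] v := ⟨{ τ with
        map_smul' := fun c v => (hT (C c) v).trans (by rw [irregD_C, zero_smul, add_zero]; rfl) },
      fun i v => congrFun (Module.End.coe_pow _ i) v⟩
  let M : Submodule O V := span O (range fun i : ℕ => τ^[i] q)
  have hML : M ≤ L := span_le.2 (by rintro _ ⟨i, rfl⟩; exact iterate_mem hst i q hq)
  have hM : M.FG := FG.of_le hL hML
  have hMst : ∀ v ∈ M, τ v ∈ M := span_stable hT _ (fun i => subset_span ⟨i, rfl⟩)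
    fun i => subset_span ⟨i + 1, iter_succ _ i q⟩
  have hqM : q ∈ M := subset_span ⟨0, rfl⟩
  have heM : ∀ i, e i ∈ M := eulerVec_mem hδ hMst hqM
  -- the annihilator of `q` modulo `X`
  let I : Ideal K[X] :=
    { carrier := {p | aeval T p q ∈ (ϖ • M : Submodule O V)}
      add_mem' := fun {p r} hp hr => by
        change aeval T (p + r) q ∈ ϖ • M
        rw [map_add]
        exact add_mem hp hr
      zero_mem' := by simp
      smul_mem' := fun r p hp => by
        change aeval T (r * p) q ∈ ϖ • M
        rw [map_mul]
        exact Polynomial.aeval_apply_smul_mem_of_le_comap (q := (ϖ • M).restrictScalars K) hp r T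
          fun v hv => by
            change T v ∈ ϖ • M
            rw [← pow_one T, hTi]
            exact irregOp_mem_X_smul hδ hMst v hv }
  let P {m : ℕ} (g : Fin m → O) : K[X] := ∑ i : Fin m, Polynomial.monomial i (constantCoeff (g i))
  have hP : ∀ {m : ℕ} (g : Fin m → O), ∑ i : Fin m, g i • e i - aeval T (P g) q ∈ ϖ • M := by
    intro m g
    simp only [P, map_sum, LinearMap.sum_apply, Polynomial.aeval_monomial, ← sum_sub_distrib]
    refine sum_mem fun i _ => ?_
    have h1 := iterate_sub_eulerVec_mem hδ hMst hqM i 0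
    rw [show eulerVec K δ q 0 = q by simp [eulerVec]] at h1
    obtain ⟨f, hf⟩ := X_dvd_iff.2 (show constantCoeff (g i - C (constantCoeff (g i))) = 0 by simp)
    have h2 := sub_mem (X_smul_mem (heM i) f) (smul_mem _ (C (constantCoeff (g i))) h1)
    rw [← hf, zero_add, sub_smul, smul_sub, sub_sub_sub_cancel_right] at h2
    change _ - constantCoeff (g i) • (T ^ (i : ℕ)) q ∈ _
    rw [hTi]
    exact h2
  have hPc : ∀ {m : ℕ} (g : Fin m → O) (i : Fin m), (P g).coeff i = constantCoeff (g i) :=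
    fun g i => by
    simp [P, Polynomial.finsetSum_coeff, Polynomial.coeff_monomial, Fin.val_inj]
  have hdeg : ∀ p : K[X], p.natDegree < n → P (fun i : Fin n => C (p.coeff i)) = p := fun p hp => by
    conv_rhs => rw [p.as_sum_range' n hp, Finset.sum_range]
    simp [P]
  have hPI : ∀ {m : ℕ} (g : Fin m → O), ∑ i : Fin m, g i • e i ∈ ϖ • M → P g ∈ I := fun g h => by
    have := sub_mem h (hP g)
    rwa [sub_sub_cancel] at this
  have hME : M ≤ span O (range fun i : Fin n => e i) := by
    let f : Fin (n + 1) → Kx := Fin.snoc (fun i => -a i) 1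
    obtain ⟨b, g, hb, hbg, i, hi⟩ := exists_primitive f ⟨Fin.last n, by simp [f]⟩
    have hrel : ∑ i, g i • e i = 0 := by
      have h1 : ∑ i, f i • e i = 0 := by
        rw [Fin.sum_univ_castSucc]
        simp only [f, Fin.snoc_castSucc, Fin.snoc_last, Fin.val_castSucc, Fin.val_last, one_smul,
          neg_smul, Finset.sum_neg_distrib]
        exact neg_add_eq_zero.2 ha.symm
      have h2 := congrArg (fun v => b • v) h1
      simpa only [smul_sum, ← mul_smul, hbg, smul_zero, ofPowerSeries_smul] using h2
    have hPn : (P g).natDegree ≤ n := Polynomial.natDegree_sum_le_of_forall_le _ _ fun j _ =>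
      (Polynomial.natDegree_monomial_le _).trans (Nat.le_of_lt_succ j.2)
    refine le_of_le_sup_smul hM fun v hv => ?_
    suffices M ≤ span O (range fun i : Fin n => e i) ⊔ ϖ • M by
      obtain ⟨x, hx, y, hy, rfl⟩ := mem_sup.1 (this hv)
      exact ⟨x, hx, by simpa using hy⟩
    refine span_le.2 ?_
    rintro _ ⟨j, rfl⟩
    -- division by the primitive relation
    have hr : (PX ^ j % P g).natDegree < n := by
      by_cases h0 : (P g).natDegree = 0
      · have hP0 : P g ≠ 0 := fun h => hi (by rw [← hPc, h, Polynomial.coeff_zero])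
        rwa [EuclideanDomain.mod_eq_zero.2 (Polynomial.isUnit_iff_degree_eq_zero.2
          (by rw [Polynomial.degree_eq_natDegree hP0, h0]; rfl)).dvd, Polynomial.natDegree_zero]
      · exact (Polynomial.natDegree_mod_lt _ h0).trans_le hPn
    have h3 := hP fun i : Fin n => C ((PX ^ j % P g).coeff i)
    have h4 : PX ^ j - PX ^ j % P g ∈ I := by
      rw [EuclideanDomain.mod_eq_sub_mul_div, sub_sub_cancel]
      exact I.mul_mem_right _ (hPI g (hrel ▸ zero_mem _))
    change aeval T _ q ∈ ϖ • M at h4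
    rw [map_sub, map_pow, aeval_X, LinearMap.sub_apply, hTi] at h4
    rw [hdeg _ hr] at h3
    have h5 := sub_mem h4 h3
    rw [sub_sub_sub_cancel_right] at h5
    have h6 : ∑ i : Fin n, C ((PX ^ j % P g).coeff i) • e i ∈
        span O (range fun i : Fin n => e i) :=
      sum_mem fun i _ => smul_mem _ _ (subset_span (Set.mem_range_self i))
    have h7 := add_mem (mem_sup_right h5) (mem_sup_left (T := ϖ • M) h6)
    rwa [sub_add_cancel] at h7
  obtain ⟨g, hg⟩ := (mem_span_range _).1 (hME (heM n))
  have hli' := linearIndependent_eulerVec hli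
  refine ⟨g, fun i => sub_eq_zero.1 (Fintype.linearIndependent_iff.1 hli'
    (fun i => a i - ofPowerSeries ℤ K (g i)) ?_ i), ?_⟩
  · simp only [sub_smul, sum_sub_distrib, ofPowerSeries_smul]
    exact (congrArg _ hg).trans (sub_eq_zero.2 ha.symm)
  rintro ⟨m, hm⟩
  have hnil : ∃ N, ∀ v ∈ M, τ^[N] v ∈ ϖ • M := by
    have h1 : ∀ j, ∀ v ∈ L, τ^[m * j] v ∈ ϖ ^ j • L := by
      intro j
      induction j with
      | zero => intro v hv; simpa using hv
      | succ j ih =>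
        intro v hv
        rw [show m * (j + 1) = m + m * j by rw [Nat.mul_succ, add_comm], Function.iterate_add_apply]
        obtain ⟨w, hw, hwv⟩ := mem_pow_smul.1 (ih v hv)
        rw [← hwv]
        have h2 : ∀ i, ∀ u ∈ L, τ^[i] (ϖ ^ j • u) - ϖ ^ j • τ^[i] u ∈ ϖ ^ (j + 1) • L := by
          intro i u hu
          induction i with
          | zero => simp
          | succ i ih =>
            rw [iter_succ, iter_succ, ← sub_add_sub_cancel _ (τ (ϖ ^ j • τ^[i] u)), ← map_sub]
            refine add_mem (irregOp_mem_pow_smul hδ hst _ _ ih) ?_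
            rw [show τ (ϖ ^ j • τ^[i] u) = _ from irregOp_X_pow_smul hδ _ _,
              ← smul_sub, add_sub_cancel_left, ← mul_smul, ← pow_succ]
            exact mem_pow_smul.2 ⟨_, L.smul_mem _ (iterate_mem hst i u hu), rfl⟩
        have h3 := hm w hw
        rw [← pow_one ϖ] at h3
        have := add_mem (h2 m w hw) (pow_smul_mem_add (m := j) h3)
        rwa [sub_add_cancel] at this
    obtain ⟨j, hj⟩ := exists_le_pow_smul hM (fun j => ϖ ^ j • L ⊓ M)
      (fun i j hij => inf_le_inf_right _ (pow_smul_anti hij L)) (fun _ => inf_le_right)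
      (fun v hv => eq_zero_of_forall_mem_pow hL fun i => (hv i).1) 1
    rw [pow_one] at hj
    exact ⟨m * j, fun v hv => hj ⟨h1 j v (hML hv), iterate_mem hMst _ v hv⟩⟩
  obtain ⟨N, hN⟩ := hnil
  have hlow : ∀ p ∈ I, p.natDegree < n → p = 0 := fun p hp hpn => by
    have h1 := hP fun i : Fin n => C (p.coeff i)
    rw [hdeg p hpn] at h1
    have h2 := add_mem h1 (show aeval T p q ∈ _ from hp)
    rw [sub_add_cancel] at h2
    obtain ⟨w, hw, hwe⟩ := (mem_smul_iff _ _ _).1 h2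
    obtain ⟨f, rfl⟩ := (mem_span_range _).1 (hME hw)
    rw [← hdeg p hpn]
    refine sum_eq_zero fun i _ => ?_
    have h3 := Fintype.linearIndependent_iff.1 hli'
      (fun i => ofPowerSeries ℤ K (X * f i - C (p.coeff i))) (by
        simp only [ofPowerSeries_smul, sub_smul, sum_sub_distrib, mul_smul, ← smul_sum]
        exact sub_eq_zero.2 hwe) i
    have h4 := (map_eq_zero_iff _ HahnSeries.ofPowerSeries_injective).1 h3
    simp [← sub_eq_zero.1 h4]
  -- the generator of `I` is a power of the variable, which divides the equation of `q`
  have hXI : PX ^ N ∈ I := by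
    change aeval T (PX ^ N) q ∈ ϖ • M
    rw [map_pow, aeval_X, hTi]
    exact hN q hqM
  obtain ⟨j, -, hj⟩ := (dvd_prime_pow Polynomial.prime_X _).1
    ((Submodule.IsPrincipal.mem_iff_generator_dvd I).1 hXI)
  have hjI : PX ^ j ∈ I := (Submodule.IsPrincipal.mem_iff_generator_dvd I).2 hj.dvd
  have hjn : n ≤ j := by
    by_contra! h
    exact pow_ne_zero j Polynomial.X_ne_zero (hlow _ hjI (by simpa))
  have h8 : P (Fin.snoc g (-1) : Fin (n + 1) → O) ∈ I := hPI _ (by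
    rw [Fin.sum_univ_castSucc]
    simp only [Fin.snoc_castSucc, Fin.snoc_last, Fin.val_castSucc, Fin.val_last, hg]
    simp)
  intro i
  have h9 := Polynomial.X_pow_dvd_iff.1 (hj.symm.dvd.trans
    ((Submodule.IsPrincipal.mem_iff_generator_dvd I).1 h8)) i (i.2.trans_le hjn)
  have h10 := hPc (Fin.snoc g (-1) : Fin (n + 1) → O) i.castSucc
  rw [Fin.snoc_castSucc] at h10
  exact h10.symm.trans h9

/-- By the integrality of the minimal equation of `q`, a vector of a stable lattice has slope at
most one. -/
theorem SlopeAt.of_isBounded (hδ : IsEuler δ) (h : SlopeAt K δ q s) : (IsBounded K τ q → s ≤ 1) ∧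
    (IsContracted K τ q → s < 1) := by
  obtain ⟨n, c, hq, hli, hc, hs, -⟩ := h
  have hrel := eulerVec_relation hc
  rcases hs with rfl | ⟨i, rfl⟩
  · exact ⟨fun _ => zero_le_one, fun _ => zero_lt_one⟩
  dsimp only
  by_cases hci : c i = 0
  · simp [hci]
  refine ⟨fun ⟨L, hL, hst, hqL⟩ => ?_, fun ⟨L, hL, hst, hqL, hm⟩ => ?_⟩
  · obtain ⟨g, hg, -⟩ := integral_of_isBounded hδ i.pos hli hrel hL hst hqL
    rw [(order_slope_le_iff i (c i) hci _ (hg i)).1]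
    exact (order_ofPowerSeries _).1
  · obtain ⟨g, hg, hg0⟩ := integral_of_isBounded hδ i.pos hli hrel hL hst hqL
    rw [(order_slope_le_iff i (c i) hci _ (hg i)).2]
    refine (order_ofPowerSeries _).2 (hg0 hm i) ?_
    rw [← hg i]
    exact mul_ne_zero (pow_ne_zero _ single_one_ne_zero) hci

theorem SlopeAt.isBounded (hδ : IsEuler δ) (h : SlopeAt K δ q s) : (s ≤ 1 → IsBounded K τ q) ∧
    (s < 1 → IsContracted K τ q) := by
  obtain ⟨n, c, hq, hli, hc, -, hs⟩ := h
  have hn : 0 < n := by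
    rcases n.eq_zero_or_pos with rfl | h
    · exact absurd (by simpa using hc) hq
    · exact h
  have key : ∀ i : Fin n, s ≤ 1 → ∃ g : O, (single 1 1 : Kx) ^ (n - (i : ℕ)) * c i =
      ofPowerSeries ℤ K g ∧ (s < 1 → constantCoeff g = 0) := by
    intro i h1
    by_cases hci : c i = 0
    · exact ⟨0, by simp [hci], by simp⟩
    have h2 := hs (Set.mem_insert_of_mem _ ⟨i, rfl⟩)
    have h3 := order_slope_le_iff i (c i) hci _ rfl
    obtain ⟨g, hg, hg'⟩ := exists_ofPowerSeries_of_order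
      (mul_ne_zero (pow_ne_zero (n - (i : ℕ)) single_one_ne_zero) hci) (h3.1.1 (h2.trans h1))
    exact ⟨g, hg, fun h4 => hg'.2 (h3.2.1 (h2.trans_lt h4))⟩
  have hrel := eulerVec_relation hc
  refine ⟨fun h1 => ?_, fun h1 => ?_⟩
  · choose g hg _ using fun i => key i h1
    simp only [hg, ofPowerSeries_smul] at hrel
    exact (isBounded_of_integral hδ hn g hrel).1
  · choose g hg hg' using fun i => key i h1.le
    simp only [hg, ofPowerSeries_smul] at hrel
    exact (isBounded_of_integral hδ hn g hrel).2 fun i => hg' i h1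

theorem exists_slopeAt [Module.Finite Kx V] (δ : V →+ V) (hq : q ≠ 0) : ∃ s, SlopeAt K δ q s := by
  have h1 : ∃ n, LinearIndependent Kx (fun i : Fin n => δ^[i] q) ∧
      ¬ LinearIndependent Kx (fun i : Fin (n + 1) => δ^[i] q) := by
    by_contra! h
    have h2 : ∀ n, LinearIndependent Kx (fun i : Fin n => δ^[i] q) := by
      intro n
      induction n with
      | zero => exact linearIndependent_empty_type
      | succ n ih => exact h n ih
    have h3 := (h2 (Module.finrank Kx V + 1)).fintype_card_le_finrank
    simp at h3
  obtain ⟨n, hn, hn'⟩ := h1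
  have h2 : (fun i : Fin (n + 1) => δ^[i] q) =
      (Fin.snoc (fun i : Fin n => δ^[i] q) (δ^[n] q) : Fin (n + 1) → V) := by
    funext i
    refine Fin.lastCases ?_ (fun j => ?_) i
    · simp
    · simp
  rw [h2, linearIndependent_finSnoc, not_and, not_not] at hn'
  obtain ⟨c, hc⟩ := (mem_span_range _).1 (hn' hn)
  have hf : (insert (0 : ℚ) (range fun i : Fin n =>
      -((c i).order : ℚ) / ((n : ℚ) - ((i : ℕ) : ℚ)))).Finite := (Set.finite_range _).insert 0
  obtain ⟨s, hs, hs'⟩ := Set.exists_max_image _ id hf ⟨0, Set.mem_insert _ _⟩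
  exact ⟨s, n, c, hq, hn, hc.symm, hs, fun t ht => hs' t ht⟩

theorem SlopeAt.map {V' : Type*} [AddCommGroup V'] [Module Kx V'] {δ' : V' →+ V'}
    (f : V →ₗ[Kx] V') (hf : Function.Injective f) (hδ : ∀ v, f (δ v) = δ' (f v)) :
    SlopeAt K δ' (f q) s ↔ SlopeAt K δ q s := by
  have h1 : ∀ i, δ'^[i] (f q) = f (δ^[i] q) := by
    intro i
    induction i with
    | zero => rfl
    | succ i ih => rw [iter_succ, iter_succ, ih, hδ]
  have h2 : ∀ n, LinearIndependent Kx (fun i : Fin n => f (δ^[i] q)) ↔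
      LinearIndependent Kx (fun i : Fin n => δ^[i] q) := fun n =>
    f.linearIndependent_iff (v := fun i : Fin n => δ^[i] q) (LinearMap.ker_eq_bot.2 hf)
  refine exists_congr fun n => exists_congr fun c => ?_
  simp only [h1, h2, ← map_smul, ← map_sum]
  rw [hf.eq_iff, ← map_zero f, hf.ne_iff]

variable (K V) in
/-- Multiplication by `X⁻¹`, as an `O`-linear map. -/
def divX : V →ₗ[O] V where
  toFun v := (single (-1) 1 : Kx) • v
  map_add' := smul_add _
  map_smul' f v := by
    rw [← ofPowerSeries_smul, smul_comm, ofPowerSeries_smul, RingHom.id_apply]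

theorem divX_apply (v : V) : divX K V v = (single (-1) 1 : Kx) • v := rfl

theorem X_smul_divX (v : V) : ϖ • divX K V v = v := by
  rw [X_smul, divX_apply, ← mul_smul, single_mul_single]
  simp

theorem divX_X_smul (v : V) : divX K V (ϖ • v) = v := by
  rw [map_smul, X_smul_divX]

/-- A Laurent series acts as a power series followed by a power of `X⁻¹`. -/
theorem laurent_smul_mem_of_stable {S : Set V} (h₁ : ∀ (f : O), ∀ v ∈ S, f • v ∈ S)
    (h₂ : ∀ v ∈ S, divX K V v ∈ S) (f : Kx) (hv : v ∈ S) : f • v ∈ S := by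
  obtain ⟨n, g, hg⟩ := exists_pow_mul_eq_ofPowerSeries f
  have h3 : ∀ n : ℕ, ∀ w, ϖ ^ n • w ∈ S → w ∈ S := by
    intro n
    induction n with
    | zero => intro w hw; simpa using hw
    | succ n ih =>
      intro w hw
      rw [pow_succ', mul_smul] at hw
      have := h₂ _ hw
      rw [divX_X_smul] at this
      exact ih w this
  refine h3 n _ ?_
  rw [X_pow_smul, ← mul_smul, hg, ofPowerSeries_smul]
  exact h₁ g v hv

theorem irregOp_divX (hδ : IsEuler δ) (v : V) : τ (divX K V v) = divX K V (τ v) - v := by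
  have h1 := irregOp_X_pow_smul hδ 1 (divX K V v)
  rw [pow_one, X_smul_divX, Nat.cast_one, one_smul, X_smul_divX] at h1
  rw [h1, divX_X_smul, add_sub_cancel_right]

theorem divX_mem_X_smul (h : v ∈ ϖ • L) : divX K V v ∈ L := by
  obtain ⟨w, hw, rfl⟩ := (mem_smul_iff _ _ _).1 h
  rwa [divX_X_smul]

theorem divX_stable (hδ : IsEuler δ) (hL : ∀ v ∈ L, τ v ∈ L) :
    ∀ v ∈ L.map (divX K V), τ v ∈ L.map (divX K V) := by
  rintro _ ⟨v, hv, rfl⟩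
  rw [irregOp_divX hδ]
  exact sub_mem (mem_map_of_mem (hL v hv)) ⟨_, L.smul_mem ϖ hv, divX_X_smul v⟩

theorem divX_iterate (hδ : IsEuler δ) (hL : ∀ v ∈ L, τ v ∈ L) (n : ℕ) (hv : v ∈ L) :
    τ^[n] (divX K V v) - divX K V (τ^[n] v) ∈ L := by
  induction n with
  | zero => simp
  | succ n ih =>
    rw [iter_succ, iter_succ]
    have h1 := irregOp_divX hδ (τ^[n] v)
    rw [← sub_add_sub_cancel _ (τ (divX K V (τ^[n] v))), ← map_sub, h1, sub_sub_cancel_left]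
    exact add_mem (hL _ ih) (neg_mem (iterate_mem hL n v hv))

theorem iterate_mem_of_le (hδ : IsEuler δ) (hL : ∀ v ∈ L, τ v ∈ L) {m n : ℕ} (hmn : m ≤ n)
    (hv : τ^[m] v ∈ ϖ • L) :
    τ^[n] v ∈ ϖ • L := by
  obtain ⟨r, rfl⟩ := Nat.exists_eq_add_of_le' hmn
  rw [Function.iterate_add_apply]
  exact iterate_mem (irregOp_mem_X_smul hδ hL) r _ hv

/-- Sums of topologically nilpotent stable lattices. -/
theorem sup_contracted (hδ : IsEuler δ) {L L' : Submodule O V}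
    (hL : ∀ v ∈ L, τ v ∈ L) (hL' : ∀ v ∈ L', τ v ∈ L') :
    (∀ v ∈ L ⊔ L', τ v ∈ L ⊔ L') ∧
    ((∃ m, ∀ v ∈ L, τ^[m] v ∈ ϖ • L) → (∃ m, ∀ v ∈ L', τ^[m] v ∈ ϖ • L') →
      ∃ m, ∀ v ∈ L ⊔ L', τ^[m] v ∈ ϖ • (L ⊔ L')) := by
  constructor
  · intro v hv
    obtain ⟨a, ha, b, hb, rfl⟩ := mem_sup.1 hv
    rw [map_add]
    exact Submodule.add_mem_sup (hL a ha) (hL' b hb)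
  · rintro ⟨m, hm⟩ ⟨n, hn⟩
    refine ⟨max m n, fun v hv => ?_⟩
    obtain ⟨a, ha, b, hb, rfl⟩ := mem_sup.1 hv
    rw [iterate_map_add, Submodule.smul_sup']
    exact Submodule.add_mem_sup (iterate_mem_of_le hδ hL (le_max_left _ _) (hm a ha))
      (iterate_mem_of_le hδ hL' (le_max_right _ _) (hn b hb))

/-- The subspace of the vectors which lie in stable lattices. -/
def boundedVectors (hδ : IsEuler δ) : Submodule Kx V where
  carrier := {q | IsBounded K τ q}
  add_mem' := by
    rintro q q' ⟨L, hL, hst, hq⟩ ⟨L', hL', hst', hq'⟩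
    exact ⟨L ⊔ L', hL.sup hL', (sup_contracted hδ hst hst').1, Submodule.add_mem_sup hq hq'⟩
  zero_mem' := ⟨⊥, Submodule.fg_bot, by simp, zero_mem _⟩
  smul_mem' f q hq := by
    refine laurent_smul_mem_of_stable ?_ ?_ f hq
    · rintro f q ⟨L, hL, hst, hq⟩
      exact ⟨L, hL, hst, L.smul_mem f hq⟩
    · rintro q ⟨L, hL, hst, hq⟩
      exact ⟨L.map (divX K V), hL.map _, divX_stable hδ hst, mem_map_of_mem hq⟩

theorem delta_mem_boundedVectors (hδ : IsEuler δ)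
    (hq : q ∈ boundedVectors (K := K) hδ) : δ q ∈ boundedVectors (K := K) hδ := by
  obtain ⟨L, hL, hst, hq⟩ := hq
  exact (divX_X_smul (K := K) (δ q)) ▸ smul_mem _ _ ⟨L, hL, hst, hst q hq⟩

/-- The subspace of the vectors which lie in stable lattices on which `T` is topologically
nilpotent. -/
def contractedVectors (hδ : IsEuler δ) : Submodule Kx V where
  carrier := {q | IsContracted K τ q}
  add_mem' := by
    rintro q q' ⟨L, hL, hst, hq, hm⟩ ⟨L', hL', hst', hq', hm'⟩
    exact ⟨L ⊔ L', hL.sup hL', (sup_contracted hδ hst hst').1, Submodule.add_mem_sup hq hq',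
      (sup_contracted hδ hst hst').2 hm hm'⟩
  zero_mem' := ⟨⊥, Submodule.fg_bot, by simp, zero_mem _, 0, by simp⟩
  smul_mem' f q hq := by
    refine laurent_smul_mem_of_stable ?_ ?_ f hq
    · rintro f q ⟨L, hL, hst, hq, hm⟩
      exact ⟨L, hL, hst, L.smul_mem f hq, hm⟩
    · rintro q ⟨L, hL, hst, hq, m, hm⟩
      refine ⟨L.map (divX K V), hL.map _, divX_stable hδ hst, mem_map_of_mem hq, m, ?_⟩
      rintro _ ⟨v, hv, rfl⟩
      have h1 := add_mem (divX_iterate hδ hst m hv) (divX_mem_X_smul (hm v hv))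
      rw [sub_add_cancel] at h1
      exact (mem_smul_iff _ _ _).2 ⟨_, mem_map_of_mem h1, X_smul_divX _⟩

theorem delta_mem_contractedVectors (hδ : IsEuler δ)
    (hq : q ∈ contractedVectors (K := K) hδ) : δ q ∈ contractedVectors (K := K) hδ := by
  obtain ⟨L, hL, hst, hq, hm⟩ := hq
  exact (divX_X_smul (K := K) (δ q)) ▸ smul_mem _ _ ⟨L, hL, hst, hst q hq, hm⟩

/-- In a space all of whose vectors lie in contracted lattices, so do all finitely generated
modules. -/
theorem exists_contracted_lattice (hδ : IsEuler δ)
    {F : Submodule O V} (hF : F.FG)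
    (h : ∀ v ∈ F, IsContracted K τ v) :
    ∃ L : Submodule O V, L.FG ∧ (∀ v ∈ L, τ v ∈ L) ∧ F ≤ L ∧ ∃ m, ∀ v ∈ L, τ^[m] v ∈ ϖ • L := by
  induction F, hF using Submodule.fg_induction with
  | singleton x =>
    obtain ⟨L, hL, hst, hq, hm⟩ := h x (Submodule.mem_span_singleton_self x)
    exact ⟨L, hL, hst, (Submodule.span_singleton_le_iff_mem _ _).2 hq, hm⟩
  | sup M₁ M₂ _ _ h₁ h₂ =>
    obtain ⟨L, hL, hst, hq, hm⟩ := h₁ fun v hv => h v (mem_sup_left hv)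
    obtain ⟨L', hL', hst', hq', hm'⟩ := h₂ fun v hv => h v (mem_sup_right hv)
    exact ⟨L ⊔ L', hL.sup hL', (sup_contracted hδ hst hst').1, sup_le_sup hq hq',
      (sup_contracted hδ hst hst').2 hm hm'⟩

/-- Dévissage: if `q` is contracted modulo a subspace all of whose vectors are contracted, then `q`
is contracted. -/
theorem IsContracted.of_quotient (hδ : IsEuler δ) (N : Submodule O V)
    (hN : ∀ v ∈ N, IsContracted K τ v)
    {P : Submodule O V} (hP : P.FG)
    (hst : ∀ v ∈ P, τ v ∈ P ⊔ N)
    (hm : ∃ m, ∀ v ∈ P, τ^[m] v ∈ ϖ • P ⊔ N) :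
    ∀ q ∈ P, IsContracted K τ q := by
  obtain ⟨m, hm⟩ := hm
  -- finitely many elements of `N` are involved
  have hfin : ∀ (M P' : Submodule O V), M.FG → M ≤ P' ⊔ N →
      ∃ F : Submodule O V, F.FG ∧ F ≤ N ∧ M ≤ P' ⊔ F := by
    intro M P' hM hle
    obtain ⟨r, b, rfl⟩ := fg_iff_fin.1 hM
    have h1 : ∀ i, ∃ y ∈ P', ∃ z ∈ N, y + z = b i := fun i =>
      mem_sup.1 (hle (subset_span ⟨i, rfl⟩))
    choose y hy z hz hyz using h1
    refine ⟨span O (range z), fg_span (Set.finite_range z),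
      span_le.2 (by rintro _ ⟨i, rfl⟩; exact hz i), span_le.2 ?_⟩
    rintro _ ⟨i, rfl⟩
    rw [← hyz]
    exact Submodule.add_mem_sup (hy i) (subset_span ⟨i, rfl⟩)
  have hT := isDerivation_irregOp hδ
  obtain ⟨F₁, hF₁, hF₁N, hF₁P⟩ := hfin (stepUp hT P) P (stepUp_fg hT hP) (stepUp_le le_sup_left hst)
  have hm' : ∃ F₂ : Submodule O V, F₂.FG ∧ F₂ ≤ N ∧
      filt hT P m ⊓ (ϖ • P ⊔ N) ≤ ϖ • P ⊔ F₂ :=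
    hfin _ _ (FG.of_le (filt_fg hT hP m) inf_le_left) inf_le_right
  obtain ⟨F₂, hF₂, hF₂N, hF₂P⟩ := hm'
  obtain ⟨L, hL, hLst, hFL, r, hr⟩ := exists_contracted_lattice hδ (hF₁.sup hF₂)
    fun v hv => hN v (sup_le hF₁N hF₂N hv)
  have hst' : ∀ v ∈ P ⊔ L, τ v ∈ P ⊔ L := by
    intro v hv
    obtain ⟨a, ha, b, hb, rfl⟩ := mem_sup.1 hv
    rw [map_add]
    refine add_mem ?_ (mem_sup_right (hLst b hb))
    exact sup_le_sup_left (le_sup_left.trans hFL) _ (hF₁P (map_mem_stepUp hT ha))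
  intro q hq
  refine ⟨P ⊔ L, hP.sup hL, hst', mem_sup_left hq, r + m, fun v hv => ?_⟩
  have h1 : ∀ w ∈ P ⊔ L, τ^[m] w ∈ ϖ • (P ⊔ L) ⊔ L := by
    intro w hw
    obtain ⟨a, ha, b, hb, rfl⟩ := mem_sup.1 hw
    rw [iterate_map_add]
    refine add_mem ?_ (mem_sup_right (iterate_mem hLst m b hb))
    have h2 := hF₂P ⟨iterate_mem_filt hT ha m, hm a ha⟩
    refine sup_le_sup ?_ (le_sup_right.trans hFL) h2
    rw [Submodule.smul_sup']
    exact le_sup_left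
  rw [Function.iterate_add_apply]
  obtain ⟨a, ha, b, hb, hab⟩ := mem_sup.1 (h1 v hv)
  rw [← hab, iterate_map_add]
  refine add_mem (iterate_mem (irregOp_mem_X_smul hδ hst') r a ha) ?_
  have := hr b hb
  obtain ⟨w, hw, hwb⟩ := (mem_smul_iff _ _ _).1 this
  rw [← hwb]
  exact X_smul_mem' (mem_sup_right hw)

end StableLattices

/-! ### Differential modules over the field of Laurent series -/

section DiffModules

/-- The ring `R⟨∂⟩` as a left `R`-module. -/
instance DiffOp.instModuleLeft {R : Type u} [CommRing R] (d : Der R) : Module R (DiffOp d) :=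
  Module.compHom _ (of d)

theorem DiffOp.of_smul_eq {R : Type u} [CommRing R] {d : Der R} {V : Type v} [AddCommGroup V]
    [Module (DiffOp d) V] [Module R V] [IsScalarTower R (DiffOp d) V] (r : R) (v : V) :
    of d r • v = r • v := by
  have h := smul_assoc r (1 : DiffOp d) v
  rw [one_smul] at h
  rw [← h]
  congr 1
  exact (mul_one (of d r)).symm

theorem DiffOp.smul_mem_of_stable {R : Type u} [CommRing R] {d : Der R} {V : Type v}
    [AddCommGroup V] [Module (DiffOp d) V] (S : AddSubgroup V)
    (h₁ : ∀ (r : R), ∀ v ∈ S, of d r • v ∈ S) (h₂ : ∀ v ∈ S, del d • v ∈ S)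
    (P : DiffOp d) {v : V} (hv : v ∈ S) : P • v ∈ S := by
  obtain ⟨Q, rfl⟩ := RingQuot.mkRingHom_surjective (DiffOp.Rel d) P
  change DiffOp.mk d Q • v ∈ S
  induction Q using FreeAlgebra.induction generalizing v with
  | grade0 n =>
    rw [eq_intCast, map_intCast, Int.cast_smul_eq_zsmul]
    exact S.zsmul_mem hv n
  | grade1 o =>
    cases o with
    | none => exact h₂ v hv
    | some r => exact h₁ r v hv
  | mul P Q hP hQ => rw [map_mul, mul_smul]; exact hP (hQ hv)
  | add P Q hP hQ => rw [map_add, add_smul]; exact S.add_mem (hP hv) (hQ hv)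

instance PuncturedOp.instModulePowerSeries (K : Type u) [CommRing K] : Module O DK :=
  Module.compHom _ (algebraMap O Kx)

set_option hygiene false in
/-- The category of modules over the differential operators on the punctured disk. -/
scoped notation "PMod" => ModuleCat.{u} (PuncturedOp K)

variable {K : Type u} [Field K] {V : Type v} [AddCommGroup V] [Module DK V]

variable (K V) in
/-- The operator `X d/dX` on a `D_K`-module. -/
def eulerAct : V →+ V := DistribSMul.toAddMonoidHom V (eulerOp K)

theorem eulerAct_apply (v : V) : eulerAct K V v = eulerOp K • v := rfl

theorem iterate_eulerAct (n : ℕ) (v : V) : (eulerAct K V)^[n] v = eulerOp K ^ n • v := by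
  induction n with
  | zero => simp
  | succ n ih => rw [iter_succ, ih, eulerAct_apply, ← mul_smul, pow_succ']

variable [Module Kx V] [Module O V] [IsScalarTower Kx DK V]
  [IsScalarTower O Kx V] [IsScalarTower O DK V]

theorem eulerAct_eq (v : V) : eulerAct K V v = (single 1 1 : Kx) • del dK • v := by
  rw [eulerAct_apply, eulerOp, mul_smul, DiffOp.of_smul_eq]

theorem del_smul_eq (v : V) :
    del dK • v = (single (-1) 1 : Kx) • eulerAct K V v := by
  rw [eulerAct_eq, ← mul_smul, single_mul_single]
  simp

theorem isDerivation_del {R : Type u} [CommRing R] {d : Der R} {V : Type v} [AddCommGroup V]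
    [Module (DiffOp d) V] [Module R V] [IsScalarTower R (DiffOp d) V] :
    IsDerivation d (DistribSMul.toAddMonoidHom V (del d)) := fun f v => by
  change del d • f • v = f • del d • v + _
  rw [← DiffOp.of_smul_eq (d := d) f v, ← mul_smul, del_mul_of, add_smul, mul_smul,
    DiffOp.of_smul_eq, DiffOp.of_smul_eq]

theorem isDerivation_eulerAct : IsEuler (eulerAct K V) := fun f v => by
  have h := isDerivation_del (d := dK) f v
  change del dK • f • v = f • del dK • v + _ at h
  rw [eulerAct_eq, h, smul_add, smul_comm, ← eulerAct_eq, ← mul_smul]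
  rfl

variable (K V) in
/-- The operator `X² d/dX` on a `D_K`-module. -/
abbrev irregAct : V →+ V := irregOp K (eulerAct K V)

theorem irregAct_eq (v : V) : irregAct K V v = (single 2 1 : Kx) • del dK • v := by
  rw [irregAct, irregOp_apply, X_smul, eulerAct_eq, ← mul_smul, single_mul_single]
  norm_num

/-- A subspace which is stable under `X d/dX` is a `D_K`-submodule. -/
def stableSub (N : Submodule Kx V) (h : ∀ v ∈ N, eulerAct K V v ∈ N) : Submodule DK V where
  toAddSubmonoid := N.toAddSubmonoid
  smul_mem' P v hv := by
    refine DiffOp.smul_mem_of_stable N.toAddSubgroup (fun r v hv => ?_) (fun v hv => ?_) P hv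
    · exact (DiffOp.of_smul_eq (d := dK) r v).symm ▸ N.smul_mem r hv
    · exact (del_smul_eq (K := K) v).symm ▸ N.smul_mem _ (h v hv)

variable {V' : Type*} [AddCommGroup V'] [Module DK V']
  [Module Kx V'] [Module O V'] [IsScalarTower Kx DK V']
  [IsScalarTower O Kx V'] [IsScalarTower O DK V']

theorem map_irregAct (f : V →ₗ[DK] V') (v : V) :
    f (irregAct K V v) = irregAct K V' (f v) := by
  rw [irregAct_eq, irregAct_eq, ← DiffOp.of_smul_eq (d := dK),
    ← DiffOp.of_smul_eq (d := dK), map_smul, map_smul]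

theorem map_irregAct_iterate (f : V →ₗ[DK] V') (n : ℕ) (v : V) :
    f ((irregAct K V)^[n] v) = (irregAct K V')^[n] (f v) := by
  induction n with
  | zero => rfl
  | succ n ih => rw [iter_succ, iter_succ, map_irregAct, ih]

theorem IsBounded.map (f : V →ₗ[DK] V') {q : V}
    (h : IsBounded K (irregAct K V) q) : IsBounded K (irregAct K V') (f q) := by
  obtain ⟨L, hL, hst, hq⟩ := h
  refine ⟨L.map (f.restrictScalars O), hL.map _, ?_, mem_map_of_mem hq⟩
  rintro _ ⟨v, hv, rfl⟩
  exact ⟨_, hst v hv, map_irregAct f v⟩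

theorem IsContracted.map (f : V →ₗ[DK] V') {q : V} (h : IsContracted K (irregAct K V) q) :
    IsContracted K (irregAct K V') (f q) := by
  obtain ⟨L, hL, hst, hq, m, hm⟩ := h
  refine ⟨L.map (f.restrictScalars O), hL.map _, ?_, mem_map_of_mem hq, m, ?_⟩
  · rintro _ ⟨v, hv, rfl⟩
    exact ⟨_, hst v hv, map_irregAct f v⟩
  · rintro _ ⟨v, hv, rfl⟩
    obtain ⟨w, hw, hwv⟩ := (mem_smul_iff _ _ _).1 (hm v hv)
    refine (mem_smul_iff _ _ _).2 ⟨_, mem_map_of_mem hw, ?_⟩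
    rw [← map_smul, hwv]
    exact map_irregAct_iterate f m v

theorem hasSlope_iff {V : Type u} [AddCommGroup V] [Module DK V] [i : Module Kx V]
    [IsScalarTower Kx DK V] {s : ℚ} :
    HasSlope K V s ↔ ∃ q : V, SlopeAt K (eulerAct K V) q s := by
  have h : Module.compHom V (of dK) = i := Module.ext' _ _ fun r m => DiffOp.of_smul_eq r m
  subst h
  constructor
  · rintro ⟨n, q, c, h⟩
    refine ⟨q, n, c, ?_⟩
    simpa only [iterate_eulerAct] using h
  · rintro ⟨q, n, c, h⟩
    refine ⟨n, q, c, ?_⟩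
    simpa only [iterate_eulerAct] using h

/-- The inclusion of a subquotient in a quotient. -/
def subquotientMap (N₁ N₂ : Submodule DK V) : (N₂ ⧸ N₁.submoduleOf N₂) →ₗ[DK] V ⧸ N₁ :=
  Submodule.mapQ (N₁.submoduleOf N₂) N₁ N₂.subtype le_rfl

theorem subquotientMap_injective (N₁ N₂ : Submodule DK V) :
    Function.Injective (subquotientMap N₁ N₂) := by
  rw [injective_iff_map_eq_zero]
  intro q hq
  obtain ⟨v, rfl⟩ := Submodule.Quotient.mk_surjective _ q
  exact (mk_eq_zero _).2 ((mk_eq_zero N₁).1 hq)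

theorem slopeAt_subquotientMap {N₁ N₂ : Submodule DK V} {q : N₂ ⧸ N₁.submoduleOf N₂}
    {s : ℚ} : SlopeAt K (eulerAct K (V ⧸ N₁)) (subquotientMap N₁ N₂ q) s ↔
      SlopeAt K (eulerAct K (N₂ ⧸ N₁.submoduleOf N₂)) q s :=
  SlopeAt.map ((subquotientMap N₁ N₂).restrictScalars Kx) (subquotientMap_injective N₁ N₂)
    fun v => (subquotientMap N₁ N₂).map_smul (eulerOp K) v

end DiffModules

section SlopeCriteria

variable {K : Type u} [Field K] {V : Type u} [AddCommGroup V] [Module DK V]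
  [Module Kx V] [Module O V] [IsScalarTower Kx DK V]
  [IsScalarTower O Kx V] [IsScalarTower O DK V]

theorem isArtinian_of_finite [Module.Finite Kx V] : IsArtinian DK V :=
  isArtinian_of_tower Kx inferInstance

instance finite_quotient [Module.Finite Kx V] (N : Submodule DK V) : Module.Finite Kx (V ⧸ N) :=
  Module.Finite.of_surjective (N.mkQ.restrictScalars Kx) N.mkQ_surjective

instance finite_sub [Module.Finite Kx V] (N : Submodule DK V) : Module.Finite Kx N :=
  Module.Finite.of_injective (N.subtype.restrictScalars Kx) N.subtype_injective

/-- A proper inclusion of submodules contributes a slope: the slope of a cyclic vector of a simple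
subquotient, which may be computed in `V ⧸ N`. -/
theorem exists_isSlope_of_lt [Module.Finite Kx V] {N B : Submodule DK V}
    (h : N < B) : ∃ v ∈ B, v ∉ N ∧ ∃ s, IsSlope K (ModuleCat.of DK V) s ∧
      SlopeAt K (eulerAct K (V ⧸ N)) (N.mkQ v) s := by
  have := isArtinian_of_finite (K := K) (V := V)
  obtain ⟨N₂, hN, hB⟩ := exists_covBy_le_of_lt h
  obtain ⟨v, hv, hvN⟩ := SetLike.exists_of_lt hN.lt
  have hq : (Submodule.Quotient.mk ⟨v, hv⟩ : N₂ ⧸ N.submoduleOf N₂) ≠ 0 := by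
    rw [Ne, mk_eq_zero]
    exact hvN
  obtain ⟨s, hs⟩ := exists_slopeAt (K := K) (eulerAct K (N₂ ⧸ N.submoduleOf N₂)) hq
  refine ⟨v, hB hv, hvN, s, ⟨N, N₂, hN.le, (covBy_iff_quot_is_simple hN.le).1 hN,
    hasSlope_iff.2 ⟨_, hs⟩⟩, slopeAt_subquotientMap.2 hs⟩

theorem exists_slopeAt_of_isSlope {s : ℚ} (h : IsSlope K (ModuleCat.of DK V) s) :
    ∃ N₁ N₂ : Submodule DK V, ∃ v ∈ N₂, v ∉ N₁ ∧ N₁ ≤ N₂ ∧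
      SlopeAt K (eulerAct K (V ⧸ N₁)) (N₁.mkQ v) s := by
  obtain ⟨N₁, N₂, hle, -, hs⟩ := h
  obtain ⟨q, hq⟩ := (hasSlope_iff (K := K) (V := ↥N₂ ⧸ N₁.submoduleOf N₂)).1 hs
  obtain ⟨⟨v, hv⟩, rfl⟩ := Submodule.Quotient.mk_surjective _ q
  refine ⟨N₁, N₂, v, hv, fun hv' => ?_, hle, slopeAt_subquotientMap.2 hq⟩
  obtain ⟨n, c, hq0, -⟩ := hq
  exact hq0 ((mk_eq_zero _).2 hv')

variable (K V) in
/-- The largest submodule of `V` whose vectors lie in stable lattices on which `X² d/dX` is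
topologically nilpotent. It collects the slopes less than one. -/
def contractedSub : Submodule DK V := stableSub (contractedVectors (K := K) isDerivation_eulerAct)
    fun _ hv => delta_mem_contractedVectors isDerivation_eulerAct hv

variable (K V) in
/-- The submodule of the vectors which lie in lattices stable under `X² d/dX`. It collects the
slopes at most one. -/
def boundedSub : Submodule DK V := stableSub (boundedVectors (K := K) isDerivation_eulerAct)
    fun _ hv => delta_mem_boundedVectors isDerivation_eulerAct hv

theorem exists_fg_lift {R : Type*} [Ring R] {M M' : Type*} [AddCommGroup M] [AddCommGroup M']
    [Module R M] [Module R M'] (f : M →ₗ[R] M') (hf : Function.Surjective f) {L : Submodule R M'}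
    (hL : L.FG) : ∃ P : Submodule R M, P.FG ∧ P.map f = L := by
  obtain ⟨r, b, rfl⟩ := fg_iff_fin.1 hL
  choose c hc using fun i => hf (b i)
  refine ⟨span R (range c), fg_span (Set.finite_range c), ?_⟩
  rw [Submodule.map_span, ← Set.range_comp]
  exact congrArg _ (congrArg _ (funext hc))

/-- The slopes of `V` are less than one if and only if every vector lies in a stable lattice on
which `X² d/dX` is topologically nilpotent. -/
theorem forall_slope_lt_one_iff [Module.Finite Kx V] :
    (∀ s, IsSlope K (ModuleCat.of DK V) s → s < 1) ↔ ∀ v : V, IsContracted K (irregAct K V) v := by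
  constructor
  · intro h
    by_contra hne
    push Not at hne
    obtain ⟨v, hv⟩ := hne
    let N := contractedSub K V
    have hlt : N < ⊤ := lt_top_iff_ne_top.2 fun h' => hv (h' ▸ Submodule.mem_top : v ∈ N)
    obtain ⟨q, -, hq, s, hs, hsq⟩ := exists_isSlope_of_lt hlt
    obtain ⟨L, hL, hst, hqL, m, hm⟩ := (hsq.isBounded isDerivation_eulerAct).2 (h s hs)
    let f : V →ₗ[O] V ⧸ N := N.mkQ.restrictScalars O
    have hf : ∀ {v}, f v = 0 ↔ v ∈ N := mk_eq_zero N
    obtain ⟨P, hP, rfl⟩ := exists_fg_lift f N.mkQ_surjective hL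
    have hsup : ∀ {P' : Submodule O V} {w : V}, f w ∈ P'.map f →
        w ∈ P' ⊔ N.restrictScalars O := by
      rintro P' w ⟨w', hw', hww'⟩
      rw [← sub_add_cancel w w', add_comm]
      exact Submodule.add_mem_sup hw' (hf.1 (by rw [map_sub, hww', sub_self]))
    obtain ⟨q', hq', hqq'⟩ := hqL
    have hqq : q - q' ∈ N := hf.1 (by rw [map_sub, hqq', sub_eq_zero]; rfl)
    have key := IsContracted.of_quotient (K := K) (δ := eulerAct K V) isDerivation_eulerAct
      (N.restrictScalars O) (fun v hv => hv) hP
      (fun v hv => hsup (by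
        have := hst (f v) (mem_map_of_mem hv)
        rwa [show irregOp K (eulerAct K (V ⧸ N)) (f v) = f (irregAct K V v) from
          (map_irregAct N.mkQ v).symm] at this))
      ⟨m, fun v hv => hsup (by
        have := hm (f v) (mem_map_of_mem hv)
        rw [show (irregOp K (eulerAct K (V ⧸ N)))^[m] (f v) = f ((irregAct K V)^[m] v) from
          (map_irregAct_iterate N.mkQ m v).symm] at this
        obtain ⟨w, ⟨w', hw', rfl⟩, hw⟩ := (mem_smul_iff _ _ _).1 this
        rw [← hw, ← map_smul]
        exact mem_map_of_mem (X_smul_mem' hw'))⟩ q' hq'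
    have := N.add_mem hqq key
    rw [sub_add_cancel] at this
    exact hq this
  · intro h s hs
    obtain ⟨N₁, N₂, v, hv, hv', hle, hsv⟩ := exists_slopeAt_of_isSlope hs
    exact (hsv.of_isBounded isDerivation_eulerAct).2 ((h v).map N₁.mkQ)

end SlopeCriteria

open DiffOp (of_smul_eq)

/-! ### Expanding operators and slopes greater than one -/

section Expanding

variable {K : Type u} [Field K] {V : Type v} [AddCommGroup V] [Module O V]

/-- The operator `T` is bijective, and its inverse preserves the finitely generated module `L` and
is topologically nilpotent. -/
structure IsExpanding (T : V →+ V) (L : Submodule O V) : Prop where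
  bij : Function.Bijective T
  fg : L.FG
  pull : ∀ v, T v ∈ L → v ∈ L
  contract : ∀ m, ∃ n, ∀ v, T^[n] v ∈ L → v ∈ ϖ ^ m • L
  absorb : ∀ v, ∃ n, ∀ w, T^[n] w = v → w ∈ L

namespace IsExpanding

variable {T : V →+ V} {L : Submodule O V}

theorem mem_of_iterate (h : IsExpanding T L) (n : ℕ) {v : V} (hv : T^[n] v ∈ L) : v ∈ L := by
  induction n generalizing v with
  | zero => exact hv
  | succ n ih => exact h.pull v (ih hv)

theorem mem_of_le (h : IsExpanding T L) {m n : ℕ} (hmn : m ≤ n) {v : V} (hv : T^[n] v ∈ L) :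
    T^[m] v ∈ L := by
  obtain ⟨r, rfl⟩ := Nat.exists_eq_add_of_le' hmn
  rw [Function.iterate_add_apply] at hv
  exact h.mem_of_iterate r hv

theorem iterate_bijective (h : IsExpanding T L) (n : ℕ) : Function.Bijective T^[n] :=
  h.bij.iterate n

theorem mem_filt (h : IsExpanding T L) {d : Der O} (hT : IsDerivation d T) (v : V) :
    ∃ j, v ∈ filt hT L j := by
  obtain ⟨n, hn⟩ := h.absorb v
  obtain ⟨w, rfl⟩ := (h.iterate_bijective n).surjective v
  exact ⟨n, iterate_mem_filt hT (hn w rfl) n⟩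

theorem mem_of_mem_filt (h : IsExpanding T L) {d : Der O} (hT : IsDerivation d T) (j : ℕ) :
    ∀ v, T^[j] v ∈ filt hT L j → v ∈ L := by
  induction j with
  | zero => exact fun v hv => hv
  | succ j ih =>
    intro v hv
    rw [filt_succ] at hv
    obtain ⟨a, ha, b, hb, hab⟩ := mem_stepUp.1 hv
    obtain ⟨a', rfl⟩ := (h.iterate_bijective j).surjective a
    obtain ⟨b', rfl⟩ := (h.iterate_bijective j).surjective b
    have h1 := ih a' ha
    obtain ⟨a'', rfl⟩ := h.bij.surjective a'
    rw [← iterate_succ_apply, ← iter_succ T, ← iterate_map_add] at hab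
    rw [(h.iterate_bijective (j + 1)).injective hab]
    exact add_mem (h.pull _ h1) (ih b' hb)

/-- Any finitely generated module is contracted by a power of the inverse of `T`. -/
theorem exists_contract (h : IsExpanding T L) {d : Der O} (hT : IsDerivation d T)
    {N : Submodule O V} (hN : N.FG) (m : ℕ) :
    ∃ n, ∀ v, T^[n] v ∈ N → v ∈ ϖ ^ m • L := by
  obtain ⟨r, b, rfl⟩ := fg_iff_fin.1 hN
  choose j hj using fun i => h.mem_filt hT (b i)
  have h1 : span O (range b) ≤ filt hT L (∑ i, j i) := by
    rw [span_le]
    rintro _ ⟨i, rfl⟩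
    exact filt_mono hT L (single_le_sum (fun _ _ => Nat.zero_le _) (mem_univ i))
      (hj i)
  obtain ⟨n, hn⟩ := h.contract m
  refine ⟨∑ i, j i + n, fun v hv => hn v (h.mem_of_mem_filt hT (∑ i, j i) _ ?_)⟩
  rw [Function.iterate_add_apply] at hv
  exact h1 hv

end IsExpanding

end Expanding

section GreaterThanOne

variable {K : Type u} [Field K] {V : Type u} [AddCommGroup V] [Module DK V]
  [Module Kx V] [Module O V] [IsScalarTower Kx DK V]
  [IsScalarTower O Kx V] [IsScalarTower O DK V]

local notation "τ" => irregAct K V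

theorem isDerivation_irregAct : IsDerivation (irregD K) τ :=
  isDerivation_irregOp isDerivation_eulerAct

theorem directed_exists_fin {M : ℕ → Submodule O V} (hM : Monotone M) {r : ℕ} {b : Fin r → V}
    (h : ∀ i, ∃ j, b i ∈ M j) : ∃ j, ∀ i, b i ∈ M j := by
  choose j hj using h
  exact ⟨∑ i, j i, fun i => hM (single_le_sum (fun _ _ => Nat.zero_le _)
    (mem_univ i)) (hj i)⟩

/-- An increasing sequence of submodules with union `N` generates `N` modulo `X`, because `N / X N`
is finite-dimensional. -/
theorem exists_generate_mod_X [Module.Finite Kx V] {M : ℕ → Submodule O V} (hM : Monotone M)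
    {N : Submodule O V} (hN : ∀ v, v ∈ N ↔ ∃ j, v ∈ M j) :
    ∃ j, N ≤ M j ⊔ ϖ • N := by
  by_contra hne
  push Not at hne
  have key : ∀ d, ∃ b : Fin d → V, (∀ i, b i ∈ N) ∧ ∀ c : Fin d → K,
      ∑ i, (C (c i) : O) • b i ∈ ϖ • N → c = 0 := by
    intro d
    induction d with
    | zero => exact ⟨Fin.elim0, fun i => i.elim0, fun c _ => Subsingleton.elim _ _⟩
    | succ d ih =>
      obtain ⟨b, hb, hbi⟩ := ih
      obtain ⟨j, hj⟩ := directed_exists_fin hM fun i => (hN _).1 (hb i)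
      obtain ⟨w, hw, hwj⟩ := SetLike.not_le_iff_exists.1 (hne j)
      refine ⟨Fin.snoc b w, fun i => ?_, fun c hc => ?_⟩
      · refine Fin.lastCases ?_ (fun i => ?_) i
        · simpa using hw
        · simpa using hb i
      · rw [Fin.sum_univ_castSucc] at hc
        simp only [Fin.snoc_castSucc, Fin.snoc_last] at hc
        have h0 : c (Fin.last d) = 0 := by
          by_contra h0
          refine hwj ?_
          have h1 : (C (c (Fin.last d)) : O) • w ∈ M j ⊔ ϖ • N := by
            rw [← add_sub_cancel_left (∑ i : Fin d, (C (c i.castSucc) : O) • b i)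
              ((C (c (Fin.last d)) : O) • w)]
            exact sub_mem (mem_sup_right hc) (mem_sup_left
              (sum_mem fun i _ => (M j).smul_mem _ (hj i)))
          have h2 := smul_mem _ (C (c (Fin.last d))⁻¹ : O) h1
          rwa [← mul_smul, ← map_mul, inv_mul_cancel₀ h0, map_one, one_smul] at h2
        rw [h0, map_zero, zero_smul, add_zero] at hc
        have h3 := hbi (fun i => c i.castSucc) hc
        funext i
        refine Fin.lastCases h0 (fun i => ?_) i
        exact congrFun h3 i
  obtain ⟨b, hb, hbi⟩ := key (Module.finrank Kx V + 1)
  have hdep : ¬ LinearIndependent Kx b := fun h => by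
    have := h.fintype_card_le_finrank
    simp at this
  obtain ⟨f, hf, hne'⟩ := Fintype.not_linearIndependent_iff.1 hdep
  obtain ⟨a, g, ha, hg, i, hi⟩ := exists_primitive f hne'
  have h1 : ∑ i, g i • b i = 0 := by
    have h2 := congrArg (fun v => a • v) hf
    simp only [smul_sum, ← mul_smul, hg, smul_zero, ofPowerSeries_smul] at h2
    exact h2
  refine hi (congrFun (hbi (fun i => constantCoeff (g i)) ?_) i)
  have h3 : ∀ i, (C (constantCoeff (g i)) : O) • b i =
      g i • b i - (g i - C (constantCoeff (g i))) • b i := fun i => by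
    rw [sub_smul, sub_sub_cancel]
  rw [sum_congr rfl fun i _ => h3 i, sum_sub_distrib, h1, zero_sub]
  refine neg_mem (sum_mem fun i _ => ?_)
  obtain ⟨f', hf'⟩ := X_dvd_iff.2 (show constantCoeff (g i - C (constantCoeff (g i))) = 0 by
      simp)
  rw [hf']
  exact X_smul_mem (hb i) f'

/-- If `V` has no nonzero quotient with a stable lattice, then `V` is the union of the filtration
generated by a lattice, and `T` is surjective. -/
theorem surjective_of_no_bounded_quotient [Module.Finite Kx V] (h : ∀ N : Submodule DK V,
      (∀ v : V ⧸ N, IsBounded K (irregAct K (V ⧸ N)) v) → N = ⊤) :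
    Function.Surjective τ ∧ ∀ L : Submodule O V, IsLattice L →
        ∀ v, ∃ j, v ∈ filt (isDerivation_irregAct (K := K) (V := V)) L j := by
  have hT := isDerivation_irregAct (K := K) (V := V)
  have hall : ∀ L : Submodule O V, IsLattice L → ∀ v, ∃ j, v ∈ filt hT L j := by
    intro L hL
    let N : Submodule O V := ⨆ j, filt hT L j
    have hN : ∀ v, v ∈ N ↔ ∃ j, v ∈ filt hT L j := fun v =>
      Submodule.mem_iSup_of_directed _ (filt_mono hT L).directed_le
    have hNst : ∀ v ∈ N, τ v ∈ N := by
      intro v hv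
      obtain ⟨j, hj⟩ := (hN v).1 hv
      exact (hN _).2 ⟨j + 1, map_mem_filt hT hj⟩
    obtain ⟨j, hj⟩ := exists_generate_mod_X (filt_mono hT L) hN
    have hj' : ∀ m, ∀ v ∈ N, ∃ c ∈ filt hT L j, v - c ∈ ϖ ^ m • N := by
      intro m
      induction m with
      | zero => exact fun v hv => ⟨0, zero_mem _, by simpa using hv⟩
      | succ m ih =>
        intro v hv
        obtain ⟨c, hc, hvc⟩ := ih v hv
        obtain ⟨w, hw, hwv⟩ := mem_pow_smul.1 hvc
        obtain ⟨c', hc', y, hy, rfl⟩ := mem_sup.1 (hj hw)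
        refine ⟨c + ϖ ^ m • c', add_mem hc (smul_mem _ _ hc'), ?_⟩
        rw [← sub_sub, ← hwv, smul_add, add_sub_cancel_left]
        rw [← pow_one ϖ] at hy
        exact pow_smul_mem_add hy
    have hdiv : ∀ m v, v ∈ ϖ ^ (m + 1) • N → divX K V v ∈ ϖ ^ m • N := by
      intro m v hv
      obtain ⟨w, hw, rfl⟩ := mem_pow_smul.1 hv
      rw [pow_succ', mul_smul, divX_X_smul]
      exact mem_pow_smul.2 ⟨w, hw, rfl⟩
    -- the largest subspace contained in `N`
    let W : Submodule Kx V :=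
      { carrier := {v | ∀ m, v ∈ (ϖ ^ m • N : Submodule O V)}
        add_mem' := fun hv hw m => add_mem (hv m) (hw m)
        zero_mem' := fun m => zero_mem _
        smul_mem' :=
          fun f _ => laurent_smul_mem_of_stable (S := {v | ∀ m, v ∈ (ϖ ^ m • N : Submodule O V)})
          (fun _ _ hv m => smul_mem _ _ (hv m))
          (fun v hv m => hdiv m v (hv (m + 1))) f }
    have hWst : ∀ v ∈ W, eulerAct K V v ∈ W := by
      intro v hv m
      have h1 : eulerAct K V v = divX K V (τ v) := (divX_X_smul _).symm
      rw [h1]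
      exact hdiv m _ (irregOp_mem_pow_smul isDerivation_eulerAct hNst _ v (hv (m + 1)))
    have hNW : ∀ v ∈ N, ∃ x ∈ filt hT L j, v - x ∈ W := by
      intro v hv
      choose c hc hvc using fun m => hj' m v hv
      obtain ⟨x, hx⟩ := exists_mem_cosets (filt_fg hT hL.fg j) (fun m => filt hT L j ⊓ ϖ ^ m • N)
        (fun _ _ hab => inf_le_inf_left _ (pow_smul_anti hab N)) (fun m => inf_le_left) c
        (fun m => ⟨sub_mem (hc _) (hc _), by
          change c (m + 1) - c m ∈ ϖ ^ m • N
          rw [← sub_sub_sub_cancel_left _ _ v]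
          exact sub_mem (hvc m) (pow_smul_anti (Nat.le_succ m) N (hvc (m + 1)))⟩)
      refine ⟨x, ?_, fun m => ?_⟩
      · have := add_mem (hx 0).1 (hc 0)
        rwa [sub_add_cancel] at this
      · have := sub_mem (hvc m) (hx m).2
        rwa [sub_sub_sub_cancel_right] at this
    have hWtop := h (stableSub W hWst) fun q => by
      let f : V →ₗ[O] V ⧸ stableSub W hWst := (stableSub W hWst).mkQ.restrictScalars O
      have hf : ∀ {v}, f v = 0 ↔ v ∈ W := mk_eq_zero (stableSub W hWst)
      have hLq : ∀ v ∈ L, IsBounded K (irregAct K (V ⧸ stableSub W hWst)) (f v) := by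
        intro v hv
        refine ⟨(filt hT L j).map f, (filt_fg hT hL.fg j).map f, ?_, mem_map_of_mem
          (filt_mono hT L (Nat.zero_le j) hv)⟩
        rintro _ ⟨w, hw, rfl⟩
        obtain ⟨x, hx, hwx⟩ := hNW _ (hNst w ((hN w).2 ⟨j, hw⟩))
        refine ⟨x, hx, ?_⟩
        rw [show irregAct K (V ⧸ stableSub W hWst) (f w) = f (τ w) from
          (map_irregAct _ w).symm, eq_comm, ← sub_eq_zero, ← map_sub]
        exact hf.2 hwx
      obtain ⟨v, rfl⟩ := (stableSub W hWst).mkQ_surjective q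
      obtain ⟨n, hn⟩ := hL.full v
      have h1 : ϖ ^ n • f v ∈ boundedVectors (K := K) (δ := eulerAct K (V ⧸ stableSub W hWst))
          isDerivation_eulerAct := by
        rw [← map_smul]
        exact hLq _ hn
      rw [X_pow_smul] at h1
      exact (Submodule.smul_mem_iff _ (pow_ne_zero n single_one_ne_zero)).1 h1
    intro v
    have h1 : v ∈ stableSub W hWst := hWtop ▸ Submodule.mem_top
    have h2 := h1 0
    rw [pow_zero, one_smul] at h2
    exact (hN v).1 h2
  refine ⟨?_, hall⟩
  obtain ⟨L, hL⟩ := exists_isLattice K V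
  -- `L` is contained in `X` times a step of the filtration
  obtain ⟨j, hj⟩ : ∃ j, L ≤ ϖ • filt hT L j := by
    obtain ⟨r, b, hb⟩ := fg_iff_fin.1 (hL.fg.map (divX K V))
    obtain ⟨j, hj⟩ := directed_exists_fin (filt_mono hT L) fun i => hall L hL (b i)
    refine ⟨j, fun v hv => (mem_smul_iff _ _ _).2 ⟨divX K V v, ?_, X_smul_divX v⟩⟩
    have h1 : span O (range b) ≤ filt hT L j := span_le.2 (by rintro _ ⟨i, rfl⟩; exact hj i)
    exact h1 (hb ▸ mem_map_of_mem hv)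
  have hstep : ∀ i, ∀ v ∈ filt hT L i, ∃ a ∈ L, ∃ b ∈ filt hT L i, v = a + τ b := by
    intro i
    induction i with
    | zero => exact fun v hv => ⟨v, hv, 0, zero_mem _, by simp⟩
    | succ i ih =>
      intro v hv
      rw [filt_succ] at hv
      obtain ⟨x, hx, y, hy, rfl⟩ := mem_stepUp.1 hv
      obtain ⟨a, ha, b, hb, rfl⟩ := ih x hx
      exact ⟨a, ha, b + y, filt_mono hT L (Nat.le_succ i) (add_mem hb hy), by
        rw [map_add, add_assoc]⟩
  intro v
  obtain ⟨i, hi⟩ := hall L hL v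
  have hji := le_max_left j i
  obtain ⟨w, -, hw⟩ := le_image_of_approx (filt_fg hT hL.fg (max j i))
    (filt_fg hT hL.fg (max j i)) (filt_fg hT hL.fg (max j i + 1)) τ
    (fun m v hv => by
      obtain ⟨w, hw, rfl⟩ := mem_pow_smul.1 (pow_smul_anti (Nat.le_succ m) _ hv)
      rw [irregOp_X_pow_smul isDerivation_eulerAct]
      refine mem_pow_smul.2 ⟨_, add_mem (map_mem_filt hT hw) ?_, rfl⟩
      exact smul_mem _ _ (smul_mem _ _ (filt_mono hT L (Nat.le_succ _) hw)))
    (fun m v hv => by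
      obtain ⟨w, hw, rfl⟩ := mem_pow_smul.1 hv
      obtain ⟨a, ha, b, hb, rfl⟩ := hstep _ w hw
      refine ⟨ϖ ^ m • b, mem_pow_smul.2 ⟨b, hb, rfl⟩, ?_⟩
      rw [irregOp_X_pow_smul isDerivation_eulerAct, ← smul_sub, add_comm a, add_sub_add_left_eq_sub]
      have h1 : a - ϖ • ((m : O) • b) ∈ ϖ ^ 1 • filt hT L (max j i) := by
        rw [pow_one]
        refine sub_mem ?_ (X_smul_mem' (smul_mem _ _ hb))
        obtain ⟨c, hc, rfl⟩ := (mem_smul_iff _ _ _).1 (hj ha)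
        exact X_smul_mem' (filt_mono hT L hji hc)
      exact pow_smul_mem_add h1)
    v (filt_mono hT L (le_max_right j i) hi)
  exact ⟨w, hw⟩

/-- The slopes of `V` are greater than one if and only if `X² d/dX` is bijective with a
topologically nilpotent inverse. -/
theorem forall_one_lt_slope_iff [Module.Finite Kx V] :
    (∀ s, IsSlope K (ModuleCat.of DK V) s → 1 < s) ↔
      ∃ L : Submodule O V, IsLattice L ∧ IsExpanding τ L := by
  have hT := isDerivation_irregAct (K := K) (V := V)
  constructor
  · intro h
    have hno : ∀ N : Submodule DK V, boundedSub K (V ⧸ N) = ⊥ := by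
      intro N
      by_contra hne
      have hlt : N < (boundedSub K (V ⧸ N)).comap N.mkQ := by
        refine lt_of_le_of_ne (fun v hv => ?_) fun heq => hne ?_
        · rw [Submodule.mem_comap, Submodule.mkQ_apply, (mk_eq_zero N).2 hv]
          exact zero_mem _
        · rw [← Submodule.map_comap_eq_of_surjective N.mkQ_surjective (boundedSub K (V ⧸ N)), ← heq]
          exact Submodule.mkQ_map_self N
      obtain ⟨v, hvB, -, s, hs, hsv⟩ := exists_isSlope_of_lt hlt
      exact absurd ((hsv.of_isBounded isDerivation_eulerAct).1 hvB) (not_le.2 (h s hs))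
    obtain ⟨hsurj, hunion⟩ := surjective_of_no_bounded_quotient (K := K) (V := V) fun N hN => by
      refine eq_top_iff.2 fun v _ => ?_
      have h1 : N.mkQ v ∈ boundedSub K (V ⧸ N) := hN _
      rw [hno N, Submodule.mem_bot] at h1
      exact (mk_eq_zero N).1 h1
    have h0 : ∀ C : Submodule O V, C.FG → (∀ v ∈ C, τ v ∈ C) → C = ⊥ := by
      intro C hC hst
      refine (Submodule.eq_bot_iff _).2 fun v hv => ?_
      have h1 : (⊥ : Submodule DK V).mkQ v ∈ boundedSub K (V ⧸ ⊥) :=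
        IsBounded.map _ ⟨C, hC, hst, hv⟩
      rw [hno, Submodule.mem_bot] at h1
      exact (Submodule.mem_bot _).1 ((mk_eq_zero ⊥).1 h1)
    obtain ⟨L, hL⟩ := exists_isLattice K V
    obtain ⟨j, hj⟩ := exists_expanding hT hL.fg (hunion L hL) h0
    obtain ⟨h1, h2, h3⟩ := hj j le_rfl
    refine ⟨filt hT L j, hL.of_le (filt_fg hT hL.fg j) (filt_mono hT L (Nat.zero_le j)),
      ⟨(injective_iff_map_eq_zero _).2 fun v hv => ?_, hsurj⟩,
      filt_fg hT hL.fg j, h1, h2, h3⟩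
    have h4 := h0 (span O {v}) (fg_span (Set.finite_singleton v)) fun w hw => by
      obtain ⟨f, rfl⟩ := Submodule.mem_span_singleton.1 hw
      rw [hT, hv, smul_zero, zero_add]
      exact smul_mem _ _ (Submodule.mem_span_singleton_self v)
    exact (Submodule.mem_bot O).1 (h4 ▸ Submodule.mem_span_singleton_self v)
  · rintro ⟨L, -, hL⟩ s hs
    by_contra hs1
    obtain ⟨N₁, N₂, v, hv, hv', hle, hsv⟩ := exists_slopeAt_of_isSlope hs
    have hb := (hsv.isBounded isDerivation_eulerAct).1 (not_lt.1 hs1)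
    -- the submodules which have a nonzero quotient with a stable lattice
    let S : Set (Submodule DK V) := {N₂ | ∃ N₁ < N₂, ∀ v ∈ N₂,
      IsBounded K (irregAct K (V ⧸ N₁)) (N₁.mkQ v)}
    have hS : S.Nonempty := by
      refine ⟨(boundedSub K (V ⧸ N₁)).comap N₁.mkQ, N₁, lt_of_le_of_ne (fun w hw => ?_) fun heq =>
        hv' ?_, fun w hw => hw⟩
      · rw [Submodule.mem_comap, Submodule.mkQ_apply, (mk_eq_zero N₁).2 hw]
        exact zero_mem _
      · rw [heq]
        exact hb
    have hart := isArtinian_of_finite (K := K) (V := V)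
    obtain ⟨B, ⟨N, hNB, hbd⟩, hmin⟩ := WellFounded.has_min
      (wellFounded_lt (α := Submodule DK V)) S hS
    obtain ⟨hsurj, -⟩ := surjective_of_no_bounded_quotient (K := K) (V := N) fun N' hN' => by
      by_contra hne
      refine hmin N ⟨N'.map N.subtype, lt_of_le_of_ne (Submodule.map_subtype_le N N') fun heq =>
        hne ?_, ?_⟩ hNB
      · refine eq_top_iff.2 fun w _ => ?_
        have h1 : (w : V) ∈ N'.map N.subtype := by rw [heq]; exact w.2
        obtain ⟨w', hw', hww'⟩ := h1
        rwa [Subtype.ext hww'] at hw'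
      · intro w hw
        exact IsBounded.map (Submodule.mapQ N' (N'.map N.subtype) N.subtype
          (Submodule.map_le_iff_le_comap.1 le_rfl)) (hN' (N'.mkQ ⟨w, hw⟩))
    have hpull : ∀ n w, τ^[n] w ∈ N → w ∈ N := by
      intro n
      induction n with
      | zero => exact fun w hw => hw
      | succ n ih =>
        intro w hw
        obtain ⟨u, hu⟩ := hsurj ⟨_, ih _ hw⟩
        have h1 : τ u = τ w := by
          have h2 := map_irregAct N.subtype u
          rw [hu] at h2
          exact h2.symm
        rw [← hL.bij.injective h1]
        exact u.2
    obtain ⟨q, hq, hqN⟩ := SetLike.exists_of_lt hNB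
    obtain ⟨P', hP', hst, hqP⟩ := hbd q hq
    let f : V →ₗ[O] V ⧸ N := N.mkQ.restrictScalars O
    have hf : ∀ {v}, f v = 0 ↔ v ∈ N := mk_eq_zero N
    obtain ⟨P, hP, rfl⟩ := exists_fg_lift f N.mkQ_surjective hP'
    have hiter : ∀ n, ∃ w ∈ P, τ^[n] q - w ∈ N := by
      intro n
      have h1 : f (τ^[n] q) ∈ P.map f := by
        rw [show f (τ^[n] q) = (irregAct K (V ⧸ N))^[n] (f q) from map_irregAct_iterate N.mkQ n q]
        exact iterate_mem hst n _ hqP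
      obtain ⟨w, hw, hw'⟩ := h1
      exact ⟨w, hw, hf.1 (by rw [map_sub, hw', sub_self])⟩
    refine hqN (show q ∈ N.restrictScalars O from mem_of_forall_mem_sup hL.fg fun m => ?_)
    obtain ⟨n, hn⟩ := hL.exists_contract hT hP m
    obtain ⟨w, hw, hwN⟩ := hiter n
    obtain ⟨w', rfl⟩ := (hL.iterate_bijective n).surjective w
    refine ⟨q - w', hpull n _ ?_, ?_⟩
    · rwa [iterate_map_sub]
    · rw [sub_sub_cancel]
      exact hn w' hw

end GreaterThanOne

/-! ### Topologies defined by lattices -/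

section Instances

open scoped Topology

instance instModuleObj {R : Type u} [CommRing R] (d : Der R) (M : ModuleCat.{u} (DiffOp d)) :
    Module R M := Module.compHom M (of d)

instance {R : Type u} [CommRing R] (d : Der R) (M : ModuleCat.{u} (DiffOp d)) :
    IsScalarTower R (DiffOp d) M := ⟨fun r P v => mul_smul (of d r) P v⟩

variable {K : Type u} [Field K]

instance (M : PMod) : Module O M := Module.compHom M (algebraMap O Kx)

instance (M : PMod) : IsScalarTower O Kx M := IsScalarTower.of_algebraMap_smul fun _ _ => rfl

instance (M : PMod) : IsScalarTower O DK M :=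
  ⟨fun r P v => mul_smul (of dK (algebraMap O Kx r)) P v⟩

theorem lowerStar_smul (M : PMod) (f : O) (v : M) :
    (f • (show (lowerStar K).obj M from v) : (lowerStar K).obj M) = (f • v : M) := by
  change (diskToPunctured K (of dO f)) • v = _
  rw [diskToPunctured, DiffOp.map, lift_of]
  rfl

variable (k : Type u) [CommRing k] [Algebra k K]

theorem isAdicOpen_of_submodule {M : ModuleCat.{u} DO} {L : Submodule O M}
    (hL : IsLattice L) (n : ℕ) : IsAdicOpen K k M
      { carrier := {v | (show M from v) ∈ ϖ ^ n • L}
        add_mem' := fun {_ _} ha hb =>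
          Submodule.add_mem (ϖ ^ n • L) ha hb
        zero_mem' := Submodule.zero_mem (ϖ ^ n • L)
        smul_mem' := fun c _ h => smul_mem (ϖ ^ n • L) (algebraMap k O c) h } := by
  intro N hN
  obtain ⟨m, hm⟩ := hL.exists_pow_smul_le (N := (show Submodule O M from N)) hN
  refine ⟨n + m, fun v hv => ?_⟩
  have h1 : ϖ ^ n • (ϖ ^ m • (show M from v)) =
      ϖ ^ (n + m) • (show M from v) := by rw [pow_add, mul_smul]
  exact (mem_pow_smul (V := M)).2 ⟨_, hm v hv, h1⟩

theorem isOpen_adicTopology_iff {M : ModuleCat.{u} DO} {L : Submodule O M}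
    (hL : IsLattice L) (S : Set M) : IsOpen[adicTopology K k M] S ↔
      ∀ s ∈ S, ∃ n, ∀ w ∈ ϖ ^ n • L, s + w ∈ S := by
  constructor
  · intro h s hs
    obtain ⟨U, hU, hUS⟩ := h s hs
    obtain ⟨n, hn⟩ := hU L hL.fg
    refine ⟨n, fun w hw => ?_⟩
    obtain ⟨v, hv, rfl⟩ := mem_pow_smul.1 hw
    exact hUS _ (hn v hv)
  · intro h s hs
    obtain ⟨n, hn⟩ := h s hs
    exact ⟨_, isAdicOpen_of_submodule k hL n, hn⟩

theorem continuous_adicTopology_iff {K' : Type u} [Field K'] [Algebra k K']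
    {M : ModuleCat.{u} DO} {M' : ModuleCat.{u} (DiskOp K')} {L : Submodule O M}
    {L' : Submodule K'⟦X⟧ M'} (hL : IsLattice L) (hL' : IsLattice L') (f : M →+ M') :
    @Continuous _ _ (adicTopology K k M) (adicTopology K' k M') f ↔
      ∀ m, ∃ n, ∀ v ∈ ϖ ^ n • L, f v ∈ (X ^ m : K'⟦X⟧) • L' := by
  constructor
  · intro h m
    have h1 : IsOpen[adicTopology K' k M'] ((X ^ m : K'⟦X⟧) • L' : Submodule K'⟦X⟧ M') :=
      (isOpen_adicTopology_iff k hL' _).2 fun s hs => ⟨m, fun w hw => add_mem hs hw⟩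
    obtain ⟨n, hn⟩ := (isOpen_adicTopology_iff k hL _).1
      (@Continuous.isOpen_preimage _ _ (adicTopology K k M) (adicTopology K' k M') f h _ h1) 0
      (by
        change f 0 ∈ (X ^ m : K'⟦X⟧) • L'
        rw [map_zero]
        exact zero_mem _)
    refine ⟨n, fun v hv => ?_⟩
    have := hn v hv
    rw [Set.mem_preimage, zero_add] at this
    exact this
  · intro h
    refine (@continuous_def _ _ (adicTopology K k M) (adicTopology K' k M') f).2 fun S hS => ?_
    refine (isOpen_adicTopology_iff k hL _).2 fun s hs => ?_
    obtain ⟨m, hm⟩ := (isOpen_adicTopology_iff k hL' _).1 hS _ hs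
    obtain ⟨n, hn⟩ := h m
    refine ⟨n, fun w hw => ?_⟩
    rw [Set.mem_preimage, map_add]
    exact hm _ (hn w hw)

/-- A bijection which identifies the filtrations by multiples of two lattices, up to cofinality, is
a homeomorphism. -/
theorem isHomeomorph_adicTopology {K' : Type u} [Field K'] [Algebra k K']
    {M : ModuleCat.{u} DO} {M' : ModuleCat.{u} (DiskOp K')} {L : Submodule O M}
    {L' : Submodule K'⟦X⟧ M'} (hL : IsLattice L) (hL' : IsLattice L') (f : M ≃+ M')
    (h₁ : ∀ m, ∃ n, ∀ v ∈ ϖ ^ n • L, f v ∈ (X ^ m : K'⟦X⟧) • L')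
    (h₂ : ∀ m, ∃ n, ∀ v, f v ∈ (X ^ n : K'⟦X⟧) • L' → v ∈ ϖ ^ m • L) :
    @IsHomeomorph _ _ (adicTopology K k M) (adicTopology K' k M') f := by
  let := adicTopology K k M
  let := adicTopology K' k M'
  have h3 : Continuous f := (continuous_adicTopology_iff k hL hL' f.toAddMonoidHom).2 h₁
  have h4 : Continuous f.symm := (continuous_adicTopology_iff k hL' hL f.symm.toAddMonoidHom).2
    fun m => by
      obtain ⟨n, hn⟩ := h₂ m
      refine ⟨n, fun v hv => hn _ ?_⟩
      have : f (f.symm v) = v := f.apply_symm_apply v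
      change f (f.symm v) ∈ _
      rwa [this]
  exact (Homeomorph.mk f.toEquiv h3 h4).isHomeomorph

end Instances

/-! ### Modules over rings of differential operators from operators -/

section OperatorModules

theorem exists_moduleCat_of_derivation {R : Type u} [CommRing R] (d : Der R) (V : Type u)
    [AddCommGroup V] (ψ : R →+* AddMonoid.End V) (D : AddMonoid.End V)
    (h : ∀ r v, D (ψ r v) = ψ r (D v) + ψ (d r) v) :
    ∃ (N : ModuleCat.{u} (DiffOp d)) (e : V ≃+ N), (∀ (r : R) v, r • e v = e (ψ r v)) ∧
      ∀ v, del d • e v = e (D v) := by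
  let f := DiffOp.lift d ψ D fun r => by ext v; exact h r v
  let : Module (DiffOp d) V := Module.compHom V f
  refine ⟨ModuleCat.of (DiffOp d) V, AddEquiv.refl V, fun r v => ?_, fun v => ?_⟩
  · change f (of d r) v = _
    rw [lift_of]
    rfl
  · change f (del d) v = _
    rw [lift_del]
    rfl

variable {K₀ K : Type u} [Field K₀] [Field K] {V : Type u} [AddCommGroup V] [Module K₀⟦X⟧ V]
  [Module K V] {d : Der K₀⟦X⟧} {T : V →+ V} {L : Submodule K₀⟦X⟧ V}

theorem map_mem_pow_smul (hT : IsDerivation d T) {M M' : Submodule K₀⟦X⟧ V} (hM : M ≤ M')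
    (h : ∀ v ∈ M, T v ∈ M') (m : ℕ) : ∀ v ∈ (X ^ (m + 1) : K₀⟦X⟧) • M,
      T v ∈ (X ^ m : K₀⟦X⟧) • M' := by
  have h1 : ∃ g : K₀⟦X⟧, d (X ^ (m + 1)) = X ^ m * g := by
    induction m with
    | zero => exact ⟨_, by rw [pow_zero, one_mul]⟩
    | succ m ih =>
      obtain ⟨g, hg⟩ := ih
      refine ⟨g + d X, ?_⟩
      rw [pow_succ _ (m + 1), d.leibniz, hg]
      ring
  obtain ⟨g, hg⟩ := h1
  intro v hv
  obtain ⟨w, hw, rfl⟩ := mem_pow_smul.1 hv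
  rw [hT, hg, mul_smul, pow_succ, mul_smul, ← smul_add]
  exact mem_pow_smul.2 ⟨_, add_mem (M'.smul_mem _ (h w hw)) (M'.smul_mem _ (hM hw)), rfl⟩

theorem exists_iterate_mem (hT : IsDerivation d T) (hL : IsLattice L) (n : ℕ) :
    ∃ m, ∀ v ∈ (X ^ m : K₀⟦X⟧) • L, T^[n] v ∈ L := by
  have h1 : ∀ n m, ∀ v ∈ (X ^ (m + n) : K₀⟦X⟧) • L, T^[n] v ∈ (X ^ m : K₀⟦X⟧) • filt hT L n := by
    intro n
    induction n with
    | zero => exact fun m v hv => hv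
    | succ n ih =>
      intro m v hv
      rw [iter_succ]
      rw [show m + (n + 1) = (m + 1) + n by lia] at hv
      exact map_mem_pow_smul hT (filt_mono hT L (Nat.le_succ n)) 
        (fun w hw => map_mem_filt hT hw) m _
        (ih (m + 1) v hv)
  obtain ⟨m, hm⟩ := hL.exists_pow_smul_le (filt_fg hT hL.fg n)
  refine ⟨m + n, fun v hv => ?_⟩
  obtain ⟨w, hw, hwv⟩ := mem_pow_smul.1 (h1 n m v hv)
  rw [← hwv]
  exact hm w hw

/-- The sets `T⁻ⁿ L`. -/
def pullFilt (T : V →+ V) (L : Submodule K₀⟦X⟧ V) (hTc : ∀ (c : K) v, T (c • v) = c • T v)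
    (hLc : ∀ (c : K), ∀ v ∈ L, c • v ∈ L) (n : ℕ) : Submodule K V where
  carrier := {v | T^[n] v ∈ L}
  add_mem' := fun hv hw => by
    change T^[n] (_ + _) ∈ L
    rw [iterate_map_add]
    exact add_mem hv hw
  zero_mem' := by
    change T^[n] 0 ∈ L
    rw [iterate_map_zero]
    exact zero_mem _
  smul_mem' := fun c v hv => by
    have : ∀ n, T^[n] (c • v) = c • T^[n] v := by
      intro n
      induction n with
      | zero => rfl
      | succ n ih => rw [iter_succ, iter_succ, ih, hTc]
    change T^[n] (c • v) ∈ L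
    rw [this]
    exact hLc c _ hv

theorem IsExpanding.topNilpotent (hE : IsExpanding T L) (hT : IsDerivation d T) (hL : IsLattice L)
    (hTc : ∀ (c : K) v, T (c • v) = c • T v) (hLc : ∀ (c : K), ∀ v ∈ L, c • v ∈ L)
    (S : Module.End K V) (hS : ∀ v, T (S v) = v) :
    TopNilpotent (pullFilt T L hTc hLc) S where
  anti m n hmn v hv := hE.mem_of_le hmn hv
  sep v hv := eq_zero_of_forall_mem_pow hL.fg fun m => by
    obtain ⟨n, hn⟩ := hE.contract m
    exact hn v (hv n)
  compl w hw := by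
    choose n hn using hE.contract
    have hstep : ∀ a b, a ≤ b → w b - w a ∈ pullFilt T L hTc hLc a := by
      intro a b hab
      induction b, hab using Nat.le_induction with
      | base => simp
      | succ b hab ih =>
        rw [← sub_add_sub_cancel _ (w b)]
        exact add_mem (show T^[a] _ ∈ L from hE.mem_of_le hab (hw b)) ih
    let N : ℕ → ℕ := fun m => ∑ i ∈ Finset.range (m + 1), n i + m
    have hN : Monotone N := monotone_nat_of_le_succ fun m => by
      simp only [N, Finset.sum_range_succ _ (m + 1)]
      lia
    have hNn : ∀ m, n m ≤ N m := fun m =>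
      (single_le_sum (f := n) (fun _ _ => Nat.zero_le _)
        (Finset.mem_range.2 (Nat.lt_succ_self m))).trans (Nat.le_add_right _ _)
    obtain ⟨s, hs⟩ := exists_limit_of_cauchy hL.fg (fun m => w (N m)) fun m =>
      hn m _ (hE.mem_of_le (hNn m) (hstep _ _ (hN (Nat.le_succ m))))
    refine ⟨s, fun j => ?_⟩
    obtain ⟨m, hm⟩ := exists_iterate_mem hT hL j
    rw [← sub_add_sub_cancel _ (w (N (max m j)))]
    refine add_mem (hm _ (pow_smul_anti (le_max_left m j) L (hs _))) (hstep _ _ ?_)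
    exact (le_max_right m j).trans (Nat.le_add_left _ _)
  stab n v hv := by
    change T^[n] (S v) ∈ L
    refine hE.pull _ ?_
    rwa [← iter_succ T, iterate_succ_apply, hS]
  nilp v m := by
    obtain ⟨n, hn⟩ := hE.absorb v
    have h1 : ∀ n w, T^[n] ((S ^ n) w) = w := by
      intro n
      induction n with
      | zero => simp
      | succ n ih =>
        intro w
        rw [pow_succ, mul_apply, iter_succ, ih, hS]
    refine ⟨m + n, ?_⟩
    change T^[m] ((S ^ (m + n)) v) ∈ L
    rw [pow_add, mul_apply, h1]
    exact hn _ (h1 n v)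

end OperatorModules

/-! ### Modules defined by expanding operators -/

section ExpandingModules

/-- If `V` is complete for `F`, the operator `S` is uniformly topologically nilpotent on `F 0`, and
`F 0` is generated by the vectors `b i` modulo `S (F 0)`, then `F 0` is generated by the `b i` over
power series in `S`. -/
theorem TopNilpotent.exists_combination {K : Type u} [Field K] {V : Type v} [AddCommGroup V]
    [Module K V] {F : ℕ → Submodule K V} {S : Module.End K V} (h : TopNilpotent F S)
    (hSF : ∀ n, ∃ m, ∀ v ∈ F 0, (S ^ m) v ∈ F n) {r : ℕ} {b : Fin r → V}
    (hb : ∀ i, b i ∈ F 0)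
    (hgen : ∀ v ∈ F 0, ∃ c : Fin r → K, ∃ w ∈ F 0, v = ∑ i, c i • b i + S w) :
    ∀ v ∈ F 0, ∃ f : Fin r → O, v = ∑ i, h.act (f i) (b i) := by
  choose! c w hw hc using hgen
  intro v hv
  let vs : ℕ → V := fun n => w^[n] v
  have hvs : ∀ n, vs n ∈ F 0 := by
    intro n
    induction n with
    | zero => exact hv
    | succ n ih =>
      simp only [vs, iter_succ]
      exact hw _ ih
  have hvs' : ∀ n, vs n = ∑ i, c (vs n) i • b i + S (vs (n + 1)) := fun n => by
    simp only [vs, iter_succ]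
    exact hc _ (hvs n)
  let f : Fin r → O := fun i => PowerSeries.mk fun n => c (vs n) i
  refine ⟨f, ?_⟩
  rw [← sub_eq_zero]
  refine h.sep _ fun n' => ?_
  obtain ⟨n, hn⟩ := hSF n'
  have h1 : v = ∑ i, aeval S (trunc n (f i)) (b i) + (S ^ n) (vs n) := by
    clear hn
    induction n with
    | zero => simp [vs]
    | succ n ih =>
      have h2 : ∀ i, aeval S (trunc (n + 1) (f i)) (b i) =
          aeval S (trunc n (f i)) (b i) + (S ^ n) (c (vs n) i • b i) := by
        intro i
        rw [PowerSeries.trunc_succ, map_add, LinearMap.add_apply,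
          ← Polynomial.C_mul_X_pow_eq_monomial]
        congr 1
        rw [map_mul, aeval_C, map_pow, aeval_X, PowerSeries.coeff_mk, map_smul]
        rfl
      rw [sum_congr rfl fun i _ => h2 i, Finset.sum_add_distrib, add_assoc, ← map_sum,
        pow_succ, mul_apply, ← map_add, ← hvs' n]
      exact ih
  nth_rewrite 1 [h1]
  rw [add_sub_right_comm, ← sum_sub_distrib]
  refine add_mem (Submodule.sum_mem _ fun i _ => ?_) (hn _ (hvs n))
  rw [← neg_mem_iff, neg_sub]
  exact h.sum_sub_mem (f i) (hn _ (hb i))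

/-- The differential module over `K((X))` defined by operators `X⁻¹` and `X² d/dX`, when the
operator `X⁻¹` is expanding. -/
theorem IsExpanding.exists_module {K₀ K : Type u} [Field K₀] [Field K] {V : Type u}
    [AddCommGroup V] [Module K₀⟦X⟧ V] [Module K V] {d : Der K₀⟦X⟧} {T D : V →+ V}
    {L : Submodule K₀⟦X⟧ V} (hE : IsExpanding T L) (hT : IsDerivation d T) (hL : IsLattice L)
    (hTc : ∀ (c : K) v, T (c • v) = c • T v) (hLc : ∀ (c : K), ∀ v ∈ L, c • v ∈ L)
    (hfin : ∀ m, ∃ (r : ℕ) (b : Fin r → V), (∀ i, b i ∈ L) ∧ ∀ v ∈ L, ∃ c : Fin r → K,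
      v - ∑ i, c i • b i ∈ (X ^ m : K₀⟦X⟧) • L)
    (hDc : ∀ (c : K) v, D (c • v) = c • D v) (hD : ∀ v, T (D v) = D (T v) + v)
    (hDL : ∀ m, ∃ n, ∀ v ∈ (X ^ n : K₀⟦X⟧) • L, D v ∈ (X ^ m : K₀⟦X⟧) • L) :
    ∃ (N : PMod) (e : V ≃+ N), (∀ (c : K) v, (HahnSeries.C c : Kx) • e v = e (c • v)) ∧
      (∀ v, (single 1 1 : Kx) • e (T v) = e v) ∧
      (∀ v, irregAct K N (e v) = e (D v)) ∧
      ∃ L' : Submodule O N, IsLattice L' ∧ ∀ v, e v ∈ L' ↔ v ∈ L := by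
  let Tl : V ≃ₗ[K] V := LinearEquiv.ofBijective
    { toFun := T, map_add' := map_add T, map_smul' := hTc } hE.bij
  let S : Module.End K V := Tl.symm.toLinearMap
  have hTl : ∀ v, Tl v = T v := fun v => rfl
  have hTS : ∀ v, T (S v) = v := fun v => Tl.apply_symm_apply v
  have hST : ∀ v, S (T v) = v := fun v => Tl.symm_apply_apply v
  let F := pullFilt T L hTc hLc
  have hF : ∀ n v, v ∈ F n ↔ T^[n] v ∈ L := fun n v => Iff.rfl
  have h : TopNilpotent F S := hE.topNilpotent hT hL hTc hLc S hTS
  have hTSn : ∀ n v, T^[n] ((S ^ n) v) = v := by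
    intro n
    induction n with
    | zero => simp
    | succ n ih =>
      intro w
      rw [pow_succ, mul_apply, iter_succ, ih, hTS]
  obtain ⟨ψ, hψ⟩ := exists_laurent_extension h.act (by
    rw [h.act_X]
    exact ⟨⟨S, Tl.toLinearMap, LinearMap.ext hST, LinearMap.ext hTS⟩, rfl⟩)
  have hψX : ψ (single 1 1) = S := by
    rw [← ofPowerSeries_X, hψ, h.act_X]
  have hψC : ∀ (c : K) v, ψ (HahnSeries.C c) v = c • v := fun c v => by
    rw [← ofPowerSeries_C, hψ, h.act_C]
  let Dl : Module.End K V := { toFun := D, map_add' := map_add D, map_smul' := hDc }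
  have hDS : ∀ v, Dl (S v) = S (Dl v) + aeval S (PX ^ 2 : Polynomial K) v := by
    intro v
    change D (S v) = S (D v) + _
    have h1 := hD (S v)
    rw [hTS] at h1
    rw [map_pow, aeval_X, pow_two, mul_apply, ← map_add, ← h1, hST]
  have hDF : ∀ m, ∃ m', ∀ v ∈ F m', Dl v ∈ F m := by
    intro m
    obtain ⟨a, ha⟩ := exists_iterate_mem hT hL m
    obtain ⟨b, hb⟩ := hDL a
    obtain ⟨n, hn⟩ := hE.contract b
    exact ⟨n, fun v hv => ha _ (hb _ (hn v hv))⟩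
  let δ : Der Kx := mulDer (single 2 1) dK
  have hder₀ : ∀ (f : O) v, D (ψ (ofPowerSeries ℤ K f) v) =
      ψ (ofPowerSeries ℤ K f) (D v) + ψ (δ (ofPowerSeries ℤ K f)) v := by
    intro f v
    have h1 := h.act_derivation hDS hDF f v
    rw [hψ]
    refine h1.trans ?_
    congr 1
    rw [← hψ]
    congr 2
    rw [mulDer_apply, mulDer_apply, map_mul, Polynomial.coe_pow, Polynomial.coe_X, map_pow,
      ofPowerSeries_X, HahnSeries.single_pow, one_pow]
    congr 1
    exact (laurent_derivative_ofPowerSeries K f).symm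
  have hder : ∀ (f : Kx) v, D (ψ f v) = ψ f (D v) + ψ (δ f) v := by
    intro f v
    obtain ⟨n, g, hg⟩ := exists_pow_mul_eq_ofPowerSeries f
    let s : Kx := ofPowerSeries ℤ K (X ^ n)
    have hs : s * f = ofPowerSeries ℤ K g := by
      rw [← hg]
      simp only [s, map_pow, ofPowerSeries_X]
    have hsne : s ≠ 0 := by
      simp only [s, map_pow, ofPowerSeries_X]
      exact pow_ne_zero n single_one_ne_zero
    have h1 := hder₀ g v
    rw [← hs] at h1
    have h2 := hder₀ (X ^ n) (ψ f v)
    have h3 : ψ s (D (ψ f v)) = ψ s (ψ f (D v) + ψ (δ f) v) := by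
      rw [δ.leibniz, map_mul, map_add, map_mul, map_mul] at h1
      simp only [mul_apply, LinearMap.add_apply] at h1
      change D (ψ s (ψ f v)) = ψ s (D (ψ f v)) + ψ (δ s) (ψ f v) at h2
      rw [h2, show ψ f (ψ (δ s) v) = ψ (δ s) (ψ f v) by
        rw [← mul_apply, ← mul_apply, ← map_mul, ← map_mul, mul_comm],
        ← add_assoc, add_left_inj] at h1
      rw [h1, map_add]
    have h4 := congrArg (ψ s⁻¹) h3
    rwa [← mul_apply, ← mul_apply, ← map_mul, inv_mul_cancel₀ hsne, map_one,
      Module.End.one_apply, Module.End.one_apply] at h4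
  obtain ⟨N, e, he, hed⟩ := exists_moduleCat_of_derivation dK V
    ((Module.toAddMonoidEnd (Module.End K V) V).comp ψ)
    ((DistribSMul.toAddMonoidHom V (ψ (single (-2) 1))).comp D) (by
      intro f v
      change ψ _ (D (ψ f v)) = ψ f (ψ _ (D v)) + ψ (dK f) v
      rw [hder, map_add]
      simp only [← mul_apply, ← map_mul]
      congr 3
      · rw [mul_comm]
      · simp only [δ]
        rw [mulDer_apply, ← mul_assoc, single_mul_single]
        simp)
  have he' : ∀ (f : Kx) v, f • e v = e (ψ f v) := he
  have hed' : ∀ v, del dK • e v = e (ψ (single (-2) 1) (D v)) := hed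
  have heA : ∀ (f : O) v, f • e v = e (h.act f v) := fun f v => by
    rw [← ofPowerSeries_smul, he', hψ]
  refine ⟨N, e, fun c v => by rw [he', hψC], fun v => by rw [he', hψX, hST], fun v => ?_, ?_⟩
  · rw [irregAct_eq, hed', he', ← mul_apply, ← map_mul, single_mul_single]
    simp
  let L' : Submodule O N :=
    { carrier := {n | e.symm n ∈ L}
      add_mem' := fun {a b} ha hb => by
        change e.symm (a + b) ∈ L
        rw [map_add]
        exact add_mem ha hb
      zero_mem' := by
        change e.symm 0 ∈ L
        rw [map_zero]
        exact zero_mem _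
      smul_mem' := fun f n hn => by
        obtain ⟨v, rfl⟩ := e.surjective n
        change e.symm (f • e v) ∈ L
        rw [heA, e.symm_apply_apply]
        have hn' : v ∈ L := by
          have : e.symm (e v) ∈ L := hn
          rwa [e.symm_apply_apply] at this
        exact h.sum_mem (m := 0) f hn' }
  have hL' : ∀ v, e v ∈ L' ↔ v ∈ L := fun v => by
    change e.symm (e v) ∈ L ↔ _
    rw [e.symm_apply_apply]
  refine ⟨L', ⟨?_, ?_⟩, hL'⟩
  · obtain ⟨m, hm⟩ := exists_iterate_mem hT hL 1
    obtain ⟨r, b, hb, hgen⟩ := hfin m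
    have hcomb := h.exists_combination (b := b) (fun n => ⟨n, fun v hv => by
      rw [hF, hTSn]
      exact hv⟩) hb (fun v hv => by
        obtain ⟨c, hc⟩ := hgen v hv
        refine ⟨c, T (v - ∑ i, c i • b i), hm _ hc, ?_⟩
        rw [hST, add_sub_cancel])
    refine fg_iff_fin.2 ⟨r, fun i => e (b i), le_antisymm (span_le.2 ?_) fun n hn => ?_⟩
    · rintro _ ⟨i, rfl⟩
      exact (hL' _).2 (hb i)
    · obtain ⟨v, rfl⟩ := e.surjective n
      obtain ⟨f, hf⟩ := hcomb v ((hL' v).1 hn)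
      rw [hf, map_sum]
      refine sum_mem fun i _ => ?_
      rw [← heA]
      exact smul_mem _ _ (subset_span ⟨i, rfl⟩)
  · intro n
    obtain ⟨v, rfl⟩ := e.surjective n
    obtain ⟨m, hm⟩ := hE.absorb v
    refine ⟨m, ?_⟩
    rw [heA, hL', map_pow, h.act_X]
    exact hm _ (hTSn m v)

end ExpandingModules

/-! ### Weyl-linear maps -/

section WeylMaps

variable {k : Type u} [Field k]

/-- The Weyl algebra is generated by the constants, `z` and `d/dz`. -/
theorem weyl_map_smul {A B : ModuleCat.{u} (Weyl k)} (f : A →+ B)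
    (hC : ∀ (c : k) v, f (of (polyD k) (PC c) • v) = of (polyD k) (PC c) • f v)
    (hX : ∀ v, f (of (polyD k) PX • v) = of (polyD k) PX • f v)
    (hD : ∀ v, f (del (polyD k) • v) = del (polyD k) • f v) (P : Weyl k) (v : A) :
    f (P • v) = P • f v := by
  refine smul_induction _ f (fun p v => ?_) hD P v
  induction p using Polynomial.induction_on generalizing v with
  | C c => exact hC c v
  | add p q hp hq => rw [map_add, add_smul, map_add, add_smul, hp, hq]
  | monomial n a ih =>
    rw [pow_succ, ← mul_assoc, map_mul _ (PC a * PX ^ n), mul_smul, mul_smul, ih, hX]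

theorem exists_weyl_iso {A B : ModuleCat.{u} (Weyl k)} (e : A ≃+ B)
    (hC : ∀ (c : k) v, e (of (polyD k) (PC c) • v) = of (polyD k) (PC c) • e v)
    (hX : ∀ v, e (of (polyD k) PX • v) = of (polyD k) PX • e v)
    (hD : ∀ v, e (del (polyD k) • v) = del (polyD k) • e v) :
    ∃ i : A ≅ B, (i.hom.hom : A → B) = e :=
  ⟨LinearEquiv.toModuleIso { e with map_smul' := weyl_map_smul e.toAddMonoidHom hC hX hD }, rfl⟩

theorem weylToInfinity_C (c : k) : weylToInfinity k (of (polyD k) (PC c)) =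
    of (laurentD k) (HahnSeries.C c) := by
  rw [weylToInfinity, DiffOp.map, lift_of]
  simp

theorem weylToInfinity_X : weylToInfinity k (of (polyD k) PX) =
    of (laurentD k) (single (-1) 1) := by
  rw [weylToInfinity, DiffOp.map, lift_of]
  simp

theorem weylToInfinity_del : weylToInfinity k (del (polyD k)) =
    of (laurentD k) (-single 2 1) * del (laurentD k) := by
  rw [weylToInfinity, DiffOp.map, lift_del]

theorem fourierHom_C (c : k) : fourierHom k (of (polyD k) (PC c)) =
    of (polyD k) (PC c) := by
  rw [fourierHom, lift_of]
  simp

theorem fourierHom_X : fourierHom k (of (polyD k) PX) = -del (polyD k) := by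
  rw [fourierHom, lift_of]
  simp

theorem fourierHom_del : fourierHom k (del (polyD k)) =
    of (polyD k) PX := by
  rw [fourierHom, lift_del]

theorem weylToInfinity_del_smul {M : ModuleCat.{u} (PuncturedOp k)} (v : M) :
    weylToInfinity k (del (polyD k)) • v = -irregAct k M v := by
  rw [weylToInfinity_del, map_neg, neg_mul, neg_smul, irregAct_eq, mul_smul, of_smul_eq]

end WeylMaps

/-! ### Topological modules at infinity -/

section Infinity

theorem IsLattice.map_equiv {K : Type u} [Field K] {V V' : Type v} [AddCommGroup V]
    [AddCommGroup V'] [Module O V] [Module O V'] {L : Submodule O V} (hL : IsLattice L)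
    (e : V ≃ₗ[O] V') : IsLattice (L.map e.toLinearMap) :=
  ⟨hL.fg.map _, fun v => by
    obtain ⟨n, hn⟩ := hL.full (e.symm v)
    refine ⟨n, _, hn, ?_⟩
    simp⟩

theorem mem_pow_smul_map_equiv {K : Type u} [Field K] {V V' : Type v} [AddCommGroup V]
    [AddCommGroup V'] [Module O V] [Module O V'] {L : Submodule O V}
    (e : V ≃ₗ[O] V') {n : ℕ} {v : V} :
    e v ∈ ϖ ^ n • L.map e.toLinearMap ↔
      v ∈ ϖ ^ n • L := by
  rw [mem_pow_smul, mem_pow_smul]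
  constructor
  · rintro ⟨_, ⟨w, hw, rfl⟩, h⟩
    refine ⟨w, hw, e.injective ?_⟩
    rw [map_smul]
    exact h
  · rintro ⟨w, hw, rfl⟩
    exact ⟨_, ⟨w, hw, rfl⟩, (map_smul e _ _).symm⟩

variable {K : Type u} [Field K]

/-- The identification of `M` with `jo_* M`. -/
def starEquiv (M : PMod) : M ≃ₗ[O] (lowerStar K).obj M where
  toFun v := v
  invFun v := v
  left_inv _ := rfl
  right_inv _ := rfl
  map_add' _ _ := rfl
  map_smul' f v := (lowerStar_smul M f v).symm

theorem exists_map_pow_smul {V V' : Type*} [AddCommGroup V] [AddCommGroup V'] [Module O V]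
    [Module O V'] (f : V →ₗ[O] V') {L : Submodule O V} {L' : Submodule O V'}
    (hL : IsLattice L) (hL' : IsLattice L') (m : ℕ) :
    ∃ n, ∀ v ∈ ϖ ^ n • L, f v ∈ ϖ ^ m • L' := by
  obtain ⟨n, hn⟩ := hL'.exists_pow_smul_le (hL.fg.map f)
  refine ⟨m + n, fun v hv => ?_⟩
  obtain ⟨w, hw, rfl⟩ := mem_pow_smul.1 hv
  rw [pow_add, mul_smul, map_smul]
  refine mem_pow_smul.2 ⟨_, ?_, rfl⟩
  rw [map_smul]
  exact hn _ (mem_map_of_mem hw)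

/-- A continuous map which commutes with constants and with `X` is linear over power series. -/
theorem map_smul_of_approx {V V' : Type*} [AddCommGroup V] [AddCommGroup V'] [Module O V]
    [Module O V'] (f : V →+ V') {L : Submodule O V} {L' : Submodule O V'}
    (hL : IsLattice L) (hL' : IsLattice L')
    (hf : ∀ m, ∃ n, ∀ v ∈ ϖ ^ n • L, f v ∈ ϖ ^ m • L')
    (g : O) (v : V) (hg : ∀ n, ∃ h, X ^ n ∣ g - h ∧ f (h • v) = h • f v) :
    f (g • v) = g • f v := by
  rw [← sub_eq_zero]
  refine eq_zero_of_forall_mem_pow hL'.fg fun m => ?_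
  obtain ⟨n, hn⟩ := hf m
  obtain ⟨a, ha⟩ := hL.full v
  obtain ⟨b, hb⟩ := hL'.full (f v)
  have key : ∀ N, n + a ≤ N → m + b ≤ N → f (g • v) - g • f v ∈ ϖ ^ m • L' := by
    intro N h1 h2
    obtain ⟨p, ⟨h, hh⟩, hp⟩ := hg N
    rw [sub_eq_iff_eq_add'.1 hh, add_smul, map_add, hp, add_smul, add_sub_add_left_eq_sub, mul_smul,
      mul_smul]
    refine sub_mem (hn _ ?_) ?_
    · obtain ⟨r, rfl⟩ := Nat.exists_eq_add_of_le h1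
      rw [pow_add, pow_add, mul_smul, mul_smul, smul_comm _ h v, smul_comm _ h]
      exact mem_pow_smul.2 ⟨_, by
        exact L.smul_mem _ (by rw [smul_comm]; exact L.smul_mem _ ha), rfl⟩
    · obtain ⟨r, rfl⟩ := Nat.exists_eq_add_of_le h2
      rw [pow_add, pow_add, mul_smul, mul_smul]
      exact mem_pow_smul.2 ⟨_, by
        rw [smul_comm _ h, smul_comm _ h]
        exact L'.smul_mem _ (by rw [smul_comm]; exact L'.smul_mem _ hb), rfl⟩
  exact key _ (le_max_left _ _) (le_max_right _ _)

theorem map_powerSeries_smul {V V' : Type*} [AddCommGroup V] [AddCommGroup V'] [Module O V]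
    [Module O V'] (f : V →+ V') {L : Submodule O V} {L' : Submodule O V'}
    (hL : IsLattice L) (hL' : IsLattice L')
    (hf : ∀ m, ∃ n, ∀ v ∈ ϖ ^ n • L, f v ∈ ϖ ^ m • L')
    (hC : ∀ (c : K) v, f ((C c : O) • v) = (C c : O) • f v)
    (hX : ∀ v, f (ϖ • v) = ϖ • f v) (g : O) (v : V) :
    f (g • v) = g • f v := by
  refine map_smul_of_approx f hL hL' hf g v fun n => ⟨(trunc n g : K[X]), ?_, ?_⟩
  · refine PowerSeries.X_pow_dvd_iff.2 fun m hm => ?_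
    rw [map_sub, Polynomial.coeff_coe, PowerSeries.coeff_trunc, if_pos hm, sub_self]
  · generalize (trunc n g : K[X]) = p
    induction p using Polynomial.induction_on generalizing v with
    | C c => rw [Polynomial.coe_C]; exact hC c v
    | add p q hp hq => rw [Polynomial.coe_add, add_smul, map_add, hp, hq, add_smul]
    | monomial n a ih =>
      rw [pow_succ, ← mul_assoc, Polynomial.coe_mul, Polynomial.coe_X, mul_smul, ih, hX, mul_smul]

/-- A continuous map which commutes with constants, with `X` and with `X² d/dX` is linear over
differential operators. -/
theorem exists_linearMap_of_approx {M M' : PMod} (f : M →+ M')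
    {L : Submodule O M} {L' : Submodule O M'} (hL : IsLattice L) (hL' : IsLattice L')
    (hf : ∀ m, ∃ n, ∀ v ∈ ϖ ^ n • L, f v ∈ ϖ ^ m • L')
    (hC : ∀ (c : K) v, f ((C c : O) • v) = (C c : O) • f v)
    (hX : ∀ v, f (ϖ • v) = ϖ • f v)
    (hD : ∀ v, f (irregAct K M v) = irregAct K M' (f v)) :
    ∃ φ : M →ₗ[DK] M', ∀ v, φ v = f v := by
  have hA := map_powerSeries_smul f hL hL' hf hC hX
  have hK : ∀ (a : Kx) (v : M), f (a • v) = a • f v := fun a v => by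
    obtain ⟨n, b, hb⟩ := exists_pow_mul_eq_ofPowerSeries a
    refine X_pow_smul_injective (K := K) n ?_
    dsimp only
    rw [← hA, X_pow_smul, X_pow_smul, ← mul_smul, ← mul_smul, hb, ofPowerSeries_smul,
      ofPowerSeries_smul, hA]
  have hdel : ∀ v : M, f (del dK • v) = del dK • f v := by
    intro v
    have h1 := hD v
    rw [irregAct_eq, irregAct_eq, hK] at h1
    exact smul_right_injective _ (HahnSeries.single_ne_zero one_ne_zero) h1
  exact ⟨{ f with
    map_smul' := smul_induction dK f
      (fun a v => by rw [of_smul_eq, of_smul_eq, hK]) hdel }, fun _ => rfl⟩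

theorem finite_of_hol {M : PMod} (h : Hol K M) : Module.Finite Kx M := h

/-- Continuous Weyl-linear maps at infinity are `D_K`-linear. -/
theorem contFF_extendInfinite (P : ObjectProperty PMod)
    (hP : ∀ M, P M → Hol K M) : ContFF (extendInfinite P) (fun M => topInfinite M) where
  faithful := by
    unfold extendInfinite
    infer_instance
  cont {M M'} f := by
    have := finite_of_hol (hP _ M.property)
    have := finite_of_hol (hP _ M'.property)
    obtain ⟨L, hL⟩ := exists_isLattice K M.obj
    obtain ⟨L', hL'⟩ := exists_isLattice K M'.obj
    refine (continuous_adicTopology_iff K (hL.map_equiv (starEquiv M.obj))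
      (hL'.map_equiv (starEquiv M'.obj)) (f.hom.hom.toAddMonoidHom)).2 fun m => ?_
    obtain ⟨n, hn⟩ := exists_map_pow_smul (f.hom.hom.restrictScalars O) hL hL' m
    exact ⟨n, fun v hv => (mem_pow_smul_map_equiv (starEquiv M'.obj)).2
      (hn v ((mem_pow_smul_map_equiv (starEquiv M.obj)).1 hv))⟩
  full {M M'} g hg := by
    have := finite_of_hol (hP _ M.property)
    have := finite_of_hol (hP _ M'.property)
    obtain ⟨L, hL⟩ := exists_isLattice K M.obj
    obtain ⟨L', hL'⟩ := exists_isLattice K M'.obj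
    let f : M.obj →+ M'.obj := g.hom.toAddMonoidHom
    have hcont : ∀ m, ∃ n, ∀ v ∈ ϖ ^ n • L,
        f v ∈ ϖ ^ m • L' := fun m => by
      obtain ⟨n, hn⟩ := (continuous_adicTopology_iff K (hL.map_equiv (starEquiv M.obj))
        (hL'.map_equiv (starEquiv M'.obj)) f).1 hg m
      exact ⟨n, fun v hv => (mem_pow_smul_map_equiv (starEquiv M'.obj)).1
        (hn v ((mem_pow_smul_map_equiv (starEquiv M.obj)).2 hv))⟩
    have hlin : ∀ (w : Weyl K) (v : M.obj), f (weylToInfinity K w • v) =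
        weylToInfinity K w • f v := fun w v => g.hom.map_smul w v
    have hC : ∀ (c : K) (v : M.obj), f ((C c : O) • v) = (C c : O) • f v := fun c v => by
      have := hlin (of (polyD K) (PC c)) v
      rw [weylToInfinity_C, of_smul_eq, of_smul_eq] at this
      rw [← ofPowerSeries_smul, ← ofPowerSeries_smul, ofPowerSeries_C]
      exact this
    have hXi : ∀ v : M.obj, f (divX K M.obj v) = divX K M'.obj (f v) := fun v => by
      have := hlin (of (polyD K) PX) v
      rw [weylToInfinity_X, of_smul_eq, of_smul_eq] at this
      exact this
    have hX : ∀ v : M.obj, f (ϖ • v) = ϖ • f v :=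
      fun v => by rw [← X_smul_divX (K := K) (f _), ← hXi, divX_X_smul]
    have hD : ∀ v : M.obj, f (irregAct K M.obj v) = irregAct K M'.obj (f v) := fun v => by
      have := hlin (del (polyD K)) v
      rw [weylToInfinity_del_smul, weylToInfinity_del_smul, map_neg, neg_inj] at this
      exact this
    obtain ⟨φ, hφ⟩ := exists_linearMap_of_approx f hL hL' hcont hC hX hD
    exact ⟨⟨ModuleCat.ofHom φ⟩, ModuleCat.hom_ext (LinearMap.ext hφ)⟩

end Infinity

/-! ### The transform from infinity to infinity -/

section InfinityInfinity

theorem iterate_smul_comm {R : Type*} [Semiring R] {V : Type*} [AddCommGroup V] [Module R V]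
    {T : V →+ V} {c : R} (hc : ∀ v, T (c • v) = c • T v) (m n : ℕ) (v : V) :
    T^[n] (c ^ m • v) = c ^ m • T^[n] v := by
  have h1 : ∀ m v, T (c ^ m • v) = c ^ m • T v := by
    intro m
    induction m with
    | zero => simp
    | succ m ih => intro v; rw [pow_succ', mul_smul, hc, ih, mul_smul]
  induction n with
  | zero => rfl
  | succ n ih => rw [iter_succ, iter_succ, ih, h1]

theorem iterate_smul {K : Type u} [Field K] {V : Type v} [AddCommGroup V] [Module O V]
    {T T' : V →+ V} {c : O} (hc : ∀ v, T (c • v) = c • T v) (hT' : ∀ v, T' v = c • T v) (n : ℕ)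
    (v : V) : T'^[n] v = c ^ n • T^[n] v := by
  induction n with
  | zero => simp
  | succ n ih =>
    rw [iter_succ, iter_succ, ih, hT',
      show T (c ^ n • T^[n] v) = _ from iterate_smul_comm hc n 1 _, ← mul_smul, ← pow_succ']
    rfl

theorem IsExpanding.unit_smul {K : Type u} [Field K] {V : Type v} [AddCommGroup V] [Module O V]
    {T T' : V →+ V} {L : Submodule O V} (h : IsExpanding T L) (c : Oˣ)
    (hc : ∀ v, T ((c : O) • v) = (c : O) • T v) (hT' : ∀ v, T' v = (c : O) • T v) :
    IsExpanding T' L := by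
  have h1 : ∀ (n : ℕ) (w : V), (c : O) ^ n • w ∈ L ↔ w ∈ L := fun n w => by
    have := Submodule.smul_mem_iff_of_isUnit L (x := w) ((c.isUnit).pow n)
    exact this
  have h2 : ∀ n v, T'^[n] v ∈ L ↔ T^[n] v ∈ L := fun n v => by rw [iterate_smul hc hT', h1]
  have h3 : Function.Bijective fun v : V => (c : O) • v :=
    ⟨fun v w h => by simpa [← mul_smul] using congrArg (fun x => ((c⁻¹ : Oˣ) : O) • x) h,
      fun v => ⟨((c⁻¹ : Oˣ) : O) • v, by simp [← mul_smul]⟩⟩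
  refine ⟨?_, h.fg, fun v hv => h.pull v ((h2 1 v).1 hv), fun m => ?_, fun v => ?_⟩
  · have : (T' : V → V) = (fun v : V => (c : O) • v) ∘ T := funext hT'
    rw [this]
    exact h3.comp h.bij
  · obtain ⟨n, hn⟩ := h.contract m
    exact ⟨n, fun v hv => hn v ((h2 n v).1 hv)⟩
  · obtain ⟨n, hn⟩ := h.absorb v
    refine ⟨n, fun w hw => ?_⟩
    rw [iterate_smul hc hT'] at hw
    rw [← h1 n]
    exact hn _ (by rw [← hw, iterate_smul_comm hc])

/-- In the module defined by the operators `X⁻¹ = T` and `D`, the multiples of the lattice are the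
inverse images under the powers of `T`. -/
theorem mem_pow_smul_of_transform {K₀ K : Type u} [Field K₀] [Field K] {V N : Type u}
    [AddCommGroup V] [Module K₀⟦X⟧ V] [AddCommGroup N] [Module O N] {T : V →+ V} (e : V ≃+ N)
    (he : ∀ v, ϖ • e (T v) = e v) {L : Submodule K₀⟦X⟧ V}
    {L' : Submodule O N} (hL : ∀ v, e v ∈ L' ↔ v ∈ L) (hT : Function.Bijective T) (m : ℕ) (v : V) :
    e v ∈ ϖ ^ m • L' ↔ T^[m] v ∈ L := by
  have h1 : ∀ m v, ϖ ^ m • e (T^[m] v) = e v := by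
    intro m
    induction m with
    | zero => simp
    | succ m ih =>
      intro v
      rw [iterate_succ_apply, pow_succ', mul_smul, ih, he]
  rw [mem_pow_smul]
  constructor
  · rintro ⟨w, hw, h⟩
    obtain ⟨u, rfl⟩ := e.surjective w
    obtain ⟨u', rfl⟩ := (hT.iterate m).surjective u
    rw [h1] at h
    rw [← e.injective h]
    exact (hL _).1 hw
  · intro h
    exact ⟨_, (hL _).2 h, h1 m v⟩

theorem divX_smul_comm {K : Type u} [Field K] {V : Type v} [AddCommGroup V] [Module Kx V]
    [Module O V] [IsScalarTower O Kx V] {δ : V →+ V} (hδ : IsEuler δ) (v : V) :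
    irregOp K δ (divX K V v) = divX K V (irregOp K δ v) - v := irregOp_divX hδ v

variable {K : Type u} [Field K]

theorem C_smul_eq {V : Type v} [AddCommGroup V] [Module Kx V]
    [Module O V] [IsScalarTower O Kx V] (c : K) (v : V) :
    (HahnSeries.C c : Kx) • v = (C c : O) • v := by
  rw [← ofPowerSeries_C, ofPowerSeries_smul]

theorem irregAct_C_smul {V : Type u} [AddCommGroup V] [Module DK V]
    [Module Kx V] [Module O V] [IsScalarTower Kx DK V]
    [IsScalarTower O Kx V] [IsScalarTower O DK V] (c : K) (v : V) :
    irregAct K V ((C c : O) • v) = (C c : O) • irregAct K V v := by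
  rw [isDerivation_irregAct (K := K) (V := V), irregD_C, zero_smul, add_zero]

/-- The module with `X⁻¹` acting as `ε X² d/dX` and `X² d/dX` acting as `-ε X⁻¹`. -/
theorem exists_transform_infinity_infinity (ε : K) (hε : ε * ε = 1)
    (M : (HolSlopeGT K).FullSubcategory) : ∃ (N : (HolSlopeGT K).FullSubcategory)
      (e : M.obj ≃+ N.obj),
      (∀ (c : K) v, (C c : O) • e v = e ((C c : O) • v)) ∧
      (∀ v, divX K N.obj (e v) = e ((C ε : O) • irregAct K M.obj v)) ∧
      (∀ v, irregAct K N.obj (e v) = e (-((C ε : O) • divX K M.obj v))) ∧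
      @IsHomeomorph _ _ (topInfinite M) (topInfinite N) e := by
  obtain ⟨M, hM⟩ := M
  have hfinM := finite_of_hol hM.1
  obtain ⟨L, hL, hE₀⟩ := (forall_one_lt_slope_iff (K := K) (V := M)).1 hM.2
  let εu : Oˣ := ⟨C ε, C ε, by rw [← map_mul, hε, map_one], by rw [← map_mul, hε, map_one]⟩
  let mulε : M →+ M := DistribSMul.toAddMonoidHom M (C ε : O)
  let T : M →+ M := mulε.comp (irregAct K M)
  let D : M →+ M := -(mulε.comp (divX K M).toAddMonoidHom)
  have hTv : ∀ v, T v = (C ε : O) • irregAct K M v := fun v => rfl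
  have hDv : ∀ v, D v = -((C ε : O) • divX K M v) := fun v => rfl
  have hder : IsDerivation (mulDer (C ε) (irregD K)) T := fun f v => by
    rw [hTv, isDerivation_irregAct (K := K) (V := M), smul_add, smul_comm, ← hTv,
      mulDer_apply, mul_smul]
  have hE : IsExpanding T L := hE₀.unit_smul εu (irregAct_C_smul ε) hTv
  let : Module K M := Module.compHom M (C : K →+* O)
  have hk : ∀ (c : K) (v : M), c • v = (C c : O) • v := fun _ _ => rfl
  have hεε : ∀ v : M, (C ε : O) • (C ε : O) • v = v := fun v => by
    rw [← mul_smul, ← map_mul, hε, map_one, one_smul]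
  obtain ⟨N, e, he₁, he₂, he₃, L', hL', heL⟩ := hE.exists_module (K := K) (D := D) hder hL
    (fun c v => by rw [hk, hk, hTv, hTv, irregAct_C_smul, smul_comm])
    (fun c v hv => L.smul_mem _ hv)
    (fun m => exists_finite_mod_pow hL.fg m)
    (fun c v => by rw [hk, hk, hDv, hDv, map_smul, smul_neg, smul_comm])
    (fun v => by
      rw [hTv, hDv, hDv, hTv, map_neg, irregAct_C_smul, smul_neg, hεε, map_smul, hεε,
        divX_smul_comm isDerivation_eulerAct, neg_sub, sub_eq_add_neg, add_comm])
    (fun m => ⟨m + 1, fun v hv => by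
      obtain ⟨w, hw, rfl⟩ := mem_pow_smul.1 hv
      rw [hDv, pow_succ', mul_smul, divX_X_smul]
      exact neg_mem (smul_mem _ _ (mem_pow_smul.2 ⟨w, hw, rfl⟩))⟩)
  have hfinN := hL'.finite
  have heX : ∀ v, ϖ • e (T v) = e v := fun v => by rw [X_smul]; exact he₂ v
  have hmem := mem_pow_smul_of_transform e heX heL hE.bij
  have hdiv : ∀ v, divX K N (e v) = e (T v) := fun v => by rw [← heX, divX_X_smul]
  have heC : ∀ (c : K) v, (C c : O) • e v = e ((C c : O) • v) :=
    fun c v => by rw [← C_smul_eq, he₁, hk]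
  have hiter : ∀ n v, (irregAct K N)^[n] (e v) = e (D^[n] v) := by
    intro n
    induction n with
    | zero => exact fun _ => rfl
    | succ n ih =>
      intro v
      rw [iter_succ, ih, he₃, iter_succ]
  have hXD : ∀ n v, ϖ ^ n • D^[n] v = (C ((-ε) ^ n) : O) • v := by
    intro n
    induction n with
    | zero => simp
    | succ n ih =>
      intro v
      rw [iterate_succ_apply, pow_succ, mul_smul]
      rw [smul_comm, ih, hDv, smul_neg, smul_neg, smul_comm _ (C ε : O), smul_comm,
        smul_comm _ (C ((-ε) ^ n) : O)]
      rw [X_smul_divX, ← mul_smul, ← map_mul, ← neg_smul, ← map_neg]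
      congr 2
      ring
  have hεn : ∀ n (v : M), (C ((-ε) ^ n) : O) • v ∈ L ↔ v ∈ L := fun n v =>
    Submodule.smul_mem_iff_of_isUnit L (((IsUnit.of_mul_eq_one ε hε).neg.pow n).map C)
  have hDmem : ∀ n v, D^[n] v ∈ L → v ∈ ϖ ^ n • L := by
    intro n v hv
    have h1 := hXD n v
    have h2 : (C ((-ε) ^ n) : O) • (C ((-ε) ^ n) : O) • v = v := by
      rw [← mul_smul, ← map_mul, ← mul_pow, neg_mul_neg, hε, one_pow, map_one, one_smul]
    rw [← h2, ← h1]
    exact smul_mem _ _ (mem_pow_smul.2 ⟨_, hv, rfl⟩)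
  have hDbij : Function.Bijective D := by
    refine ⟨(injective_iff_map_eq_zero D).2 fun v hv => ?_, fun v => ⟨-((C ε : O) • ϖ • v), ?_⟩⟩
    · have h1 := hXD 1 v
      rw [Function.iterate_one, hv, smul_zero, pow_one, map_neg, neg_smul, zero_eq_neg] at h1
      rw [← hεε v, h1, smul_zero]
    · rw [hDv, map_neg, map_smul, divX_X_smul, smul_neg, neg_neg, hεε]
  have hNbij : Function.Bijective (irregAct K N) := by
    have h1 : (irregAct K N : N → N) = e ∘ D ∘ e.symm := by
      funext n
      obtain ⟨v, rfl⟩ := e.surjective n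
      rw [he₃, Function.comp_apply, Function.comp_apply, e.symm_apply_apply]
    rw [h1]
    exact e.bijective.comp (hDbij.comp e.symm.bijective)
  have hcof : ∀ m, ∃ n, ∀ v ∈ ϖ ^ n • L,
      e v ∈ ϖ ^ m • L' := fun m => by
    obtain ⟨n, hn⟩ := exists_iterate_mem hder hL m
    exact ⟨n, fun v hv => (hmem m v).2 (hn v hv)⟩
  refine ⟨⟨N, hfinN, (forall_one_lt_slope_iff (K := K) (V := N)).2 ⟨L', hL', hNbij, hL'.fg,
    fun n hn => ?_, fun m => ?_, fun n => ?_⟩⟩, e, heC, fun v => hdiv v, fun v => he₃ v, ?_⟩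
  · obtain ⟨v, rfl⟩ := e.surjective n
    rw [he₃, heL] at hn
    exact (heL v).2 (pow_smul_le 1 L (hDmem 1 v hn))
  · obtain ⟨n, hn⟩ := hcof m
    refine ⟨n, fun w hw => ?_⟩
    obtain ⟨v, rfl⟩ := e.surjective w
    rw [hiter, heL] at hw
    exact hn v (hDmem n v hw)
  · obtain ⟨v, rfl⟩ := e.surjective n
    obtain ⟨n, hn⟩ := hL.full v
    refine ⟨n, fun w hw => ?_⟩
    obtain ⟨u, rfl⟩ := e.surjective w
    rw [hiter] at hw
    rw [← e.injective hw, hXD, hεn] at hn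
    exact (heL u).2 hn
  · refine isHomeomorph_adicTopology K (hL.map_equiv (starEquiv M)) (hL'.map_equiv (starEquiv N))
      e (fun m => ?_) fun m => ?_
    · obtain ⟨n, hn⟩ := hcof m
      exact ⟨n, fun v hv => (mem_pow_smul_map_equiv (starEquiv N)).2
        (hn v ((mem_pow_smul_map_equiv (starEquiv M)).1 hv))⟩
    · obtain ⟨n, hn⟩ := hE.contract m
      exact ⟨n, fun v hv => (mem_pow_smul_map_equiv (starEquiv M)).2
        (hn v ((hmem n v).1 ((mem_pow_smul_map_equiv (starEquiv N)).1 hv)))⟩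

/-- The Fourier transform is restriction of scalars along an automorphism of the Weyl algebra and
keeps the topologies. -/
theorem ContFF.fourier {C : Type*} [Category* C] {S : C ⥤ ModuleCat.{u} (Weyl K)}
    {tS : ∀ c, TopologicalSpace (S.obj c)} (h : ContFF S tS) :
    ContFF (S ⋙ LocalFourier.fourier K) (fun c => tS c) where
  faithful := by
    have := h.faithful
    unfold LocalFourier.fourier
    infer_instance
  cont f := h.cont f
  full {c c'} g hg := by
    have hs : ∀ (P : Weyl K) (v : S.obj c), g.hom (show S.obj c from fourierHom K P • v) =
        (fourierHom K P • (show S.obj c' from g.hom v) : S.obj c') := fun P v => g.hom.map_smul P v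
    let g' : S.obj c →+ S.obj c' := g.hom.toAddMonoidHom
    have hg' : ∀ (P : Weyl K) (v : S.obj c), g' (fourierHom K P • v) = fourierHom K P • g' v := hs
    refine Exists.imp (fun f hf => ?_) (h.full (ModuleCat.ofHom
      { g' with map_smul' := weyl_map_smul g' (fun c v => ?_) (fun v => ?_) fun v => ?_ }) hg)
    · ext v
      exact congrArg (fun f => f.hom v) hf
    · rw [← fourierHom_C, hg']
    · rw [← fourierHom_del, hg']
    · have := hg' (of (polyD K) PX) v
      rw [fourierHom_X, neg_smul, neg_smul, map_neg, neg_inj] at this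
      exact this

theorem isHomeomorph_symm {A B : Type*} (tA : TopologicalSpace A) (tB : TopologicalSpace B)
    (e : A ≃ B) (he : IsHomeomorph e) : IsHomeomorph e.symm :=
  (show (e.symm : B → A) = (he.homeomorph e).symm from funext fun y => by
    apply (he.homeomorph e).injective
    rw [Homeomorph.apply_symm_apply]
    exact e.apply_symm_apply y) ▸ (he.homeomorph e).symm.isHomeomorph

theorem exists_isHomeomorph_iso {A B : ModuleCat.{u} (Weyl K)} (tA : TopologicalSpace A)
    (tB : TopologicalSpace B) (e : A ≃+ B) (he : IsHomeomorph e)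
    (hC : ∀ (c : K) v, e (of (polyD K) (PC c) • v) = of (polyD K) (PC c) • e v)
    (hX : ∀ v, e (of (polyD K) PX • v) = of (polyD K) PX • e v)
    (hD : ∀ v, e (del (polyD K) • v) = del (polyD K) • e v) :
    ∃ i : A ≅ B, IsHomeomorph i.hom.hom := by
  obtain ⟨i, hi⟩ := exists_weyl_iso e hC hX hD
  exact ⟨i, by rw [hi]; exact he⟩

/-- The local transform from infinity to infinity; it is its own inverse up to the sign of `z`. -/
theorem exists_equivalence_infinity_infinity :
    ∃ (F : (HolSlopeGT K).FullSubcategory ≌ (HolSlopeGT K).FullSubcategory)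
        (θ : extendInfinite (HolSlopeGT K) ⋙ fourier K ≅ F.functor ⋙ extendInfinite (HolSlopeGT K)),
        IsBicontinuous (fun M => topInfinite M) (fun M => topInfinite (F.functor.obj M)) θ ∧
        ∀ (G : (HolSlopeGT K).FullSubcategory ⥤ (HolSlopeGT K).FullSubcategory)
          (η : extendInfinite (HolSlopeGT K) ⋙ fourier K ≅ G ⋙ extendInfinite (HolSlopeGT K)),
          IsBicontinuous (fun M => topInfinite M) (fun M => topInfinite (G.obj M)) η →
          ∃! α : F.functor ≅ G,
            θ ≪≫ Functor.isoWhiskerRight α (extendInfinite (HolSlopeGT K)) = η := by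
  have hA := contFF_extendInfinite (HolSlopeGT K) fun M h => h.1
  have hF := ContFF.fourier (S := extendInfinite (HolSlopeGT K)) (tS := fun M => topInfinite M) hA
  refine ContFF.exists_equivalence (T := extendInfinite (HolSlopeGT K))
    (S := extendInfinite (HolSlopeGT K) ⋙ fourier K)
    (tS := fun M => topInfinite M) (tT := fun M => topInfinite M) hF hA
    (fun M => ?_) (fun M => ?_)
  · obtain ⟨N, e, heC, heX, heD, he⟩ := exists_transform_infinity_infinity 1 (one_mul 1) M
    refine ⟨N, exists_isHomeomorph_iso (A := (extendInfinite (HolSlopeGT K) ⋙ fourier K).obj M)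
      (B := (extendInfinite (HolSlopeGT K)).obj N) (topInfinite M) (topInfinite N) e he
      (fun c (v : M.obj) => ?_) (fun (v : M.obj) => ?_) fun (v : M.obj) => ?_⟩
    · change e (weylToInfinity K (fourierHom K _) • v) = weylToInfinity K _ • e v
      rw [fourierHom_C, weylToInfinity_C, of_smul_eq, of_smul_eq, C_smul_eq, C_smul_eq, heC]
    · change e (weylToInfinity K (fourierHom K _) • v) = weylToInfinity K _ • e v
      rw [fourierHom_X, map_neg, neg_smul, weylToInfinity_del_smul, neg_neg, weylToInfinity_X,
        of_smul_eq]
      refine Eq.trans ?_ (heX v).symm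
      rw [map_one, one_smul]
    · change e (weylToInfinity K (fourierHom K _) • v) = weylToInfinity K _ • e v
      rw [fourierHom_del, weylToInfinity_del_smul, weylToInfinity_X, of_smul_eq, heD,
        map_neg, neg_neg, map_one (C : K →+* O), one_smul]
      rfl
  · obtain ⟨N, e, heC, heX, heD, he⟩ := exists_transform_infinity_infinity (-1) (by simp) M
    refine ⟨N, exists_isHomeomorph_iso (A := (extendInfinite (HolSlopeGT K) ⋙ fourier K).obj N)
      (B := (extendInfinite (HolSlopeGT K)).obj M) (topInfinite N) (topInfinite M) e.symm
      (isHomeomorph_symm (topInfinite M) (topInfinite N) e.toEquiv he) (fun c v => ?_)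
      (fun v => ?_) fun v => ?_⟩
    · obtain ⟨v, rfl⟩ := e.surjective v
      change e.symm (weylToInfinity K (fourierHom K _) • e v) = weylToInfinity K _ • e.symm (e v)
      rw [fourierHom_C, weylToInfinity_C, of_smul_eq, of_smul_eq, C_smul_eq,
        C_smul_eq, heC, e.symm_apply_apply, e.symm_apply_apply]
    · obtain ⟨v, rfl⟩ := e.surjective v
      change e.symm (weylToInfinity K (fourierHom K _) • e v) = weylToInfinity K _ • e.symm (e v)
      rw [fourierHom_X, map_neg, neg_smul, weylToInfinity_del_smul, neg_neg, weylToInfinity_X,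
        of_smul_eq, heD, e.symm_apply_apply, e.symm_apply_apply, map_neg, map_one, neg_smul,
        neg_neg, one_smul]
      rfl
    · obtain ⟨v, rfl⟩ := e.surjective v
      change e.symm (weylToInfinity K (fourierHom K _) • e v) = weylToInfinity K _ • e.symm (e v)
      rw [fourierHom_del, weylToInfinity_del_smul, weylToInfinity_X, of_smul_eq, e.symm_apply_apply]
      refine (congrArg e.symm (heX v)).trans ?_
      rw [e.symm_apply_apply, map_neg, map_one, neg_smul, one_smul]

end InfinityInfinity

/-! ### Cyclic vectors -/

section Cyclic

variable {K : Type u} [Field K]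

/-- The determinant is a polynomial in the coefficient of `B`, and it has infinitely many roots. -/
theorem det_add_smul_eq_zero [CharZero K] {n : ℕ} (A B : Matrix (Fin n) (Fin n) K) {s : K}
    (hs : s ≠ 0) (h : ∀ l : ℕ, (A + ((l : K) * s) • B).det = 0) : (A + B).det = 0 := by
  let M : Matrix (Fin n) (Fin n) (Polynomial K) := A.map PC + (PX : Polynomial K) • B.map PC
  have hM : ∀ x, M.det.eval x = (A + x • B).det := fun x => by
    rw [← Polynomial.coe_evalRingHom, RingHom.map_det]
    congr 1
    ext i j
    simp [M, mul_comm x]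
  have h0 : M.det = 0 := by
    refine Polynomial.eq_zero_of_infinite_isRoot _
      ((Set.infinite_range_of_injective (f := fun l : ℕ => (l : K) * s) fun a b hab => ?_).mono ?_)
    · exact Nat.cast_injective (mul_right_cancel₀ hs hab)
    · rintro _ ⟨l, rfl⟩
      exact (hM _).trans (h l)
  have := hM 1
  rwa [h0, Polynomial.eval_zero, one_smul, eq_comm] at this

variable {V : Type v} [AddCommGroup V] [Module K V] {δ : Der K} {θ : AddMonoid.End V}

theorem iterate_pow_smul (hθ : IsDerivation δ θ) {t : K} (ht : δ t = t) (m i : ℕ) (v : V) :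
    (θ ^ i) (t ^ m • v) = t ^ m • ((θ + (m : AddMonoid.End V)) ^ i) v := by
  have h1 : ∀ m : ℕ, δ (t ^ m) = m * t ^ m := by
    intro m
    induction m with
    | zero =>
      have := δ.leibniz 1 1
      simpa using this
    | succ m ih =>
      rw [pow_succ, δ.leibniz, ih, ht]
      push_cast
      ring
  induction i generalizing v with
  | zero => simp
  | succ i ih =>
    rw [pow_succ, pow_succ]
    refine (congrArg (θ ^ i) (hθ (t ^ m) v)).trans ?_
    rw [h1, mul_comm, mul_smul, ← smul_add, ih, Nat.cast_smul_eq_nsmul]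
    rfl

theorem add_natCast_pow_apply (m i : ℕ) (v : V) : ((θ + (m : AddMonoid.End V)) ^ i) v =
    ∑ j ∈ Finset.range (i + 1), ((m : K) ^ (i - j) * (i.choose j : K)) • (θ ^ j) v := by
  rw [(Nat.cast_commute m θ).symm.add_pow]
  refine (AddMonoidHom.finsetSum_apply _ _ v).trans (sum_congr rfl fun j _ => ?_)
  rw [← Nat.cast_pow, mul_assoc, ← Nat.cast_mul, ← Nat.cast_pow, ← Nat.cast_mul,
    Nat.cast_smul_eq_nsmul]
  exact map_nsmul (θ ^ j) _ v

/-- A sequence `e, θ e, …` of `r` independent vectors can be made longer: replace `e` by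
`e + c tᵐ f` for a suitable constant `c` and a suitable `m`. Otherwise the determinants of the
components of the first `r + 1` derivatives of these vectors, which are polynomials in `c` and in
`m`, would vanish, but their leading terms do not. -/
theorem exists_independent_succ [CharZero K] (hθ : IsDerivation δ θ) {t : K} (ht : δ t = t)
    (ht0 : t ≠ 0) {r : ℕ} {e f : V} (he : LinearIndependent K fun i : Fin r => (θ ^ (i : ℕ)) e)
    (hf : f ∉ span K (range fun i : Fin r => (θ ^ (i : ℕ)) e)) :
    ∃ e', LinearIndependent K fun i : Fin (r + 1) => (θ ^ (i : ℕ)) e' := by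
  by_contra! hno
  have hb : LinearIndependent K (Fin.snoc (fun i : Fin r => (θ ^ (i : ℕ)) e) f : Fin (r + 1) → V) :=
    linearIndependent_finSnoc.2 ⟨he, hf⟩
  obtain ⟨ψ, hψ⟩ := LinearMap.exists_leftInverse_of_injective
    (Fintype.linearCombination K (Fin.snoc (fun i : Fin r => (θ ^ (i : ℕ)) e) f : Fin (r + 1) → V))
    (LinearMap.ker_eq_bot.2 (linearIndependent_iff_injective_fintypeLinearCombination.1 hb))
  have hψb : ∀ i, ψ (Fin.snoc (α := fun _ => V) (fun i : Fin r => (θ ^ (i : ℕ)) e) f i) =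
      Pi.single i 1 := fun i => by
    have := LinearMap.congr_fun hψ (Pi.single i 1)
    simpa using this
  let P (g : V) : Matrix (Fin (r + 1)) (Fin (r + 1)) K := Matrix.of fun i => ψ ((θ ^ (i : ℕ)) g)
  have hP : ∀ g, (P g).det = 0 := fun g => by
    obtain ⟨c, hc, i, hi⟩ := Fintype.not_linearIndependent_iff.1 (hno g)
    refine Matrix.exists_vecMul_eq_zero_iff.1 ⟨c, fun h => hi (congrFun h i), ?_⟩
    have := congrArg ψ hc
    rw [map_sum, map_zero] at this
    rw [← this]
    ext j
    simp [Matrix.vecMul, dotProduct, P]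
  let B (m : ℕ) : Matrix (Fin (r + 1)) (Fin (r + 1)) K :=
    Matrix.of fun i => ψ (((θ + (m : AddMonoid.End V)) ^ (i : ℕ)) f)
  have h1 : ∀ (m : ℕ) (y : K), y ≠ 0 → (P e + y • B m).det = 0 := fun m y hy => by
    refine det_add_smul_eq_zero (P e) (y • B m) (s := t ^ m * y⁻¹)
      (mul_ne_zero (pow_ne_zero m ht0) (inv_ne_zero hy)) fun l => ?_
    rw [← hP (e + (l : K) • t ^ m • f), ← mul_smul, mul_assoc, mul_assoc, inv_mul_cancel₀ hy,
      mul_one]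
    congr 1
    ext i j
    simp only [P, B, Matrix.add_apply, Matrix.smul_apply, Matrix.of_apply, map_add, Pi.add_apply]
    rw [Nat.cast_smul_eq_nsmul, map_nsmul, iterate_pow_smul hθ ht, map_nsmul, map_smul,
      Pi.smul_apply, Pi.smul_apply, smul_eq_mul, smul_eq_mul, mul_assoc, nsmul_eq_mul]
  let F : Matrix (Fin (r + 1)) (Fin (r + 1)) (Polynomial K) := Matrix.of fun i j =>
    PC (ψ ((θ ^ (i : ℕ)) e) j) + ∑ l ∈ Finset.range ((i : ℕ) + 1),
      PX ^ (r - i + l) * PC (((i : ℕ).choose l : K) * ψ ((θ ^ l) f) j)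
  have hF : ∀ x, F.det.eval x = (F.map (Polynomial.eval x)).det := fun x => by
    rw [← Polynomial.coe_evalRingHom, RingHom.map_det]
    rfl
  have hF0 : F.det = 0 := by
    refine Polynomial.eq_zero_of_infinite_isRoot _
      ((Set.infinite_range_of_injective (f := fun m : ℕ => ((m + 1 : ℕ) : K)⁻¹)
        fun a b hab => ?_).mono ?_)
    · exact Nat.succ_injective (Nat.cast_injective (inv_injective hab))
    · rintro _ ⟨m, rfl⟩
      have hm : ((m + 1 : ℕ) : K) ≠ 0 := Nat.cast_ne_zero.2 m.succ_ne_zero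
      refine (hF _).trans ((congrArg Matrix.det ?_).trans
        (h1 (m + 1) ((((m + 1 : ℕ) : K)⁻¹) ^ r) (pow_ne_zero r (inv_ne_zero hm))))
      ext i j
      simp only [F, P, B, Matrix.add_apply, Matrix.smul_apply, Matrix.of_apply, Matrix.map_apply,
        Polynomial.eval_add, eval_C, Polynomial.eval_finsetSum, Polynomial.eval_mul,
        Polynomial.eval_pow, eval_X]
      rw [add_natCast_pow_apply (K := K), map_sum, Finset.sum_apply, smul_eq_mul, Finset.mul_sum]
      congr 1
      refine sum_congr rfl fun l hl => ?_
      rw [map_smul, Pi.smul_apply, smul_eq_mul, ← mul_assoc, ← mul_assoc, ← mul_assoc]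
      congr 2
      have hl' : l ≤ i := Nat.lt_succ_iff.1 (Finset.mem_range.1 hl)
      have hr : r = (r - i + l) + (i - l) := by lia
      have hx : (((m + 1 : ℕ) : K)⁻¹) ^ r = _ := congrArg _ hr
      rw [hx, pow_add _ (r - (i : ℕ) + l) (i - l), mul_assoc, ← mul_pow, inv_mul_cancel₀ hm,
        one_pow, mul_one]
  have h2 := hF 0
  rw [hF0, Polynomial.eval_zero, eq_comm] at h2
  have hlast : ψ ((θ ^ r) e) (Fin.last r) = 0 := by
    have hmem : (θ ^ r) e ∈ span K (range fun i : Fin r => (θ ^ (i : ℕ)) e) := by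
      by_contra hmem
      refine hno e ?_
      have := linearIndependent_finSnoc.2 ⟨he, hmem⟩
      convert this using 1
      ext i
      refine Fin.lastCases ?_ (fun i => ?_) i <;> simp
    obtain ⟨c, hc⟩ := (mem_span_range _).1 hmem
    rw [← hc, map_sum, Finset.sum_apply]
    refine sum_eq_zero fun i _ => ?_
    have := hψb i.castSucc
    rw [Fin.snoc_castSucc] at this
    rw [map_smul, this]
    simp [Fin.last, Fin.ext_iff, (Fin.is_lt i).ne']
  have hrow : ∀ (i : Fin (r + 1)) j, (F.map (Polynomial.eval 0)) i j =
      ψ ((θ ^ (i : ℕ)) e) j + if (i : ℕ) = r then ψ f j else 0 := fun i j => by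
    simp only [F, Matrix.of_apply, Matrix.map_apply, Polynomial.eval_add, eval_C,
      Polynomial.eval_finsetSum, Polynomial.eval_mul, Polynomial.eval_pow, eval_X]
    congr 1
    rw [Finset.sum_range_succ', sum_eq_zero fun l _ => by
      rw [zero_pow (by lia), zero_mul], zero_add]
    split_ifs with hi
    · simp [hi]
    · rw [zero_pow (by lia), zero_mul]
  refine one_ne_zero (α := K) (Eq.trans ?_ h2)
  rw [Matrix.det_of_isLowerTriangular, eq_comm]
  · refine Finset.prod_eq_one fun i _ => ?_
    rw [hrow]
    refine Fin.lastCases ?_ (fun i => ?_) i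
    · have := hψb (Fin.last r)
      rw [Fin.snoc_last] at this
      simp [hlast, this, -AddMonoid.End.coe_pow]
    · have := hψb i.castSucc
      rw [Fin.snoc_castSucc] at this
      simp [-AddMonoid.End.coe_pow, this, (Fin.is_lt i).ne]
  · intro i j hij
    have hij' : i < j := hij
    rw [hrow]
    have h3 : i ≠ Fin.last r := fun h => by
      rw [h] at hij'
      exact absurd hij' (Fin.le_last j).not_gt
    obtain ⟨i, rfl⟩ := Fin.exists_castSucc_eq.2 h3
    have := hψb i.castSucc
    rw [Fin.snoc_castSucc] at this
    simp [-AddMonoid.End.coe_pow, this, (Fin.is_lt i).ne, hij'.ne']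

/-- The cyclic vector theorem. -/
theorem exists_cyclic_vector [CharZero K] [Module.Finite K V] (hθ : IsDerivation δ θ) {t : K}
    (ht : δ t = t) (ht0 : t ≠ 0) : ∃ e : V,
      LinearIndependent K (fun i : Fin (Module.finrank K V) => (θ ^ (i : ℕ)) e) ∧
      span K (range fun i : Fin (Module.finrank K V) => (θ ^ (i : ℕ)) e) = ⊤ := by
  have h : ∀ r ≤ Module.finrank K V, ∃ e : V,
      LinearIndependent K (fun i : Fin r => (θ ^ (i : ℕ)) e) := by
    intro r
    induction r with
    | zero => exact fun _ => ⟨0, linearIndependent_empty_type⟩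
    | succ r ih =>
      intro hr
      obtain ⟨e, he⟩ := ih (Nat.le_of_succ_le hr)
      have hne : span K (range fun i : Fin r => (θ ^ (i : ℕ)) e) ≠ ⊤ := fun h => by
        have := finrank_span_eq_card he
        rw [h, finrank_top, Fintype.card_fin] at this
        lia
      obtain ⟨f, -, hf⟩ := SetLike.exists_of_lt (lt_top_iff_ne_top.2 hne)
      exact exists_independent_succ hθ ht ht0 he hf
  obtain ⟨e, he⟩ := h _ le_rfl
  exact ⟨e, he, he.span_eq_top_of_card_eq_finrank' (Fintype.card_fin _)⟩

end Cyclic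

/-! ### Normal forms of differential operators -/

section NormalForm

variable {R : Type u} [CommRing R] {d : Der R}

theorem DiffOp.exists_eval₂ (P : DiffOp d) : ∃ p : R[X], P = p.eval₂ (of d) (del d) := by
  have h := DiffOp.smul_mem_of_stable (V := DiffOp d)
    (Polynomial.eval₂AddMonoidHom (of d) (del d)).range ?_ ?_ P (v := 1)
    ⟨1, by simp⟩
  · rw [smul_eq_mul, mul_one] at h
    exact h.imp fun _ h => h.symm
  · rintro r _ ⟨p, rfl⟩
    induction p using Polynomial.induction_on' with
    | add p q hp hq =>
      rw [map_add, smul_add]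
      exact add_mem hp hq
    | monomial n a =>
      refine ⟨Polynomial.monomial n (r * a), ?_⟩
      simp [Polynomial.eval₂AddMonoidHom, Polynomial.eval₂_monomial, mul_assoc]
  · rintro _ ⟨p, rfl⟩
    induction p using Polynomial.induction_on' with
    | add p q hp hq =>
      rw [map_add, smul_add]
      exact add_mem hp hq
    | monomial n a =>
      refine ⟨Polynomial.monomial (n + 1) a + Polynomial.monomial n (d a), ?_⟩
      simp [Polynomial.eval₂AddMonoidHom, Polynomial.eval₂_monomial, ← mul_assoc,
        del_mul_of, eval₂_add, add_mul, pow_succ']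

/-- Multiplication by `∂` on the left, in terms of the coefficients of normal forms. -/
def shiftDer (d : Der R) : AddMonoid.End (ℕ → R) where
  toFun f n := (if n = 0 then 0 else f (n - 1)) + d (f n)
  map_zero' := by
    funext n
    change (if n = 0 then (0 : R) else 0) + d 0 = 0
    rw [map_zero, ite_self, add_zero]
  map_add' f g := by
    funext n
    change (if n = 0 then (0 : R) else f (n - 1) + g (n - 1)) + d (f n + g n) =
      (_ + d (f n)) + (_ + d (g n))
    rw [map_add]
    split_ifs <;> abel

variable (d) in
/-- The left module `R⟨∂⟩`, described by the coefficients of normal forms. -/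
abbrev normalFormModule : Module (DiffOp d) (ℕ → R) :=
  moduleOfDerivation d (ℕ → R) (shiftDer d) fun r f => by
    funext n
    change (if n = 0 then (0 : R) else r * f (n - 1)) + d (r * f n) =
      r * ((if n = 0 then (0 : R) else f (n - 1)) + d (f n)) + d r * f n
    rw [d.leibniz]
    split_ifs <;> ring

attribute [local instance] normalFormModule

theorem del_pow_smul_normalForm {m : ℕ} {f : ℕ → R} (hf : ∀ n, m < n → f n = 0) (i : ℕ) :
    (∀ n, i + m < n → (del d ^ i • f) n = 0) ∧ (del d ^ i • f) (i + m) = f m := by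
  have hdel : ∀ f : ℕ → R, del d • f = shiftDer d f := fun f => by
    change (DiffOp.lift d _ _ _ (del d) : AddMonoid.End _) f = _
    rw [lift_del]
  induction i with
  | zero => simpa using hf
  | succ i ih =>
    rw [pow_succ', mul_smul, hdel]
    refine ⟨fun n hn => ?_, ?_⟩
    · change (if n = 0 then (0 : R) else _) + d _ = 0
      rw [if_neg (by lia), ih.1 _ (by lia), ih.1 _ (by lia), map_zero, add_zero]
    · change (if i + 1 + m = 0 then (0 : R) else _) + d _ = _
      rw [if_neg (by lia), ih.1 (i + 1 + m) (by lia), map_zero, add_zero, ← ih.2]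
      lia

theorem eval₂_smul_normalForm (p : R[X]) {m : ℕ} {f : ℕ → R} (hf : ∀ n, m < n → f n = 0) :
    (∀ n, p.natDegree + m < n → (p.eval₂ (of d) (del d) • f) n = 0) ∧
      (p.eval₂ (of d) (del d) • f) (p.natDegree + m) = p.leadingCoeff * f m := by
  have hof : ∀ (r : R) (f : ℕ → R), of d r • f = r • f := fun r f => by
    change (DiffOp.lift d _ _ _ (of d r) : AddMonoid.End _) f = _
    rw [lift_of]
    rfl
  rw [Polynomial.eval₂_eq_sum_range, sum_smul]
  simp only [mul_smul, hof, Finset.sum_apply, Pi.smul_apply]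
  refine ⟨fun n hn => sum_eq_zero fun i hi => ?_, ?_⟩
  · rw [(del_pow_smul_normalForm hf i).1 n (by have := Finset.mem_range.1 hi; lia), smul_zero]
  · rw [Finset.sum_range_succ, sum_eq_zero fun i hi => ?_, zero_add,
      (del_pow_smul_normalForm hf _).2, smul_eq_mul]
    · rfl
    · rw [(del_pow_smul_normalForm hf i).1 _ (by have := Finset.mem_range.1 hi; lia), smul_zero]

/-- Normal forms are unique. -/
theorem DiffOp.eq_zero_of_eval₂_eq_zero {p : R[X]} (h : p.eval₂ (of d) (del d) = 0) : p = 0 := by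
  have h1 := (eval₂_smul_normalForm (d := d) p (f := Pi.single 0 1)
    fun n hn => Pi.single_eq_of_ne hn.ne' _).2
  rw [h, zero_smul, Pi.single_eq_same, mul_one] at h1
  exact Polynomial.leadingCoeff_eq_zero.1 h1.symm

/-- The ring of differential operators over a domain has no zero divisors: leading coefficients
are multiplicative. -/
instance [IsDomain R] : NoZeroDivisors (DiffOp d) where
  eq_zero_or_eq_zero_of_mul_eq_zero := by
    intro P Q h
    obtain ⟨p, rfl⟩ := DiffOp.exists_eval₂ P
    obtain ⟨q, rfl⟩ := DiffOp.exists_eval₂ Q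
    by_contra! hne
    have hp : p ≠ 0 := fun h => hne.1 (by rw [h, Polynomial.eval₂_zero])
    have hq : q ≠ 0 := fun h => hne.2 (by rw [h, Polynomial.eval₂_zero])
    have h1 := eval₂_smul_normalForm (d := d) q (f := Pi.single 0 1)
      fun n hn => Pi.single_eq_of_ne hn.ne' _
    have h2 := (eval₂_smul_normalForm (d := d) p h1.1).2
    rw [← mul_smul, h, zero_smul, h1.2, Pi.single_eq_same, mul_one] at h2
    exact mul_ne_zero (Polynomial.leadingCoeff_ne_zero.2 hp) (Polynomial.leadingCoeff_ne_zero.2 hq)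
      h2.symm

/-- Every operator is congruent modulo `R⟨∂⟩ ∂` to a function. -/
theorem DiffOp.exists_eq_mul_del_add (P : DiffOp d) :
    ∃ (Q : DiffOp d) (r : R), P = Q * del d + of d r := by
  obtain ⟨p, rfl⟩ := DiffOp.exists_eval₂ P
  refine ⟨p.divX.eval₂ (of d) (del d), p.coeff 0, ?_⟩
  conv_lhs => rw [← p.divX_mul_X_add]
  rw [eval₂_add, Polynomial.eval₂_mul_X, Polynomial.eval₂_C]

theorem DiffOp.adjoint_of (r : R) : (adjoint d (of d r)).unop = of d r := by
  rw [adjoint, lift_of]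
  rfl

theorem DiffOp.adjoint_del : (adjoint d (del d)).unop = -del d := by
  rw [adjoint, lift_del]
  rfl

theorem DiffOp.adjoint_mul (P Q : DiffOp d) : (adjoint d (P * Q)).unop =
    (adjoint d Q).unop * (adjoint d P).unop := by
  rw [map_mul, MulOpposite.unop_mul]

theorem DiffOp.adjoint_adjoint (P : DiffOp d) : (adjoint d (adjoint d P).unop).unop = P := by
  obtain ⟨p, rfl⟩ := DiffOp.exists_eval₂ P
  induction p using Polynomial.induction_on' with
  | add p q hp hq =>
    rw [eval₂_add, map_add, MulOpposite.unop_add, map_add, MulOpposite.unop_add, hp, hq]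
  | monomial n a =>
    have h : ∀ n, (adjoint d (adjoint d (del d ^ n)).unop).unop =
        del d ^ n := fun n => by
      rw [map_pow, MulOpposite.unop_pow, DiffOp.adjoint_del, map_pow, MulOpposite.unop_pow,
        map_neg, MulOpposite.unop_neg, DiffOp.adjoint_del, neg_neg]
    rw [Polynomial.eval₂_monomial, DiffOp.adjoint_mul, DiffOp.adjoint_mul, h, DiffOp.adjoint_of,
      DiffOp.adjoint_of]

end NormalForm

open DiffOp (adjoint_of adjoint_del adjoint_mul adjoint_adjoint)

/-! ### Indicial polynomials and modules supported at the origin -/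

section Symbols

variable {K : Type u} [Field K]

variable (K) in
/-- The operator `X d/dX` in `D_A`. -/
def diskEuler : DO := of dO X * del dO

theorem powerD_C (c : K) : dO (C c) = 0 := PowerSeries.derivative_C

theorem powerD_X : dO X = 1 := by
  change PowerSeries.derivative K _ = 1
  simp

theorem diskEuler_mul_of (f : O) : diskEuler K * of dO f = of dO f * diskEuler K +
      of dO (X * dO f) := by
  rw [diskEuler, mul_assoc, del_mul_of, mul_add, ← mul_assoc, ← mul_assoc, ← map_mul,
    ← map_mul, ← map_mul, mul_comm f]

theorem del_mul_X_pow (m : ℕ) : del dO * of dO (X ^ (m + 1)) =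
    of dO (X ^ m) * (diskEuler K + of dO (C ((m : K) + 1))) := by
  have h : dO (X ^ (m + 1)) = X ^ m * C ((m : K) + 1) := by
    change PowerSeries.derivative K _ = _
    rw [Derivation.leibniz_pow]
    simp [mul_comm]
  rw [del_mul_of, h, diskEuler, mul_add, ← map_mul, ← mul_assoc, ← map_mul, pow_succ]

theorem adjoint_diskEuler : (adjoint _ (diskEuler K)).unop = -1 - diskEuler K := by
  rw [diskEuler, adjoint_mul, adjoint_of, adjoint_del, neg_mul, del_mul_of, powerD_X, map_one]
  abel

/-- The operator `P` is a polynomial in `X d/dX` with coefficients in `O`, and the constant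
terms of the coefficients form the polynomial `q`, the indicial polynomial of `P`. -/
inductive HasSymbol : DO → K[X] → Prop
  | func (f : O) : HasSymbol (of _ f) (PC (constantCoeff f))
  | euler : HasSymbol (diskEuler K) PX
  | add {P P' q q'} : HasSymbol P q → HasSymbol P' q' → HasSymbol (P + P') (q + q')
  | mul {P P' q q'} : HasSymbol P q → HasSymbol P' q' → HasSymbol (P * P') (q * q')

namespace HasSymbol

theorem const (c : K) : HasSymbol (of _ (C c)) (PC c) := by
  simpa using HasSymbol.func (C c)

theorem one : HasSymbol (1 : DO) 1 := by simpa using HasSymbol.const (1 : K)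

theorem zero : HasSymbol (0 : DO) 0 := by simpa using HasSymbol.const (0 : K)

theorem neg {P : DO} {q : K[X]} (h : HasSymbol P q) : HasSymbol (-P) (-q) := by
  have := (HasSymbol.const (-1 : K)).mul h
  simpa using this

theorem pow {P : DO} {q : K[X]} (h : HasSymbol P q) (n : ℕ) : HasSymbol (P ^ n) (q ^ n) := by
  induction n with
  | zero => simpa using one
  | succ n ih => simpa [pow_succ] using ih.mul h

theorem sum {ι : Type*} (s : Finset ι) {P : ι → DO} {q : ι → K[X]}
    (h : ∀ i, HasSymbol (P i) (q i)) : HasSymbol (∑ i ∈ s, P i) (∑ i ∈ s, q i) := by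
  classical
  induction s using Finset.induction_on with
  | empty => simpa using zero
  | insert a s ha ih => rw [Finset.sum_insert ha, Finset.sum_insert ha]; exact (h a).add ih

theorem adjoint {P : DO} {q : K[X]} (h : HasSymbol P q) :
    HasSymbol (adjoint _ P).unop (q.comp (-1 - PX)) := by
  induction h with
  | func f =>
    rw [adjoint_of, Polynomial.C_comp]
    exact HasSymbol.func f
  | euler =>
    rw [adjoint_diskEuler, Polynomial.X_comp, sub_eq_add_neg, sub_eq_add_neg]
    exact one.neg.add euler.neg
  | add _ _ h h' => simpa using h.add h'
  | mul _ _ h h' =>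
    rw [adjoint_mul, Polynomial.mul_comp, mul_comm]
    exact h'.mul h

variable {N : Type v} [AddCommGroup N] [Module DO N] {P : DO} {q : K[X]}

/-- On the kernel of `X ^ (m + 1)`, the operator `X d/dX` is `-(m + 1)` modulo the kernel
of `X ^ m`. -/
theorem smul_torsion (h : HasSymbol P q) (m : ℕ) {v : N} (hv : of dO (X ^ (m + 1)) • v = 0) :
    of dO (X ^ m) • P • v =
      of dO (X ^ m * C (q.eval (-((m : K) + 1)))) • v := by
  induction h generalizing v with
  | func f =>
    obtain ⟨g, hg⟩ := X_dvd_iff.2 (show constantCoeff (f - C (constantCoeff f)) = 0 by simp)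
    rw [← mul_smul, ← map_mul, eval_C, ← sub_eq_zero, ← sub_smul, ← map_sub, ← mul_sub,
      hg, ← mul_assoc, ← pow_succ, mul_comm, map_mul, mul_smul, hv, smul_zero]
  | euler =>
    have := congrArg (fun x => del dO • x) hv
    simp only [smul_zero] at this
    rw [← mul_smul, del_mul_X_pow, mul_smul, add_smul, smul_add,
      ← mul_smul _ (of _ (C _)) v, ← map_mul] at this
    rw [eq_neg_of_add_eq_zero_left this, eval_X, ← neg_smul, ← map_neg, ← mul_neg,
      ← map_neg]
  | add _ _ h h' =>
    rw [add_smul, smul_add, h hv, h' hv, ← add_smul, ← map_add, ← mul_add, ← map_add,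
      Polynomial.eval_add]
  | @mul P P' q q' _ _ h h' =>
    have h1 : of dO (X ^ (m + 1)) • P' • v = 0 := by
      rw [pow_succ', map_mul, mul_smul, h' hv, ← mul_smul, ← map_mul, ← mul_assoc, ← pow_succ',
        mul_comm, map_mul, mul_smul, hv, smul_zero]
    rw [mul_smul, h h1, mul_comm, map_mul, mul_smul, h' hv, ← mul_smul, ← map_mul, mul_left_comm,
      ← map_mul, Polynomial.eval_mul]

/-- On a module supported at the origin, an operator is injective if its indicial polynomial does
not vanish at negative integers. -/
theorem eq_zero_of_torsion (h : HasSymbol P q) (hq : ∀ m : ℕ, q.eval (-((m : K) + 1)) ≠ 0) (m : ℕ)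
    {v : N} (hv : of dO (X ^ m) • v = 0) (hP : P • v = 0) : v = 0 := by
  induction m with
  | zero => simpa using hv
  | succ m ih =>
    refine ih ?_
    have h1 := h.smul_torsion m hv
    rw [hP, smul_zero, mul_comm, map_mul, mul_smul] at h1
    have h2 := congrArg (fun x => of dO (C (q.eval (-((m : K) + 1)))⁻¹) • x) h1
    simp only [smul_zero] at h2
    rwa [← mul_smul, ← map_mul, ← map_mul, inv_mul_cancel₀ (hq m), map_one, map_one, one_smul,
      eq_comm] at h2

theorem exists_smul_eq_of_torsion (h : HasSymbol P q) (hq : ∀ m : ℕ, q.eval (-((m : K) + 1)) ≠ 0)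
    (m : ℕ) {v : N} (hv : of dO (X ^ m) • v = 0) :
    ∃ w : N, P • w = v ∧ of dO (X ^ m) • w = 0 := by
  induction m generalizing v with
  | zero => exact ⟨0, by simpa using hv.symm, smul_zero _⟩
  | succ m ih =>
    let v' : N := of dO (C (q.eval (-((m : K) + 1)))⁻¹) • v
    have hv' : of dO (X ^ (m + 1)) • v' = 0 := by
      rw [← mul_smul, ← map_mul, mul_comm, map_mul, mul_smul, hv, smul_zero]
    obtain ⟨w, hw, hw'⟩ := ih (v := v - P • v') (by
      rw [smul_sub, h.smul_torsion m hv', ← mul_smul, ← map_mul, mul_assoc, ← map_mul,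
        mul_inv_cancel₀ (hq m), map_one, mul_one, sub_self])
    refine ⟨v' + w, by rw [smul_add, hw, add_sub_cancel], ?_⟩
    rw [smul_add, hv', pow_succ', map_mul, mul_smul, hw', smul_zero, zero_add]

end HasSymbol

/-- A module supported at the origin on which `∂` is surjective vanishes. -/
theorem eq_zero_of_torsion_of_surjective {N : Type v} [AddCommGroup N] [Module DO N]
    [CharZero K] (hN : ∀ v : N, ∃ m, of dO (X ^ m) • v = 0)
    (hs : ∀ v : N, ∃ w : N, del dO • w = v) (v : N) : v = 0 := by
  have h1 : ∀ v : N, of dO X • v = 0 → v = 0 := fun v hv => by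
    obtain ⟨w, rfl⟩ := hs v
    obtain ⟨m, hm⟩ := hN w
    rw [HasSymbol.euler.eq_zero_of_torsion (fun m => ?_) m hm ((mul_smul _ _ _).trans hv),
      smul_zero]
    rw [eval_X]
    exact neg_ne_zero.2 (Nat.cast_add_one_ne_zero m)
  obtain ⟨m, hm⟩ := hN v
  induction m with
  | zero => simpa using hm
  | succ m ih =>
    rw [pow_succ', map_mul, mul_smul] at hm
    exact ih (h1 _ hm)

end Symbols

/-! ### Operators on power series and division -/

section Division

variable {K : Type u} [Field K] {P : DO} {q : K[X]} {f : O} {n m : ℕ}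

variable (K) in
/-- Differential operators act on power series. -/
abbrev powerSeriesModule : Module DO O := moduleOfDerivation dO O
    (show AddMonoid.End O from (dO).toAddMonoidHom) fun r f => by
    change dO (r * f) = r * dO f + dO r * f
    rw [Der.leibniz]
    ring

attribute [local instance] powerSeriesModule

theorem of_smul_powerSeries (f g : O) : of dO f • g = f * g := by
  exact congrArg (fun φ : AddMonoid.End O => φ g) (lift_of dO _ _ _ f)

theorem del_smul_powerSeries (g : O) : del dO • g = dO g := by
  exact congrArg (fun φ : AddMonoid.End O => φ g) (lift_del dO _ _ _)

/-- The action on power series shows that `P ∂` is the part of an operator without constant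
term. -/
theorem exists_eq_mul_del (h : P • (1 : O) = 0) : ∃ Q, P = Q * del dO := by
  obtain ⟨Q, r, rfl⟩ := DiffOp.exists_eq_mul_del_add P
  have h1 : dO 1 = 0 := by rw [← map_one C, powerD_C]
  rw [add_smul, mul_smul, del_smul_powerSeries, h1, smul_zero, zero_add, of_smul_powerSeries,
    mul_one] at h
  exact ⟨Q, by rw [h, map_zero, add_zero]⟩

theorem HasSymbol.smul_X_pow (h : HasSymbol P q) (m : ℕ) (hf : X ^ m ∣ f) :
    X ^ (m + 1) ∣ P • f - C (q.eval (m : K)) * f := by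
  induction h generalizing f with
  | func g =>
    rw [of_smul_powerSeries, eval_C, ← sub_mul, pow_succ']
    exact mul_dvd_mul (X_dvd_iff.2 (by simp)) hf
  | euler =>
    obtain ⟨g, rfl⟩ := hf
    rw [diskEuler, mul_smul, del_smul_powerSeries, of_smul_powerSeries, Der.leibniz, mul_add,
      mul_comm g, ← mul_assoc _ _ g, powerD_X_pow, eval_X, map_natCast]
    exact ⟨dO g, by ring⟩
  | add _ _ h h' =>
    have := dvd_add (h hf) (h' hf)
    rw [add_smul, Polynomial.eval_add, map_add]
    convert this using 1
    ring
  | @mul P P' q q' _ _ h h' =>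
    have h1 := h' hf
    have h2 : X ^ m ∣ P' • f := by
      have := dvd_add ((pow_dvd_pow _ m.le_succ).trans h1) (hf.mul_left (C (q'.eval (m : K))))
      rwa [sub_add_cancel] at this
    have := dvd_add (h h2) (h1.mul_left (C (q.eval (m : K))))
    rw [mul_smul, Polynomial.eval_mul, map_mul]
    convert this using 1
    ring

theorem HasSymbol.dvd_smul (h : HasSymbol P q) (hf : X ^ m ∣ f) : X ^ m ∣ P • f := by
  have := dvd_add ((pow_dvd_pow _ m.le_succ).trans (h.smul_X_pow m hf))
    (hf.mul_left (C (q.eval (m : K))))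
  rwa [sub_add_cancel] at this

theorem HasSymbol.powerSeries_injective (h : HasSymbol P q)
    (hq : ∀ m : ℕ, q.eval (m : K) ≠ 0) (hf : P • f = 0) : f = 0 := by
  have h1 : ∀ m, X ^ m ∣ f := by
    intro m
    induction m with
    | zero => simp
    | succ m ih =>
      have h2 := h.smul_X_pow m ih
      rw [hf, zero_sub, dvd_neg] at h2
      have h3 := h2.mul_left (C (q.eval (m : K))⁻¹)
      rwa [← mul_assoc, ← map_mul, inv_mul_cancel₀ (hq m), map_one, one_mul] at h3
  ext n
  exact PowerSeries.X_pow_dvd_iff.1 (h1 (n + 1)) n n.lt_succ_self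

theorem mem_pow_smul_top :
    f ∈ ϖ ^ m • (⊤ : Submodule O O) ↔ X ^ m ∣ f := by
  rw [mem_pow_smul]
  constructor
  · rintro ⟨g, -, rfl⟩
    exact ⟨g, rfl⟩
  · rintro ⟨g, rfl⟩
    exact ⟨g, trivial, rfl⟩

theorem HasSymbol.powerSeries_surjective (h : HasSymbol P q)
    (hq : ∀ m : ℕ, q.eval (m : K) ≠ 0) (f : O) : ∃ g : O, P • g = f := by
  have hfg : (⊤ : Submodule O O).FG := ⟨{1}, by simp⟩
  have hex := le_image_of_approx hfg hfg hfg (DistribSMul.toAddMonoidHom O P)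
    (fun m v hv => mem_pow_smul_top.2
      (h.dvd_smul ((pow_dvd_pow _ m.le_succ).trans (mem_pow_smul_top.1 hv))))
    (fun m v hv => ?_) f trivial
  · exact hex.imp fun g hg => hg.2
  · have hv' := (mem_pow_smul_top.1 hv).mul_left (C (q.eval (m : K))⁻¹)
    refine ⟨_, mem_pow_smul_top.2 hv', mem_pow_smul_top.2 ?_⟩
    have := h.smul_X_pow m hv'
    rw [← mul_assoc, ← map_mul, mul_inv_cancel₀ (hq m), map_one, one_mul] at this
    rw [dvd_sub_comm]
    exact this

variable (K) in
/-- The operators of order less than `n` which are polynomials in `X d/dX` with coefficients in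
`O`. -/
def eulerSpan (n : ℕ) : Submodule O DO := span O (range fun i : Fin n => diskEuler K ^ (i : ℕ))

theorem of_mul_mem_eulerSpan (f : O) (h : P ∈ eulerSpan K n) :
    of dO f * P ∈ eulerSpan K n := (eulerSpan K n).smul_mem f h

theorem eulerSpan_fg (n : ℕ) : (eulerSpan K n).FG := fg_span (Set.finite_range _)

theorem pow_mem_eulerSpan {i n : ℕ} (h : i < n) : diskEuler K ^ i ∈ eulerSpan K n :=
  subset_span ⟨⟨i, h⟩, rfl⟩

theorem eulerSpan_mono {m n : ℕ} (h : m ≤ n) : eulerSpan K m ≤ eulerSpan K n := by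
  refine span_le.2 ?_
  rintro _ ⟨i, rfl⟩
  exact pow_mem_eulerSpan (i.2.trans_le h)

theorem mem_eulerSpan : P ∈ eulerSpan K n ↔
    ∃ f : Fin n → O, P = ∑ i, of dO (f i) * diskEuler K ^ (i : ℕ) := by
  rw [eulerSpan, mem_span_range]
  exact exists_congr fun f => eq_comm

theorem euler_mul_mem_eulerSpan (h : P ∈ eulerSpan K n) :
    diskEuler K * P ∈ eulerSpan K (n + 1) := by
  obtain ⟨f, rfl⟩ := mem_eulerSpan.1 h
  rw [Finset.mul_sum]
  refine sum_mem fun i _ => ?_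
  rw [← mul_assoc, diskEuler_mul_of, add_mul, mul_assoc, ← pow_succ']
  exact add_mem (of_mul_mem_eulerSpan _ (pow_mem_eulerSpan (by lia)))
    (of_mul_mem_eulerSpan _ (pow_mem_eulerSpan (by lia)))

/-- `P` is a polynomial of degree `n` in `X d/dX` with leading coefficient `c`. -/
def HasLead (n : ℕ) (c : O) (P : DO) : Prop := P - of dO c * diskEuler K ^ n ∈ eulerSpan K n

namespace HasLead

variable {c c' : O} {Q : DO}

theorem mem (h : HasLead n c P) : P ∈ eulerSpan K (n + 1) := by
  have := add_mem (eulerSpan_mono n.le_succ h)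
    (of_mul_mem_eulerSpan c (pow_mem_eulerSpan n.lt_succ_self))
  rwa [sub_add_cancel] at this

theorem add (h : HasLead n c P) (h' : HasLead n c' Q) : HasLead n (c + c') (P + Q) := by
  have := add_mem h h'
  rw [HasLead, map_add, add_mul]
  convert this using 1
  abel

theorem of_mem (h : P ∈ eulerSpan K n) : HasLead n 0 P := by
  rw [HasLead, map_zero, zero_mul, sub_zero]
  exact h

theorem of_mul (f : O) (h : HasLead n c P) : HasLead n (f * c) (of _ f * P) := by
  have := of_mul_mem_eulerSpan f h
  rwa [mul_sub, ← mul_assoc, ← map_mul] at this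

theorem euler_mul (h : HasLead n c P) : HasLead (n + 1) c (diskEuler K * P) := by
  have h1 := euler_mul_mem_eulerSpan h
  rw [mul_sub, ← mul_assoc, diskEuler_mul_of, add_mul, mul_assoc, ← pow_succ'] at h1
  have h2 := add_mem h1 (of_mul_mem_eulerSpan (X * dO c) (pow_mem_eulerSpan n.lt_succ_self))
  rw [HasLead]
  convert h2 using 1
  abel

theorem affine_mul (a b : K) (h : HasLead n c P) : HasLead (n + 1) (C a * c)
    ((of _ (C b) + of _ (C a) * diskEuler K) * P) := by
  have := (of_mem (of_mul_mem_eulerSpan (C b) h.mem)).add (h.euler_mul.of_mul (C a))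
  rwa [zero_add, ← mul_assoc, ← add_mul] at this

theorem affine_pow_mul (a b : K) (n : ℕ) (f : O) : HasLead n (C (a ^ n) * f)
    ((of _ (C b) + of _ (C a) * diskEuler K) ^ n *
      of _ f) := by
  induction n with
  | zero =>
    rw [HasLead]
    simp
  | succ n ih =>
    have := ih.affine_mul a b
    rwa [← mul_assoc, ← mul_assoc, ← map_mul, ← pow_succ', ← pow_succ'] at this

theorem adjoint_mul_pow (n : ℕ) (f : O) : HasLead n (C ((-1) ^ n) * f)
    (adjoint _ (of _ f * diskEuler K ^ n)).unop := by
  have := affine_pow_mul (-1) (-1) n f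
  rw [adjoint_mul, adjoint_of, map_pow (adjoint _), MulOpposite.unop_pow, adjoint_diskEuler]
  convert this using 3
  simp [sub_eq_add_neg]

theorem adjoint (h : HasLead n c P) : HasLead n (C ((-1) ^ n) * c) (adjoint _ P).unop := by
  obtain ⟨f, hf⟩ := mem_eulerSpan.1 h
  rw [sub_eq_iff_eq_add] at hf
  rw [hf, map_add, MulOpposite.unop_add, map_sum, Finset.unop_sum]
  have := (of_mem (n := n) (Submodule.sum_mem (t := Finset.univ) _ fun (i : Fin n) _ =>
    eulerSpan_mono (Nat.succ_le_of_lt i.2) (adjoint_mul_pow (i : ℕ) (f i)).mem)).add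
      (adjoint_mul_pow n c)
  rwa [zero_add] at this

/-- Division with remainder by `Q`, after multiplication by a power of `X`. -/
theorem exists_pow_mul_eq (h : HasLead n c Q) (hc : c ≠ 0) (P : DO) :
    ∃ (N : ℕ) (T l : DO), l ∈ eulerSpan K n ∧
      of dO (X ^ N) * P = T * Q + l := by
  let ρ : DO →ₗ[O] DO :=
    { toFun := fun T => T * Q
      map_add' := fun T T' => add_mul T T' Q
      map_smul' := fun r T => mul_assoc _ _ _ }
  let W : Submodule O DO := LinearMap.range ρ ⊔ eulerSpan K n
  have hρ : ∀ T, T * Q ∈ W := fun T => mem_sup_left ⟨T, rfl⟩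
  have hl : ∀ l ∈ eulerSpan K n, l ∈ W := fun l hl => mem_sup_right hl
  -- a multiple of an operator of order `n` is congruent to one of smaller order
  obtain ⟨k, hk⟩ : ∃ k, ∀ P ∈ eulerSpan K (n + 1), ϖ ^ k • P ∈ W := by
    obtain ⟨g, hg⟩ := (PowerSeries.isUnit_divided_by_X_pow_order hc).exists_left_inv
    have hg' : X ^ c.order.toNat = g * c := by
      conv_rhs => rw [← PowerSeries.X_pow_order_mul_divXPowOrder (f := c), mul_left_comm, hg,
        mul_one]
    refine ⟨c.order.toNat, fun P hP => ?_⟩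
    obtain ⟨f, rfl⟩ := mem_eulerSpan.1 hP
    rw [smul_sum]
    have h1 : (c • diskEuler K ^ n : DO) ∈ W := by
      have := sub_mem (hρ 1) (hl _ h)
      rwa [one_mul, sub_sub_cancel] at this
    refine W.sum_mem fun i _ => ?_
    change ϖ ^ c.order.toNat • f i • (diskEuler K ^ (i : ℕ) : DO) ∈ W
    rcases Nat.lt_succ_iff_lt_or_eq.1 i.2 with hi | hi
    · exact W.smul_mem _ (W.smul_mem _ (hl _ (pow_mem_eulerSpan hi)))
    · rw [hi, smul_comm, hg', mul_smul]
      exact W.smul_mem _ (W.smul_mem _ h1)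
  have hθ : ∀ P ∈ W, ϖ ^ k • (diskEuler K * P) ∈ W := fun P hP => by
    obtain ⟨_, ⟨T, rfl⟩, l, hl', rfl⟩ := mem_sup.1 hP
    rw [mul_add, smul_add]
    refine add_mem (W.smul_mem _ ?_) (hk _ (euler_mul_mem_eulerSpan hl'))
    change diskEuler K * (T * Q) ∈ W
    rw [← mul_assoc]
    exact hρ _
  let J : AddSubgroup DO :=
    { carrier := {P | ∃ N, ϖ ^ N • P ∈ W}
      zero_mem' := ⟨0, by simp⟩
      neg_mem' := by
        rintro P ⟨N, h⟩
        exact ⟨N, by rw [smul_neg]; exact neg_mem h⟩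
      add_mem' := by
        rintro P P' ⟨N, h⟩ ⟨N', h'⟩
        refine ⟨N + N', ?_⟩
        rw [smul_add, pow_add, mul_smul, smul_comm, mul_smul]
        exact add_mem (W.smul_mem _ h) (W.smul_mem _ h') }
  have hJ : P • 1 ∈ J := DiffOp.smul_mem_of_stable J ?_ ?_ P (v := 1)
    ⟨k, hk 1 (by simpa using pow_mem_eulerSpan n.succ_pos)⟩
  · obtain ⟨N, hN⟩ := hJ
    rw [smul_eq_mul, mul_one] at hN
    obtain ⟨_, ⟨T, rfl⟩, l, hl', h'⟩ := mem_sup.1 hN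
    exact ⟨N, T, l, hl', h'.symm⟩
  · rintro r P ⟨N, h⟩
    refine ⟨N, ?_⟩
    change ϖ ^ N • r • P ∈ W
    rw [smul_comm]
    exact W.smul_mem r h
  · rintro P ⟨N, h⟩
    refine ⟨k + N + 1, ?_⟩
    have h1 : ϖ ^ (k + N + 1) • (del dO * P) = ϖ ^ k • (diskEuler K * ϖ ^ N • P) -
          (X ^ k * (N : O)) • ϖ ^ N • P := by
      have h2 : diskEuler K * ϖ ^ N • P = ϖ ^ N • ϖ • (del dO * P) + ((N : O) * X ^ N) • P := by
        change diskEuler K * (of _ _ * P) = of _ _ * (of _ _ * (_ * _)) + of _ _ * P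
        rw [← mul_assoc, diskEuler_mul_of, powerD_X_pow, add_mul, diskEuler, mul_assoc, mul_assoc]
      rw [h2, smul_add, ← mul_smul _ (ϖ ^ N) P, ← mul_smul _ _ P, ← mul_smul,
        ← mul_smul, mul_assoc (X ^ k) (N : O), add_sub_cancel_right, pow_succ, pow_add,
        mul_assoc]
    change _ • (del dO * P) ∈ W
    rw [h1]
    exact sub_mem (hθ _ h) (W.smul_mem _ h)

end HasLead

end Division

/-! ### Nonresonant presentations -/

section Presentations

variable {K : Type u} [Field K]

theorem diskToPunctured_of (f : O) : diskToPunctured K (of dO f) =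
    of dK (ofPowerSeries ℤ K f) := by
  rw [diskToPunctured, DiffOp.map, lift_of]
  rfl

theorem diskToPunctured_del : diskToPunctured K (del dO) = del dK := by
  rw [diskToPunctured, DiffOp.map, lift_del, map_one, one_mul]

theorem diskToPunctured_euler : diskToPunctured K (diskEuler K) = eulerOp K := by
  rw [diskEuler, map_mul, diskToPunctured_of, diskToPunctured_del, ofPowerSeries_X]
  rfl

theorem eulerD_single (N : ℤ) : eulerD K (single N 1) = (N : Kx) * single N 1 := by
  refine HahnSeries.ext (funext fun m => (laurent_euler_coeff K _ m).trans ?_)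
  rw [← map_intCast HahnSeries.C, HahnSeries.C_mul_eq_smul, HahnSeries.coeff_smul, smul_eq_mul,
    HahnSeries.coeff_single]
  split_ifs with h
  · rw [h]
  · simp

section

variable {W : Type u} [AddCommGroup W] [Module DK W]
  [Module Kx W] [Module O W] [IsScalarTower Kx DK W]
  [IsScalarTower O Kx W] [IsScalarTower O DK W]

theorem diskToPunctured_of_smul (f : O) (w : W) : diskToPunctured K (of dO f) • w = f • w := by
  rw [diskToPunctured_of, of_smul_eq, ofPowerSeries_smul]

theorem eulerOp_smul_single (N : ℤ) (w : W) : eulerOp K • (single N 1 : Kx) • w =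
    (single N 1 : Kx) • (eulerOp K • w + (HahnSeries.C (N : K) : Kx) • w) := by
  refine (isDerivation_eulerAct (K := K) (V := W) (single N 1) w).trans ?_
  rw [eulerD_single, smul_add, mul_comm, mul_smul, map_intCast]
  rfl

theorem eulerSpan_smul_mem {n : ℕ} {l : DO} (hl : l ∈ eulerSpan K n) (w : W) :
    diskToPunctured K l • w ∈
      span Kx (range fun i : Fin n => eulerOp K ^ (i : ℕ) • w) := by
  obtain ⟨f, rfl⟩ := mem_eulerSpan.1 hl
  rw [map_sum, sum_smul]
  refine sum_mem fun i _ => ?_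
  rw [map_mul, map_pow, diskToPunctured_euler, mul_smul, diskToPunctured_of, of_smul_eq]
  exact smul_mem _ _ (subset_span ⟨i, rfl⟩)

/-- A cyclic vector satisfies a differential equation with primitive coefficients in `O`. -/
theorem exists_cyclic_equation [CharZero K] [Module.Finite Kx W] :
    ∃ (n : ℕ) (e : W) (g : Fin (n + 1) → O),
      LinearIndependent Kx (fun i : Fin n => eulerOp K ^ (i : ℕ) • e) ∧
      span Kx (range fun i : Fin n => eulerOp K ^ (i : ℕ) • e) = ⊤ ∧
      ∑ i : Fin (n + 1), g i • eulerOp K ^ (i : ℕ) • e = 0 ∧ g (Fin.last n) ≠ 0 ∧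
      ∑ i : Fin (n + 1), PC (constantCoeff (g i)) * PX ^ (i : ℕ) ≠ (0 : K[X]) := by
  have : CharZero Kx := charZero_of_injective_algebraMap (R := K) (algebraMap K Kx).injective
  have hθ : IsEuler (show AddMonoid.End W from eulerAct K W) := isDerivation_eulerAct
  obtain ⟨e, hli, hspan⟩ := exists_cyclic_vector hθ (t := single 1 1)
    (by rw [eulerD_single, Int.cast_one, one_mul]) single_one_ne_zero
  set n := Module.finrank Kx W
  have hpow : ∀ (i : ℕ) (v : W), ((show AddMonoid.End W from eulerAct K W) ^ i) v =
      eulerOp K ^ i • v :=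
    fun i v => by
      rw [AddMonoid.End.coe_pow]
      exact iterate_eulerAct i v
  simp only [hpow] at hli hspan
  have hmem : eulerOp K ^ n • e ∈
      span Kx (range fun i : Fin n => eulerOp K ^ (i : ℕ) • e) := hspan ▸ trivial
  obtain ⟨f, hf⟩ := (mem_span_range _).1 hmem
  obtain ⟨a, g, ha, hag, hg⟩ := exists_primitive (Fin.snoc (α := fun _ => Kx) f (-1))
    ⟨Fin.last n, by simp⟩
  have hrel : ∑ i : Fin (n + 1), g i • eulerOp K ^ (i : ℕ) • e = 0 := by
    simp_rw [← ofPowerSeries_smul, ← hag, mul_smul]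
    rw [← smul_sum, Fin.sum_univ_castSucc]
    simp only [Fin.snoc_castSucc, Fin.snoc_last, Fin.val_castSucc, Fin.val_last]
    rw [hf, neg_one_smul, add_neg_cancel, smul_zero]
  have hgn : g (Fin.last n) ≠ 0 := fun h => by
    have := hag (Fin.last n)
    rw [Fin.snoc_last, h, map_zero, mul_neg_one, neg_eq_zero] at this
    exact ha this
  refine ⟨n, e, g, hli, hspan, hrel, hgn, fun h => ?_⟩
  obtain ⟨i, hi⟩ := hg
  have := congrArg (fun p => Polynomial.coeff p (i : ℕ)) h
  simp only [Polynomial.finsetSum_coeff, Polynomial.coeff_C_mul_X_pow,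
    Polynomial.coeff_zero] at this
  rw [Finset.sum_eq_single i (fun j _ hj => if_neg fun h => hj (Fin.ext h.symm)) (by simp),
    if_pos rfl] at this
  exact hi this

variable (K W) in
/-- A cyclic vector can be multiplied by any power of `X`, which shifts the indicial polynomial. -/
theorem exists_euler_operator [CharZero K] [Module.Finite Kx W] :
    ∃ (n : ℕ) (c : O) (b : K[X]), c ≠ 0 ∧ b ≠ 0 ∧ ∀ N : ℤ, ∃ (B : DO) (w : W),
      HasLead n c B ∧ HasSymbol B (b.comp (PX - PC (N : K))) ∧
      diskToPunctured K B • w = 0 ∧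
      (∀ l ∈ eulerSpan K n, diskToPunctured K l • w = 0 → l = 0) ∧
      ∀ v : W, ∃ (m : ℕ), ∃ l ∈ eulerSpan K n, ϖ ^ m • v = diskToPunctured K l • w := by
  obtain ⟨n, e, g, hli, hspan, hrel, hgn, hq⟩ := exists_cyclic_equation (K := K) (W := W)
  refine ⟨n, g (Fin.last n), _, hgn, hq, fun N => ?_⟩
  let E : DO := of _ (C (-(N : K))) + of _ (C 1) * diskEuler K
  let B : DO := ∑ i : Fin (n + 1), of dO (g i) * E ^ (i : ℕ)
  let w : W := (single N 1 : Kx) • e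
  have hE : ∀ i : ℕ, diskToPunctured K E ^ i • w = (single N 1 : Kx) • eulerOp K ^ i • e := by
    intro i
    induction i with
    | zero => simp [w]
    | succ i ih =>
      rw [pow_succ', mul_smul, ih, map_add, map_one (C : K →+* O),
        map_one (of dO), one_mul, diskToPunctured_euler, add_smul,
        diskToPunctured_of, of_smul_eq, ofPowerSeries_C, eulerOp_smul_single,
        ← mul_smul (eulerOp K), ← pow_succ', map_neg, neg_smul, smul_add,
        smul_comm (HahnSeries.C (N : K) : Kx)]
      abel
  have hB : HasLead n (g (Fin.last n)) B := by
    have h1 : ∀ i : Fin (n + 1), HasLead (i : ℕ) (g i) (of dO (g i) * E ^ (i : ℕ)) := fun i => by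
      have := (HasLead.affine_pow_mul 1 (-(N : K)) i 1).of_mul (g i)
      simpa [E] using this
    have h2 := (HasLead.of_mem (Submodule.sum_mem (t := Finset.univ) (eulerSpan K n)
      fun (i : Fin n) _ => eulerSpan_mono (Nat.succ_le_of_lt i.2) (h1 i.castSucc).mem)).add
        (h1 (Fin.last n))
    rw [zero_add] at h2
    simp only [B, Fin.sum_univ_castSucc]
    exact h2
  have hBw : diskToPunctured K B • w = 0 := by
    simp only [B, map_sum, sum_smul, map_mul, map_pow, mul_smul, hE, diskToPunctured_of_smul]
    simp_rw [smul_comm (g _)]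
    rw [← smul_sum, hrel, smul_zero]
  set U := span Kx (range fun i : Fin n => eulerOp K ^ (i : ℕ) • w) with hU
  have hUpow : ∀ i ≤ n, eulerOp K ^ i • w ∈ U := fun i hi => by
    rcases hi.lt_or_eq with hi | hi
    · exact subset_span ⟨⟨i, hi⟩, rfl⟩
    · rw [hi]
      have h1 := eulerSpan_smul_mem hB w
      rw [map_sub, sub_smul, hBw, zero_sub, neg_mem_iff, map_mul, map_pow, diskToPunctured_euler,
        mul_smul, diskToPunctured_of, of_smul_eq] at h1
      refine (Submodule.smul_mem_iff _ (s := ofPowerSeries ℤ K (g (Fin.last n))) ?_).1 h1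
      exact fun h => hgn (HahnSeries.ofPowerSeries_injective (h.trans (map_zero _).symm))
  have hUstab : ∀ v ∈ U, eulerOp K • v ∈ U := fun v hv => by
    induction hv using Submodule.span_induction with
    | mem x hx =>
      obtain ⟨i, rfl⟩ := hx
      rw [← mul_smul, ← pow_succ']
      exact hUpow _ i.2
    | zero => rw [smul_zero]; exact zero_mem _
    | add x y _ _ hx hy => rw [smul_add]; exact add_mem hx hy
    | smul a x hx' hx =>
      have := isDerivation_eulerAct (K := K) (V := W) a x
      rw [eulerAct_apply] at this
      rw [this]
      exact add_mem (U.smul_mem _ hx) (U.smul_mem _ hx')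
  have hUe : e ∈ U := by
    have h1 : (single (-N) 1 : Kx) • w = e := by
      simp [w, ← mul_smul, single_mul_single]
    rw [← h1]
    have := hUpow 0 n.zero_le
    rw [pow_zero, one_smul] at this
    exact U.smul_mem _ this
  have hUtop : U = ⊤ := by
    rw [eq_top_iff, ← hspan, span_le]
    rintro _ ⟨i, rfl⟩
    have h1 : ∀ i : ℕ, eulerOp K ^ i • e ∈ U := by
      intro i
      induction i with
      | zero => simpa using hUe
      | succ i ih => rw [pow_succ', mul_smul]; exact hUstab _ ih
    exact h1 i
  have hliw := linearIndependent_of_top_le_span_of_card_eq_finrank (R := Kx)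
    (b := fun i : Fin n => eulerOp K ^ (i : ℕ) • w) hUtop.ge
    (Module.finrank_eq_card_basis (Module.Basis.mk hli hspan.ge)).symm
  have hsum : ∀ f : Fin n → O, diskToPunctured K (∑ i, of dO (f i) *
      diskEuler K ^ (i : ℕ)) • w = ∑ i, ofPowerSeries ℤ K (f i) • eulerOp K ^ (i : ℕ) • w :=
    fun f => by
      simp only [map_sum, sum_smul, map_mul, map_pow, diskToPunctured_euler, mul_smul,
        diskToPunctured_of, of_smul_eq]
  refine ⟨B, w, hB, ?_, hBw, fun l hl h => ?_, fun v => ?_⟩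
  · have h1 : ∀ i : Fin (n + 1), HasSymbol (of dO (g i) * E ^ (i : ℕ))
        (PC (constantCoeff (g i)) * (PC (-(N : K)) + PC 1 * PX) ^ (i : ℕ)) := fun i =>
      (HasSymbol.func _).mul (((HasSymbol.const _).add
        ((HasSymbol.const _).mul HasSymbol.euler)).pow _)
    have h2 := HasSymbol.sum Finset.univ h1
    convert h2 using 1
    rw [Polynomial.sum_comp]
    refine sum_congr rfl fun i _ => ?_
    simp [sub_eq_neg_add]
  · obtain ⟨f, rfl⟩ := mem_eulerSpan.1 hl
    rw [hsum] at h
    have := Fintype.linearIndependent_iff.1 hliw _ h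
    refine sum_eq_zero fun i _ => ?_
    rw [HahnSeries.ofPowerSeries_injective ((this i).trans (map_zero _).symm), map_zero, zero_mul]
  · obtain ⟨f, hf⟩ := (mem_span_range _).1 (hUtop ▸ trivial : v ∈ U)
    obtain ⟨m, g', hg'⟩ := exists_common_denominator f
    refine ⟨m, _, mem_eulerSpan.2 ⟨g', rfl⟩, ?_⟩
    rw [hsum, X_pow_smul, ← hf, smul_sum]
    exact sum_congr rfl fun i _ => by rw [← mul_smul, hg']

end

end Presentations

section Nonresonant

variable {K : Type u} [Field K]

/-- `Q` is a polynomial in `X d/dX` over `O` whose indicial polynomial has no roots among the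
natural numbers. -/
structure Nonresonant (n : ℕ) (Q : DO) : Prop where
  lead : ∃ c, c ≠ 0 ∧ HasLead n c Q
  symbol : ∃ q, HasSymbol Q q ∧ ∀ m : ℕ, q.eval (m : K) ≠ 0

theorem exists_shift_ne_zero [CharZero K] {b : K[X]} (hb : b ≠ 0) :
    ∃ N : ℕ, ∀ m : ℕ, b.eval ((m : K) + (N : K)) ≠ 0 := by
  have hfin : {m : ℕ | b.eval (m : K) = 0}.Finite :=
    (Polynomial.finite_setOfPred_isRoot hb).preimage (Nat.cast_injective.injOn)
  obtain ⟨N, hN⟩ := hfin.bddAbove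
  refine ⟨N + 1, fun m h => ?_⟩
  have := hN (show m + (N + 1) ∈ {m : ℕ | b.eval (m : K) = 0} by simpa using h)
  lia

/-- Vectors killed by a power of `X` form a submodule. -/
theorem exists_torsion_smul {N : Type v} [AddCommGroup N] [Module DO N] {m : ℕ} {v : N}
    (hv : of dO (X ^ m) • v = 0) (P : DO) :
    ∃ m, of dO (X ^ m) • P • v = 0 := by
  refine DiffOp.smul_mem_of_stable
    { carrier := {v : N | ∃ m, of dO (X ^ m) • v = 0}
      zero_mem' := ⟨0, smul_zero _⟩
      neg_mem' := fun {v} ⟨m, h⟩ => ⟨m, by rw [smul_neg, h, neg_zero]⟩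
      add_mem' := fun {v w} ⟨m, h⟩ ⟨m', h'⟩ => ⟨m + m', ?_⟩ } ?_ ?_ P ⟨m, hv⟩
  · rw [smul_add, pow_add, map_mul, mul_smul _ _ w, h', smul_zero, add_zero, ← map_mul, mul_comm,
      map_mul, mul_smul, h, smul_zero]
  · rintro r v ⟨m, h⟩
    exact ⟨m, by rw [← mul_smul, ← map_mul, mul_comm, map_mul, mul_smul, h, smul_zero]⟩
  · rintro v ⟨m, h⟩
    refine ⟨m + 1, ?_⟩
    have h1 := del_mul_of dO (X ^ (m + 1))
    have h2 : dO (X ^ (m + 1)) = C ((m : K) + 1) * X ^ m := by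
      change PowerSeries.derivative K _ = _
      rw [Derivation.leibniz_pow]
      simp
    rw [← sub_eq_iff_eq_add] at h1
    rw [← mul_smul, ← h1, sub_smul, mul_smul, pow_succ', map_mul, mul_smul, h, ← pow_succ', h2,
      map_mul, mul_smul, h, smul_zero, smul_zero, smul_zero, sub_zero]

namespace Nonresonant

variable {n : ℕ} {Q : DO}

theorem ne_zero (h : Nonresonant n Q) : Q ≠ 0 := by
  rintro rfl
  obtain ⟨q, hq, hq'⟩ := h.symbol
  let := powerSeriesModule K
  exact one_ne_zero (hq.powerSeries_injective hq' (f := 1) (zero_smul _ _))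

theorem adjoint_symbol (h : Nonresonant n Q) : ∃ q, HasSymbol (adjoint _ Q).unop q ∧
    ∀ m : ℕ, q.eval (-((m : K) + 1)) ≠ 0 := by
  obtain ⟨q, hq, hq'⟩ := h.symbol
  refine ⟨_, hq.adjoint, fun m => ?_⟩
  convert hq' m using 1
  simp

theorem adjoint_lead (h : Nonresonant n Q) : ∃ c, c ≠ 0 ∧ HasLead n c (adjoint _ Q).unop := by
  obtain ⟨c, hc, hQ⟩ := h.lead
  exact ⟨_, mul_ne_zero (by simp) hc, hQ.adjoint⟩

theorem of_X_ne_zero : of dO X ≠ 0 := fun h => by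
  let := powerSeriesModule K
  have h1 := of_smul_powerSeries ϖ 1
  rw [h, zero_smul, mul_one, eq_comm] at h1
  exact PowerSeries.X_ne_zero h1

theorem del_ne_zero : del dO ≠ 0 := fun h => by
  let := powerSeriesModule K
  have h1 := del_smul_powerSeries ϖ
  rw [h, zero_smul, powerD_X] at h1
  exact zero_ne_one h1

variable (K) in
/-- The module of delta functions at the origin. -/
abbrev Delta : Type u := DO ⧸ span DO {of dO X}

theorem delta_torsion (v : Delta K) : ∃ m, of dO (X ^ m) • v = 0 := by
  obtain ⟨P, rfl⟩ := Submodule.Quotient.mk_surjective _ v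
  have h1 : of dO (X ^ 1) • (Submodule.Quotient.mk 1 : Delta K) = 0 := by
    rw [← Submodule.Quotient.mk_smul, mk_eq_zero, pow_one, smul_eq_mul, mul_one]
    exact Submodule.mem_span_singleton_self _
  have := exists_torsion_smul h1 P
  rwa [← Submodule.Quotient.mk_smul, smul_eq_mul, mul_one] at this

theorem delta_mk_eq_zero {P : DO} : (Submodule.Quotient.mk P : Delta K) = 0 ↔
    ∃ U, (adjoint _ P).unop = of dO X * U := by
  rw [mk_eq_zero, Submodule.mem_span_singleton]
  constructor
  · rintro ⟨U, rfl⟩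
    exact ⟨_, by rw [smul_eq_mul, adjoint_mul, adjoint_of]⟩
  · rintro ⟨U, hU⟩
    exact ⟨(adjoint _ U).unop, by
      rw [← adjoint_adjoint P, hU, adjoint_mul, adjoint_of, smul_eq_mul]⟩

/-- `X` is not a zero divisor modulo the left ideal generated by `Q`: the adjoint of `Q` is
injective on delta functions. -/
theorem exists_eq_mul_of_X_mul (h : Nonresonant n Q) {S T : DO}
    (hST : of dO X * S = T * Q) : ∃ U, S = U * Q := by
  obtain ⟨q, hq, hq'⟩ := h.adjoint_symbol
  obtain ⟨m, hm⟩ := delta_torsion (Submodule.Quotient.mk (adjoint _ T).unop : Delta K)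
  have h1 := hq.eq_zero_of_torsion hq' m hm (by
    rw [← Submodule.Quotient.mk_smul, smul_eq_mul, ← adjoint_mul, ← hST, delta_mk_eq_zero,
      adjoint_adjoint]
    exact ⟨S, rfl⟩)
  rw [delta_mk_eq_zero, adjoint_adjoint] at h1
  obtain ⟨U, hU⟩ := h1
  exact ⟨U, mul_left_cancel₀ of_X_ne_zero (by rw [hST, hU, mul_assoc])⟩

/-- `X` is surjective modulo the left ideal generated by `Q`: the adjoint of `Q` is surjective on
delta functions. -/
theorem exists_eq_X_mul_add (h : Nonresonant n Q) (T : DO) : ∃ S U, T = of dO X * S + U * Q := by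
  obtain ⟨q, hq, hq'⟩ := h.adjoint_symbol
  obtain ⟨m, hm⟩ := delta_torsion (Submodule.Quotient.mk (adjoint _ T).unop : Delta K)
  obtain ⟨w, hw, -⟩ := hq.exists_smul_eq_of_torsion hq' m hm
  obtain ⟨U, rfl⟩ := Submodule.Quotient.mk_surjective _ w
  rw [← Submodule.Quotient.mk_smul, eq_comm, ← sub_eq_zero, ← Submodule.Quotient.mk_sub,
    delta_mk_eq_zero, map_sub, MulOpposite.unop_sub, adjoint_adjoint, smul_eq_mul,
    adjoint_mul, adjoint_adjoint] at hw
  obtain ⟨S, hS⟩ := hw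
  exact ⟨S, (adjoint _ U).unop, by rw [← hS, sub_add_cancel]⟩

end Nonresonant

end Nonresonant

/-! ### Verdier duality for cyclic modules -/

section Verdier

variable {R : Type u} [CommRing R] {d : Der R}

theorem rightMul_comp (P Q : DiffOp d) : rightMul d P ≫ rightMul d Q = rightMul d (P * Q) := by
  ext
  simp [rightMul]

theorem eq_rightMul (f : ModuleCat.of (DiffOp d) (DiffOp d) ⟶ ModuleCat.of (DiffOp d) (DiffOp d)) :
    f = rightMul d (f.hom 1) := by
  ext
  simp [rightMul]

/-- The vector `e` generates the module, and its annihilator is the left ideal generated by `Q`. -/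
structure IsPresentation {P : Type v} [AddCommGroup P] [Module (DiffOp d) P] (e : P)
    (Q : DiffOp d) : Prop where
  rel : Q • e = 0
  gen : ∀ v, ∃ T : DiffOp d, T • e = v
  ann : ∀ T : DiffOp d, T • e = 0 → ∃ U, T = U * Q

theorem IsPresentation.exists_hom {N N' : Type*} [AddCommGroup N] [Module (DiffOp d) N]
    [AddCommGroup N'] [Module (DiffOp d) N'] {e : N} {Q : DiffOp d} (h : IsPresentation e Q)
    {e' : N'} (he' : Q • e' = 0) : ∃ f : N →ₗ[DiffOp d] N', f e = e' := by
  have hker : ker (LinearMap.toSpanSingleton (DiffOp d) N e) ≤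
      ker (LinearMap.toSpanSingleton (DiffOp d) N' e') := fun T hT => by
    obtain ⟨U, rfl⟩ := h.ann T hT
    rw [mem_ker, LinearMap.toSpanSingleton_apply, mul_smul, he', smul_zero]
  let i := (LinearMap.toSpanSingleton (DiffOp d) N e).quotKerEquivOfSurjective h.gen
  refine ⟨(Submodule.liftQ _ _ hker).comp i.symm.toLinearMap, ?_⟩
  have h1 : i.symm e = Submodule.Quotient.mk 1 := by
    rw [LinearEquiv.symm_apply_eq]
    exact (one_smul _ e).symm
  rw [LinearMap.comp_apply, LinearEquiv.coe_coe, h1]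
  exact one_smul _ e'

theorem IsPresentation.hom_ext {N N' : Type*} [AddCommGroup N] [Module (DiffOp d) N]
    [AddCommGroup N'] [Module (DiffOp d) N'] {e : N} {Q : DiffOp d} (h : IsPresentation e Q)
    {f g : N →ₗ[DiffOp d] N'} (hfg : f e = g e) : f = g := by
  ext v
  obtain ⟨T, rfl⟩ := h.gen v
  rw [map_smul, map_smul, hfg]

namespace IsPresentation

variable {N N' : ModuleCat.{u} (DiffOp d)} {e : N} {Q : DiffOp d} {e' : N'} {Q' : DiffOp d}

/-- The sequence `0 → D → D → N → 0` defined by a presentation. -/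
abbrev complex (h : IsPresentation e Q) : ShortComplex (ModuleCat.{u} (DiffOp d)) :=
  ShortComplex.mk (rightMul d Q)
    (ModuleCat.ofHom (LinearMap.toSpanSingleton (DiffOp d) N e) : ModuleCat.of (DiffOp d)
      (DiffOp d) ⟶ N)
    (by
      ext
      simpa [rightMul] using h.rel)

theorem shortExact [IsDomain R] (h : IsPresentation e Q) (hQ : Q ≠ 0) : h.complex.ShortExact where
  exact := (ShortComplex.moduleCat_exact_iff _).2 fun T hT => by
    obtain ⟨U, rfl⟩ := h.ann T hT
    exact ⟨U, rfl⟩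
  mono_f := (ModuleCat.mono_iff_injective _).2 fun T T' hT => mul_right_cancel₀ hQ hT
  epi_g := (ModuleCat.epi_iff_surjective _).2 h.gen

/-- The class of the extension defined by a presentation generates the dual module. -/
def dualGen [IsDomain R] (h : IsPresentation e Q) (hQ : Q ≠ 0) : VerdierDual d N :=
  (h.shortExact hQ).extClass

theorem smul_dualGen [IsDomain R] (h : IsPresentation e Q) (hQ : Q ≠ 0) (P : DiffOp d) :
    P • h.dualGen hQ = (h.shortExact hQ).extClass.comp
      (Abelian.Ext.mk₀ (rightMul d (adjoint d P).unop)) (add_zero 1) := rfl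

theorem dual [IsDomain R] (h : IsPresentation e Q) (hQ : Q ≠ 0) :
    IsPresentation (h.dualGen hQ) (adjoint d Q).unop where
  rel := by
    rw [smul_dualGen, adjoint_adjoint]
    exact (h.shortExact hQ).extClass_comp
  gen x := by
    have : Projective h.complex.X₂ :=
      inferInstanceAs (Projective (ModuleCat.of (DiffOp d) (DiffOp d)))
    obtain ⟨y, hy⟩ := precomp_extClass_surjective_of_projective_X₂
      (ModuleCat.of (DiffOp d) (DiffOp d)) (h.shortExact hQ) 0 x
    obtain ⟨f, rfl⟩ := Abelian.Ext.mk₀_bijective _ _ |>.2 y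
    refine ⟨(adjoint d (f.hom 1)).unop, ?_⟩
    rw [smul_dualGen, adjoint_adjoint, ← eq_rightMul]
    exact hy
  ann P hP := by
    rw [smul_dualGen] at hP
    obtain ⟨y, hy⟩ := Abelian.Ext.contravariant_sequence_exact₁ (h.shortExact hQ) _ _
      (add_zero 1) hP
    obtain ⟨f, rfl⟩ := Abelian.Ext.mk₀_bijective _ _ |>.2 y
    rw [Abelian.Ext.mk₀_comp_mk₀] at hy
    have h1 := (Abelian.Ext.mk₀_bijective _ _).1 hy
    have h2 : Q * f.hom 1 = (adjoint d P).unop := by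
      have := congrArg (fun g => g.hom (1 : DiffOp d)) h1
      have h3 := eq_rightMul f
      change f.hom (1 * Q) = 1 * _ at this
      rw [one_mul, one_mul, h3] at this
      exact this
    exact ⟨(adjoint d (f.hom 1)).unop, by
      rw [← adjoint_mul, h2, adjoint_adjoint]⟩

theorem map_dualGen [IsDomain R] (h : IsPresentation e Q) (hQ : Q ≠ 0) (h' : IsPresentation e' Q')
    (hQ' : Q' ≠ 0) (f : N ⟶ N') {P P' : DiffOp d} (hf : f.hom e = P • e') (hP : Q * P = P' * Q') :
    ((verdierDual d).map f.op).hom (h'.dualGen hQ') = (adjoint d P').unop • h.dualGen hQ := by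
  let φ : h.complex ⟶ h'.complex :=
    { τ₁ := rightMul d P'
      τ₂ := rightMul d P
      τ₃ := f
      comm₁₂ := by
        change rightMul d P' ≫ rightMul d Q' = rightMul d Q ≫ rightMul d P
        rw [rightMul_comp, rightMul_comp, hP]
      comm₂₃ := by
        ext
        change (1 * P) • e' = f.hom ((1 : DiffOp d) • e)
        rw [one_mul, one_smul, hf] }
  rw [smul_dualGen, adjoint_adjoint]
  exact (ShortComplex.ShortExact.extClass_naturality (h.shortExact hQ) (h'.shortExact hQ') φ).symm

theorem exists_lift (h : IsPresentation e Q) (h' : IsPresentation e' Q') (f : N ⟶ N') :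
    ∃ P P' : DiffOp d, f.hom e = P • e' ∧ Q * P = P' * Q' := by
  obtain ⟨P, hP⟩ := h'.gen (f.hom e)
  obtain ⟨P', hP'⟩ := h'.ann (Q * P) (by rw [mul_smul, hP, ← map_smul, h.rel, map_zero])
  exact ⟨P, P', hP.symm, hP'⟩

theorem verdierDual_full [IsDomain R] (h : IsPresentation e Q) (hQ : Q ≠ 0)
    (h' : IsPresentation e' Q') (hQ' : Q' ≠ 0)
    (φ : (verdierDual d).obj (Opposite.op N') ⟶ (verdierDual d).obj (Opposite.op N)) :
    ∃ f : N ⟶ N', (verdierDual d).map f.op = φ := by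
  let ψ : VerdierDual d N' →ₗ[DiffOp d] VerdierDual d N := φ.hom
  obtain ⟨T, hT⟩ := (h.dual hQ).gen (ψ (h'.dualGen hQ'))
  obtain ⟨U, hU⟩ := (h.dual hQ).ann ((adjoint d Q').unop * T) (by
    rw [mul_smul, hT, ← map_smul, (h'.dual hQ').rel, map_zero])
  have hQU : Q * (adjoint d U).unop = (adjoint d T).unop * Q' := by
    have := congrArg (fun P => (adjoint d P).unop) hU
    simp only [adjoint_mul, adjoint_adjoint] at this
    exact this.symm
  obtain ⟨f, hf⟩ := h.exists_hom (e' := (adjoint d U).unop • e') (by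
    rw [← mul_smul, hQU, mul_smul, h'.rel, smul_zero])
  refine ⟨ModuleCat.ofHom f, ModuleCat.hom_ext ((h'.dual hQ').hom_ext ?_)⟩
  refine (h.map_dualGen hQ h' hQ' (ModuleCat.ofHom f) hf hQU).trans ?_
  rw [adjoint_adjoint]
  exact hT

theorem verdierDual_faithful [IsDomain R] (h : IsPresentation e Q) (hQ : Q ≠ 0)
    (h' : IsPresentation e' Q') (hQ' : Q' ≠ 0) {f g : N ⟶ N'}
    (hfg : (verdierDual d).map f.op = (verdierDual d).map g.op) : f = g := by
  obtain ⟨P, P', hP, hPP⟩ := h.exists_lift h' f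
  obtain ⟨S, S', hS, hSS⟩ := h.exists_lift h' g
  have h1 : (adjoint d P').unop • h.dualGen hQ = (adjoint d S').unop • h.dualGen hQ :=
    (h.map_dualGen hQ h' hQ' f hP hPP).symm.trans
      ((congrArg (fun φ => φ.hom (h'.dualGen hQ')) hfg).trans (h.map_dualGen hQ h' hQ' g hS hSS))
  rw [← sub_eq_zero, ← sub_smul] at h1
  obtain ⟨U, hU⟩ := (h.dual hQ).ann _ h1
  have h2 := congrArg (fun P => (adjoint d P).unop) hU
  simp only [map_sub, MulOpposite.unop_sub, adjoint_mul, adjoint_adjoint] at h2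
  have h3 : P - S = (adjoint d U).unop * Q' := by
    refine mul_left_cancel₀ hQ ?_
    rw [mul_sub, hPP, hSS, ← sub_mul, h2, mul_assoc]
  refine ModuleCat.hom_ext (h.hom_ext ?_)
  rw [hP, hS, ← sub_eq_zero, ← sub_smul, h3, mul_smul, h'.rel, smul_zero]

end IsPresentation

end Verdier

/-! ### The extension functor from the punctured disk -/

section LowerShriek

variable {K : Type u} [Field K]

theorem X_pow_smul_eq_zero {M : PMod} {v : M} {m : ℕ}
    (h : diskToPunctured K (of _ (X ^ m)) • v = 0) : v = 0 := by
  rw [diskToPunctured_of_smul] at h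
  exact X_pow_smul_injective m (h.trans (smul_zero _).symm)

theorem Nonresonant.exists_smul_eq {n : ℕ} {Q : DO} (hQ : Nonresonant n Q)
    {M : PMod} {e : M} (hQe : diskToPunctured K Q • e = 0) (m : ℕ) (v : M)
    (l : DO) (h : diskToPunctured K (of _ (X ^ m)) • v =
      diskToPunctured K l • e) : ∃ T, diskToPunctured K T • e = v := by
  induction m generalizing v l with
  | zero => exact ⟨l, by simpa using h.symm⟩
  | succ m ih =>
    obtain ⟨S, U, rfl⟩ := hQ.exists_eq_X_mul_add l
    refine ih v S ?_
    rw [map_add, map_mul, map_mul _ U, add_smul, mul_smul, mul_smul, hQe, smul_zero, add_zero,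
      pow_succ', map_mul, map_mul, mul_smul, ← sub_eq_zero, ← smul_sub] at h
    rw [← sub_eq_zero]
    exact X_pow_smul_eq_zero (m := 1) (by rw [pow_one]; exact h)

theorem Nonresonant.exists_eq_mul_of_X_pow_mul {n : ℕ} {Q : DO} (hQ : Nonresonant n Q) (N : ℕ)
    {S T : DO} (h : of _ (X ^ N) * T = S * Q) : ∃ U, T = U * Q := by
  induction N generalizing T S with
  | zero => exact ⟨S, by simpa using h⟩
  | succ N ih =>
    rw [pow_succ', map_mul, mul_assoc] at h
    obtain ⟨U, hU⟩ := hQ.exists_eq_mul_of_X_mul h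
    exact ih hU

/-- A holonomic module over the punctured disk has a nonresonant presentation: multiply a cyclic
vector by a large negative power of `X`. -/
theorem exists_nonresonant_presentation [CharZero K] {M : PMod}
    (hM : Hol K M) : ∃ (n : ℕ) (Q : DO) (e : (lowerStar K).obj M),
      Nonresonant n Q ∧ IsPresentation e Q := by
  have := finite_of_hol hM
  obtain ⟨n, c, b, hc, hb, h⟩ := exists_euler_operator K M
  obtain ⟨N, hN⟩ := exists_shift_ne_zero hb
  obtain ⟨Q, e, hlead, hsymb, hQe, hann, hgen⟩ := h (-N)
  have hQ : Nonresonant n Q := ⟨⟨c, hc, hlead⟩, _, hsymb, fun m => by simpa using hN m⟩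
  refine ⟨n, Q, e, hQ, hQe, fun (v : M) => ?_, fun T (hT : diskToPunctured K T • e = 0) => ?_⟩
  · obtain ⟨m, l, -, hl⟩ := hgen v
    exact hQ.exists_smul_eq hQe m v l (by rw [diskToPunctured_of_smul]; exact hl)
  · obtain ⟨N, S, l, hl, hS⟩ := hlead.exists_pow_mul_eq hc T
    have h1 := congrArg (fun P => diskToPunctured K P • e) hS
    simp only [map_add, map_mul, add_smul, mul_smul, hT, hQe, smul_zero, zero_add] at h1
    rw [hann l hl h1.symm, add_zero] at hS
    exact hQ.exists_eq_mul_of_X_pow_mul N hS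

theorem lowerStar_full {M N : PMod}
    (g : (lowerStar K).obj M ⟶ (lowerStar K).obj N) : ∃ f : M ⟶ N, (lowerStar K).map f = g := by
  let g' : M →+ N := g.hom.toAddMonoidHom
  have hg : ∀ (P : DO) (v : M), g' (diskToPunctured K P • v) = diskToPunctured K P • g' v :=
    fun P v => g.hom.map_smul P v
  have hof : ∀ (a : O) (v : M), g' (a • v) = a • g' v := fun a v => by
    rw [← diskToPunctured_of_smul, hg, diskToPunctured_of_smul]
  have hs := smul_induction dK (M := M) (N := N) g' (fun a v => ?_) fun v => ?_
  · exact ⟨ModuleCat.ofHom { g' with map_smul' := hs }, rfl⟩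
  · obtain ⟨n, b, hb⟩ := exists_pow_mul_eq_ofPowerSeries a
    refine X_pow_smul_injective (K := K) (V := N) n ?_
    change ϖ ^ n • _ = ϖ ^ n • _
    rw [← hof, of_smul_eq, of_smul_eq, X_pow_smul, X_pow_smul, ← mul_smul, ← mul_smul, hb,
      ofPowerSeries_smul, ofPowerSeries_smul, hof]
  · rw [← diskToPunctured_del, hg]

theorem linDual_full {M N : PMod} (hM : Hol K M) (hN : Hol K N)
    (ψ : (linDual dK).obj (Opposite.op N) ⟶ (linDual dK).obj (Opposite.op M)) :
    ∃ f : M ⟶ N, (linDual dK).map f.op = ψ := by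
  have : Module.Finite Kx (under dK M) := hM
  have : Module.Finite Kx (under dK N) := hN
  let ψ' : LinDual dK N →ₗ[Kx] LinDual dK M :=
    { toFun := fun φ => ψ.hom φ
      map_add' := fun φ φ' => ψ.hom.map_add φ φ'
      map_smul' := fun r φ => by
        have := ψ.hom.map_smul (of dK r) φ
        exact ((congrArg ψ.hom (LinDual.of_smul _ N r φ)).symm.trans this).trans
          (LinDual.of_smul _ M r (ψ.hom φ)) }
  have hψ : ∀ φ, ψ' (LinDual.nabla _ N φ) = LinDual.nabla _ M (ψ' φ) := fun φ => by
    have := ψ.hom.map_smul (del dK) φ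
    exact ((congrArg ψ.hom (LinDual.del_smul _ N φ)).symm.trans this).trans
      (LinDual.del_smul _ M (ψ.hom φ))
  let f : under dK M →ₗ[Kx] under dK N :=
    (Module.evalEquiv Kx (under dK N)).symm.toLinearMap ∘ₗ ψ'.dualMap ∘ₗ
      Module.Dual.eval Kx (under dK M)
  have hf : ∀ (φ : LinDual dK N) m, φ (f m) = ψ' φ m := fun φ m =>
    Module.apply_evalEquiv_symm_apply (R := Kx) (M := under dK N) φ _
  have hfn : ∀ m, f (nabla _ M m) = nabla _ N (f m) := fun m => by
    rw [← sub_eq_zero, ← Module.forall_dual_apply_eq_zero_iff Kx]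
    intro φ
    have h1 := LinearMap.congr_fun (hψ φ) m
    have h2 : ψ' (LinDual.nabla _ N φ) m = dK (φ (f m)) - φ (nabla _ N (f m)) := (hf _ m).symm
    have h3 : LinDual.nabla _ M (ψ' φ) m = dK (ψ' φ m) - ψ' φ (nabla _ M m) := rfl
    rw [map_sub, hf, sub_eq_zero, ← sub_right_inj (a := dK (ψ' φ m)), ← h3, ← h1, h2, hf]
  let f' : M →+ N := f.toAddMonoidHom
  have hs := smul_induction dK (M := M) (N := N) f' (fun r m => f.map_smul r m) hfn
  refine ⟨ModuleCat.ofHom { f' with map_smul' := hs }, ?_⟩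
  ext φ
  exact LinearMap.ext fun m => hf φ m

theorem linDual_faithful {M N : PMod} (hN : Hol K N) {f g : M ⟶ N}
    (h : (linDual dK).map f.op = (linDual dK).map g.op) : f = g := by
  have : Module.Finite Kx (under dK N) := hN
  ext m
  refine sub_eq_zero.1 ((Module.forall_dual_apply_eq_zero_iff Kx
    (show under dK N from f.hom m - g.hom m)).1 fun φ => ?_)
  have := LinearMap.congr_fun (congrArg (fun ψ => ψ.hom φ) h) m
  exact (φ.map_sub (show under dK N from f.hom m) (g.hom m)).trans (sub_eq_zero.2 this)

theorem hol_linDual {M : PMod} (hM : Hol K M) :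
    Hol K ((linDual dK).obj (Opposite.op M)) := by
  have : Module.Finite Kx (under dK M) := hM
  let i : LinDual dK M →ₗ[Kx]
      under dK ((linDual dK).obj (Opposite.op M)) :=
    { toFun := fun φ => φ
      map_add' := fun _ _ => rfl
      map_smul' := fun r φ => (LinDual.of_smul _ M r φ).symm }
  exact Module.Finite.of_surjective i fun φ => ⟨φ, rfl⟩

theorem lowerShriek_full [CharZero K] {M N : PMod} (hM : Hol K M)
    (hN : Hol K N) (φ : (lowerShriek K).obj M ⟶ (lowerShriek K).obj N) :
    ∃ f : M ⟶ N, (lowerShriek K).map f = φ := by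
  obtain ⟨n, Q, e, hQ, he⟩ := exists_nonresonant_presentation (hol_linDual hM)
  obtain ⟨n', Q', e', hQ', he'⟩ := exists_nonresonant_presentation (hol_linDual hN)
  obtain ⟨g, rfl⟩ := he'.verdierDual_full hQ'.ne_zero he hQ.ne_zero φ
  obtain ⟨g, rfl⟩ := lowerStar_full g
  obtain ⟨f, rfl⟩ := linDual_full hM hN g
  exact ⟨f, rfl⟩

theorem lowerShriek_faithful [CharZero K] {M N : PMod} (hM : Hol K M)
    (hN : Hol K N) {f g : M ⟶ N} (h : (lowerShriek K).map f = (lowerShriek K).map g) : f = g := by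
  obtain ⟨n, Q, e, hQ, he⟩ := exists_nonresonant_presentation (hol_linDual hM)
  obtain ⟨n', Q', e', hQ', he'⟩ := exists_nonresonant_presentation (hol_linDual hN)
  have h1 := he'.verdierDual_faithful hQ'.ne_zero he hQ.ne_zero
    (f := (lowerStar K).map ((linDual dK).map f.op))
    (g := (lowerStar K).map ((linDual dK).map g.op)) h
  refine linDual_faithful hN ?_
  ext φ
  exact congrArg (fun ψ => ψ.hom φ) h1

end LowerShriek

/-! ### The essential image of the extension functor -/

section EssentialImage

open scoped TensorProduct

variable {K : Type u} [Field K]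

theorem IsPresentation.exists_equiv {R : Type u} [CommRing R] {d : Der R} {N N' : Type*}
    [AddCommGroup N] [Module (DiffOp d) N] [AddCommGroup N'] [Module (DiffOp d) N'] {e : N}
    {e' : N'}
    {Q : DiffOp d} (h : IsPresentation e Q) (h' : IsPresentation e' Q) :
    ∃ f : N ≃ₗ[DiffOp d] N', f e = e' := by
  obtain ⟨f, hf⟩ := h.exists_hom h'.rel
  obtain ⟨g, hg⟩ := h'.exists_hom h.rel
  refine ⟨LinearEquiv.ofLinearMap f g (h'.hom_ext ?_) (h.hom_ext ?_), hf⟩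
  · rw [LinearMap.comp_apply, hg, hf, LinearMap.id_apply]
  · rw [LinearMap.comp_apply, hf, hg, LinearMap.id_apply]

theorem IsPresentation.map {R : Type u} [CommRing R] {d : Der R} {N N' : Type*}
    [AddCommGroup N] [Module (DiffOp d) N] [AddCommGroup N'] [Module (DiffOp d) N'] {e : N}
    {Q : DiffOp d} (h : IsPresentation e Q) (f : N ≃ₗ[DiffOp d] N') : IsPresentation (f e) Q where
  rel := by rw [← map_smul, h.rel, map_zero]
  gen v := by
    obtain ⟨T, hT⟩ := h.gen (f.symm v)
    exact ⟨T, by rw [← map_smul, hT, f.apply_symm_apply]⟩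
  ann T hT := h.ann T (f.injective (by rw [map_smul, hT, map_zero]))

theorem isPresentation_mk {R : Type u} [CommRing R] {d : Der R} (Q : DiffOp d) :
    IsPresentation (Submodule.Quotient.mk 1 : DiffOp d ⧸ span (DiffOp d) {Q}) Q where
  rel := by
    rw [← Submodule.Quotient.mk_smul, mk_eq_zero, smul_eq_mul, mul_one]
    exact Submodule.mem_span_singleton_self Q
  gen v := by
    obtain ⟨T, rfl⟩ := Submodule.Quotient.mk_surjective _ v
    exact ⟨T, by rw [← Submodule.Quotient.mk_smul, smul_eq_mul, mul_one]⟩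
  ann T hT := by
    rw [← Submodule.Quotient.mk_smul, mk_eq_zero, smul_eq_mul, mul_one,
      Submodule.mem_span_singleton] at hT
    obtain ⟨U, rfl⟩ := hT
    exact ⟨U, rfl⟩

namespace Nonresonant

variable {n : ℕ} {Q : DO} (h : Nonresonant n Q)

include h

/-- The operator `d/dX` is bijective on the module presented by the adjoint of a nonresonant
operator, because a nonresonant operator is bijective on power series. -/
theorem del_surjective {N : Type*} [AddCommGroup N] [Module DO N] {g : N}
    (hg : IsPresentation g (adjoint _ Q).unop) (v : N) :
    ∃ w : N, del dO • w = v := by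
  let := powerSeriesModule K
  obtain ⟨P, rfl⟩ := hg.gen v
  obtain ⟨q, hq, hq'⟩ := h.symbol
  obtain ⟨f, hf⟩ := hq.powerSeries_surjective hq' ((adjoint _ P).unop • (1 : O))
  obtain ⟨S, hS⟩ := exists_eq_mul_del (P := (adjoint _ P).unop - Q * of _ f) (by
    rw [sub_smul, mul_smul, of_smul_powerSeries, mul_one, hf, sub_self])
  have h1 := congrArg (fun T => (adjoint _ T).unop) hS
  simp only [map_sub, MulOpposite.unop_sub, adjoint_mul, adjoint_of,
    adjoint_del, adjoint_adjoint] at h1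
  refine ⟨(-(adjoint _ S).unop) • g, ?_⟩
  rw [← mul_smul, mul_neg, ← neg_mul, ← h1, sub_smul, mul_smul, hg.rel, smul_zero, sub_zero]

theorem del_injective {N : Type*} [AddCommGroup N] [Module DO N] {g : N}
    (hg : IsPresentation g (adjoint _ Q).unop) {v : N}
    (hv : del dO • v = 0) : v = 0 := by
  let := powerSeriesModule K
  obtain ⟨P, rfl⟩ := hg.gen v
  obtain ⟨q, hq, hq'⟩ := h.symbol
  rw [← mul_smul] at hv
  obtain ⟨U, hU⟩ := hg.ann _ hv
  have h1 := congrArg (fun T => (adjoint _ T).unop) hU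
  simp only [adjoint_mul, adjoint_del, adjoint_adjoint] at h1
  have hdel : del dO • (1 : O) = 0 := by
    rw [del_smul_powerSeries, ← map_one C, powerD_C]
  obtain ⟨S, hS⟩ := exists_eq_mul_del (P := (adjoint _ U).unop) (hq.powerSeries_injective hq' (by
      rw [← mul_smul, ← h1, mul_smul, neg_smul, hdel, neg_zero, smul_zero]))
  rw [hS, ← mul_assoc, mul_neg, ← neg_mul] at h1
  have h2 := congrArg (fun T => (adjoint _ T).unop) (mul_right_cancel₀ del_ne_zero h1)
  simp only [map_neg, MulOpposite.unop_neg, adjoint_mul, adjoint_adjoint] at h2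
  rw [← neg_neg P, h2, neg_smul, mul_smul, hg.rel, smul_zero, neg_zero]

theorem exists_isLattice {V : ModuleCat.{u} DO} {g : V} (hg : IsPresentation g (adjoint _ Q).unop) :
    ∃ L : Submodule O V, IsLattice L ∧ g ∈ L := by
  let f : DO →ₗ[O] V :=
    { toFun := fun P => P • g
      map_add' := fun P P' => add_smul P P' g
      map_smul' := fun r P => mul_smul (of dO r) P g }
  refine ⟨(eulerSpan K (n + 1)).map f, ⟨(eulerSpan_fg _).map f, fun v => ?_⟩, 1, ?_, one_smul _ g⟩
  · obtain ⟨c, hc, hQ⟩ := h.adjoint_lead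
    obtain ⟨P, rfl⟩ := hg.gen v
    obtain ⟨N, T, l, hl, hN⟩ := hQ.exists_pow_mul_eq hc P
    refine ⟨N, l, eulerSpan_mono n.le_succ hl, ?_⟩
    change l • g = of dO (X ^ N) • P • g
    rw [← mul_smul, hN, add_smul, mul_smul, hg.rel, smul_zero, zero_add]
  · exact pow_zero (diskEuler K) ▸ pow_mem_eulerSpan (i := 0) n.succ_pos

end Nonresonant

theorem diskToPunctured_injective : Function.Injective (diskToPunctured K) := by
  refine (injective_iff_map_eq_zero _).2 fun P hP => ?_
  obtain ⟨p, rfl⟩ := P.exists_eval₂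
  rw [Polynomial.hom_eval₂, diskToPunctured_del] at hP
  have h1 : (diskToPunctured K).comp (of dO) = (of dK).comp (ofPowerSeries ℤ K) :=
    RingHom.ext diskToPunctured_of
  rw [h1, ← Polynomial.eval₂_map] at hP
  rw [(Polynomial.map_eq_zero_iff HahnSeries.ofPowerSeries_injective).1
    (DiffOp.eq_zero_of_eval₂_eq_zero hP), Polynomial.eval₂_zero]

theorem exists_X_pow_mul_eq (T : DK) : ∃ (N : ℕ) (S : DO),
    diskToPunctured K (of _ (X ^ N)) * T = diskToPunctured K S := by
  obtain ⟨p, rfl⟩ := T.exists_eval₂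
  induction p using Polynomial.induction_on' with
  | add p q hp hq =>
    obtain ⟨N, S, hS⟩ := hp
    obtain ⟨N', S', hS'⟩ := hq
    refine ⟨N + N', of _ (X ^ N') * S + of _ (X ^ N) * S', ?_⟩
    rw [eval₂_add, mul_add, map_add, map_mul, map_mul, ← hS, ← hS', ← mul_assoc,
      ← mul_assoc, ← map_mul, ← map_mul, ← map_mul, ← map_mul, ← pow_add, ← pow_add, add_comm N']
  | monomial n a =>
    obtain ⟨N, b, hb⟩ := exists_pow_mul_eq_ofPowerSeries a
    refine ⟨N, of _ b * del _ ^ n, ?_⟩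
    rw [Polynomial.eval₂_monomial, map_mul, map_pow _ (del _), diskToPunctured_del,
      diskToPunctured_of, diskToPunctured_of, ← mul_assoc, ← map_mul, ← hb, map_pow,
      ofPowerSeries_X]

/-- The canonical map from a holonomic module to its double dual. -/
theorem exists_linDual_linDual_equiv {M : PMod} (hM : Hol K M) : Nonempty (M ≃ₗ[DK] (linDual dK).obj
      (Opposite.op ((linDual dK).obj (Opposite.op M)))) := by
  have : Module.Finite Kx (under dK M) := hM
  let M' : PMod := (linDual dK).obj (Opposite.op M)
  have hsm : ∀ (r : Kx) (φ : LinDual dK M),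
      (r • (show under dK M' from φ)) = (r • φ : LinDual dK M) :=
    fun r φ => LinDual.of_smul _ M r φ
  let i : under dK M' ≃ₗ[Kx] Module.Dual Kx (under dK M) :=
    { toFun := fun φ => φ, invFun := fun φ => φ, left_inv := fun _ => rfl, right_inv := fun _ => rfl
      map_add' := fun _ _ => rfl, map_smul' := fun r φ => hsm r φ }
  let E : under dK M ≃ₗ[Kx] LinDual dK M' := (Module.evalEquiv Kx (under dK M)).trans i.dualMap
  have hE : ∀ m φ, E m φ = i φ m := fun m φ => rfl
  let E' : M →+ LinDual dK M' := E.toLinearMap.toAddMonoidHom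
  have hs := smul_induction dK (M := M) (N := LinDual dK M') E'
    (fun r m => (E.map_smul r m).trans (LinDual.of_smul _ M' r (E m)).symm) fun m => by
      rw [LinDual.del_smul]
      refine LinearMap.ext fun φ => ?_
      have h1 : i (nabla _ M' φ) m = dK (i φ m) - i φ (nabla _ M m) :=
        LinearMap.congr_fun (LinDual.del_smul _ M φ) m
      change i φ (nabla _ M m) = dK (i φ m) - i (nabla _ M' φ) m
      rw [h1, sub_sub_cancel]
  exact ⟨{ E' with
    map_smul' := hs, invFun := E.symm, left_inv := E.left_inv, right_inv := E.right_inv }⟩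

theorem hol_of_map_lowerStar {V : Type*} [AddCommGroup V] [Module DO V] [Module O V]
    [IsScalarTower O DO V] {W : PMod}
    (f : V →ₗ[DO] (lowerStar K).obj W) {L : Submodule O V} (hL : L.FG)
    (h : ∀ w : (lowerStar K).obj W, ∃ n, ∃ v ∈ L,
      of dO (X ^ n) • w = f v) : Hol K W := by
  let f' : V →ₗ[O] W :=
    { toFun := f
      map_add' := f.map_add
      map_smul' := fun r v => by
        rw [← of_smul_eq (d := dO), map_smul]
        exact lowerStar_smul W r (f v) }
  have hW : IsLattice (L.map f') := ⟨hL.map f', fun w => by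
    obtain ⟨n, v, hv, h⟩ := h w
    exact ⟨n, v, hv, h.symm.trans (lowerStar_smul W _ w)⟩⟩
  exact hW.finite

section BaseChange

variable {R S : Type u} [CommRing R] [CommRing S] [Algebra R S] {d : Der R} {e : Der S}
  (he : ∀ r, e (algebraMap R S r) = algebraMap R S (d r)) (M : ModuleCat.{u} (DiffOp d))

theorem baseChange_of_smul (s : S) (x : S ⊗[R] under d M) :
    (of e s • (show baseChange d e he M from x) : baseChange d e he M) =
      (s • x : S ⊗[R] under d M) := by
  change (DiffOp.lift _ _ _ _ (of _ s) : AddMonoid.End _) x = _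
  rw [lift_of]
  rfl

theorem baseChange_del_smul (x : S ⊗[R] under d M) :
    (del e • (show baseChange d e he M from x) : baseChange d e he M) =
      baseChangeNabla d e he M x := by
  change (DiffOp.lift _ _ _ _ (del _) : AddMonoid.End _) x = _
  rw [lift_del]

end BaseChange

/-- The restriction of a module over the disk to the punctured disk. -/
theorem exists_restriction (V : ModuleCat.{u} DO) {L : Submodule O V} (hL : IsLattice L) :
    ∃ (W : PMod) (ι : V →ₗ[DO] (lowerStar K).obj W), Hol K W ∧
      (∀ v, ι v = 0 → ∃ m, of dO (X ^ m) • v = 0) ∧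
      ∀ w, ∃ m v, of dO (X ^ m) • w = ι v := by
  let W := baseChange dO dK (fun f => laurent_derivative_ofPowerSeries K f) V
  let j := TensorProduct.mk O Kx (under dO V) 1
  have hj : IsLocalizedModule (Submonoid.powers ϖ) j :=
    (isLocalizedModule_iff_isBaseChange _ Kx _).2 (TensorProduct.isBaseChange _ _ _)
  have hofp : ∀ (f : O) (x : Kx ⊗[O] under dO V),
      (of dO f • (show (lowerStar K).obj W from x) : (lowerStar K).obj W) =
        (f • x : Kx ⊗[O] under dO V) := fun f x => by
    change diskToPunctured K (of _ f) • (show W from x) = _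
    rw [diskToPunctured_of]
    exact (baseChange_of_smul _ V _ x).trans (algebraMap_smul Kx f x)
  let j' : V →+ (lowerStar K).obj W := j.toAddMonoidHom
  have hs := smul_induction dO (M := V) (N := (lowerStar K).obj W) j'
    (fun f v => (j.map_smul f v).trans (hofp f (j v)).symm) fun v => by
      change j _ = diskToPunctured K (del _) • (show W from j v)
      rw [diskToPunctured_del]
      refine Eq.trans ?_ (baseChange_del_smul _ V (j v)).symm
      change _ = dK 1 ⊗ₜ[O] (show under dO V from v) + j (nabla dO V v)
      rw [← map_one HahnSeries.C, laurentD_C, TensorProduct.zero_tmul, zero_add]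
      rfl
  let ι : V →ₗ[DO] (lowerStar K).obj W := { j' with map_smul' := hs }
  have hcok : ∀ w, ∃ m v, of dO (X ^ m) • w = ι v := fun w => by
    obtain ⟨⟨v, _, m, rfl⟩, hv⟩ := hj.surj w
    exact ⟨m, v, (hofp _ w).trans hv⟩
  refine ⟨W, ι, ?_, fun v hv => ?_, hcok⟩
  · refine hol_of_map_lowerStar ι hL.fg fun w => ?_
    obtain ⟨m, v, hv⟩ := hcok w
    obtain ⟨n, hn⟩ := hL.full v
    refine ⟨n + m, ϖ ^ n • v, hn, ?_⟩
    rw [pow_add, map_mul, mul_smul, hv, ← map_smul]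
    rfl
  · obtain ⟨⟨_, m, rfl⟩, hm⟩ := (hj.eq_zero_iff (m := v)).1 hv
    exact ⟨m, hm⟩

/-- A module over the punctured disk with a presentation defined over the disk. -/
theorem Nonresonant.exists_presentation {n : ℕ} {Q : DO} (hQ : Nonresonant n Q) :
    ∃ (P : PMod) (e : (lowerStar K).obj P), Hol K P ∧ IsPresentation e Q := by
  let P := ModuleCat.of DK (DK ⧸ span DK {diskToPunctured K Q})
  let e : P := Submodule.Quotient.mk 1
  have he : IsPresentation e (diskToPunctured K Q) := isPresentation_mk _
  obtain ⟨c, hc, hlead⟩ := hQ.lead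
  have hgen : ∀ v : P, ∃ m, ∃ l ∈ eulerSpan K n,
      diskToPunctured K (of _ (X ^ m)) • v = diskToPunctured K l • e := fun v => by
    obtain ⟨T, rfl⟩ := he.gen v
    obtain ⟨N, S, hS⟩ := exists_X_pow_mul_eq T
    obtain ⟨N', U, l, hl, hN'⟩ := hlead.exists_pow_mul_eq hc S
    refine ⟨N' + N, l, hl, ?_⟩
    rw [pow_add, map_mul, map_mul, mul_smul, ← mul_smul _ T, hS, ← mul_smul, ← map_mul, hN',
      map_add, map_mul, add_smul, mul_smul, he.rel, smul_zero, zero_add]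
  refine ⟨P, e, ?_, he.rel, fun v => ?_, fun T (hT : diskToPunctured K T • e = 0) => ?_⟩
  · have : IsScalarTower O DO DO := ⟨fun r P P' => mul_assoc (of dO r) P P'⟩
    refine hol_of_map_lowerStar (LinearMap.toSpanSingleton DO ((lowerStar K).obj P) e)
      (eulerSpan_fg n) fun v => ?_
    obtain ⟨m, l, hl, h⟩ := hgen v
    exact ⟨m, l, hl, h⟩
  · obtain ⟨m, l, -, h⟩ := hgen v
    exact hQ.exists_smul_eq he.rel m v l h
  · obtain ⟨S, hS⟩ := he.ann _ hT
    obtain ⟨N, S', hS'⟩ := exists_X_pow_mul_eq S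
    refine hQ.exists_eq_mul_of_X_pow_mul N (S := S') (diskToPunctured_injective ?_)
    rw [map_mul, map_mul, hS, ← mul_assoc, hS']

/-- A vector which generates `V` up to `X`-torsion generates `V` when `d/dX` is surjective: the
quotient is supported at the origin, and `d/dX` is not surjective on such a module unless it
vanishes. -/
theorem surjective_of_torsion [CharZero K] {V : Type u} [AddCommGroup V] [Module DO V]
    (hs : ∀ v : V, ∃ w : V, del dO • w = v) {v : V}
    (h : ∀ x : V, ∃ (m : ℕ) (l : DO), of dO (X ^ m) • x = l • v)
    (x : V) : ∃ T : DO, T • v = x := by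
  rw [← Submodule.mem_span_singleton, ← mk_eq_zero]
  refine eq_zero_of_torsion_of_surjective (K := K) (fun y => ?_) (fun y => ?_) _
  · obtain ⟨y, rfl⟩ := Submodule.Quotient.mk_surjective _ y
    obtain ⟨m, l, hl⟩ := h y
    refine ⟨m, ?_⟩
    rw [← Submodule.Quotient.mk_smul, hl, mk_eq_zero]
    exact smul_mem _ _ (Submodule.mem_span_singleton_self v)
  · obtain ⟨y, rfl⟩ := Submodule.Quotient.mk_surjective _ y
    obtain ⟨w, rfl⟩ := hs y
    exact ⟨Submodule.Quotient.mk w, by rw [← Submodule.Quotient.mk_smul]⟩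

/-- Solutions of `P` lift along a map with torsion kernel and cokernel. -/
theorem HasSymbol.exists_lift {P : DO} {q : K[X]} (h : HasSymbol P q)
    (hq : ∀ m : ℕ, q.eval (-((m : K) + 1)) ≠ 0) {V W : Type u} [AddCommGroup V]
    [Module DO V] [AddCommGroup W] [Module DO W] (f : V →ₗ[DO] W)
    (hker : ∀ v, f v = 0 → ∃ m, of dO (X ^ m) • v = 0)
    (hcok : ∀ w, ∃ m v, of dO (X ^ m) • w = f v) {w : W}
    (hw : P • w = 0) : ∃ v, f v = w ∧ P • v = 0 := by
  obtain ⟨m, v, hv⟩ := hcok w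
  have h0 := h.eq_zero_of_torsion (v := (LinearMap.range f).mkQ w) hq m
    (by rw [← map_smul, hv]; exact (mk_eq_zero _).2 ⟨v, rfl⟩)
    (by rw [← map_smul, hw, map_zero])
  obtain ⟨v₁, rfl⟩ := (mk_eq_zero _).1 h0
  obtain ⟨m, hm⟩ := hker (P • v₁) (by rw [map_smul, hw])
  obtain ⟨t, ht, htm⟩ := h.exists_smul_eq_of_torsion hq m hm
  have hft : f t = 0 := h.eq_zero_of_torsion hq m (by rw [← map_smul, htm, map_zero])
    (by rw [← map_smul, ht, map_smul, hw])
  exact ⟨v₁ - t, by rw [map_sub, hft, sub_zero], by rw [smul_sub, ht, sub_self]⟩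

/-- A module with bijective derivation is determined by a presentation of its restriction to the
punctured disk: torsion modules on which the derivation is surjective vanish. -/
theorem exists_presentation_adjoint [CharZero K] {V : ModuleCat.{u} DO}
    {L : Submodule O V} (hL : IsLattice L)
    (hs : ∀ v : V, ∃ w : V, del dO • w = v)
    (hi : ∀ v : V, del dO • v = 0 → v = 0) :
    ∃ (n : ℕ) (Q : DO) (v : V), Nonresonant n Q ∧ IsPresentation v (adjoint _ Q).unop := by
  obtain ⟨W, ι, hW, hker, hcok⟩ := exists_restriction V hL
  have := finite_of_hol hW
  obtain ⟨n, c, b, hc, hb, h⟩ := exists_euler_operator K W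
  obtain ⟨N, hN⟩ := exists_shift_ne_zero (b := b.comp (-1 - PX)) (fun h0 => hb (by
    have := congrArg (fun p => p.comp (-1 - PX)) h0
    simpa [Polynomial.comp_assoc] using this))
  obtain ⟨R, w, hlead, hsymb, hRw, hann, hgen⟩ := h N
  have hr : ∀ m : ℕ, (b.comp (PX - PC ((N : ℤ) : K))).eval (-((m : K) + 1)) ≠ 0 := fun m => by
      convert hN m using 1
      simp only [Polynomial.eval_comp, Polynomial.eval_sub, eval_X, eval_C,
        Polynomial.eval_neg, Polynomial.eval_one, Int.cast_natCast]
      congr 1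
      ring
  have hQ : Nonresonant n (adjoint _ R).unop := by
    refine ⟨⟨_, mul_ne_zero (by simp) hc, hlead.adjoint⟩, _, hsymb.adjoint, fun m => ?_⟩
    convert hr m using 1
    rw [Polynomial.eval_comp]
    congr 1
    simp
    ring
  obtain ⟨v, hιv, hRv⟩ := hsymb.exists_lift hr ι hker hcok hRw
  refine ⟨n, _, v, hQ, ?_⟩
  rw [adjoint_adjoint]
  refine ⟨hRv, surjective_of_torsion hs fun x => ?_, fun P hP => ?_⟩
  · obtain ⟨m, l, -, hl⟩ := hgen (ι x)
    obtain ⟨m', hm'⟩ := hker (of _ (X ^ m) • x - l • v) (by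
      rw [map_sub, map_smul, map_smul, hιv, sub_eq_zero]
      exact (lowerStar_smul W _ (ι x)).trans hl)
    refine ⟨m' + m, of _ (X ^ m') * l, ?_⟩
    rwa [smul_sub, ← mul_smul, ← map_mul, ← pow_add, sub_eq_zero, ← mul_smul] at hm'
  · have hE := isPresentation_mk R
    obtain ⟨φ, hφ⟩ := hE.exists_hom hRv
    have hE' : IsPresentation (Submodule.Quotient.mk 1 : DO ⧸ span DO {R})
        (adjoint _ (adjoint _ R).unop).unop := by rwa [adjoint_adjoint]
    have h0 : ∀ x : ker φ, x = 0 := by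
      refine eq_zero_of_torsion_of_surjective (K := K) (fun x => ?_) fun x => ?_
      · obtain ⟨x, hx⟩ := x
        obtain ⟨T, rfl⟩ := hE.gen x
        obtain ⟨N, S, l, hl, hS⟩ := hlead.exists_pow_mul_eq hc T
        have h1 : l = 0 := by
          refine hann l hl ?_
          have h2 := congrArg (fun P => ι (P • v)) hS
          simp only [add_smul, mul_smul, hRv, smul_zero, zero_add] at h2
          rw [mem_ker, map_smul, hφ] at hx
          rw [hx, smul_zero, map_zero, map_smul, hιv] at h2
          exact h2.symm
        refine ⟨N, Subtype.ext ?_⟩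
        change of _ (X ^ N) • T • _ = (0 : _)
        rw [← mul_smul, hS, h1, add_zero, mul_smul, hE.rel, smul_zero]
      · obtain ⟨y, hy⟩ := hQ.del_surjective hE' x.1
        refine ⟨⟨y, hi _ ?_⟩, Subtype.ext hy⟩
        rw [← map_smul, hy]
        exact x.2
    exact hE.ann P (congrArg Subtype.val (h0 ⟨P • _, by rw [mem_ker, map_smul, hφ, hP]⟩))

/-- The extension by zero of a holonomic module has a presentation by the adjoint of a nonresonant
operator. -/
theorem exists_presentation_lowerShriek [CharZero K] {M : PMod}
    (hM : Hol K M) : ∃ (n : ℕ) (Q : DO) (g : (lowerShriek K).obj M), Nonresonant n Q ∧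
      IsPresentation g (adjoint _ Q).unop := by
  obtain ⟨n, Q, e, hQ, he⟩ := exists_nonresonant_presentation (hol_linDual hM)
  exact ⟨n, Q, he.dualGen hQ.ne_zero, hQ, he.dual hQ.ne_zero⟩

/-- The modules `j_! M` are those with a lattice on which the derivation is bijective. -/
theorem exists_lowerShriek_equiv [CharZero K] {V : ModuleCat.{u} DO}
    {L : Submodule O V} (hL : IsLattice L)
    (hs : ∀ v : V, ∃ w : V, del dO • w = v)
    (hi : ∀ v : V, del dO • v = 0 → v = 0) :
    ∃ M : PMod, Hol K M ∧ Nonempty (V ≃ₗ[DO] (lowerShriek K).obj M) := by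
  obtain ⟨n, Q, v, hQ, hv⟩ := exists_presentation_adjoint hL hs hi
  obtain ⟨P, e, hP, he⟩ := hQ.exists_presentation
  obtain ⟨i⟩ := exists_linDual_linDual_equiv hP
  let M := (linDual dK).obj (Opposite.op P)
  let j : (lowerStar K).obj P ≃ₗ[DO] (lowerStar K).obj ((linDual dK).obj (Opposite.op M)) :=
    { i with map_smul' := fun T x => i.map_smul (diskToPunctured K T) x }
  obtain ⟨f, -⟩ := hv.exists_equiv ((he.map j).dual hQ.ne_zero)
  exact ⟨M, hol_linDual hP, ⟨f⟩⟩

end EssentialImage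

/-! ### Functions on the affine line near a closed point -/

section Density

variable {k K : Type u} [Field k] [CharZero k] [Field K] [Algebra k K] (a : K)

/-- The expansion of polynomials at the point with coordinate `a`. -/
def expansion : k[X] →+* O := Polynomial.eval₂RingHom ((C : K →+* O).comp (algebraMap k K))
    (C a + X)

theorem expansion_C (c : k) : expansion a (PC c) = C (algebraMap k K c) := by
  simp [expansion]

theorem expansion_X : expansion a (PX : k[X]) = C a + X := by
  simp [expansion]

theorem constantCoeff_expansion (q : k[X]) : constantCoeff (expansion a q) = aeval a q := by
  rw [expansion, Polynomial.coe_eval₂RingHom, Polynomial.hom_eval₂, Polynomial.aeval_def]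
  congr 1
  simp

theorem powerD_expansion (q : k[X]) :
    dO (expansion a q) = expansion a (Polynomial.derivative q) := by
  rw [expansion, Der.map_eval₂ dO (C.comp (algebraMap k K)) _ (fun c => powerD_C _),
    map_add, powerD_C, powerD_X, zero_add, mul_one]

theorem weylToDisk_of (q : k[X]) : weylToDisk K k a (of (polyD k) q) =
    of dO (expansion a q) := by
  rw [weylToDisk, DiffOp.map, lift_of]
  rfl

theorem weylToDisk_del : weylToDisk K k a (del (polyD k)) = del dO := by
  rw [weylToDisk, DiffOp.map, lift_del, map_one, one_mul]

variable {a} {p : k[X]} (hp : Irreducible p) (ha : aeval a p = 0)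

include hp ha

theorem dvd_of_aeval_eq_zero {q : k[X]} (hq : aeval a q = 0) : p ∣ q := by
  by_contra h
  obtain ⟨u, v, huv⟩ := (hp.coprime_iff_not_dvd).2 h
  have := congrArg (aeval a) huv
  rw [map_add, map_mul, map_mul, ha, hq, mul_zero, mul_zero, add_zero, map_one] at this
  exact zero_ne_one this

/-- An equation of a closed point is a uniformizer, since it is separable. -/
theorem exists_expansion_eq : ∃ h : O, expansion a p = X * h ∧ constantCoeff h ≠ 0 := by
  obtain ⟨h, hh⟩ := X_dvd_iff.2 ((constantCoeff_expansion a p).trans ha)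
  refine ⟨h, hh, fun h0 => ?_⟩
  obtain ⟨u, v, huv⟩ := hp.separable
  have h1 := congrArg constantCoeff (powerD_expansion a p)
  rw [hh, constantCoeff_expansion, Der.leibniz, powerD_X, map_add, map_mul, map_mul,
    PowerSeries.constantCoeff_X, zero_mul, h0, zero_mul, zero_add] at h1
  have := congrArg (aeval a) huv
  rw [map_add, map_mul, map_mul, ha, ← h1, mul_zero, mul_zero, add_zero, map_one] at this
  exact zero_ne_one this

theorem pow_dvd_of_X_pow_dvd_expansion {q : k[X]} {m : ℕ} (h : X ^ m ∣ expansion a q) :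
    p ^ m ∣ q := by
  obtain ⟨g, hg, hg0⟩ := exists_expansion_eq hp ha
  induction m with
  | zero => simp
  | succ m ih =>
    obtain ⟨r, rfl⟩ := ih ((pow_dvd_pow _ m.le_succ).trans h)
    rw [map_mul, map_pow, hg, mul_pow, pow_succ, mul_assoc] at h
    have h1 := (mul_dvd_mul_iff_left (pow_ne_zero m PowerSeries.X_ne_zero)).1 h
    rw [X_dvd_iff, map_mul, map_pow, mul_eq_zero, constantCoeff_expansion] at h1
    rw [pow_succ]
    exact mul_dvd_mul_left _ (dvd_of_aeval_eq_zero hp ha (h1.resolve_left (pow_ne_zero m hg0)))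

/-- Polynomials are dense in the completed local ring. -/
theorem exists_expansion_approx (hs : Function.Surjective (aeval a : k[X] → K))
    (g : O) (m : ℕ) : ∃ q : k[X], X ^ m ∣ g - expansion a q := by
  obtain ⟨h, hh, hh0⟩ := exists_expansion_eq hp ha
  induction m with
  | zero => exact ⟨0, by simp⟩
  | succ m ih =>
    obtain ⟨q, r, hr⟩ := ih
    obtain ⟨s, hs⟩ := hs (constantCoeff r / constantCoeff h ^ m)
    refine ⟨q + s * p ^ m, ?_⟩
    rw [map_add, ← sub_sub, hr, map_mul, map_pow, hh, mul_pow, mul_left_comm, ← mul_sub, pow_succ]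
    refine mul_dvd_mul_left _ (X_dvd_iff.2 ?_)
    rw [map_sub, map_mul, map_pow, constantCoeff_expansion, hs,
      div_mul_cancel₀ _ (pow_ne_zero m hh0), sub_self]

omit hp ha in
theorem continuous_of_hom {A B : ModuleCat.{u} DO} {L : Submodule O A}
    {L' : Submodule O B} (hL : IsLattice L) (hL' : IsLattice L') (f : A →ₗ[DO] B) :
    @Continuous _ _ (adicTopology K k A) (adicTopology K k B) f := by
  let f' : A →ₗ[O] B :=
    { f with map_smul' := fun r v => f.map_smul (of dO r) v }
  exact (continuous_adicTopology_iff k hL hL' f.toAddMonoidHom).2 (exists_map_pow_smul f' hL hL')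

/-- The functor `j_{x*} jo_!` is fully faithful with respect to continuous maps, because polynomials
are dense in the completed local ring. -/
theorem contFF_lowerShriek [CharZero K] (hs : Function.Surjective (aeval a : k[X] → K)) :
    ContFF ((Hol K).ι ⋙ lowerShriek K ⋙ restrictScalars (weylToDisk K k a))
      (fun M => adicTopology K k ((lowerShriek K).obj M.obj)) where
  faithful := ⟨fun {M M'} f g hfg => by
    refine ObjectProperty.hom_ext _ (lowerShriek_faithful M.property M'.property ?_)
    exact (restrictScalars (weylToDisk K k a)).map_injective hfg⟩
  cont {M M'} f := by
    obtain ⟨n, Q, g, hQ, hg⟩ := exists_presentation_lowerShriek M.property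
    obtain ⟨n', Q', g', hQ', hg'⟩ := exists_presentation_lowerShriek M'.property
    obtain ⟨L, hL, -⟩ := hQ.exists_isLattice hg
    obtain ⟨L', hL', -⟩ := hQ'.exists_isLattice hg'
    exact continuous_of_hom hL hL' ((lowerShriek K).map f.hom).hom
  full {M M'} φ hφ := by
    obtain ⟨n, Q, g, hQ, hg⟩ := exists_presentation_lowerShriek M.property
    obtain ⟨n', Q', g', hQ', hg'⟩ := exists_presentation_lowerShriek M'.property
    obtain ⟨L, hL, -⟩ := hQ.exists_isLattice hg
    obtain ⟨L', hL', -⟩ := hQ'.exists_isLattice hg'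
    let f : (lowerShriek K).obj M.obj →+ (lowerShriek K).obj M'.obj := φ.hom.toAddMonoidHom
    have hf : ∀ (P : Weyl k) v, f (weylToDisk K k a P • v) = weylToDisk K k a P • f v :=
      fun P v => φ.hom.map_smul P v
    have hs := smul_induction dO f (fun r v => ?_) fun v => ?_
    · let f' : (lowerShriek K).obj M.obj ⟶ (lowerShriek K).obj M'.obj :=
        ModuleCat.ofHom { f with map_smul' := hs }
      obtain ⟨g, hg⟩ := lowerShriek_full M.property M'.property f'
      exact ⟨ObjectProperty.homMk g, by
        change (restrictScalars (weylToDisk K k a)).map ((lowerShriek K).map g) = φ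
        rw [hg]
        rfl⟩
    · refine map_smul_of_approx f hL hL' ((continuous_adicTopology_iff k hL hL' f).1 hφ) r v
        fun n => ?_
      obtain ⟨q, hq⟩ := exists_expansion_approx hp ha hs r n
      refine ⟨_, hq, ?_⟩
      have := hf (of (polyD k) q) v
      rwa [weylToDisk_of] at this
    · rw [← weylToDisk_del (k := k) a, hf]

end Density

/-! ### The transform from a finite point to infinity -/

section FiniteToInfinity

variable {k K : Type u} [Field k] [CharZero k] [Field K] [Algebra k K] [CharZero K]

/-- A finitely generated module with an injective derivation `d/dX` vanishes, since `v` is congruent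
to its flat part `∑ (-X)ⁱ ∂ⁱv / i!` modulo `X`. -/
theorem eq_bot_of_del_injective {V : Type u} [AddCommGroup V] [Module O V] {D : V →+ V}
    (hD : IsDerivation dO D) (hi : ∀ v, D v = 0 → v = 0) {L : Submodule O V} (hL : L.FG)
    (hst : ∀ v ∈ L, D v ∈ L) : L = ⊥ := by
  refine eq_bot_of_le_smul hL fun v hv => ?_
  have hit : ∀ i, D^[i] v ∈ L := fun i => by
    induction i with
    | zero => exact hv
    | succ i ih => rw [iter_succ]; exact hst _ ih
  let b : ℕ → K := fun i => (-1) ^ i * ((i.factorial : K))⁻¹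
  obtain ⟨s, hs, hsum⟩ := exists_limit hL (fun i => (C (b i) : O) • D^[i] v)
    fun i => L.smul_mem _ (hit i)
  have hpart : ∀ n, D (∑ i ∈ Finset.range (n + 1), ϖ ^ i • (C (b i) : O) • D^[i] v) =
        ϖ ^ n • (C (b n) : O) • D^[n + 1] v := fun n => by
    induction n with
    | zero =>
      simp only [zero_add, Finset.sum_range_one, pow_zero, one_smul, Function.iterate_zero, id_eq,
        Function.iterate_one]
      rw [hD, powerD_C, zero_smul, add_zero]
    | succ n ih =>
      have h1 : dO (X ^ (n + 1)) = C ((n : K) + 1) * X ^ n := by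
        change PowerSeries.derivative K _ = _
        rw [Derivation.leibniz_pow]
        simp
      have h2 : b n + (n + 1) * b (n + 1) = 0 := by
        have : (n.factorial : K) ≠ 0 := Nat.cast_ne_zero.2 n.factorial_ne_zero
        have : (n : K) + 1 ≠ 0 := by exact_mod_cast n.succ_ne_zero
        simp only [b, Nat.factorial_succ, Nat.cast_mul, Nat.cast_succ, pow_succ]
        field_simp
        ring
      rw [Finset.sum_range_succ, map_add, ih, hD, hD, powerD_C, zero_smul, add_zero, h1, smul_smul,
        smul_smul _ _ (D^[n + 1] v), ← iter_succ D, add_left_comm, ← add_smul,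
        mul_comm (C _) (X ^ n), mul_assoc, ← mul_add, ← map_mul, ← map_add, h2,
        map_zero, mul_zero, zero_smul, add_zero]
  have hDs : s = 0 := by
    refine hi _ (eq_zero_of_forall_mem_pow hL fun n => ?_)
    have h1 := map_mem_pow_smul (M := L) (M' := L) hD le_rfl hst n _ (hsum (n + 1))
    rw [map_sub, hpart] at h1
    have h2 : ϖ ^ n • (C (b n) : O) • D^[n + 1] v ∈ ϖ ^ n • L :=
      mem_pow_smul.2 ⟨_, L.smul_mem (C (b n)) (hit (n + 1)), rfl⟩
    exact (Submodule.sub_mem_iff_left _ h2).1 h1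
  have h1 := hsum 1
  rw [hDs, zero_sub, pow_one, neg_mem_iff] at h1
  simpa [b] using h1

theorem exists_finite_mod_pow_of_finite [Module.Finite k K] {V : Type v} [AddCommGroup V]
    [Module O V] {L : Submodule O V} (hL : L.FG) (m : ℕ) :
    ∃ (r : ℕ) (b : Fin r → V), (∀ i, b i ∈ L) ∧ ∀ v ∈ L, ∃ c : Fin r → k,
      v - ∑ i, (C (algebraMap k K (c i)) : O) • b i ∈ ϖ ^ m • L := by
  obtain ⟨r, b, hb, h⟩ := exists_finite_mod_pow hL m
  let β := Module.finBasis k K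
  refine ⟨r * Module.finrank k K, fun i => (C (β (finProdFinEquiv.symm i).2) : O) •
    b (finProdFinEquiv.symm i).1, fun i => L.smul_mem _ (hb _), fun v hv => ?_⟩
  obtain ⟨c, hc⟩ := h v hv
  refine ⟨fun i => β.repr (c (finProdFinEquiv.symm i).1) (finProdFinEquiv.symm i).2, ?_⟩
  convert hc using 2
  rw [← finProdFinEquiv.sum_comp]
  simp only [Equiv.symm_apply_apply, Fintype.sum_prod_type]
  refine sum_congr rfl fun i _ => ?_
  simp only [← mul_smul, ← sum_smul, ← map_mul, ← map_sum, ← Algebra.smul_def, β.sum_repr]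

/-- On `j_! M` the operator `ε d/dX`, `ε = ±1`, is the inverse of the coordinate at infinity for the
structure of a module over `k((X))`. -/
theorem exists_transform_finite_infinity [Module.Finite k K] {V : ModuleCat.{u} DO} {n : ℕ}
    {Q : DO} (hQ : Nonresonant n Q) {g : V} (hg : IsPresentation g (adjoint _ Q).unop)
    (a : K) (ε : ℤ) (hε : ε * ε = 1) :
    ∃ (N : ModuleCat.{u} (PuncturedOp k)) (e : V ≃+ N) (L' : Submodule k⟦X⟧ N), IsLattice L' ∧
      (∀ (c : k) v, (HahnSeries.C c : k⸨X⸩) • e v = e ((C (algebraMap k K c) : O) • v)) ∧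
      (∀ v, (single 1 1 : k⸨X⸩) • e (ε • del dO • v) = e v) ∧
      (∀ v, irregAct k N (e v) = e (ε • (C a + X : O) • v)) ∧
      @IsHomeomorph _ _ (adicTopology K k V) (adicTopology k k ((lowerStar k).obj N)) e ∧
      (∀ (f : O) v, e v ∈ L' → e (f • v) ∈ L') ∧
      ∃ m, ∀ v, e v ∈ L' → e (ϖ ^ m • v) ∈ (X : k⟦X⟧) • L' := by
  obtain ⟨L, hL, hgL⟩ := hQ.exists_isLattice hg
  let D₀ : V →+ V := DistribSMul.toAddMonoidHom V (del dO)
  have hD₀ : IsDerivation dO D₀ := fun f v => nabla_smul dO V f v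
  let T : V →+ V := ε • D₀
  have hTv : ∀ v, T v = ε • D₀ v := fun v => rfl
  have hεε : ∀ v : V, ε • ε • v = v := fun v => by rw [smul_smul, hε, one_smul]
  have hT : IsDerivation (mulDer (ε : O) dO) T := fun f v => by
    rw [hTv, hD₀, smul_add, smul_comm, ← hTv, mulDer_apply, mul_smul, Int.cast_smul_eq_zsmul]
  have hD₀T : ∀ v, D₀ v = ε • T v := fun v => by rw [hTv, hεε]
  have hbij : Function.Bijective T := by
    refine ⟨(injective_iff_map_eq_zero T).2 fun v hv => hQ.del_injective hg ?_, fun v => ?_⟩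
    · exact (hD₀T v).trans (by rw [hv, smul_zero])
    · obtain ⟨w, hw⟩ := hQ.del_surjective hg v
      refine ⟨ε • w, ?_⟩
      rw [map_zsmul, hTv, hεε]
      exact hw
  have hfull : ∀ v : V, ∃ j, v ∈ filt hT L j := fun v => by
    obtain ⟨P, rfl⟩ := hg.gen v
    refine DiffOp.smul_mem_of_stable
      { carrier := {v : V | ∃ j, v ∈ filt hT L j}
        zero_mem' := ⟨0, zero_mem _⟩
        neg_mem' := fun {v} ⟨j, h⟩ => ⟨j, neg_mem h⟩
        add_mem' := fun {v w} ⟨j, h⟩ ⟨j', h'⟩ => ⟨max j j',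
          add_mem (filt_mono hT L (le_max_left _ _) h) (filt_mono hT L (le_max_right _ _) h')⟩ }
      ?_ ?_ P ⟨0, hgL⟩
    · rintro r v ⟨j, h⟩
      exact ⟨j, (filt hT L j).smul_mem r h⟩
    · rintro v ⟨j, h⟩
      refine ⟨j + 1, ?_⟩
      change D₀ v ∈ _
      rw [hD₀T]
      exact zsmul_mem (map_mem_filt hT h) ε
  obtain ⟨j₀, hj⟩ := exists_expanding hT hL.fg hfull fun L hL hst =>
    eq_bot_of_del_injective hD₀ (fun v hv => hQ.del_injective hg hv) hL fun v hv =>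
      hD₀T v ▸ zsmul_mem (hst v hv) ε
  obtain ⟨hpull, hcontr, habs⟩ := hj j₀ le_rfl
  have hΛ : IsLattice (filt hT L j₀) := hL.of_le (filt_fg hT hL.fg j₀)
    (filt_mono hT L (Nat.zero_le j₀))
  generalize filt hT L j₀ = Λ at hpull hcontr habs hΛ
  have hE : IsExpanding T Λ := ⟨hbij, hΛ.fg, hpull, hcontr, habs⟩
  let f₀ : O := C a + X
  let D : V →+ V := ε • DistribSMul.toAddMonoidHom V f₀
  have hDv : ∀ v, D v = ε • f₀ • v := fun v => rfl
  let : Module k V := Module.compHom V (C.comp (algebraMap k K) : k →+* O)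
  have hk : ∀ (c : k) (v : V), c • v = (C (algebraMap k K c) : O) • v := fun _ _ => rfl
  have hTC : ∀ (c : K) v, T ((C c : O) • v) = (C c : O) • T v :=
    fun c v => by rw [hT, mulDer_apply, powerD_C, mul_zero, zero_smul, add_zero]
  obtain ⟨N, e, he₁, he₂, he₃, L', hL', heL⟩ := hE.exists_module (K := k) (D := D) hT hΛ
    (fun c v => by rw [hk, hk, hTC]) (fun c v hv => Λ.smul_mem _ hv)
    (fun m => exists_finite_mod_pow_of_finite hΛ.fg m)
    (fun c v => by rw [hk, hk, hDv, hDv, smul_comm f₀, smul_comm ε])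
    (fun v => by
      have h1 : dO f₀ = 1 := by rw [map_add, powerD_C, powerD_X, zero_add]
      rw [hDv, hDv, map_zsmul, hT, mulDer_apply, h1, mul_one, smul_add, Int.cast_smul_eq_zsmul,
        hεε])
    (fun m => ⟨m, fun v hv => zsmul_mem (smul_mem _ f₀ hv) ε⟩)
  have heX : ∀ v, (X : k⟦X⟧) • e (T v) = e v := fun v => by rw [X_smul]; exact he₂ v
  have hmem := mem_pow_smul_of_transform e heX heL hbij
  refine ⟨N, e, L', hL', he₁, he₂, he₃, ?_, fun f v hv => ?_, ?_⟩
  · refine isHomeomorph_adicTopology k hΛ (hL'.map_equiv (starEquiv N))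
      (e.trans (starEquiv N).toAddEquiv) (fun m => ?_) fun m => ?_
    · obtain ⟨n, hn⟩ := exists_iterate_mem hT hΛ m
      exact ⟨n, fun v hv => (mem_pow_smul_map_equiv (starEquiv N)).2 ((hmem m v).2 (hn v hv))⟩
    · obtain ⟨n, hn⟩ := hcontr m
      exact ⟨n, fun v hv => hn v ((hmem n v).1 ((mem_pow_smul_map_equiv (starEquiv N)).1 hv))⟩
  · rw [heL] at hv ⊢
    exact Λ.smul_mem _ hv
  · obtain ⟨m, hm⟩ := exists_iterate_mem hT hΛ 1
    refine ⟨m, fun v hv => ?_⟩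
    have := (hmem 1 (ϖ ^ m • v)).2 (hm _ (mem_pow_smul.2 ⟨v, (heL v).1 hv, rfl⟩))
    rwa [pow_one] at this

end FiniteToInfinity

/-! ### Extension of constants to the algebraic closure -/

section Unramified

open scoped TensorProduct

variable {K : Type u} [Field K]

local notation "φ" => algebraMap K (AlgebraicClosure K)

/-- The algebra structure used in the definition of `toUnr`. -/
abbrev unrAlgebra : Algebra Kx (AlgebraicClosure K)⸨X⸩ := (laurentMap φ).toAlgebra

/-- The canonical map from `M` to `M ⊗ K̄((ζ))`. -/
def unr (M : PMod) : M →+ toUnr K M := letI := unrAlgebra (K := K)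
  (TensorProduct.mk Kx (AlgebraicClosure K)⸨X⸩ (under dK M) 1).toAddMonoidHom

variable (M : PMod)

theorem unr_smul (f : Kx) (m : M) : unr M (f • m) = laurentMap φ f • unr M m := by
  let := unrAlgebra (K := K)
  refine Eq.trans ?_ (baseChange_of_smul (laurentD_map _) M _ _).symm
  change (1 : (AlgebraicClosure K)⸨X⸩) ⊗ₜ[Kx] (f • (show under dK M from m)) =
    (laurentMap φ f * 1) ⊗ₜ[Kx] (show under dK M from m)
  rw [← TensorProduct.smul_tmul]
  rfl

theorem unr_del (m : M) : unr M (del dK • m) =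
    del (laurentD (AlgebraicClosure K)) • unr M m := by
  let := unrAlgebra (K := K)
  refine Eq.trans ?_ (baseChange_del_smul (laurentD_map _) M _).symm
  change (1 : (AlgebraicClosure K)⸨X⸩) ⊗ₜ[Kx] nabla dK M m =
    laurentD (AlgebraicClosure K) 1 ⊗ₜ[Kx] (show under dK M from m) + 1 ⊗ₜ[Kx] nabla dK M m
  rw [← map_one HahnSeries.C, laurentD_C, TensorProduct.zero_tmul, zero_add]

/-- The base change is generated by the vectors `1 ⊗ m`. -/
theorem mem_of_unr_mem (S : AddSubgroup (toUnr K M)) (hS : ∀ (f : (AlgebraicClosure K)⸨X⸩), ∀ w ∈ S,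
    f • w ∈ S) (h : ∀ m, unr M m ∈ S) (w : toUnr K M) : w ∈ S := by
  let := unrAlgebra (K := K)
  refine TensorProduct.induction_on (motive := fun w => (show toUnr K M from w) ∈ S) w S.zero_mem
    (fun f m => ?_) fun _ _ => S.add_mem
  have h1 := hS f _ (h m)
  have h2 : (f • unr M m : toUnr K M) = (f * 1) ⊗ₜ[Kx] (show under dK M from m) :=
    baseChange_of_smul (laurentD_map _) M _ _
  rwa [h2, mul_one] at h1

/-- Base change of an endomorphism. -/
theorem exists_unr_map (B : M →ₗ[DK] M) :
    ∃ B' : toUnr K M →ₗ[PuncturedOp (AlgebraicClosure K)] toUnr K M,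
      ∀ m, B' (unr M m) = unr M (B m) := by
  let := unrAlgebra (K := K)
  let B₀ : under dK M →ₗ[Kx] under dK M := ((restrictScalars (of dK)).map (ModuleCat.ofHom B)).hom
  let B₁ := B₀.baseChange (AlgebraicClosure K)⸨X⸩
  let B₂ : toUnr K M →+ toUnr K M := B₁.toAddMonoidHom
  have hs := smul_induction (laurentD (AlgebraicClosure K)) B₂ (fun f w => ?_) fun w => ?_
  · exact ⟨{ B₂ with map_smul' := hs }, fun m => rfl⟩
  · refine (congrArg B₁ (baseChange_of_smul (laurentD_map _) M f w)).trans
      ((B₁.map_smul f w).trans (baseChange_of_smul (laurentD_map _) M f _).symm)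
  · refine (congrArg B₁ (baseChange_del_smul (laurentD_map _) M w)).trans
      (Eq.trans ?_ (baseChange_del_smul (laurentD_map _) M _).symm)
    let ν := baseChangeNabla dK (laurentD (AlgebraicClosure K)) (laurentD_map _) M
    refine TensorProduct.induction_on (motive := fun w => B₁ (ν w) = ν (B₁ w)) w ?_ (fun f m => ?_)
      fun x y hx hy => ?_
    · simp only [map_zero]
    · change B₁ (laurentD _ f ⊗ₜ[Kx] m + f ⊗ₜ[Kx] nabla dK M m) =
        laurentD _ f ⊗ₜ[Kx] B₀ m + f ⊗ₜ[Kx] nabla dK M (B₀ m)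
      rw [map_add, LinearMap.baseChange_tmul, LinearMap.baseChange_tmul]
      congr 2
      exact B.map_smul (del dK) m
    · rw [map_add, map_add, hx, hy, ← map_add, ← map_add]

theorem exists_unr_basis (hM : Hol K M) : ∃ (r : ℕ) (b : Fin r → M),
    (∀ m : M, ∃ c : Fin r → Kx, m = ∑ i, c i • b i) ∧
      LinearIndependent (AlgebraicClosure K)⸨X⸩ fun i => unr M (b i) := by
  let := unrAlgebra (K := K)
  have : Module.Finite Kx (under dK M) := hM
  let b := Module.finBasis Kx (under dK M)
  let b' := Algebra.TensorProduct.basis (AlgebraicClosure K)⸨X⸩ b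
  refine ⟨_, b, fun m => ⟨b.repr m, (b.sum_repr m).symm⟩, ?_⟩
  refine Fintype.linearIndependent_iff.2 fun g hg => Fintype.linearIndependent_iff.1
    b'.linearIndependent g (Eq.trans ?_ hg)
  refine sum_congr rfl fun i _ => ?_
  rw [Algebra.TensorProduct.basis_apply]
  exact (baseChange_of_smul (laurentD_map _) M _ _).symm

theorem irregAct_unr (m : M) : irregAct (AlgebraicClosure K) (toUnr K M) (unr M m) =
    unr M (irregAct K M m) := by
  rw [irregAct_eq, irregAct_eq, unr_smul, unr_del]
  congr 1
  ext n
  change (single 2 (1 : AlgebraicClosure K)).coeff n = φ ((single 2 (1 : K)).coeff n)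
  by_cases hn : n = 2 <;> simp [hn]

theorem laurentMap_ofPowerSeries {K K' : Type*} [Field K] [Field K'] (f : K →+* K') (g : O) :
    laurentMap f (ofPowerSeries ℤ K g) = ofPowerSeries ℤ K' (PowerSeries.map f g) := by
  ext n
  change f ((ofPowerSeries ℤ K g).coeff n) = _
  rw [PowerSeries.coeff_coe, PowerSeries.coeff_coe]
  split_ifs <;> simp

theorem unr_powerSeries_smul (f : O) (m : M) :
    unr M (f • m) = (PowerSeries.map φ f : (AlgebraicClosure K)⟦X⟧) • unr M m := by
  rw [← ofPowerSeries_smul, unr_smul, laurentMap_ofPowerSeries, ofPowerSeries_smul]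

end Unramified

/-! ### The type of a module at infinity -/

section EndAct

variable {K : Type u} [Field K]

/-- The action of constants on a module over the punctured disk commutes with differential
operators. -/
def constEnd (V : PMod) : K →+* Module.End DK V where
  toFun c :=
    { toFun := fun v => (HahnSeries.C c : Kx) • v
      map_add' := smul_add _
      map_smul' := smul_induction dK (M := V) (N := V)
        (DistribSMul.toAddMonoidHom V (HahnSeries.C c : Kx))
        (fun r v => by
          change of dK (HahnSeries.C c) • of dK r • v = of dK r • of dK (HahnSeries.C c) • v
          rw [← mul_smul, ← mul_smul, ← map_mul, ← map_mul, mul_comm])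
        fun v => by
          change of dK (HahnSeries.C c) • del dK • v = del dK • of dK (HahnSeries.C c) • v
          rw [← mul_smul, ← mul_smul, del_mul_of, laurentD_C, map_zero, add_zero] }
  map_one' := LinearMap.ext fun v => by
    change (HahnSeries.C (1 : K) : Kx) • v = v
    rw [map_one, one_smul]
  map_mul' c c' := LinearMap.ext fun v => by
    change (HahnSeries.C (c * c') : Kx) • v = (HahnSeries.C c : Kx) • (HahnSeries.C c' : Kx) • v
    rw [map_mul, mul_smul]
  map_zero' := LinearMap.ext fun v => by
    change (HahnSeries.C (0 : K) : Kx) • v = 0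
    rw [map_zero, zero_smul]
  map_add' c c' := LinearMap.ext fun v => by
    change (HahnSeries.C (c + c') : Kx) • v = (HahnSeries.C c : Kx) • v + (HahnSeries.C c' : Kx) • v
    rw [map_add, add_smul]

theorem constEnd_apply {V : PMod} (c : K) (v : V) :
    constEnd V c v = (HahnSeries.C c : Kx) • v := rfl

/-- Polynomials in an endomorphism of a module over the punctured disk. -/
def endAct {V : PMod} (B : Module.End DK V) :
    K[X] →+* Module.End DK V :=
  Polynomial.eval₂RingHom' (constEnd V) B fun c => LinearMap.ext fun v => by
    change (HahnSeries.C c : Kx) • B v = B ((HahnSeries.C c : Kx) • v)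
    rw [← of_smul_eq (d := dK), ← of_smul_eq (d := dK), map_smul]

variable {V : PMod} (B : Module.End DK V)

theorem endAct_C (c : K) : endAct B (PC c) = constEnd V c := Polynomial.eval₂_C _ _

theorem endAct_X : endAct B PX = B := Polynomial.eval₂_X _ _

theorem mem_ker_endAct_X_sub_C {β : K} {v : V} : v ∈ ker (endAct B (PX - PC β)) ↔
      B v = (HahnSeries.C β : Kx) • v := by
  rw [mem_ker, map_sub, endAct_X, endAct_C, LinearMap.sub_apply, sub_eq_zero,
    constEnd_apply]

theorem pairwise_isCoprime_X_sub_C (Γ : Finset K) :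
    Pairwise (Function.onFun IsCoprime fun γ : Γ => (PX - PC (γ : K))) :=
  fun _ _ h => Polynomial.isCoprime_X_sub_C_of_isUnit_sub
    (sub_ne_zero.2 (Subtype.coe_injective.ne h)).isUnit

/-- An endomorphism which satisfies an equation with simple roots is diagonalizable. -/
theorem decompose_ker_endAct {Γ : Finset K} {s : Set K} (hs : ∀ β, β ∈ s ↔ β ∈ Γ)
    (hB : endAct B (∏ γ ∈ Γ, (PX - PC γ)) = 0) :
    iSupIndep (fun β : s => ker (endAct B (PX - PC (β : K)))) ∧
      ⨆ β : s, ker (endAct B (PX - PC (β : K))) = ⊤ := by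
  classical
  have hle : ∀ {p q : K[X]}, p ∣ q → ker (endAct B p) ≤ ker (endAct B q) := by
    rintro p _ ⟨r, rfl⟩ v hv
    rw [mem_ker] at hv ⊢
    rw [mul_comm, map_mul, mul_apply, hv, map_zero]
  constructor
  · intro β
    rw [Submodule.disjoint_def]
    intro v h1 h2
    let R : K[X] := ∏ γ ∈ Γ \ {(β : K)}, (PX - PC γ)
    have hR : ∀ γ : s, γ ≠ β → PX - PC (γ : K) ∣ R := fun γ hγ => by
      refine Finset.dvd_prod_of_mem (fun γ => PX - PC γ) ?_
      rw [Finset.mem_sdiff, Finset.mem_singleton]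
      exact ⟨(hs _).1 γ.2, fun h => hγ (Subtype.ext h)⟩
    have hsup : ⨆ γ : s, ⨆ (_ : γ ≠ β), ker (endAct B (PX - PC (γ : K))) ≤
        ker (endAct B R) := iSup₂_le fun γ hγ => hle (hR γ hγ)
    have h3 := hsup h2
    obtain ⟨a, b, hab⟩ := (pairwise_coprime_iff_coprime_prod (t := Γ)
      (s := fun γ => PX - PC γ)).1 (pairwise_isCoprime_X_sub_C Γ) β ((hs _).1 β.2)
    have := congrArg (fun p => endAct B p v) hab
    simp only [map_add, map_mul, LinearMap.add_apply, mul_apply, map_one,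
      Module.End.one_apply] at this
    rwa [LinearMap.mem_ker.1 h1, map_zero, zero_add, show endAct B _ v = 0 from h3, map_zero,
      eq_comm] at this
  · rw [eq_top_iff]
    rintro v -
    rcases Γ.eq_empty_or_nonempty with rfl | hΓ
    · rw [Finset.prod_empty, map_one] at hB
      rw [show v = (1 : Module.End DK V) v from rfl, hB]
      exact zero_mem _
    obtain ⟨μ, hμ⟩ := (exists_sum_eq_one_iff_pairwise_coprime
      (s := fun γ => PX - PC γ) hΓ).2 (pairwise_isCoprime_X_sub_C Γ)
    have h1 := congrArg (fun p => endAct B p v) hμ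
    simp only [map_sum, LinearMap.sum_apply, map_one, Module.End.one_apply] at h1
    rw [← h1]
    refine sum_mem fun γ hγ => Submodule.mem_iSup_of_mem ⟨γ, (hs γ).2 hγ⟩ ?_
    rw [mem_ker, ← mul_apply, ← map_mul, mul_left_comm,
      Finset.sdiff_singleton_eq_erase, Finset.mul_prod_erase _ (fun γ => PX - PC γ) hγ,
      map_mul, hB, mul_zero, LinearMap.zero_apply]

end EndAct

section TypeOut

theorem IsDerivation.iterate_smul_sub_mem {K : Type u} [Field K] {V : Type v} [AddCommGroup V]
    [Module O V] {T : V →+ V} (hT : IsDerivation (irregD K) T) {L : Submodule O V}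
    (hst : ∀ v ∈ L, T v ∈ L) (f : O) {v : V} (hv : v ∈ L) (n : ℕ) :
    T^[n] v ∈ L ∧ T^[n] (f • v) - f • T^[n] v ∈ ϖ • L := by
  have hX : ∀ f : O, ∀ v ∈ L, T (f • v) - f • T v ∈ ϖ • L := fun f v hv => by
    rw [hT, add_sub_cancel_left]
    change (X ^ 2 * dO f) • v ∈ _
    rw [pow_two, mul_assoc, mul_smul]
    exact Submodule.smul_mem_pointwise_smul _ _ _ (L.smul_mem _ hv)
  have hstX : ∀ v ∈ ϖ • L, T v ∈ ϖ • L := by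
    intro v hv
    obtain ⟨w, hw, rfl⟩ := hv
    have := add_mem (hX X w hw) (Submodule.smul_mem_pointwise_smul _ X _ (hst w hw))
    rwa [sub_add_cancel] at this
  induction n with
  | zero => exact ⟨hv, by simp⟩
  | succ n ih =>
    refine ⟨by rw [iter_succ]; exact hst _ ih.1, ?_⟩
    have h1 := add_mem (hstX _ ih.2) (hX f _ ih.1)
    rwa [map_sub, sub_add_sub_cancel, ← iter_succ T, ← iter_succ T] at h1

variable {K : Type u} [Field K]

theorem twist_of (f r : Kx) : twist dK f (of _ r) = of _ r := lift_of ..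

theorem twist_del (f : Kx) : twist dK f (del _) = del _ + of _ f := lift_del ..

theorem exists_twist (V : PMod) (f : Kx) : ∃ N : PMod,
      Nonempty (V ≅ (restrictScalars (twist dK f)).obj N) := by
  let N := (restrictScalars (twist dK (-f))).obj V
  have hs := smul_induction dK (M := V)
    (N := (restrictScalars (twist dK f)).obj N) (AddMonoidHom.id V)
    (fun r v => by
      change _ = twist dK (-f) (twist dK f (of _ r)) • v
      rw [twist_of, twist_of]
      rfl)
    fun v => by
      change _ = twist dK (-f) (twist dK f (del _)) • v
      rw [twist_del, map_add, twist_of, twist_del, map_neg, neg_add_cancel_right]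
      rfl
  let e : V ≃ₗ[DK] (restrictScalars (twist dK f)).obj N :=
    { AddEquiv.refl V with map_smul' := hs }
  exact ⟨N, ⟨e.toModuleIso⟩⟩

/-- The action of `X² d/dX` on the twist of a module by `β X⁻²`. -/
theorem exists_equiv_of_twist {V N : PMod} {β : K}
    (i : V ≅ (restrictScalars (twist dK (single (-2) β))).obj N) :
    ∃ e : V ≃+ N, (∀ (r : Kx) v, e (r • v) = r • e v) ∧ (∀ (r : O) v, e (r • v) = r • e v) ∧
      ∀ v, e (irregAct K V v) = irregAct K N (e v) + (HahnSeries.C β : Kx) • e v := by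
  let e : V ≃+ N := i.toLinearEquiv.toAddEquiv
  have he : ∀ (P : DK) v,
      e (P • v) = twist dK (single (-2) β) P • e v :=
    fun P v => i.toLinearEquiv.map_smul P v
  have heK : ∀ (r : Kx) v, e (r • v) = r • e v := fun r v => by
    rw [← of_smul_eq (d := dK), he, twist_of, of_smul_eq]
  refine ⟨e, heK, fun r v => by rw [← ofPowerSeries_smul, heK, ofPowerSeries_smul], fun v => ?_⟩
  rw [irregAct_eq, irregAct_eq, heK, he, twist_del, add_smul, smul_add, of_smul_eq,
    ← mul_smul (single 2 (1 : K)) (single (-2) β), single_mul_single,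
    one_mul]
  rfl

/-- An eigenspace, on which `X² d/dX - β` is topologically nilpotent, is of type `β`. -/
theorem holTypeGeom_of_contracted {V : PMod} {L : Submodule O V}
    (hL : IsLattice L) (B : Module.End DK V)
    (hst : ∀ v ∈ L, (irregAct K V - B.toAddMonoidHom) v ∈ L) {n : ℕ}
    (hn : ∀ v ∈ L, (irregAct K V - B.toAddMonoidHom)^[n] v ∈ ϖ • L) (β : K) :
    HolTypeGeom K β (ModuleCat.of _ (ker (endAct B (PX - PC β)))) := by
  obtain ⟨N, ⟨j⟩⟩ := exists_twist (ModuleCat.of DK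
    (ker (endAct B (PX - PC β)))) (single (-2) β)
  obtain ⟨e, heK, heA, heZ⟩ := exists_equiv_of_twist j
  let i : N →ₗ[O] V :=
    { toFun := fun v => (e.symm v).1
      map_add' := fun v w => by rw [map_add]; rfl
      map_smul' := fun r v => by
        obtain ⟨v, rfl⟩ := e.surjective v
        rw [← heA, e.symm_apply_apply, e.symm_apply_apply]
        rfl }
  have hi : Function.Injective i := Subtype.coe_injective.comp e.symm.injective
  have hT : ∀ v, i (irregAct K N v) = (irregAct K V - B.toAddMonoidHom) (i v) := fun v => by
    obtain ⟨v, rfl⟩ := e.surjective v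
    rw [← sub_eq_iff_eq_add.2 (heZ v), ← heK, ← map_sub]
    change (e.symm (e _)).1 = irregAct K V (e.symm (e v)).1 - B (e.symm (e v)).1
    rw [e.symm_apply_apply, e.symm_apply_apply, (mem_ker_endAct_X_sub_C B).1 v.2]
    rfl
  have hTn : ∀ m v, i ((irregAct K N)^[m] v) = (irregAct K V - B.toAddMonoidHom)^[m] (i v) := by
    intro m v
    exact (Function.Semiconj.iterate_right (f := i) hT m) v
  have hL' : IsLattice (L.comap i) := by
    refine ⟨Submodule.fg_of_fg_map_injective i hi (FG.of_le hL.fg (Submodule.map_comap_le i L)),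
      fun v => ?_⟩
    obtain ⟨m, hm⟩ := hL.full (i v)
    exact ⟨m, by rw [Submodule.mem_comap, map_smul]; exact hm⟩
  have hNfin : Module.Finite Kx N := hL'.finite
  have hcon : ∀ v : N, IsContracted K (irregAct K N) v := by
    intro v
    obtain ⟨m, hm⟩ := hL'.full v
    have h1 : ϖ ^ m • v ∈ contractedSub K N := by
      refine ⟨L.comap i, hL'.fg, fun w hw => ?_, hm, n, fun w hw => ?_⟩
      · change i _ ∈ L
        rw [hT]
        exact hst _ hw
      · obtain ⟨y, hy, hyw⟩ := hn _ hw
        refine ⟨divX K N ((irregAct K N)^[n] w), ?_, X_smul_divX _⟩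
        change i _ ∈ L
        have h2 : ϖ • i (divX K N ((irregAct K N)^[n] w)) = ϖ • y := by
          rw [← map_smul, X_smul_divX, hTn]
          exact hyw.symm
        have h3 := X_pow_smul_injective (K := K) (V := V) 1 (by simpa using h2)
        rw [h3]
        exact hy
    have h2 := smul_mem (contractedSub K N) (of dK ((single 1 1)⁻¹ ^ m)) h1
    rw [X_pow_smul, of_smul_eq, ← mul_smul, ← mul_pow, inv_mul_cancel₀ single_one_ne_zero, one_pow,
      one_smul] at h2
    exact h2
  exact ⟨N, ⟨hNfin, (forall_slope_lt_one_iff (K := K) (V := N)).2 hcon⟩, ⟨j⟩⟩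

end TypeOut

/-! ### Eigenspaces of an endomorphism over the algebraic closure -/

section UnrLattice

variable {K : Type u} [Field K] {M : PMod}

local notation "φ" => algebraMap K (AlgebraicClosure K)

/-- The base change of a lattice is a lattice. -/
theorem isLattice_unr {L : Submodule O M} (hL : IsLattice L) {r : ℕ} {b : Fin r → M}
    (hb : span O (range b) = L) :
    IsLattice (span (AlgebraicClosure K)⟦X⟧ (range fun i => unr M (b i))) ∧
      ∀ m ∈ L, unr M m ∈ span (AlgebraicClosure K)⟦X⟧ (range fun i => unr M (b i)) := by
  set L' := span (AlgebraicClosure K)⟦X⟧ (range fun i => unr M (b i))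
  have hmem : ∀ m ∈ L, unr M m ∈ L' := by
    intro m hm
    rw [← hb, mem_span_range] at hm
    obtain ⟨c, rfl⟩ := hm
    rw [map_sum]
    refine sum_mem fun i _ => ?_
    rw [unr_powerSeries_smul]
    exact L'.smul_mem _ (subset_span ⟨i, rfl⟩)
  refine ⟨⟨fg_span (Set.finite_range _), fun w => ?_⟩, hmem⟩
  refine mem_of_unr_mem M
    { carrier := {w | ∃ n, (X ^ n : (AlgebraicClosure K)⟦X⟧) • w ∈ L'}
      zero_mem' := ⟨0, by rw [smul_zero]; exact zero_mem _⟩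
      neg_mem' := fun {w} ⟨n, h⟩ => ⟨n, by rw [smul_neg]; exact neg_mem h⟩
      add_mem' := fun {w w'} ⟨n, h⟩ ⟨n', h'⟩ => ⟨n + n', by
        rw [smul_add, pow_add, mul_smul _ _ w', mul_comm, mul_smul]
        exact add_mem (L'.smul_mem _ h) (L'.smul_mem _ h')⟩ } ?_ (fun m => ?_) w
  · rintro f w ⟨n, h⟩
    obtain ⟨a, g, hg⟩ := exists_pow_mul_eq_ofPowerSeries f
    refine ⟨n + a, ?_⟩
    rw [pow_add, mul_smul, X_pow_smul a, ← mul_smul (_ ^ a) f, hg, ofPowerSeries_smul, smul_comm]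
    exact L'.smul_mem _ h
  · obtain ⟨n, hn⟩ := hL.full m
    refine ⟨n, ?_⟩
    have := hmem _ hn
    rwa [unr_powerSeries_smul, map_pow, PowerSeries.map_X] at this

theorem unr_endAct {B : Module.End DK M}
    {B' : Module.End (PuncturedOp (AlgebraicClosure K)) (toUnr K M)}
    (h : ∀ m, B' (unr M m) = unr M (B m)) (q : K[X]) (m : M) :
    endAct B' (q.map φ) (unr M m) = unr M (endAct B q m) := by
  induction q using Polynomial.induction_on generalizing m with
  | C c =>
    rw [Polynomial.map_C, endAct_C, endAct_C, constEnd_apply, constEnd_apply, ← ofPowerSeries_C,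
      ← ofPowerSeries_C, ofPowerSeries_smul, ofPowerSeries_smul, unr_powerSeries_smul,
      PowerSeries.map_C]
  | add p q hp hq =>
    rw [Polynomial.map_add, map_add, map_add, LinearMap.add_apply, hp, hq, LinearMap.add_apply,
      map_add]
  | monomial n a ih =>
    rw [pow_succ, ← mul_assoc, Polynomial.map_mul, map_mul, map_mul, Polynomial.map_X, endAct_X,
      endAct_X, mul_apply, mul_apply, h, ih]

open scoped Classical in
theorem mem_geom_iff {y : ClosedPt K} {p : K[X]} (hp : p ≠ 0) (hy : y.asIdeal = Ideal.span {p})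
    (β : AlgebraicClosure K) : β ∈ y.geom ↔ β ∈ (p.map φ).roots.toFinset := by
  rw [Multiset.mem_toFinset, Polynomial.mem_roots (Polynomial.map_ne_zero hp), Polynomial.IsRoot,
    Polynomial.eval_map_algebraMap]
  constructor
  · exact fun h => h p (hy ▸ Ideal.mem_span_singleton_self p)
  · intro h q hq
    obtain ⟨r, rfl⟩ := Ideal.mem_span_singleton.1 (hy ▸ hq)
    rw [map_mul, h, zero_mul]

/-- If `X² d/dX` is the sum of a topologically nilpotent operator and of an endomorphism `B` whose
eigenvalues are the geometric points of `y`, the eigenspaces of `B` give the decomposition required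
of a module of type `y`. -/
theorem holType_of_endomorphism [CharZero K] {y : ClosedPt K} {p : K[X]} (hp : Irreducible p)
    (hy : y.asIdeal = Ideal.span {p}) {L : Submodule O M} (hL : IsLattice L)
    (B : Module.End DK M) (hB : endAct B p = 0)
    (hst : ∀ v ∈ L, (irregAct K M - B.toAddMonoidHom) v ∈ L) {n : ℕ}
    (hn : ∀ v ∈ L, (irregAct K M - B.toAddMonoidHom)^[n] v ∈ ϖ • L) :
    HolType y M := by
  classical
  obtain ⟨B', hB'⟩ := exists_unr_map M B
  have hprod : p.map φ = PC (p.map φ).leadingCoeff *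
      ∏ γ ∈ (p.map φ).roots.toFinset, (PX - PC γ) := by
    conv_lhs => rw [(IsAlgClosed.splits (p.map φ)).eq_prod_roots]
    rw [Finset.prod, Multiset.toFinset_val,
      Multiset.dedup_eq_self.2 (Polynomial.nodup_roots hp.separable.map)]
  have h0 : endAct B' (p.map φ) = 0 := LinearMap.ext fun w =>
    mem_of_unr_mem M (ker (endAct B' (p.map φ))).toAddSubgroup (fun f w hw => by
        rw [← of_smul_eq (d := laurentD (AlgebraicClosure K))]
        exact smul_mem _ _ hw)
      (fun m => by
        change endAct B' (p.map φ) (unr M m) = 0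
        rw [unr_endAct hB', hB, LinearMap.zero_apply, map_zero]) w
  have h1 : endAct B' (∏ γ ∈ (p.map φ).roots.toFinset, (PX - PC γ)) = 0 := by
    have hc : (p.map φ).leadingCoeff ≠ 0 :=
      Polynomial.leadingCoeff_ne_zero.2 (Polynomial.map_ne_zero hp.ne_zero)
    rw [← one_mul (∏ γ ∈ _, _), ← map_one PC, ← inv_mul_cancel₀ hc, map_mul PC, mul_assoc,
      ← hprod, map_mul, h0, mul_zero]
  obtain ⟨hind, hsup⟩ := decompose_ker_endAct B' (mem_geom_iff hp.ne_zero hy) h1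
  refine ⟨hL.finite, _, hind, hsup, fun β => ?_⟩
  obtain ⟨r, b, hb⟩ := fg_iff_fin.1 hL.fg
  obtain ⟨hL', hmem⟩ := isLattice_unr hL hb
  set L' := span (AlgebraicClosure K)⟦X⟧ (range fun i => unr M (b i))
  have hder : IsDerivation (irregD (AlgebraicClosure K))
      (irregAct (AlgebraicClosure K) (toUnr K M) - B'.toAddMonoidHom) := fun f v => by
    change irregAct _ _ (f • v) - B' (f • v) = f • (irregAct _ _ v - B' v) + _
    have h : B' (f • v) = f • B' v := by
      rw [← ofPowerSeries_smul, ← ofPowerSeries_smul, ← of_smul_eq (d := laurentD _),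
        ← of_smul_eq (d := laurentD _), map_smul]
    rw [isDerivation_irregAct, h, smul_sub]
    abel
  have hTu : ∀ m, (irregAct (AlgebraicClosure K) (toUnr K M) - B'.toAddMonoidHom) (unr M m) =
      unr M ((irregAct K M - B.toAddMonoidHom) m) := fun m => by
    change irregAct _ _ _ - B' _ = unr M (_ - B m)
    rw [irregAct_unr, hB', map_sub]
  have hbL : ∀ i, b i ∈ L := fun i => hb ▸ subset_span ⟨i, rfl⟩
  have hst' : ∀ w ∈ L', (irregAct (AlgebraicClosure K) (toUnr K M) - B'.toAddMonoidHom) w ∈ L' := by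
    intro w hw
    induction hw using Submodule.span_induction with
    | mem w hw =>
      obtain ⟨i, rfl⟩ := hw
      rw [hTu]
      exact hmem _ (hst _ (hbL i))
    | zero => rw [map_zero]; exact zero_mem _
    | add v w _ _ hv hw => rw [map_add]; exact add_mem hv hw
    | smul f w hw ih =>
      rw [hder]
      exact add_mem (L'.smul_mem _ ih) (L'.smul_mem _ hw)
  refine holTypeGeom_of_contracted hL' B' hst' (n := n) (fun w hw => ?_) β
  induction hw using Submodule.span_induction with
  | mem w hw =>
    obtain ⟨i, rfl⟩ := hw
    obtain ⟨m, hm, h⟩ := hn _ (hbL i)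
    have h2 : (irregAct (AlgebraicClosure K) (toUnr K M) - B'.toAddMonoidHom)^[n] (unr M (b i)) =
        unr M ((irregAct K M - B.toAddMonoidHom)^[n] (b i)) :=
      ((Function.Semiconj.iterate_right (f := unr M) (fun m => (hTu m).symm) n) (b i)).symm
    have h3 : ϖ • m = (irregAct K M - B.toAddMonoidHom)^[n] (b i) := h
    rw [h2, ← h3, unr_powerSeries_smul, PowerSeries.map_X]
    exact Submodule.smul_mem_pointwise_smul _ _ _ (hmem _ hm)
  | zero => rw [iterate_map_zero]; exact zero_mem _
  | add v w _ _ hv hw => rw [iterate_map_add]; exact add_mem hv hw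
  | smul f w hw ih =>
    have h2 := (hder.iterate_smul_sub_mem hst' f hw n).2
    have h3 := add_mem h2 (smul_mem _ f ih)
    rwa [sub_add_cancel] at h3

end UnrLattice

/-! ### Lattices of modules of a given type -/

section TypeIn

variable {K : Type u} [Field K]

/-- Polynomials in `X² d/dX`. -/
def irregPoly (W : PMod) : K[X] →+* AddMonoid.End W :=
  Polynomial.eval₂RingHom' ((Module.toAddMonoidEnd O W).comp C)
    (irregAct K W : AddMonoid.End W) fun c =>
      AddMonoidHom.ext fun v => (irregAct_C_smul (K := K) c v).symm

variable {W : PMod}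

theorem irregPoly_C (c : K) (v : W) : irregPoly W (PC c) v = (C c : O) • v :=
  congrArg (fun f : AddMonoid.End W => f v) (Polynomial.eval₂_C _ _)

theorem irregPoly_X (v : W) : irregPoly W PX v = irregAct K W v :=
  congrArg (fun f : AddMonoid.End W => f v) (Polynomial.eval₂_X _ _)

theorem irregPoly_mul (p q : K[X]) (v : W) :
    irregPoly W (p * q) v = irregPoly W p (irregPoly W q v) := by
  rw [map_mul]
  rfl

theorem irregPoly_add (p q : K[X]) (v : W) :
    irregPoly W (p + q) v = irregPoly W p v + irregPoly W q v := by
  rw [map_add]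
  rfl

theorem irregPoly_mem {L : Submodule O W} (hst : ∀ v ∈ L, irregAct K W v ∈ L) (q : K[X]) {v : W}
    (hv : v ∈ L) : irregPoly W q v ∈ L := by
  induction q using Polynomial.induction_on generalizing v with
  | C c => rw [irregPoly_C]; exact L.smul_mem _ hv
  | add p q hp hq => rw [irregPoly_add]; exact add_mem (hp hv) (hq hv)
  | monomial n a ih =>
    rw [pow_succ, ← mul_assoc, irregPoly_mul, irregPoly_X]
    exact ih (hst v hv)

theorem irregAct_mem_pow_smul {L : Submodule O W} (hst : ∀ v ∈ L, irregAct K W v ∈ L) (n : ℕ) :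
    ∀ v ∈ ϖ ^ n • L, irregAct K W v ∈ ϖ ^ n • L :=
  irregOp_mem_pow_smul isDerivation_eulerAct hst n

theorem exists_lattice_of_holTypeGeom [CharZero K] {β : K} {N : Submodule DK W}
    (h : HolTypeGeom K β (ModuleCat.of _ N)) : ∃ L : Submodule O W, L.FG ∧
      (∀ w ∈ L, irregAct K W w ∈ L) ∧ (∀ w ∈ N, ∃ n, ϖ ^ n • w ∈ L) ∧
      ∃ m, ∀ w ∈ L, irregPoly W ((PX - PC β) ^ m) w ∈ ϖ • L := by
  obtain ⟨N', ⟨hN', hs⟩, ⟨i⟩⟩ := h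
  obtain ⟨e, -, heA, heZ⟩ := exists_equiv_of_twist i
  have := finite_of_hol hN'
  obtain ⟨L₀, hL₀⟩ := exists_isLattice K N'
  obtain ⟨L, hL, hst, hle, m, hm⟩ := exists_contracted_lattice (δ := eulerAct K N')
    isDerivation_eulerAct hL₀.fg fun v _ => (forall_slope_lt_one_iff (K := K) (V := N')).1 hs v
  let j : N' →ₗ[O] W :=
    { toFun := fun v => (e.symm v).1
      map_add' := fun v w => by rw [map_add]; rfl
      map_smul' := fun r v => by
        obtain ⟨v, rfl⟩ := e.surjective v
        rw [← heA, e.symm_apply_apply, e.symm_apply_apply]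
        rfl }
  have hj : ∀ v, irregAct K W (j v) = j (irregAct K N' v) + (C β : O) • j v := by
    intro v
    obtain ⟨v, rfl⟩ := e.surjective v
    have h1 := congrArg e.symm (heZ v)
    rw [e.symm_apply_apply, C_smul_eq, map_add] at h1
    rw [← map_smul]
    change irregAct K W (e.symm (e v)).1 = _
    rw [e.symm_apply_apply]
    exact congrArg Subtype.val h1
  have hjm : ∀ m v, irregPoly W ((PX - PC β) ^ m) (j v) =
      j ((irregAct K N')^[m] v) := by
    intro m
    induction m with
    | zero => intro v; rw [pow_zero, map_one]; rfl
    | succ m ih =>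
      intro v
      rw [pow_succ, irregPoly_mul, iterate_succ_apply, ← ih]
      congr 1
      rw [map_sub]
      change irregPoly W PX (j v) - irregPoly W (PC β) (j v) = _
      rw [irregPoly_X, irregPoly_C, hj, add_sub_cancel_right]
  refine ⟨L.map j, hL.map j, ?_, fun w hw => ?_, m, ?_⟩
  · rintro _ ⟨v, hv, rfl⟩
    rw [hj]
    exact add_mem ⟨_, hst v hv, rfl⟩ (smul_mem _ _ ⟨v, hv, rfl⟩)
  · obtain ⟨n, hn⟩ := hL₀.full (e ⟨w, hw⟩)
    refine ⟨n, _, hle hn, ?_⟩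
    rw [map_smul]
    exact congrArg (fun z : N => ϖ ^ n • z.1) (e.symm_apply_apply ⟨w, hw⟩)
  · rintro _ ⟨v, hv, rfl⟩
    rw [hjm]
    obtain ⟨z, hz, h⟩ := hm v hv
    refine ⟨j z, ⟨z, hz, rfl⟩, ?_⟩
    rw [← h]
    exact (map_smul j _ _).symm

theorem exists_lattice_of_decomposition [CharZero K] {s : Set K} [Finite s]
    {N : s → Submodule DK W} (hN : ⨆ β, N β = ⊤)
    (h : ∀ β : s, HolTypeGeom K β (ModuleCat.of _ (N β))) {q : K[X]}
    (hq : ∀ β ∈ s, PX - PC β ∣ q) : ∃ L : Submodule O W, IsLattice L ∧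
      (∀ w ∈ L, irregAct K W w ∈ L) ∧
      ∃ m, ∀ w ∈ L, irregPoly W (q ^ m) w ∈ ϖ • L := by
  have := Fintype.ofFinite s
  choose L hfg hst hfull m hm using fun β => exists_lattice_of_holTypeGeom (h β)
  refine ⟨⨆ β, L β, ⟨Submodule.fg_iSup _ hfg, fun w => ?_⟩, fun w hw => ?_, ∑ β, m β,
    fun w hw => ?_⟩
  · have hw : w ∈ ⨆ β, N β := hN ▸ Submodule.mem_top
    refine Submodule.iSup_induction N
      (motive := fun w => ∃ n, ϖ ^ n • w ∈ ⨆ β, L β) hw (fun β w hw => ?_)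
      ⟨0, by rw [smul_zero]; exact zero_mem _⟩ ?_
    · obtain ⟨n, hn⟩ := hfull β w hw
      exact ⟨n, Submodule.mem_iSup_of_mem β hn⟩
    · rintro v w ⟨n, hn⟩ ⟨n', hn'⟩
      refine ⟨n + n', ?_⟩
      rw [smul_add, pow_add, mul_smul _ _ w, mul_comm, mul_smul]
      exact add_mem (smul_mem _ _ hn) (smul_mem _ _ hn')
  · refine Submodule.iSup_induction L (motive := fun w => irregAct K W w ∈ ⨆ β, L β) hw
      (fun β w hw => Submodule.mem_iSup_of_mem β (hst β w hw)) ?_ fun v w hv hw => ?_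
    · rw [map_zero]; exact zero_mem _
    · rw [map_add]; exact add_mem hv hw
  · refine Submodule.iSup_induction L
      (motive := fun w => irregPoly W (q ^ ∑ β, m β) w ∈ ϖ • ⨆ β, L β) hw
      (fun β w hw => ?_) ?_ fun v w hv hw => ?_
    · obtain ⟨r, hr⟩ := (pow_dvd_pow_of_dvd (hq β β.2) (m β)).trans (pow_dvd_pow q
        (single_le_sum (f := m) (fun _ _ => Nat.zero_le _) (mem_univ β)))
      rw [hr, mul_comm, irregPoly_mul]
      have h1 := hm β w hw
      rw [← pow_one ϖ] at h1 ⊢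
      exact pow_smul_mono 1 (le_iSup L β) (irregPoly_mem (irregAct_mem_pow_smul (hst β) 1) r h1)
    · rw [map_zero]; exact zero_mem _
    · rw [map_add]; exact add_mem hv hw

end TypeIn

section UnramifiedType

variable {K : Type u} [Field K] {M : PMod}

local notation "φ" => algebraMap K (AlgebraicClosure K)

theorem irregPoly_unr (q : K[X]) (m : M) :
    irregPoly (toUnr K M) (q.map φ) (unr M m) = unr M (irregPoly M q m) := by
  induction q using Polynomial.induction_on generalizing m with
  | C c => rw [Polynomial.map_C, irregPoly_C, irregPoly_C, unr_powerSeries_smul, PowerSeries.map_C]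
  | add p q hp hq => rw [Polynomial.map_add, irregPoly_add, hp, hq, irregPoly_add, map_add]
  | monomial n a ih =>
    rw [pow_succ, ← mul_assoc, Polynomial.map_mul, irregPoly_mul, irregPoly_mul, Polynomial.map_X,
      irregPoly_X, irregPoly_X, irregAct_unr, ih]

theorem exists_of_laurentMap_eq {f : Kx} {g : (AlgebraicClosure K)⟦X⟧}
    (h : laurentMap φ f = ofPowerSeries ℤ _ g) :
    ∃ g' : O, f = ofPowerSeries ℤ K g' := by
  refine ⟨PowerSeries.mk fun n => f.coeff n, HahnSeries.ext (funext fun n => ?_)⟩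
  have h1 : φ (f.coeff n) = _ := congrArg (fun f => HahnSeries.coeff f n) h
  rw [PowerSeries.coeff_coe] at h1 ⊢
  split_ifs with hn
  · rw [if_pos hn] at h1
    exact (map_eq_zero φ).1 h1
  · rw [PowerSeries.coeff_mk]
    congr 1
    lia

/-- The vectors of `M` which lie in a lattice of the base change form a lattice: in a basis of `M`
their coordinates have bounded denominators. -/
theorem isLattice_comap_unr (hM : Hol K M) {L : Submodule (AlgebraicClosure K)⟦X⟧ (toUnr K M)}
    (hL : IsLattice L) {L₀ : Submodule O M} (h : ∀ m, m ∈ L₀ ↔ unr M m ∈ L) : IsLattice L₀ := by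
  obtain ⟨r, b, hb, hli⟩ := exists_unr_basis M hM
  have hb' : IsLattice (span O (range b)) := by
    refine ⟨fg_span (Set.finite_range _), fun m => ?_⟩
    obtain ⟨c, rfl⟩ := hb m
    obtain ⟨n, g, hg⟩ := exists_common_denominator c
    refine ⟨n, ?_⟩
    rw [smul_sum]
    refine sum_mem fun i _ => ?_
    rw [X_pow_smul, ← mul_smul, hg, ofPowerSeries_smul]
    exact smul_mem _ _ (subset_span ⟨i, rfl⟩)
  obtain ⟨n, hn⟩ := (isLattice_unr hb' rfl).1.exists_pow_smul_le hL.fg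
  refine ⟨?_, fun m => ?_⟩
  · refine Submodule.fg_of_fg_map_injective (LinearMap.lsmul O M (X ^ n))
      (X_pow_smul_injective n) (FG.of_le hb'.fg ?_)
    rintro _ ⟨m, hm, rfl⟩
    have h1 := hn _ ((h m).1 hm)
    obtain ⟨c, rfl⟩ := hb m
    obtain ⟨g, hg⟩ := (mem_span_range _).1 h1
    change ϖ ^ n • ∑ i, c i • b i ∈ _
    rw [smul_sum]
    refine sum_mem fun i _ => ?_
    have h2 : ∀ i, ofPowerSeries ℤ _ (g i) = laurentMap φ ((single 1 1 : Kx) ^ n * c i) := by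
      have h3 := Fintype.linearIndependent_iff.1 hli (fun i => ofPowerSeries ℤ _ (g i) -
        laurentMap φ ((single 1 1 : Kx) ^ n * c i)) (by
          simp only [sub_smul, sum_sub_distrib, ofPowerSeries_smul]
          rw [hg, ← PowerSeries.map_X φ, ← map_pow, ← unr_powerSeries_smul, smul_sum, map_sum,
            sub_eq_zero]
          refine sum_congr rfl fun i _ => ?_
          rw [X_pow_smul, ← mul_smul, unr_smul])
      exact fun i => sub_eq_zero.1 (h3 i)
    obtain ⟨g', hg'⟩ := exists_of_laurentMap_eq (h2 i).symm
    rw [X_pow_smul, ← mul_smul, hg', ofPowerSeries_smul]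
    exact smul_mem _ _ (subset_span ⟨i, rfl⟩)
  · obtain ⟨n, hn⟩ := hL.full (unr M m)
    exact ⟨n, by rwa [h, unr_powerSeries_smul, map_pow, PowerSeries.map_X]⟩

/-- A module of type `y` contains a lattice on which `p(X² d/dX)` is topologically nilpotent, where
`p` is an equation of `y`. -/
theorem exists_lattice_of_holType [CharZero K] {y : ClosedPt K} {p : K[X]} (hp : p ≠ 0)
    (hy : y.asIdeal = Ideal.span {p}) (hM : HolType y M) : ∃ L : Submodule O M, IsLattice L ∧
      (∀ v ∈ L, irregAct K M v ∈ L) ∧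
      ∃ n, ∀ v ∈ L, irregPoly M (p ^ n) v ∈ ϖ • L := by
  classical
  obtain ⟨hM, N, -, hN, h⟩ := hM
  have hfin : Finite y.geom := by
    rw [show y.geom = _ from Set.ext fun β => mem_geom_iff hp hy β]
    exact Finset.finite_toSet _
  have : CharZero (AlgebraicClosure K) :=
    charZero_of_injective_algebraMap (algebraMap K _).injective
  obtain ⟨L, hL, hst, m, hm⟩ := exists_lattice_of_decomposition hN h (q := p.map φ) fun β hβ =>
    Polynomial.dvd_iff_isRoot.2 (Polynomial.mem_roots'.1 (Multiset.mem_toFinset.1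
      ((mem_geom_iff hp hy β).1 hβ))).2
  let L₀ : Submodule O M :=
    { carrier := {m | unr M m ∈ L}
      zero_mem' := by rw [Set.mem_ofPred_eq, map_zero]; exact zero_mem _
      add_mem' := fun {v w} hv hw => by rw [Set.mem_ofPred_eq, map_add]; exact add_mem hv hw
      smul_mem' := fun f v hv => by
        rw [Set.mem_ofPred_eq, unr_powerSeries_smul]; exact L.smul_mem _ hv }
  refine ⟨L₀, isLattice_comap_unr hM hL fun _ => Iff.rfl, fun v hv => ?_, m, fun v hv => ?_⟩
  · change unr M _ ∈ L
    rw [← irregAct_unr]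
    exact hst _ hv
  · obtain ⟨w, hw, h1⟩ := hm _ hv
    refine ⟨divX K M (irregPoly M (p ^ m) v), ?_, X_smul_divX _⟩
    rw [← Polynomial.map_pow, irregPoly_unr, ← X_smul_divX (K := K) (irregPoly M (p ^ m) v),
      unr_powerSeries_smul, PowerSeries.map_X] at h1
    have h2 : w = unr M (divX K M (irregPoly M (p ^ m) v)) :=
      X_pow_smul_injective (K := AlgebraicClosure K) (V := toUnr K M) 1 (by simpa using h1)
    change unr M _ ∈ L
    rw [← h2]
    exact hw

end UnramifiedType

/-! ### The type of the transform from a finite point -/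

section FiniteForward

variable {k K : Type u} [Field k] [CharZero k] [Field K] [Algebra k K] [CharZero K]

/-- The transform of `j_! M` to infinity, for a point with coordinate `a`, has type `ε a`: the
constant `ε a` acts on it by an endomorphism. -/
theorem exists_transform_finite_infinity_holType [Module.Finite k K]
    {M : PMod} (hM : Hol K M) (a : K) (ε : ℤ) (hε : ε * ε = 1)
    {y : ClosedPt k} {p : k[X]} (hp : Irreducible p) (hy : y.asIdeal = Ideal.span {p})
    (hpa : aeval ((ε : K) * a) p = 0) :
    ∃ (N : ModuleCat.{u} (PuncturedOp k)) (e : (lowerShriek K).obj M ≃+ N), HolType y N ∧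
      (∀ (c : k) v, (HahnSeries.C c : k⸨X⸩) • e v = e ((C (algebraMap k K c) : O) • v)) ∧
      (∀ v, divX k N (e v) = e (ε • del dO • v)) ∧
      (∀ v, irregAct k N (e v) = e (ε • (C a + X : O) • v)) ∧
      @IsHomeomorph _ _ (adicTopology K k ((lowerShriek K).obj M))
        (adicTopology k k ((lowerStar k).obj N)) e := by
  obtain ⟨n, Q, g, hQ, hg⟩ := exists_presentation_lowerShriek hM
  obtain ⟨N, e, L', hL', heC, heX, heZ, he, hmul, m, hm⟩ :=
    exists_transform_finite_infinity (k := k) hQ hg a ε hε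
  have heX' : ∀ v, (X : k⟦X⟧) • e (ε • del dO • v) = e v := fun v => by
    rw [X_smul, heX]
  let b : O := C ((ε : K) * a)
  have hb : ∀ v : (lowerShriek K).obj M, b • v = ε • (C a : O) • v := fun v => by
    rw [← Int.cast_smul_eq_zsmul O, ← mul_smul, ← map_intCast (C : K →+* O), ← map_mul]
  have hbd : ∀ v : (lowerShriek K).obj M,
      del dO • b • v = b • del dO • v := fun v => by
    have h1 := isDerivation_del (d := dO) b v
    rwa [powerD_C, zero_smul, add_zero] at h1
  let B₀ : N →+ N := (e.toAddMonoidHom.comp (DistribSMul.toAddMonoidHom _ b)).comp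
    e.symm.toAddMonoidHom
  have hB₀ : ∀ v, B₀ (e v) = e (b • v) :=
    fun v => congrArg (fun w => e (b • w)) (e.symm_apply_apply v)
  have hB₀X : ∀ w, B₀ ((X : k⟦X⟧) • w) = (X : k⟦X⟧) • B₀ w := by
    intro w
    obtain ⟨v, rfl⟩ := e.surjective w
    obtain ⟨u, rfl⟩ : ∃ u, ε • del dO • u = v := by
      obtain ⟨u, hu⟩ := hQ.del_surjective hg (ε • v)
      exact ⟨u, by rw [hu, smul_smul, hε, one_smul]⟩
    rw [heX', hB₀, hB₀, smul_comm b, ← hbd, heX']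
  have hB₀L : ∀ w ∈ L', B₀ w ∈ L' := by
    intro w hw
    obtain ⟨v, rfl⟩ := e.surjective w
    rw [hB₀]
    exact hmul _ _ hw
  obtain ⟨B, hB⟩ := exists_linearMap_of_approx B₀ hL' hL' (fun m => ⟨m, fun v hv => by
      obtain ⟨w, hw, rfl⟩ := mem_pow_smul.1 hv
      exact mem_pow_smul.2 ⟨_, hB₀L w hw, (iterate_smul_comm hB₀X m 1 w).symm⟩⟩)
    (fun c w => by
      obtain ⟨v, rfl⟩ := e.surjective w
      rw [← C_smul_eq, ← C_smul_eq, heC, hB₀, hB₀, heC, smul_comm]) hB₀X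
    fun w => by
      obtain ⟨v, rfl⟩ := e.surjective w
      rw [heZ, hB₀, hB₀, heZ, smul_comm b, smul_comm b]
  have hBe : ∀ v, B (e v) = e (b • v) := fun v => (hB _).trans (hB₀ v)
  have hpoly : ∀ (q : k[X]) v, endAct B q (e v) =
      e ((C (aeval ((ε : K) * a) q) : O) • v) := by
    intro q
    induction q using Polynomial.induction_on with
    | C c => intro v; rw [endAct_C, constEnd_apply, heC, aeval_C]
    | add p q hp hq =>
      intro v
      rw [map_add, LinearMap.add_apply, hp, hq, map_add, map_add, add_smul, map_add]
    | monomial n c ih =>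
      intro v
      rw [pow_succ, ← mul_assoc, map_mul, mul_apply, endAct_X, hBe, ih,
        map_mul (aeval _) _ PX, map_mul C, mul_smul,
        aeval_X]
  have hT : ∀ n v, (irregAct k N - B.toAddMonoidHom)^[n] (e v) =
      e (ε ^ n • ϖ ^ n • v) := by
    intro n
    induction n with
    | zero => intro v; simp
    | succ n ih =>
      intro v
      rw [iter_succ, ih]
      change irregAct k N (e _) - B (e _) = _
      rw [heZ, hBe, hb, add_smul, smul_add, map_add, add_sub_cancel_left, smul_comm _ (ε ^ n),
        ← mul_smul, ← mul_smul, ← pow_succ', ← pow_succ']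
  refine ⟨N, e, holType_of_endomorphism hp hy hL' B ?_ (fun w hw => ?_) (n := m) fun w hw => ?_,
    heC, fun v => ?_, heZ, he⟩
  · refine LinearMap.ext fun w => ?_
    obtain ⟨v, rfl⟩ := e.surjective w
    rw [hpoly, hpa, map_zero, zero_smul, map_zero, LinearMap.zero_apply]
  · obtain ⟨v, rfl⟩ := e.surjective w
    have h1 := hT 1 v
    rw [Function.iterate_one] at h1
    rw [h1, map_zsmul]
    exact zsmul_mem (hmul _ _ hw) _
  · obtain ⟨v, rfl⟩ := e.surjective w
    rw [hT, map_zsmul]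
    exact zsmul_mem (hm v hw) _
  · rw [← heX' v, divX_X_smul]

end FiniteForward

/-! ### Hensel's lemma for operators -/

section Root

variable {k : Type u} [Field k] {V : Type v} [AddCommGroup V] [Module k V] {F : ℕ → Submodule k V}
  {Z : Module.End k V} {p : k[X]}

/-- If `p(Z)` is topologically nilpotent, polynomials in `Z` which converge in the completion at `p`
converge to an operator. -/
theorem TopNilpotent.exists_limit (h : TopNilpotent F (aeval Z p))
    (hZ : ∀ n, ∀ v ∈ F n, Z v ∈ F n) {f : ℕ → k[X]} (hf : ∀ m, p ^ m ∣ f (m + 1) - f m) :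
    ∃ A : Module.End k V, ∀ v m N, (aeval Z p ^ N) v ∈ F m → A v - aeval Z (f N) v ∈ F m := by
  have hdvd : ∀ N r, p ^ N ∣ f (N + r) - f N := by
    intro N r
    induction r with
    | zero => simp
    | succ r ih =>
      rw [← sub_add_sub_cancel _ (f (N + r))]
      exact dvd_add ((pow_dvd_pow p (Nat.le_add_right N r)).trans (hf _)) ih
  have h1 : ∀ {v m N N'}, N ≤ N' → (aeval Z p ^ N) v ∈ F m →
      aeval Z (f N') v - aeval Z (f N) v ∈ F m := by
    intro v m N N' hN hv
    obtain ⟨r, rfl⟩ := Nat.exists_eq_add_of_le hN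
    obtain ⟨q, hq⟩ := hdvd N r
    rw [← LinearMap.sub_apply, ← map_sub, hq, mul_comm, map_mul, map_pow, mul_apply]
    exact aeval_apply_mem (hZ m) q hv
  have h2 : ∀ {v m N N'}, (aeval Z p ^ N) v ∈ F m → (aeval Z p ^ N') v ∈ F m →
      aeval Z (f N') v - aeval Z (f N) v ∈ F m := by
    intro v m N N' hN hN'
    rcases le_total N N' with hle | hle
    · exact h1 hle hN
    · rw [← neg_mem_iff, neg_sub]
      exact h1 hle hN'
  have hex : ∀ v, ∃ w, ∀ m N, (aeval Z p ^ N) v ∈ F m →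
      w - aeval Z (f N) v ∈ F m := by
    intro v
    choose N hN using h.nilp v
    obtain ⟨w, hw⟩ := h.compl (fun m => aeval Z (f (N m)) v) fun n =>
      h2 (hN n) (h.anti (Nat.le_succ n) (hN (n + 1)))
    refine ⟨w, fun m n hn => ?_⟩
    rw [← sub_add_sub_cancel w]
    exact add_mem (hw m) (h2 hn (hN m))
  choose A hA using hex
  refine ⟨{ toFun := A, map_add' := fun v w => ?_, map_smul' := fun c v => ?_ }, hA⟩
  · rw [← sub_eq_zero]
    refine h.sep _ fun m => ?_
    obtain ⟨N₁, h₁⟩ := h.eventually_pow_mem v m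
    obtain ⟨N₂, h₂⟩ := h.eventually_pow_mem w m
    have e₁ := hA v m _ (h₁ (N₁ + N₂) (by lia))
    have e₂ := hA w m _ (h₂ (N₁ + N₂) (by lia))
    have e₃ := hA (v + w) m (N₁ + N₂) (by
      rw [map_add]; exact add_mem (h₁ _ (by lia)) (h₂ _ (by lia)))
    rw [map_add] at e₃
    convert sub_mem (sub_mem e₃ e₁) e₂ using 1
    abel
  · rw [← sub_eq_zero]
    refine h.sep _ fun m => ?_
    obtain ⟨N, hN⟩ := h.nilp v m
    have e₁ := (F m).smul_mem c (hA v m N hN)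
    have e₂ := hA (c • v) m N (by rw [map_smul]; exact (F m).smul_mem c hN)
    rw [map_smul] at e₂
    convert sub_mem e₂ e₁ using 1
    rw [smul_sub, RingHom.id_apply]
    abel

theorem aeval_apply_comm {A Z : Module.End k V} (h : ∀ v, A (Z v) = Z (A v)) (q : k[X]) (v : V) :
    A (aeval Z q v) = aeval Z q (A v) := by
  induction q using Polynomial.induction_on generalizing v with
  | C c => simp
  | add p q hp hq => simp only [map_add, LinearMap.add_apply, hp, hq]
  | monomial n a ih =>
    rw [pow_succ, ← mul_assoc, map_mul, aeval_X, mul_apply, ih, h]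
    rfl

theorem aeval_sub_mem (hZ : ∀ n, ∀ v ∈ F n, Z v ∈ F n) {f : ℕ → k[X]} {A : Module.End k V}
    (hA : ∀ v m N, (aeval Z p ^ N) v ∈ F m → A v - aeval Z (f N) v ∈ F m)
    (hAF : ∀ n, ∀ v ∈ F n, A v ∈ F n) (hAZ : ∀ v, A (Z v) = Z (A v)) {v : V} {m N : ℕ}
    (hv : (aeval Z p ^ N) v ∈ F m) (q : k[X]) :
    aeval A q v - aeval Z (q.comp (f N)) v ∈ F m := by
  induction q using Polynomial.induction_on with
  | C c => simp
  | add p q hp hq =>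
    rw [Polynomial.add_comp, map_add, map_add, LinearMap.add_apply, LinearMap.add_apply,
      add_sub_add_comm]
    exact add_mem hp hq
  | monomial n a ih =>
    rw [pow_succ, ← mul_assoc]
    generalize PC a * PX ^ n = r at ih
    have h1 := hA (aeval A r v) m N (by
      rw [← map_pow, aeval_apply_comm (fun v => (aeval_apply_comm hAZ (p ^ N) v).symm)]
      exact aeval_apply_mem (hAF m) r (by rwa [map_pow]))
    have h2 := add_mem h1 (aeval_apply_mem (hZ m) (f N) ih)
    rw [map_sub, sub_add_sub_cancel] at h2
    rwa [Polynomial.mul_comp, Polynomial.X_comp, mul_comm, mul_comm _ (f N), map_mul, map_mul,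
      aeval_X]

/-- If `p(Z)` is topologically nilpotent, the polynomial `p` has a root `A` such that `Z - A` is
topologically nilpotent, by Hensel's lemma. It commutes with `Z` and with the operators which behave
like the derivation `d/dZ`. -/
theorem TopNilpotent.exists_root (h : TopNilpotent F (aeval Z p))
    (hZ : ∀ n, ∀ v ∈ F n, Z v ∈ F n) {f : ℕ → k[X]} (hf : ∀ m, p ^ m ∣ f (m + 1) - f m)
    (hf' : ∀ m, p ^ m ∣ Polynomial.derivative (f (m + 1))) (hp : ∀ m, p ^ m ∣ p.comp (f m))
    (hfX : ∀ m, p ∣ PX - f (m + 1)) {E : Module.End k V}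
    (hEc : ∀ m, ∃ m', ∀ v ∈ F m', E v ∈ F m) (hE : ∀ v, E (Z v) = Z (E v) + v) :
    ∃ A : Module.End k V, aeval A p = 0 ∧ (∀ v, A (Z v) = Z (A v)) ∧
      (∀ v, E (A v) = A (E v)) ∧ (∀ n, ∀ v ∈ F n, A v ∈ F n) ∧
      ∀ N m v, (aeval Z p ^ (N + 1)) v ∈ F m → ((Z - A) ^ (N + 1)) v ∈ F m := by
  obtain ⟨A, hA⟩ := h.exists_limit hZ hf
  have hAF : ∀ n, ∀ v ∈ F n, A v ∈ F n := fun n v hv => by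
    have h1 := add_mem (hA v n 0 (by simpa using hv)) (aeval_apply_mem (hZ n) (f 0) hv)
    rwa [sub_add_cancel] at h1
  have hAZ : ∀ v, A (Z v) = Z (A v) := fun v => by
    rw [← sub_eq_zero]
    refine h.sep _ fun m => ?_
    obtain ⟨N₁, h₁⟩ := h.eventually_pow_mem v m
    obtain ⟨N₂, h₂⟩ := h.eventually_pow_mem (Z v) m
    have e₁ := hA _ m _ (h₂ (N₁ + N₂) (by lia))
    have e₂ := hZ m _ (hA v m _ (h₁ (N₁ + N₂) (by lia)))
    rw [map_sub, aeval_apply_comm fun _ => rfl] at e₂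
    have := sub_mem e₁ e₂
    rwa [sub_sub_sub_cancel_right] at this
  refine ⟨A, LinearMap.ext fun v => h.sep _ fun m => ?_, hAZ, fun v => ?_, hAF, fun N m v hv => ?_⟩
  · obtain ⟨N, hN⟩ := h.nilp v m
    obtain ⟨r, hr⟩ := hp N
    have h1 := aeval_sub_mem hZ hA hAF hAZ hN p
    rw [hr, mul_comm, map_mul, map_pow, mul_apply] at h1
    exact (Submodule.sub_mem_iff_left _ (aeval_apply_mem (hZ m) r hN)).1 h1
  · rw [← sub_eq_zero]
    refine h.sep _ fun m => ?_
    obtain ⟨m', hm'⟩ := hEc m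
    obtain ⟨N₁, h₁⟩ := h.eventually_pow_mem v m'
    obtain ⟨N₂, h₂⟩ := h.eventually_pow_mem (E v) m
    obtain ⟨N₃, h₃⟩ := h.eventually_pow_mem v m
    let N := N₁ + N₂ + N₃
    have e₁ := hm' _ (hA v m' (N + 1) (h₁ _ (by lia)))
    have e₂ := hA (E v) m (N + 1) (h₂ _ (by lia))
    obtain ⟨r, hr⟩ := hf' N
    have e₃ := aeval_apply_mem (hZ m) r (h₃ N (by lia))
    rw [← map_pow, ← mul_apply, ← map_mul, mul_comm, ← hr] at e₃
    have h4 : E (aeval Z (f (N + 1)) v) = aeval Z (f (N + 1)) (E v) +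
        aeval Z (Polynomial.derivative (f (N + 1))) v := by
      have := TopNilpotent.aeval_derivation (q := 1) (fun v => by rw [map_one]; exact hE v)
        (f (N + 1)) v
      rwa [one_mul] at this
    rw [map_sub, h4] at e₁
    convert add_mem (sub_mem e₁ e₂) e₃ using 1
    abel
  · obtain ⟨r, hr⟩ := hfX N
    have h1 := aeval_sub_mem (f := fun N => PX - f N) (A := Z - A) (N := N + 1) hZ
      (fun v m N hN => by
        rw [LinearMap.sub_apply, map_sub, aeval_X, LinearMap.sub_apply,
          sub_sub_sub_cancel_left, ← neg_mem_iff, neg_sub]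
        exact hA v m N hN) (fun n v hv => sub_mem (hZ n v hv) (hAF n v hv))
      (fun v => by rw [LinearMap.sub_apply, LinearMap.sub_apply, map_sub, hAZ]) hv (PX ^ (N + 1))
    rw [map_pow, aeval_X, Polynomial.X_pow_comp, hr, mul_pow, mul_comm, map_mul, map_pow,
      map_pow, mul_apply, ← map_pow (aeval Z) r] at h1
    exact (Submodule.sub_mem_iff_left _ (aeval_apply_mem (hZ m) _ hv)).1 h1

end Root

/-! ### Openness of the Euler operator -/

section Openness

variable {K : Type u} [Field K] [CharZero K] {W : Type u} [AddCommGroup W] [Module DK W]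
  [Module Kx W] [Module O W] [IsScalarTower Kx DK W]
  [IsScalarTower O Kx W] [IsScalarTower O DK W]

/-- The image of a lattice under `X d/dX` is open. Modulo this image every vector is congruent to
a multiple of the cyclic vector `w`, and the equation for `w` shows that the class of `Xᵐ w` is
that of a multiple of `Xᵐ⁺¹ w`, if `-m` is not a root of the indicial polynomial. -/
theorem exists_isLattice_euler_surjective [Module.Finite Kx W] :
    ∃ G : Submodule O W, IsLattice G ∧ ∃ m₀, ∀ m, m₀ ≤ m → ∀ v ∈ ϖ ^ m • G, ∃ u ∈ ϖ ^ m • G,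
        eulerAct K W u = v := by
  obtain ⟨n, w, g, -, hspan, hrel, -, hq⟩ := exists_cyclic_equation (K := K) (W := W)
  set q := ∑ i : Fin (n + 1), PC (constantCoeff (g i)) * (PX : K[X]) ^ (i : ℕ)
  have hq' : q.comp (-PX) ≠ 0 := fun h => hq (by
    have := congrArg (fun p => p.comp (-PX)) h
    simpa [Polynomial.comp_assoc] using this)
  obtain ⟨m₀, hm₀⟩ := exists_shift_ne_zero hq'
  let G : Submodule O W := span O (range fun i : Fin (n + 1) => eulerOp K ^ (i : ℕ) • w)
  have hG : ∀ i ≤ n, eulerOp K ^ i • w ∈ G := fun i hi =>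
    subset_span ⟨⟨i, Nat.lt_succ_of_le hi⟩, rfl⟩
  have hGfg : G.FG := fg_span (Set.finite_range _)
  have hGl : IsLattice G := by
    refine ⟨hGfg, fun v => ?_⟩
    have hv : v ∈ span Kx (range fun i : Fin n => eulerOp K ^ (i : ℕ) • w) := hspan ▸ trivial
    obtain ⟨c, rfl⟩ := (mem_span_range _).1 hv
    obtain ⟨N, f, hf⟩ := exists_common_denominator c
    refine ⟨N, ?_⟩
    rw [smul_sum]
    refine sum_mem fun i _ => ?_
    rw [X_pow_smul, ← mul_smul, hf, ofPowerSeries_smul]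
    exact G.smul_mem _ (hG i i.2.le)
  have hδ : IsDerivation (mulDer X dO) (eulerAct K W) := fun f v =>
    derivation_smul (K := K) isDerivation_eulerAct f v
  let S : ℕ → AddSubgroup W := fun m =>
    { carrier := {v | ∃ u ∈ ϖ ^ m • G, v - eulerAct K W u ∈ ϖ ^ (m + 1) • G}
      zero_mem' := ⟨0, zero_mem _, by rw [map_zero, sub_zero]; exact zero_mem _⟩
      neg_mem' := fun {v} ⟨u, hu, h⟩ => ⟨-u, neg_mem hu, by
        rw [map_neg, ← neg_sub']; exact neg_mem h⟩
      add_mem' := fun {v v'} ⟨u, hu, h⟩ ⟨u', hu', h'⟩ => ⟨u + u', add_mem hu hu', by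
        rw [map_add, add_sub_add_comm]; exact add_mem h h'⟩ }
  have hS₀ : ∀ m, ∀ v ∈ ϖ ^ (m + 1) • G, v ∈ S m := fun m v hv =>
    ⟨0, zero_mem _, by rwa [map_zero, sub_zero]⟩
  have hfG : ∀ {m : ℕ} {f : O} {v : W}, X ^ m ∣ f → v ∈ G →
      f • v ∈ ϖ ^ m • G := by
    rintro m _ v ⟨h, rfl⟩ hv
    rw [mul_smul]
    exact mem_pow_smul.2 ⟨_, G.smul_mem h hv, rfl⟩
  have hstep : ∀ m, ∀ i ≤ n, ∀ f : O, X ^ m ∣ f →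
      f • eulerOp K ^ i • w - (C ((-(m : K)) ^ i) * f) • w ∈ S m := by
    intro m i
    induction i with
    | zero => intro _ f _; simp
    | succ i ih =>
      intro hi f hf
      have hi' : i ≤ n := (Nat.le_succ i).trans hi
      have h1 := ih hi' (C (-(m : K)) * f) (hf.mul_left _)
      have h2 : f • eulerOp K ^ (i + 1) • w - (C (-(m : K)) * f) • eulerOp K ^ i • w ∈ S m := by
        refine ⟨f • eulerOp K ^ i • w, hfG hf (hG i hi'), ?_⟩
        have h3 : X ^ (m + 1) ∣
            C (-(m : K)) * f + X * dO f := by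
          obtain ⟨h, rfl⟩ := hf
          refine ⟨dO h, ?_⟩
          rw [(dO).leibniz, map_neg, map_natCast]
          linear_combination h * powerD_X_pow (K := K) m
        rw [hδ, mulDer_apply, eulerAct_apply, ← mul_smul (eulerOp K), ← pow_succ']
        have h4 := neg_mem (hfG h3 (hG i hi'))
        rw [add_smul] at h4
        convert h4 using 1
        abel
      have h4 := add_mem h2 h1
      rwa [sub_add_sub_cancel, ← mul_assoc, ← map_mul, ← pow_succ] at h4
  have hw : ∀ m, m₀ ≤ m → ∀ f : O, X ^ m ∣ f → f • w ∈ S m := by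
    intro m hm f hf
    have hqm : q.eval (-(m : K)) ≠ 0 := by
      have := hm₀ (m - m₀)
      rw [← Nat.cast_add, Nat.sub_add_cancel hm, Polynomial.eval_comp] at this
      simpa using this
    let f' : O := C (q.eval (-(m : K)))⁻¹ * f
    have h1 : ∑ i : Fin (n + 1), ((f' * g i) • eulerOp K ^ (i : ℕ) • w -
        (C ((-(m : K)) ^ (i : ℕ)) * (f' * g i)) • w) ∈ S m := sum_mem fun i _ =>
      hstep m i (Nat.le_of_lt_succ i.2) _ ((hf.mul_left _).mul_right _)
    simp only [sum_sub_distrib, mul_smul f'] at h1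
    rw [← smul_sum, hrel, smul_zero, zero_sub, neg_mem_iff, ← sum_smul] at h1
    have h2 : X ^ (m + 1) ∣ f - ∑ i : Fin (n + 1), C ((-(m : K)) ^ (i : ℕ)) * (f' * g i) := by
      have h3 : f = f' * C (q.eval (-(m : K))) := by
        simp only [f']
        rw [mul_right_comm, ← map_mul, inv_mul_cancel₀ hqm, map_one, one_mul]
      nth_rewrite 1 [h3]
      rw [Polynomial.eval_finsetSum, map_sum, Finset.mul_sum, ← sum_sub_distrib]
      refine Finset.dvd_sum fun i _ => ?_
      obtain ⟨h, hh⟩ := hf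
      obtain ⟨r, hr⟩ := X_dvd_iff.2 (show constantCoeff (C (constantCoeff (g i)) - g i) = 0 by simp)
      refine ⟨C (q.eval (-(m : K)))⁻¹ * h * C ((-(m : K)) ^ (i : ℕ)) * r, ?_⟩
      rw [Polynomial.eval_mul, eval_C, Polynomial.eval_pow, eval_X, map_mul]
      simp only [f']
      rw [hh]
      linear_combination (C (q.eval (-(m : K)))⁻¹ * X ^ m * h * C ((-(m : K)) ^ (i : ℕ))) * hr
    have h3 := add_mem (hS₀ m _ (hfG h2 (by simpa using hG 0 n.zero_le))) h1
    rwa [← add_smul, sub_add_cancel] at h3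
  have hGS : ∀ m, m₀ ≤ m → ∀ v ∈ ϖ ^ m • G, v ∈ S m := by
    intro m hm v hv
    obtain ⟨v', hv', rfl⟩ := mem_pow_smul.1 hv
    obtain ⟨c, rfl⟩ := (mem_span_range _).1 (show v' ∈ span O
      (range fun i : Fin (n + 1) => eulerOp K ^ (i : ℕ) • w) from hv')
    rw [smul_sum]
    refine sum_mem fun i _ => ?_
    rw [← mul_smul]
    have h1 := add_mem (hstep m i (Nat.le_of_lt_succ i.2) _ (Dvd.intro (c i) rfl))
      (hw m hm _ ((Dvd.intro (c i) rfl).mul_left (C ((-(m : K)) ^ (i : ℕ)))))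
    rwa [sub_add_cancel] at h1
  refine ⟨G, hGl, m₀, fun m hm => ?_⟩
  have hle : ϖ ^ m • G ≤ filt hδ (ϖ ^ m • G) 1 := filt_mono hδ _ (Nat.zero_le 1)
  have hfgm : (ϖ ^ m • G).FG := FG.of_le hGfg (pow_smul_le m G)
  refine le_image_of_approx hfgm hfgm (filt_fg hδ hfgm 1) (eulerAct K W)
    (map_mem_pow_smul hδ hle fun v hv => map_mem_filt (j := 0) hδ hv) fun j v hv => ?_
  rw [smul_smul, ← pow_add] at hv
  obtain ⟨u, hu, h⟩ := hGS (j + m) (hm.trans (Nat.le_add_left m j)) v hv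
  refine ⟨u, ?_, ?_⟩
  · rwa [smul_smul, ← pow_add]
  · rwa [smul_smul, ← pow_add, add_right_comm]

end Openness

/-! ### The transform from infinity to a closed point -/

section ConstantAction

variable {K : Type u} [Field K] {M : PMod}

instance (M : PMod) : Module K M := Module.compHom M (C : K →+* O)

/-- The multiples `Xⁿ L` of a lattice, as subspaces over the constants. -/
def adicFilt (L : Submodule O M) (n : ℕ) : Submodule K M where
  carrier := {v | v ∈ ϖ ^ n • L}
  add_mem' h h' := Submodule.add_mem (ϖ ^ n • L) h h'
  zero_mem' := zero_mem (ϖ ^ n • L)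
  smul_mem' c _ h := smul_mem (ϖ ^ n • L) (C c : O) h

theorem mem_adicFilt_zero {L : Submodule O M} {v : M} : v ∈ adicFilt L 0 ↔ v ∈ L := by
  change v ∈ ϖ ^ 0 • L ↔ _
  rw [pow_zero, one_smul]

variable (M)

/-- The operator `X² d/dX`, linear over the constants. -/
def irregEnd : Module.End K M where
  toFun := irregAct K M
  map_add' := map_add _
  map_smul' := irregAct_C_smul

/-- The operator `X⁻¹`, linear over the constants. -/
def divEnd : Module.End K M where
  toFun := divX K M
  map_add' := map_add _
  map_smul' c v := map_smul (divX K M) (C c : O) v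

variable {M}

theorem divEnd_irregEnd (v : M) : divEnd M (irregEnd M v) = irregEnd M (divEnd M v) + v :=
  eq_add_of_sub_eq (irregOp_divX (K := K) isDerivation_eulerAct v).symm

theorem divEnd_mem {L : Submodule O M} {n : ℕ} {v : M} :
    divEnd M v ∈ adicFilt L n ↔ v ∈ adicFilt L (n + 1) := by
  change divX K M v ∈ ϖ ^ n • L ↔ v ∈ ϖ ^ (n + 1) • L
  rw [mem_pow_smul, mem_pow_smul]
  constructor
  · rintro ⟨w, hw, h⟩
    exact ⟨w, hw, by rw [pow_succ', mul_smul, h, X_smul_divX]⟩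
  · rintro ⟨w, hw, rfl⟩
    exact ⟨w, hw, by rw [pow_succ', mul_smul, divX_X_smul]⟩

theorem divEnd_iterate_mem {L : Submodule O M} {n : ℕ} {v : M} :
    (divEnd M)^[n] v ∈ L ↔ v ∈ adicFilt L n := by
  induction n generalizing v with
  | zero => exact mem_adicFilt_zero.symm
  | succ n ih => rw [iterate_succ_apply, ih, divEnd_mem]

theorem divEnd_bijective : Function.Bijective (divEnd M) := ⟨fun v w h => by
    have h1 : divX K M v = divX K M w := h
    rw [← X_smul_divX (K := K) v, h1, X_smul_divX],
    fun v => ⟨ϖ • v, divX_X_smul v⟩⟩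

theorem aeval_irregEnd (q : K[X]) (v : M) :
    aeval (irregEnd M) q v = irregPoly M q v := by
  induction q using Polynomial.induction_on generalizing v with
  | C c => rw [aeval_C, irregPoly_C]; rfl
  | add p q hp hq => rw [map_add, LinearMap.add_apply, hp, hq, irregPoly_add]
  | monomial n a ih =>
    rw [pow_succ, ← mul_assoc, map_mul, mul_apply, aeval_X, irregPoly_mul, irregPoly_X, ih]
    rfl

variable {L : Submodule O M} (hst : ∀ v ∈ L, irregAct K M v ∈ L) {p : K[X]} {n : ℕ}

include hst in
theorem irregEnd_mem (m : ℕ) : ∀ v ∈ adicFilt L m, irregEnd M v ∈ adicFilt L m :=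
  irregAct_mem_pow_smul hst m

theorem divEnd_aeval (q : K[X]) (v : M) : divEnd M (aeval (irregEnd M) q v) =
    aeval (irregEnd M) q (divEnd M v) +
      aeval (irregEnd M) (Polynomial.derivative q) v := by
  have := TopNilpotent.aeval_derivation (q := 1) (D := divEnd M) (T := irregEnd M)
    (fun v => by rw [map_one]; exact divEnd_irregEnd v) q v
  rwa [one_mul] at this

variable (hn : ∀ v ∈ L, irregPoly M (p ^ n) v ∈ ϖ • L)
include hst hn

theorem aeval_pow_mem_adicFilt (m : ℕ) {v : M} (hv : v ∈ L) :
    aeval (irregEnd M) (p ^ (n * m)) v ∈ adicFilt L m := by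
  have h1 : ∀ m, ∀ v ∈ adicFilt L m,
      aeval (irregEnd M) (p ^ n) v ∈ adicFilt L (m + 1) := by
    intro m
    induction m with
    | zero =>
      intro v hv
      rw [aeval_irregEnd]
      change _ ∈ ϖ ^ 1 • L
      rw [pow_one]
      exact hn v (mem_adicFilt_zero.1 hv)
    | succ m ih =>
      intro v hv
      rw [← divEnd_mem, divEnd_aeval]
      exact add_mem (ih _ (divEnd_mem.2 hv)) (aeval_apply_mem (irregEnd_mem hst (m + 1)) _ hv)
  induction m with
  | zero => simpa using mem_adicFilt_zero.2 hv
  | succ m ih =>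
    rw [Nat.mul_succ, Nat.add_comm (n * m) n, pow_add, map_mul, mul_apply]
    exact h1 m _ ih

/-- If `p(X² d/dX)` maps a power of itself to a contraction of a lattice, it is topologically
nilpotent. -/
theorem topNilpotent_adicFilt (hL : IsLattice L) :
    TopNilpotent (adicFilt L) (aeval (irregEnd M) p) where
  anti := fun _ _ h => pow_smul_anti h L
  sep _ h := eq_zero_of_forall_mem_pow hL.fg h
  compl y hy := exists_limit_of_cauchy hL.fg y hy
  stab m _ hv := aeval_apply_mem (irregEnd_mem hst m) p hv
  nilp v m := by
    have key : ∀ j (v : M), ϖ ^ j • v ∈ L → ∀ m, ∃ N₀, ∀ N, N₀ ≤ N →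
        aeval (irregEnd M) (p ^ N) v ∈ adicFilt L m := by
      intro j
      induction j with
      | zero =>
        intro v hv m
        rw [pow_zero, one_smul] at hv
        refine ⟨n * m, fun N hN => ?_⟩
        obtain ⟨r, rfl⟩ := Nat.exists_eq_add_of_le' hN
        rw [pow_add, map_mul, mul_apply]
        exact aeval_apply_mem (irregEnd_mem hst m) _ (aeval_pow_mem_adicFilt hst hn m hv)
      | succ j ih =>
        intro v hv m
        obtain ⟨N₁, h₁⟩ := ih (ϖ • v) (by rwa [← mul_smul, ← pow_succ]) (m + 1)
        refine ⟨N₁ + 1, fun N hN => ?_⟩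
        have h2 := divEnd_aeval (p ^ N) (ϖ • v)
        have h3 : divEnd M (ϖ • v) = v := divX_X_smul v
        rw [h3] at h2
        rw [eq_sub_of_add_eq h2.symm, Polynomial.derivative_pow, mul_right_comm, map_mul, mul_apply]
        exact sub_mem (divEnd_mem.2 (h₁ N (by lia))) (aeval_apply_mem (irregEnd_mem hst m) _
          (pow_smul_anti m.le_succ L (h₁ (N - 1) (by lia))))
    obtain ⟨j, hj⟩ := hL.full v
    obtain ⟨N, hN⟩ := key j v hj m
    exact ⟨N, by rw [← map_pow]; exact hN N le_rfl⟩

end ConstantAction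

/-! ### Modules over the residue field -/

section ResidueField

variable {k K : Type u} [Field k] [Field K] [Algebra k K]

/-- Hensel's lemma for `X² d/dX` on a module of type `y`. -/
theorem exists_root_of_holType [CharZero k] {M : ModuleCat.{u} (PuncturedOp k)} {b : K} {p : k[X]}
    (hp : Irreducible p) (hb : aeval b p = 0)
    (hs : Function.Surjective (aeval b : k[X] → K)) {L : Submodule k⟦X⟧ M}
    (hL : IsLattice L) (hst : ∀ v ∈ L, irregAct k M v ∈ L) {n : ℕ}
    (hn : ∀ v ∈ L, irregPoly M (p ^ n) v ∈ (X : k⟦X⟧) • L) :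
    ∃ A : Module.End k M, aeval A p = 0 ∧ (∀ v, A (irregEnd M v) = irregEnd M (A v)) ∧
      (∀ v, divEnd M (A v) = A (divEnd M v)) ∧ (∀ m, ∀ v ∈ adicFilt L m, A v ∈ adicFilt L m) ∧
      ∀ v ∈ L, ((irregEnd M - A) ^ (n + 1)) v ∈ adicFilt L 1 := by
  choose f hf using fun m => exists_expansion_approx hp hb hs (C b) m
  have hX : ∀ m, X ^ m ∣ expansion b (f (m + 1)) - expansion b (f m) := fun m => by
    rw [← sub_sub_sub_cancel_left _ _ (C b)]
    exact dvd_sub (hf m) ((pow_dvd_pow _ m.le_succ).trans (hf (m + 1)))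
  obtain ⟨A, hA, hAZ, hAE, hAF, hAn⟩ := (topNilpotent_adicFilt hst hn hL).exists_root
    (irregEnd_mem hst) (f := f)
    (fun m => pow_dvd_of_X_pow_dvd_expansion hp hb (by rw [map_sub]; exact hX m))
    (fun m => pow_dvd_of_X_pow_dvd_expansion hp hb (by
      obtain ⟨r, hr⟩ := hf (m + 1)
      have h1 := congrArg dO (sub_eq_iff_eq_add'.1 hr)
      rw [powerD_C, map_add, powerD_expansion, (dO).leibniz] at h1
      rw [eq_neg_of_add_eq_zero_left h1.symm, dvd_neg]
      refine dvd_add ((pow_dvd_pow _ m.le_succ).mul_right _) (dvd_mul_of_dvd_right ?_ _)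
      change _ ∣ PowerSeries.derivative K _
      rw [Derivation.leibniz_pow, Nat.add_sub_cancel]
      exact ⟨(m + 1 : ℕ) • PowerSeries.derivative K X, by
        rw [mul_smul_comm]; rfl⟩))
    (fun m => pow_dvd_of_X_pow_dvd_expansion hp hb (by
      have h1 : expansion b (p.comp (f m)) = p.eval₂ ((C : K →+* O).comp
          (algebraMap k K)) (expansion b (f m)) := by
        rw [Polynomial.comp, Polynomial.hom_eval₂]
        congr 1
        exact RingHom.ext fun c => expansion_C b c
      have h2 : p.eval₂ ((C : K →+* O).comp (algebraMap k K)) (C b) = 0 := by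
        rw [← Polynomial.hom_eval₂, ← Polynomial.aeval_def, hb, map_zero]
      rw [h1, ← Polynomial.eval_map, ← dvd_neg, ← zero_sub]
      rw [← Polynomial.eval_map] at h2
      rw [← h2]
      exact (hf m).trans (Polynomial.sub_dvd_eval_sub _ _ _)))
    (fun m => dvd_of_aeval_eq_zero hp hb (by
      have h1 : constantCoeff (C b - expansion b (f (m + 1))) = 0 :=
        X_dvd_iff.1 ((dvd_pow_self _ m.succ_ne_zero).trans (hf (m + 1)))
      rw [map_sub, PowerSeries.constantCoeff_C, constantCoeff_expansion] at h1
      rw [map_sub, aeval_X, h1]))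
    (E := divEnd M) (fun m => ⟨m + 1, fun v hv => divEnd_mem.2 hv⟩) divEnd_irregEnd
  refine ⟨A, hA, hAZ, hAE, hAF, fun v hv => hAn n 1 v ?_⟩
  rw [pow_succ', mul_apply, ← map_pow]
  have := aeval_pow_mem_adicFilt hst hn 1 hv
  rw [mul_one] at this
  exact aeval_apply_mem (irregEnd_mem hst 1) _ this

/-- A module of type `y` becomes a module over the residue field, with `ε (X² d/dX - b)` as the new
`X² d/dX`, which is topologically nilpotent, and the new `X⁻¹` equal to `ε X⁻¹`. -/
theorem exists_module_over_residue [CharZero k] {M : ModuleCat.{u} (PuncturedOp k)} {y : ClosedPt k}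
    (hM : HolType y M) (a : K) (ε : ℤ) (hε : ε * ε = 1) {p : k[X]} (hp : Irreducible p)
    (hy : y.asIdeal = Ideal.span {p}) (hpa : aeval ((ε : K) * a) p = 0)
    (hs : Function.Surjective (aeval ((ε : K) * a) : k[X] → K)) :
    ∃ (N : PMod) (e : M ≃+ N) (L : Submodule k⟦X⟧ M)
      (L' : Submodule O N), IsLattice L ∧ IsLattice L' ∧
      (∀ (c : k) v, e ((C c : k⟦X⟧) • v) = (C (algebraMap k K c) : O) • e v) ∧
      (∀ v, e (ε • divX k M v) = divX K N (e v)) ∧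
      (∀ v, e (ε • irregAct k M v) = irregAct K N (e v) + (C a : O) • e v) ∧
      (∀ m v, e v ∈ ϖ ^ m • L' ↔ v ∈ (X ^ m : k⟦X⟧) • L) ∧
      (∀ v ∈ L', irregAct K N v ∈ L') ∧
      ∃ n, ∀ v ∈ L', irregPoly N (PX ^ n) v ∈ ϖ • L' := by
  obtain ⟨L, hL, hst, n, hn⟩ := exists_lattice_of_holType hp.ne_zero hy hM
  obtain ⟨A, hA, hAZ, hAE, hAF, hAn⟩ := exists_root_of_holType hp hpa hs hL hst hn
  have hεε : ∀ v : M, ε • ε • v = v := fun v => by rw [smul_smul, hε, one_smul]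
  let α : k[X] →ₐ[k] K := aeval ((ε : K) * a)
  let γ : k[X] →ₐ[k] Module.End k M := aeval A
  let Φ : K →+* Module.End k M := (α : k[X] →+* K).liftOfSurjective hs
    ⟨(γ : k[X] →+* Module.End k M), fun q hq => by
      obtain ⟨r, rfl⟩ := dvd_of_aeval_eq_zero hp hpa (show α q = 0 from hq)
      change aeval A _ = 0
      rw [map_mul, hA, zero_mul]⟩
  have hΦ : ∀ q : k[X], Φ (aeval ((ε : K) * a) q) = aeval A q := fun q =>
    RingHom.liftOfRightInverse_comp_apply (α : k[X] →+* K) _ _ _ q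
  let : Module K M := Module.compHom M Φ
  have hK : ∀ c : K, ∃ q : k[X], ∀ v : M, c • v = aeval A q v := fun c => by
    obtain ⟨q, rfl⟩ := hs c
    exact ⟨q, fun v => congrArg (fun f : Module.End k M => f v) (hΦ q)⟩
  have hKa : ∀ v : M, a • v = ε • A v := fun v => by
    have h1 := hΦ (PC (ε : k) * PX)
    rw [map_mul (aeval _), map_mul (aeval A), aeval_C,
      aeval_X, aeval_C, aeval_X, map_intCast, map_intCast, ← mul_assoc, ← Int.cast_mul, hε,
      Int.cast_one, one_mul] at h1
    refine (congrArg (fun f : Module.End k M => f v) h1).trans ?_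
    rw [mul_apply, Module.End.intCast_apply]
  have hKk : ∀ (c : k) (v : M), algebraMap k K c • v = (C c : k⟦X⟧) • v := fun c v => by
    have := hΦ (PC c)
    rw [aeval_C, aeval_C] at this
    exact congrArg (fun f : Module.End k M => f v) this
  let T : M →+ M := ε • (divEnd M).toAddMonoidHom
  let D : M →+ M := ε • (irregEnd M - A).toAddMonoidHom
  have hT : ∀ v, T v = ε • divEnd M v := fun v => rfl
  have hD : ∀ v, D v = ε • (irregEnd M v - A v) := fun v => rfl
  have hTn : ∀ n v, T^[n] v = (ε ^ n) • (divEnd M)^[n] v := by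
    intro n
    induction n with
    | zero => simp
    | succ n ih =>
      intro v
      rw [iter_succ, iter_succ, ih, hT, map_zsmul, smul_smul, pow_succ']
  have hDn : ∀ n v, D^[n] v = (ε ^ n) • ((irregEnd M - A) ^ n) v := by
    intro n
    induction n with
    | zero => simp
    | succ n ih =>
      intro v
      rw [iter_succ, ih, hD, ← LinearMap.sub_apply, map_zsmul, smul_smul,
        ← pow_succ', pow_succ' (irregEnd M - A), mul_apply]
  have hεL : ∀ (n : ℕ) {N : Submodule k⟦X⟧ M} {v}, (ε ^ n) • v ∈ N ↔ v ∈ N := fun n N v =>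
    ⟨fun h => by
      have := zsmul_mem h (ε ^ n)
      rwa [smul_smul, ← mul_pow, hε, one_pow, one_smul] at this, fun h => zsmul_mem h _⟩
  have hTL : ∀ m v, T^[m] v ∈ L ↔ v ∈ (X ^ m : k⟦X⟧) • L := fun m v => by
    rw [hTn, hεL]
    exact divEnd_iterate_mem
  have hTbij : Function.Bijective T := (show Function.Bijective fun v : M => ε • v from
      ⟨fun v w h => by rw [← hεε v, ← hεε w]; exact congrArg _ h, fun v => ⟨_, hεε v⟩⟩).comp
      divEnd_bijective
  have hE : IsExpanding T L := ⟨hTbij, hL.fg, fun v hv => pow_smul_le 1 L ((hTL 1 v).1 hv),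
    fun m => ⟨m, fun v => (hTL m v).1⟩, fun v => by
      obtain ⟨n, hn⟩ := hL.full v
      refine ⟨n, fun w hw => ?_⟩
      rw [hTn] at hw
      have h1 : ∀ n (w : M), (X ^ n : k⟦X⟧) • (divEnd M)^[n] w = w := by
        intro n
        induction n with
        | zero => simp
        | succ n ih =>
          intro w
          rw [iterate_succ_apply, pow_succ', mul_smul, ih]
          exact X_smul_divX w
      rwa [← hw, smul_comm, h1, hεL] at hn⟩
  obtain ⟨N, e, he₁, he₂, he₃, L', hL', heL⟩ := hE.exists_module (K := K) (D := D)
    (d := ⟨0, fun _ _ => by simp⟩)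
    (fun f v => by
      rw [hT, hT, smul_comm]
      change ε • divX k M (f • v) = _ + (0 : k⟦X⟧) • v
      rw [zero_smul, add_zero, map_smul]
      rfl) hL
    (fun c v => by
      obtain ⟨q, hq⟩ := hK c
      rw [hq, hq, hT, hT, aeval_apply_comm hAE, map_zsmul])
    (fun c v hv => by
      obtain ⟨q, hq⟩ := hK c
      rw [hq]
      exact mem_adicFilt_zero.1 (aeval_apply_mem (hAF 0) q (mem_adicFilt_zero.2 hv)))
    (fun m => by
      obtain ⟨r, b, hb, h⟩ := exists_finite_mod_pow hL.fg m
      refine ⟨r, b, hb, fun v hv => ?_⟩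
      obtain ⟨c, hc⟩ := h v hv
      exact ⟨fun i => algebraMap k K (c i), by simpa only [hKk] using hc⟩)
    (fun c v => by
      obtain ⟨q, hq⟩ := hK c
      rw [hq, hq, hD, hD, aeval_apply_comm (fun v => (hAZ v).symm), aeval_apply_comm (fun _ => rfl),
        ← map_sub, map_zsmul])
    (fun v => by
      rw [hT, hD, hD, hT, map_zsmul, hεε, map_sub, divEnd_irregEnd, hAE, map_zsmul, map_zsmul,
        ← smul_sub, hεε]
      abel)
    (fun m => ⟨m, fun v hv => zsmul_mem (sub_mem (irregEnd_mem hst m v hv) (hAF m v hv)) ε⟩)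
  have heX : ∀ v, ϖ • e (T v) = e v := fun v => by rw [X_smul]; exact he₂ v
  have hmem := mem_pow_smul_of_transform e heX heL hE.bij
  have hiter : ∀ m v, irregPoly N (PX ^ m) (e v) = e (D^[m] v) := by
    intro m
    induction m with
    | zero => intro v; rw [pow_zero, map_one]; rfl
    | succ m ih => intro v; rw [pow_succ', irregPoly_mul, ih, irregPoly_X, he₃, iter_succ]
  refine ⟨N, e, L, L', hL, hL', fun c v => ?_, fun v => ?_, fun v => ?_,
    fun m v => (hmem m v).trans (hTL m v), fun w hw => ?_, n + 1, fun w hw => ?_⟩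
  · rw [← C_smul_eq (K := K), he₁, hKk]
  · rw [← heX v, divX_X_smul]
    rfl
  · rw [he₃, ← C_smul_eq, he₁, hKa, ← map_add, hD, ← smul_add, sub_add_cancel]
    rfl
  · obtain ⟨v, rfl⟩ := e.surjective w
    rw [he₃, heL]
    have hv := mem_adicFilt_zero.2 ((heL v).1 hw)
    exact zsmul_mem (mem_adicFilt_zero.1 (sub_mem (irregEnd_mem hst 0 v hv) (hAF 0 v hv))) ε
  · obtain ⟨v, rfl⟩ := e.surjective w
    rw [hiter, ← pow_one X, (hmem 1 _).trans (hTL 1 _), hDn, hεL]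
    exact hAn v ((heL v).1 hw)

end ResidueField

/-! ### Modules `j_! M` from topologically nilpotent operators -/

section NilpotentModules

variable {K : Type u} [Field K] [CharZero K]

/-- If `X² d/dX` is topologically nilpotent on `N`, its image contains multiples of every lattice,
and power series in `X² d/dX` act on `N`; with `∂ = X⁻¹` this is a module of the form `j_! M`. -/
theorem exists_lowerShriek_of_nilpotent {N : PMod} {L : Submodule O N}
    (hL : IsLattice L) (hst : ∀ v ∈ L, irregAct K N v ∈ L) {n : ℕ}
    (hn : ∀ v ∈ L, irregPoly N (PX ^ n) v ∈ ϖ • L) :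
    ∃ (M : PMod) (e : N ≃+ (lowerShriek K).obj M)
      (L' : Submodule O ((lowerShriek K).obj M)), Hol K M ∧ IsLattice L' ∧
      (∀ (c : K) v, e ((C c : O) • v) = (C c : O) • e v) ∧
      (∀ v, e (irregAct K N v) = ϖ • e v) ∧
      (∀ v, e (divX K N v) = del dO • e v) ∧
      (∀ m, ∃ m', ∀ v ∈ ϖ ^ m' • L, e v ∈ ϖ ^ m • L') ∧
      ∀ m, ∃ m', ∀ v, e v ∈ ϖ ^ m' • L' → v ∈ ϖ ^ m • L := by
  have h := topNilpotent_adicFilt hst hn hL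
  rw [aeval_X] at h
  have hZn : ∀ m, ∃ m', ∀ v ∈ L, (irregEnd N ^ m') v ∈ adicFilt L m := fun m =>
    ⟨n * m, fun v hv => by
      have := aeval_pow_mem_adicFilt hst hn m hv
      rwa [map_pow, aeval_X] at this⟩
  have hder : ∀ (f : O) v, divEnd N (h.act f v) = h.act f (divEnd N v) + h.act (dO f) v :=
    fun f v => by
      have := h.act_derivation (D := divEnd N) (q := 1)
        (fun v => by rw [map_one]; exact divEnd_irregEnd v)
        (fun m => ⟨m + 1, fun v hv => divEnd_mem.2 hv⟩) f v
      rwa [mulDer_apply, Polynomial.coe_one, one_mul] at this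
  obtain ⟨V, e, he, hed⟩ := exists_moduleCat_of_derivation dO N
    ((Module.toAddMonoidEnd (Module.End K N) N).comp h.act) (divEnd N).toAddMonoidHom hder
  have he' : ∀ (f : O) v, f • e v = e (h.act f v) := he
  have hed' : ∀ v, del dO • e v = e (divEnd N v) := hed
  have heX : ∀ m v, ϖ ^ m • e v = e ((irregEnd N ^ m) v) := fun m v => by
    rw [he', map_pow, h.act_X]
  let L' : Submodule O V :=
    { carrier := {w | e.symm w ∈ L}
      add_mem' := fun {a b} ha hb => by
        change e.symm (a + b) ∈ L
        rw [map_add]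
        exact add_mem ha hb
      zero_mem' := by
        change e.symm 0 ∈ L
        rw [map_zero]
        exact zero_mem _
      smul_mem' := fun f w hw => by
        obtain ⟨v, rfl⟩ := e.surjective w
        change e.symm (f • e v) ∈ L
        rw [he', e.symm_apply_apply]
        change e.symm (e v) ∈ L at hw
        rw [e.symm_apply_apply] at hw
        exact mem_adicFilt_zero.1 (h.sum_mem f (mem_adicFilt_zero.2 hw)) }
  have heL : ∀ v, e v ∈ L' ↔ v ∈ L := fun v => by
    change e.symm (e v) ∈ L ↔ _
    rw [e.symm_apply_apply]
  -- The image of `X² d/dX` is open.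
  have := hL.finite
  obtain ⟨G, hG, m₀, hm₀⟩ := exists_isLattice_euler_surjective (K := K) (W := N)
  have hZG : ∀ i m, m₀ ≤ m → ∀ v ∈ ϖ ^ (m + i) • G, ∃ u ∈ ϖ ^ m • G, (irregEnd N ^ i) u = v := by
    intro i
    induction i with
    | zero => exact fun m _ v hv => ⟨v, hv, by simp⟩
    | succ i ih =>
      intro m hm v hv
      obtain ⟨w, hw, rfl⟩ := mem_pow_smul.1 hv
      obtain ⟨u, hu, h1⟩ := hm₀ (m + i) (hm.trans (Nat.le_add_right m i)) _
        (mem_pow_smul.2 ⟨w, hw, rfl⟩)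
      obtain ⟨u', hu', rfl⟩ := ih m hm u hu
      refine ⟨u', hu', ?_⟩
      rw [pow_succ', mul_apply, ← add_assoc, pow_succ', mul_smul, ← h1]
      rfl
  obtain ⟨s, hs⟩ := hL.exists_pow_smul_le hG.fg
  obtain ⟨t, ht⟩ := hG.exists_pow_smul_le hL.fg
  have hZL : ∀ i, ∀ v ∈ ϖ ^ (s + m₀ + i + t) • L, ∃ u ∈ L, (irregEnd N ^ i) u = v := by
    intro i v hv
    obtain ⟨w, hw, rfl⟩ := mem_pow_smul.1 hv
    obtain ⟨u, hu, h1⟩ := hZG i (s + m₀) (Nat.le_add_left _ _) _ (mem_pow_smul.2 ⟨_, ht w hw, rfl⟩)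
    refine ⟨u, ?_, by rw [h1, ← mul_smul, ← pow_add]⟩
    obtain ⟨u', hu', rfl⟩ := mem_pow_smul.1 hu
    rw [pow_add, mul_comm, mul_smul]
    exact L.smul_mem _ (hs u' hu')
  have hL' : IsLattice L' := by
    refine ⟨?_, fun w => ?_⟩
    · obtain ⟨r, b, hb, hgen⟩ := exists_finite_mod_pow hL.fg (s + m₀ + 1 + t)
      have hcomb := h.exists_combination (b := b)
        (fun m => (hZn m).imp fun _ h v hv => h v (mem_adicFilt_zero.1 hv))
        (fun i => mem_adicFilt_zero.2 (hb i)) fun v hv => by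
          obtain ⟨c, hc⟩ := hgen v (mem_adicFilt_zero.1 hv)
          obtain ⟨u, hu, h1⟩ := hZL 1 _ hc
          refine ⟨c, u, mem_adicFilt_zero.2 hu, ?_⟩
          rw [pow_one] at h1
          rw [h1]
          exact (add_sub_cancel _ _).symm
      refine fg_iff_fin.2 ⟨r, fun i => e (b i), le_antisymm (span_le.2 ?_) fun w hw => ?_⟩
      · rintro _ ⟨i, rfl⟩
        exact (heL _).2 (hb i)
      · obtain ⟨v, rfl⟩ := e.surjective w
        obtain ⟨f, rfl⟩ := hcomb v (mem_adicFilt_zero.2 ((heL v).1 hw))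
        rw [map_sum]
        refine sum_mem fun i _ => ?_
        rw [← he']
        exact smul_mem _ _ (subset_span ⟨i, rfl⟩)
    · obtain ⟨v, rfl⟩ := e.surjective w
      obtain ⟨m, hm⟩ := h.nilp v 0
      exact ⟨m, by rw [heX, heL]; exact mem_adicFilt_zero.1 hm⟩
  obtain ⟨M, hM, ⟨j⟩⟩ := exists_lowerShriek_equiv hL' (fun w => by
      obtain ⟨v, rfl⟩ := e.surjective w
      obtain ⟨u, rfl⟩ := divEnd_bijective.2 v
      exact ⟨e u, hed' u⟩) fun w hw => by
      obtain ⟨v, rfl⟩ := e.surjective w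
      rw [hed', ← map_zero e] at hw
      rw [divEnd_bijective.1 ((e.injective hw).trans (map_zero _).symm), map_zero]
  let j' : V ≃ₗ[O] (lowerShriek K).obj M :=
    { j with map_smul' := fun f v => j.map_smul (of dO f) v }
  have hjj : ∀ v, j' v = j v := fun _ => rfl
  have hjm : ∀ {m : ℕ} {v : N}, j' (e v) ∈ ϖ ^ m • L'.map j'.toLinearMap ↔
      ∃ u ∈ L, (irregEnd N ^ m) u = v := fun {m v} => by
    rw [mem_pow_smul_map_equiv, mem_pow_smul]
    constructor
    · rintro ⟨w, hw, h1⟩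
      obtain ⟨u, rfl⟩ := e.surjective w
      rw [heX] at h1
      exact ⟨u, (heL u).1 hw, e.injective h1⟩
    · rintro ⟨u, hu, rfl⟩
      exact ⟨e u, (heL u).2 hu, heX m u⟩
  refine ⟨M, e.trans j'.toAddEquiv, L'.map j'.toLinearMap, hM, hL'.map_equiv j', fun c v => ?_,
    fun v => ?_, fun v => ?_, fun m => ⟨s + m₀ + m + t, fun v hv => hjm.2 (hZL m v hv)⟩,
    fun m => ?_⟩
  · change j' (e _) = _ • j' (e v)
    rw [← map_smul, he', h.act_C]
    rfl
  · change j' (e _) = _ • j' (e v)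
    rw [← map_smul, he', h.act_X]
    rfl
  · change j (e _) = _ • j (e v)
    rw [← map_smul, hed']
    rfl
  · obtain ⟨m', hm'⟩ := hZn m
    refine ⟨m', fun v hv => ?_⟩
    obtain ⟨u, hu, rfl⟩ := hjm.1 hv
    exact hm' u hu

end NilpotentModules

/-! ### The equivalences between a finite point and infinity -/

section FinitePoint

variable {k K : Type u} [Field k] [CharZero k] [Field K] [Algebra k K] [CharZero K]

/-- The transform of a module of type `ε a` at infinity to the point with coordinate `a`. -/
theorem exists_transform_infinity_finite {M : ModuleCat.{u} (PuncturedOp k)} {y : ClosedPt k}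
    (hM : HolType y M) (a : K) (ε : ℤ) (hε : ε * ε = 1) {p : k[X]} (hp : Irreducible p)
    (hy : y.asIdeal = Ideal.span {p}) (hpa : aeval ((ε : K) * a) p = 0)
    (hs : Function.Surjective (aeval ((ε : K) * a) : k[X] → K)) :
    ∃ (N : PMod) (e : M ≃+ (lowerShriek K).obj N), Hol K N ∧
      (∀ (c : k) v, e ((C c : k⟦X⟧) • v) = (C (algebraMap k K c) : O) • e v) ∧
      (∀ v, e (ε • divX k M v) = del dO • e v) ∧
      (∀ v, e (ε • irregAct k M v) = (C a + X : O) • e v) ∧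
      @IsHomeomorph _ _ (adicTopology k k ((lowerStar k).obj M))
        (adicTopology K k ((lowerShriek K).obj N)) e := by
  obtain ⟨N₁, e₁, L, L₁, hL, hL₁, hC₁, hX₁, hZ₁, hm₁, hst, n, hn⟩ :=
    exists_module_over_residue hM a ε hε hp hy hpa hs
  obtain ⟨N, e, L', hN, hL', hC, hZ, hX, hc, hc'⟩ := exists_lowerShriek_of_nilpotent hL₁ hst hn
  refine ⟨N, e₁.trans e, hN, fun c v => ?_, fun v => ?_, fun v => ?_,
    isHomeomorph_adicTopology k (hL.map_equiv (starEquiv M)) hL' (e₁.trans e) (fun m => ?_)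
      fun m => ?_⟩
  · exact (congrArg e (hC₁ c v)).trans (hC _ _)
  · exact (congrArg e (hX₁ v)).trans (hX _)
  · refine (congrArg e (hZ₁ v)).trans ?_
    rw [map_add, hZ, hC, add_comm, ← add_smul]
    rfl
  · obtain ⟨m', hm'⟩ := hc m
    exact ⟨m', fun v hv => hm' _ ((hm₁ m' v).2 ((mem_pow_smul_map_equiv (starEquiv M)).1 hv))⟩
  · obtain ⟨m', hm'⟩ := hc' m
    exact ⟨m', fun v hv => (mem_pow_smul_map_equiv (starEquiv M)).2 ((hm₁ m v).1 (hm' _ hv))⟩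

variable {a : K} {V : ModuleCat.{u} DO} {N : ModuleCat.{u} (PuncturedOp k)}

theorem weylToDisk_C_smul (c : k) (v : V) : weylToDisk K k a (of (polyD k) (PC c)) • v =
      (C (algebraMap k K c) : O) • v := by
  rw [weylToDisk_of, expansion_C, of_smul_eq]

theorem weylToDisk_X_smul (v : V) : weylToDisk K k a (of (polyD k) PX) • v = (C a + X : O) • v := by
  rw [weylToDisk_of, expansion_X, of_smul_eq]

theorem weylToInfinity_C_smul (c : k) (v : N) :
    weylToInfinity k (of (polyD k) (PC c)) • v = (C c : k⟦X⟧) • v := by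
  rw [weylToInfinity_C, of_smul_eq, C_smul_eq]

theorem weylToInfinity_X_smul (v : N) : weylToInfinity k (of (polyD k) PX) • v = divX k N v := by
  rw [weylToInfinity_X, of_smul_eq]
  rfl

theorem exists_iso_finite_infinity (tV : TopologicalSpace V) (tN : TopologicalSpace N) (e : V ≃+ N)
    (he : IsHomeomorph e)
    (hC : ∀ (c : k) v, e ((C (algebraMap k K c) : O) • v) = (C c : k⟦X⟧) • e v)
    (hD : ∀ v, divX k N (e v) = e (-(del dO • v)))
    (hX : ∀ v, irregAct k N (e v) = e (-((C a + X : O) • v))) :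
    ∃ i : (fourier k).obj ((restrictScalars (weylToDisk K k a)).obj V) ≅
      (restrictScalars (weylToInfinity k)).obj N, @IsHomeomorph _ _ tV tN i.hom.hom := by
  refine exists_isHomeomorph_iso (A := (fourier k).obj ((restrictScalars (weylToDisk K k a)).obj V))
    (B := (restrictScalars (weylToInfinity k)).obj N) tV tN e he
    (fun c (v : V) => ?_) (fun (v : V) => ?_) fun (v : V) => ?_
  · change e (weylToDisk K k a (fourierHom k _) • v) = weylToInfinity k _ • e v
    rw [fourierHom_C, weylToDisk_C_smul, weylToInfinity_C_smul, hC]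
  · change e (weylToDisk K k a (fourierHom k _) • v) = weylToInfinity k _ • e v
    rw [fourierHom_X, map_neg, neg_smul, weylToDisk_del, weylToInfinity_X_smul, hD]
  · change e (weylToDisk K k a (fourierHom k _) • v) = weylToInfinity k _ • e v
    rw [fourierHom_del, weylToDisk_X_smul, weylToInfinity_del_smul, hX, map_neg, neg_neg]

theorem exists_iso_infinity_finite (tN : TopologicalSpace N) (tV : TopologicalSpace V) (e : N ≃+ V)
    (he : IsHomeomorph e)
    (hC : ∀ (c : k) v, e ((C c : k⟦X⟧) • v) = (C (algebraMap k K c) : O) • e v)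
    (hD : ∀ v, e (divX k N v) = del dO • e v)
    (hX : ∀ v, e (irregAct k N v) = (C a + X : O) • e v) :
    ∃ i : (fourier k).obj ((restrictScalars (weylToInfinity k)).obj N) ≅
      (restrictScalars (weylToDisk K k a)).obj V, @IsHomeomorph _ _ tN tV i.hom.hom := by
  refine exists_isHomeomorph_iso (A := (fourier k).obj ((restrictScalars (weylToInfinity k)).obj N))
    (B := (restrictScalars (weylToDisk K k a)).obj V) tN tV e he
    (fun c (v : N) => ?_) (fun (v : N) => ?_) fun (v : N) => ?_
  · change e (weylToInfinity k (fourierHom k _) • v) = weylToDisk K k a _ • e v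
    rw [fourierHom_C, weylToDisk_C_smul, weylToInfinity_C_smul, hC]
  · change e (weylToInfinity k (fourierHom k _) • v) = weylToDisk K k a _ • e v
    rw [fourierHom_X, map_neg, neg_smul, weylToDisk_X_smul, weylToInfinity_del_smul, neg_neg, hX]
  · change e (weylToInfinity k (fourierHom k _) • v) = weylToDisk K k a _ • e v
    rw [fourierHom_del, weylToDisk_del, weylToInfinity_X_smul, hD]

variable [Module.Finite k K] (a)
  (hs : Function.Surjective (aeval a : k[X] → K)) {q p : k[X]} (hq : Irreducible q)
  (ha : aeval a q = 0) {y : ClosedPt k} (hp : Irreducible p)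
  (hy : y.asIdeal = Ideal.span {p})

include hs hq ha hp hy

/-- The local transform from a closed point, with coordinate `a` in its residue field `K`, to
infinity. -/
theorem exists_equivalence_finite_infinity (hpa : aeval (-a) p = 0) :
    ∃ (F : (Hol K).FullSubcategory ≌ (HolType y).FullSubcategory)
      (θ : ((Hol K).ι ⋙ lowerShriek K ⋙ restrictScalars (weylToDisk K k a)) ⋙ fourier k ≅
        F.functor ⋙ extendInfinite (HolType y)),
      IsBicontinuous (fun M => adicTopology K k ((lowerShriek K).obj M.obj))
        (fun M => topInfinite (F.functor.obj M)) θ ∧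
      ∀ (G : (Hol K).FullSubcategory ⥤ (HolType y).FullSubcategory)
        (η : ((Hol K).ι ⋙ lowerShriek K ⋙ restrictScalars (weylToDisk K k a)) ⋙
          fourier k ≅ G ⋙ extendInfinite (HolType y)),
        IsBicontinuous (fun M => adicTopology K k ((lowerShriek K).obj M.obj))
          (fun M => topInfinite (G.obj M)) η →
        ∃! α : F.functor ≅ G, θ ≪≫ Functor.isoWhiskerRight α (extendInfinite (HolType y)) = η := by
  have hε : ((-1 : ℤ) : K) * a = -a := by simp
  have hs' : Function.Surjective (aeval (((-1 : ℤ) : K) * a) : k[X] → K) := fun c => by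
    obtain ⟨r, rfl⟩ := hs c
    refine ⟨r.comp (-PX), ?_⟩
    rw [Polynomial.aeval_comp, hε]
    simp
  refine ContFF.exists_equivalence
    (S := ((Hol K).ι ⋙ lowerShriek K ⋙ restrictScalars (weylToDisk K k a)) ⋙ fourier k)
    (T := extendInfinite (HolType y))
    (tS := fun M => adicTopology K k ((lowerShriek K).obj M.obj)) (tT := fun M => topInfinite M)
    (ContFF.fourier (contFF_lowerShriek hq ha hs))
    (contFF_extendInfinite (HolType y) fun M h => h.1) (fun M => ?_) fun N => ?_
  · obtain ⟨N, e, hN, hC, hD, hX, he⟩ := exists_transform_finite_infinity_holType (k := k)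
      M.property a (-1) (by norm_num) hp hy (by rwa [hε])
    exact ⟨⟨N, hN⟩, exists_iso_finite_infinity _ _ e he
      (fun c v => (hC c v).symm.trans (C_smul_eq c _)) (fun v => by simpa using hD v)
      fun v => by simpa using hX v⟩
  · obtain ⟨M, e, hM, hC, hD, hX, he⟩ := exists_transform_infinity_finite (k := k) (K := K)
      N.property a (-1) (by norm_num) hp hy (by rwa [hε]) hs'
    refine ⟨⟨M, hM⟩, exists_iso_finite_infinity _ _ e.symm (isHomeomorph_symm _ _ e.toEquiv he)
      (fun c v => ?_) (fun v => ?_) fun v => ?_⟩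
    · rw [e.symm_apply_eq, hC, e.apply_symm_apply]
    · rw [e.eq_symm_apply, ← e.apply_symm_apply v, ← hD, e.symm_apply_apply]
      simp
    · rw [e.eq_symm_apply, ← e.apply_symm_apply v, ← hX, e.symm_apply_apply]
      simp

/-- The local transform from infinity to a closed point, with coordinate `a` in its residue field
`K`. -/
theorem exists_equivalence_infinity_finite (hpa : aeval a p = 0) :
    ∃ (F : (HolType y).FullSubcategory ≌ (Hol K).FullSubcategory)
      (θ : extendInfinite (HolType y) ⋙ fourier k ≅
        F.functor ⋙ (Hol K).ι ⋙ lowerShriek K ⋙ restrictScalars (weylToDisk K k a)),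
      IsBicontinuous (fun M => topInfinite M)
        (fun M => adicTopology K k ((lowerShriek K).obj (F.functor.obj M).obj)) θ ∧
      ∀ (G : (HolType y).FullSubcategory ⥤ (Hol K).FullSubcategory)
        (η : extendInfinite (HolType y) ⋙ fourier k ≅
          G ⋙ (Hol K).ι ⋙ lowerShriek K ⋙ restrictScalars (weylToDisk K k a)),
        IsBicontinuous (fun M => topInfinite M)
          (fun M => adicTopology K k ((lowerShriek K).obj (G.obj M).obj)) η →
        ∃! α : F.functor ≅ G, θ ≪≫ Functor.isoWhiskerRight α
          ((Hol K).ι ⋙ lowerShriek K ⋙ restrictScalars (weylToDisk K k a)) = η := by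
  have hε : ((1 : ℤ) : K) * a = a := by simp
  refine ContFF.exists_equivalence (S := extendInfinite (HolType y) ⋙ fourier k)
    (T := (Hol K).ι ⋙ lowerShriek K ⋙ restrictScalars (weylToDisk K k a))
    (tS := fun M => topInfinite M) (tT := fun M => adicTopology K k ((lowerShriek K).obj M.obj))
    (ContFF.fourier (S := extendInfinite (HolType y)) (tS := fun M => topInfinite M)
      (contFF_extendInfinite (HolType y) fun M h => h.1))
    (contFF_lowerShriek hq ha hs) (fun M => ?_) fun N => ?_
  · obtain ⟨N, e, hN, hC, hD, hX, he⟩ := exists_transform_infinity_finite (k := k) (K := K)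
      M.property a 1 (by norm_num) hp hy (by rwa [hε]) (by rwa [hε])
    exact ⟨⟨N, hN⟩, exists_iso_infinity_finite _ _ e he hC (fun v => by simpa using hD v)
      fun v => by simpa using hX v⟩
  · obtain ⟨M, e, hM, hC, hD, hX, he⟩ := exists_transform_finite_infinity_holType (k := k)
      N.property a 1 (by norm_num) hp hy (by rwa [hε])
    refine ⟨⟨M, hM⟩, exists_iso_infinity_finite _ _ e.symm (isHomeomorph_symm _ _ e.toEquiv he)
      (fun c v => ?_) (fun v => ?_) fun v => ?_⟩
    · rw [e.symm_apply_eq, ← hC, e.apply_symm_apply, C_smul_eq]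
    · rw [e.symm_apply_eq, ← one_smul ℤ (_ • _), ← hD, e.apply_symm_apply]
      rfl
    · rw [e.symm_apply_eq, ← one_smul ℤ (_ • _), ← hX, e.apply_symm_apply]
      rfl

end FinitePoint

/-! ### Closed points of the affine line -/

section ClosedPoints

variable {k : Type u} [Field k]

theorem ClosedPt.exists_generator (x : ClosedPt k) :
    ∃ p, Irreducible p ∧ x.asIdeal = Ideal.span {p} := by
  have := x.isMaximal
  obtain ⟨p, hp⟩ := (IsPrincipalIdealRing.principal x.asIdeal).principal
  have hp' : x.asIdeal = Ideal.span {p} := hp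
  have h0 : p ≠ 0 := by
    rintro rfl
    rw [Ideal.span_singleton_zero] at hp'
    exact Ring.ne_bot_of_isMaximal_of_not_isField x.isMaximal (Polynomial.not_isField k) hp'
  refine ⟨p, (Ideal.span_singleton_prime h0).1 (hp' ▸ this.isPrime) |>.irreducible, hp'⟩

theorem ClosedPt.aeval_coord (x : ClosedPt k) (p : k[X]) :
    aeval x.coord p = Ideal.Quotient.mk x.asIdeal p := by
  have := Polynomial.aeval_algHom_apply (Ideal.Quotient.mkₐ k x.asIdeal) PX p
  rwa [Polynomial.aeval_X_left_apply] at this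

theorem ClosedPt.aeval_neg_coord (x : ClosedPt k) {p : k[X]} (hp : p ∈ x.neg.asIdeal) :
    aeval (-x.coord) p = 0 := by
  have h1 : aeval (-PX : k[X]) p ∈ x.asIdeal := hp
  rw [← Ideal.Quotient.eq_zero_iff_mem, ← x.aeval_coord, ← Polynomial.aeval_algHom_apply,
    map_neg, aeval_X] at h1
  exact h1

end ClosedPoints

end LocalFourier

end

open LocalFourier in
theorem mainTheorem1 (k : Type u) [Field k] [CharZero k] :
    (∀ x : ClosedPt k,
      ∃ (F : (Hol x.residue).FullSubcategory ≌ (HolType x.neg).FullSubcategory)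
        (θ : extendFinite x ⋙ fourier k ≅ F.functor ⋙ extendInfinite (HolType x.neg)),
        IsBicontinuous (fun M => topFinite x M) (fun M => topInfinite (F.functor.obj M)) θ ∧
        ∀ (G : (Hol x.residue).FullSubcategory ⥤ (HolType x.neg).FullSubcategory)
          (η : extendFinite x ⋙ fourier k ≅ G ⋙ extendInfinite (HolType x.neg)),
          IsBicontinuous (fun M => topFinite x M) (fun M => topInfinite (G.obj M)) η →
          ∃! α : F.functor ≅ G,
            θ ≪≫ Functor.isoWhiskerRight α (extendInfinite (HolType x.neg)) = η) ∧
    (∀ x : ClosedPt k,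
      ∃ (F : (HolType x).FullSubcategory ≌ (Hol x.residue).FullSubcategory)
        (θ : extendInfinite (HolType x) ⋙ fourier k ≅ F.functor ⋙ extendFinite x),
        IsBicontinuous (fun M => topInfinite M) (fun M => topFinite x (F.functor.obj M)) θ ∧
        ∀ (G : (HolType x).FullSubcategory ⥤ (Hol x.residue).FullSubcategory)
          (η : extendInfinite (HolType x) ⋙ fourier k ≅ G ⋙ extendFinite x),
          IsBicontinuous (fun M => topInfinite M) (fun M => topFinite x (G.obj M)) η →
          ∃! α : F.functor ≅ G,
            θ ≪≫ Functor.isoWhiskerRight α (extendFinite x) = η) ∧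
    (∃ (F : (HolSlopeGT k).FullSubcategory ≌ (HolSlopeGT k).FullSubcategory)
        (θ : extendInfinite (HolSlopeGT k) ⋙ fourier k ≅
          F.functor ⋙ extendInfinite (HolSlopeGT k)),
        IsBicontinuous (fun M => topInfinite M) (fun M => topInfinite (F.functor.obj M)) θ ∧
        ∀ (G : (HolSlopeGT k).FullSubcategory ⥤ (HolSlopeGT k).FullSubcategory)
          (η : extendInfinite (HolSlopeGT k) ⋙ fourier k ≅
            G ⋙ extendInfinite (HolSlopeGT k)),
          IsBicontinuous (fun M => topInfinite M) (fun M => topInfinite (G.obj M)) η →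
          ∃! α : F.functor ≅ G,
            θ ≪≫ Functor.isoWhiskerRight α (extendInfinite (HolSlopeGT k)) = η) := by
  have hs : ∀ x : ClosedPt k, Function.Surjective (Polynomial.aeval x.coord) := fun x c => by
    obtain ⟨p, rfl⟩ := Ideal.Quotient.mk_surjective c
    exact ⟨p, x.aeval_coord p⟩
  refine ⟨fun x => ?_, fun x => ?_, exists_equivalence_infinity_infinity⟩
  · have := x.isMaximal
    let : Field x.residue := Ideal.Quotient.field x.asIdeal
    have : CharZero x.residue := charZero_of_injective_algebraMap (algebraMap k x.residue).injective
    have : Module.Finite k x.residue := finite_of_finite_type_of_isJacobsonRing k x.residue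
    obtain ⟨q, hq, hx⟩ := x.exists_generator
    obtain ⟨p, hp, hy⟩ := x.neg.exists_generator
    exact exists_equivalence_finite_infinity x.coord (hs x) hq
      ((x.aeval_coord q).trans (Ideal.Quotient.eq_zero_iff_mem.2
        (hx ▸ Ideal.mem_span_singleton_self q))) hp hy
      (x.aeval_neg_coord (hy ▸ Ideal.mem_span_singleton_self p))
  · have := x.isMaximal
    let : Field x.residue := Ideal.Quotient.field x.asIdeal
    have : CharZero x.residue := charZero_of_injective_algebraMap (algebraMap k x.residue).injective
    have : Module.Finite k x.residue := finite_of_finite_type_of_isJacobsonRing k x.residue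
    obtain ⟨p, hp, hx⟩ := x.exists_generator
    have ha : Polynomial.aeval x.coord p = 0 := (x.aeval_coord p).trans
      (Ideal.Quotient.eq_zero_iff_mem.2 (hx ▸ Ideal.mem_span_singleton_self p))
    exact exists_equivalence_infinity_finite x.coord (hs x) hp ha hp hx ha
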